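/- **Setting.** A temporal multigraph on nodes $v_1,\dots,v_n$ with lifetime $T$ is a multiset of edges $(\{u,v\},t)$ with $t\in[1,T]$; $u=v$ is a loop. Let $w_{i,j,t}$ be the number of edges $(\{v_i,v_j\},t)$ and $m_{i,j}=\sum_t w_{i,j,t}$ the multiplicity of $\{v_i,v_j\}$. The graph is simple if it has no loops and all $w_{i,j,t}\le 1$; an edge is simple if it is not a loop and has $w_{i,j,t}=1$. A tuple $\mathbf D=(\mathbf d,T)$ is realizable if some simple temporal graph has degree $d_i$ at $v_i$ for all $i$. Put $\Delta=\max_i d_i$, $M=\sum_i d_i$, $M_2=\sum_i d_i(d_i-1)$, $B_L=M_2/M$, $B_D=M_2^2/(M^2T)$. The tensor $\mathbf W(G)$ has entries $w_{i,i,t}$ on the diagonal and, for $i\ne j$, $w_{i,j,t}$ if this is $\ge 2$ and $0$ otherwise; $k_i=d_i-\sum_t(2\mathbf W_{i,i,t}+\sum_{j\neq i}\mathbf W_{i,j,t})$. **Algorithm T-Gen** (integer constants $\lambda,\kappa,\mu'$). All probabilities below are truncated to $[0,1]$, quotients $x/0$ are read as $0$, and a switching always replaces distinct edge copies of the graph with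 distinct temporal edges that do not exist in it. *Initial graph.* Draw all marbles, $d_i$ of them labelled $i$, from an urn without replacement; the labels of each successive two form an edge, which gets an independent uniform timestamp. If the resulting $G$ is simple, output it. Otherwise restart unless $M>16\Delta^2+4\Delta+2B_L+4B_D$, $T>\Delta-1$ and: $G$ has at most $B_L$ loops and $D/2\le B_D$, where $D$ is the sum of the $w_{i,j,t}\ge2$ over all $i<j$ and $t$; no $w_{i,i,t}\ge 2$; no $w_{i,j,t}\geq 3$ ($i\ne j$); no node has more than $\lambda$ loops or more than $\kappa$ incident temporal double-edges ($w_{i,j,t}=2$). *Stage 1.* For each loop $(\{v_1\},t_1)$, in an order that depends (arbitrarily) on $\mathbf W(G)$: pick a uniformly random TL switching, i.e. one that replaces the loop and simple edges $(\{v_2,v_4\},t_2),(\{v_3,v_5\},t_3)$ with $(\{v_1,v_2\},t_4),(\{v_1,v_3\},t_5),(\{v_4,v_5\},t_6)$, where $v_2,\dots,v_5\ne v_1$ and $v_4\neq v_5$. With $f$ the number of such switchings, restart with probability $1-f/(M^2T^3)$. Perform the switching, giving $G'$. Restart if $m_{2,4}\ge\mu'$ or $m_{3,5}\ge\mu'$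 in $G'$. Restart with probability $1-(T-\mu'+1)^2/b_2$, where $b_2$ is the number of pairs of timestamps $t_2,t_3$ for which $(\{v_2,v_4\},t_2),(\{v_3,v_5\},t_3)$ do not exist in $G'$. Perform an auxiliary step (below) with base nodes $v_1,\dots,v_5$, pairs $\{v_2,v_4\},\{v_3,v_5\}$ and $s=2B_L+4B_D$. Finally restart with probability $1-\frac{k_1(k_1-1)(M-2B_L-4B_D-4\Delta)}{b_0b_1}$, where $k_1$ refers to $\mathbf W(G')$ and, in the current graph, $b_0$ is the number of ordered pairs of distinct simple edges at $v_1$ and $b_1$ the number of oriented simple edges avoiding $v_1,v_2,v_3$. *Stage 2.* For each temporal double-edge $(\{v_1,v_2\},t_1)$, again in an arbitrary order determined by the current $\mathbf W(G)$, choose TD$_1$ or TD$_0$ with $p(\mathrm{TD}_1)/p(\mathrm{TD}_0)=\frac{p_C(I)}{p_B(I)}\cdot\frac{M^2T^3\,\beta_0}{M^4T^6\,\beta_1}$, where $p_B(I)$, $p_C(I)$ are the probabilities of not performing an auxiliary switching in the respective auxiliary steps (below), $\beta_1=k_1k_2(M-4B_D-4\Delta)(T-\mu'+1)^2$, $\beta_0=k_1(k_1-1)k_2(k_2-1)(M-4B_D-4\Delta)^2(T-\mu'+1)^4$,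 and $k_1,k_2$ refer to $\mathbf W(G)$ with the entry of the double-edge set to $0$. TD$_1$ replaces one copy of the double-edge and simple edges $(\{v_3,v_5\},t_2),(\{v_4,v_6\},t_3)$ with $(\{v_1,v_3\},t_4),(\{v_2,v_4\},t_5),(\{v_5,v_6\},t_6)$, where $v_3,\dots,v_6\notin\{v_1,v_2\}$ and $v_5\ne v_6$. TD$_0$ replaces both copies and simple edges $(\{v_3,v_7\},t_2),(\{v_4,v_8\},t_3),(\{v_5,v_9\},t_4),(\{v_6,v_{10}\},t_5)$ with $(\{v_1,v_3\},t_6),(\{v_2,v_4\},t_7),(\{v_1,v_5\},t_8),(\{v_2,v_6\},t_9),(\{v_7,v_8\},t_{10}),(\{v_9,v_{10}\},t_{11})$, where $v_3,\dots,v_{10}\notin\{v_1,v_2\}$, $v_7\neq v_8$, $v_9\ne v_{10}$. Then proceed as in Stage 1: the f-rejection uses the bound $M^2T^3$ (TD$_1$) or $M^4T^6$ (TD$_0$); restart if one of the node pairs of the (two or four) removed simple edges has multiplicity $\ge\mu'$ in $G'$; reject with the lower bound $(T-\mu'+1)^2$ or $(T-\mu'+1)^4$ for the number of choices of available timestamps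 for these pairs; perform the auxiliary step with base nodes $v_1,\dots,v_6$ or $v_1,\dots,v_{10}$, these two (type B) or four (type C) pairs, and $s=4B_D$; and reject at the end with probability $1-\frac{k_1k_2(M-4B_D-4\Delta)}{b_0b_1}$ or $1-\frac{k_1(k_1-1)k_2(k_2-1)(M-4B_D-4\Delta)^2}{b_0b_1}$, where $b_0$ counts the choices of one simple edge at $v_1$ and one at $v_2$ (TD$_1$), or of two distinct ordered simple edges at $v_1$ and two at $v_2$ (TD$_0$), and $b_1$ counts the oriented simple edges avoiding $v_1,\dots,v_4$ (TD$_1$), or the ordered pairs of distinct, oriented simple edges avoiding $v_1,\dots,v_6$ (TD$_0$). *Auxiliary step* with pairs $\{a_p,b_p\}$, $1\le p\le q$. Choose the identity $I$, or a vector $r\in\{0,\dots,\Delta-1\}^q$ with $\max_p r_p\ge\mu'$, where, with $K=\sum_p r_p$, $\overline f_r=\Delta^{2K}T^{2K}$ and $\underline b_r=(M-s-4(K+q+1)\Delta)^K(T-\Delta+1)^{2K}$, the probabilities satisfy $p(r)=p(I)\,\overline f_r/\underline b_r$. If $I$ is chosen, do nothing. Otherwise restart if some $m_{a_p,b_p}\ge1$;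 pick a uniformly random auxiliary switching of type $r$, i.e. one which, for every $p$ and $1\le i\le r_p$, replaces simple edges $(\{a_p,x_{p,i}\},\cdot),(\{b_p,y_{p,i}\},\cdot)$ with edges $(\{a_p,b_p\},\cdot),(\{x_{p,i},y_{p,i}\},\cdot)$, all base nodes, $x_{p,i}$ and $y_{p,i}$ being distinct and all $\{a_p,b_p\}$ being non-edges; restart with probability $1-f/\overline f_r$, where $f$ is the number of these switchings; perform the switching; restart with probability $1-\underline b_r/b$, where $b$ is the number of switchings of type $r$ that produce the graph obtained. When both stages are completed, the graph is output. A *run* consists of independent attempts of this kind up to and including the first one that outputs a graph; the graphs *visited* are the initial graphs and all graphs produced by a switching, in all attempts of the run. **Lemma.** Let $\epsilon>0$ and let $(\mathbf D_k)_{k\in\mathbb N}$ be a sequence of realizable tuples with $M\to\infty$, $\Delta^{2+\epsilon}=O(M)$ and $T-\Delta=\Omega(T)$ (that is, $T-\Delta\ge cT$ for a constant $c>0$ and all large $k$). Run T-Gen with integer constants $\lambda,\kappa\ge\lfloor1+1/\epsilon\rfloor$ and $\mu'\ge\lfloor3+2/\epsilon\rfloor$ (for instance $\mu'=\lfloor3+2/\epsilon\rfloor$;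 if $\mu'>\lceil3+2/\epsilon\rceil$, assume also $T\geq\mu'$ for all large $k$). Then, with probability tending to $1$ as $k\to\infty$, no graph visited during a run of T-Gen on $\mathbf D_k$ contains an edge of multiplicity $m_{i,j}$ higher than $\mu=\lfloor3+2/\epsilon\rfloor$ (including $i=j$, i.e. loops). -/

import Mathlib

open Filter Topology MeasureTheory Asymptotics
open scoped Finset

noncomputable section

namespace TGen

/-! ## Input tuples and temporal multigraphs -/

/-- An input tuple `(d, T)`: a degree sequence `d₁, …, dₙ` and a lifetime `T > 0`. -/
structure Input where
  n : ℕ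
  d : Fin n → ℕ
  T : ℕ
  T_pos : 0 < T

variable (D : Input)

abbrev Node := Fin D.n

/-- Timestamps; the `T` elements of `Fin T` stand for `1, …, T`. -/
abbrev Stamp := Fin D.T

/-- A temporal edge `({u, v}, t)`; it is a loop if `u = v`. -/
abbrev TEdge := Sym2 (Node D) × Stamp D

/-- A temporal multigraph on the nodes `v₁, …, vₙ`: a multiset of temporal edges. -/
abbrev TGraph := Multiset (TEdge D)

instance : Nonempty (Stamp D) := ⟨⟨0, D.T_pos⟩⟩

/-- The maximum degree `Δ`. -/
def maxDeg : ℕ := Finset.univ.sup D.d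

/-- `M`, the sum of the degrees. -/
def degSum : ℕ := ∑ i, D.d i

/-- `M₂ = ∑ dᵢ (dᵢ - 1)`. -/
def degSum₂ : ℕ := ∑ i, D.d i * (D.d i - 1)

/-- `B_L = M₂ / M`. -/
def BL : ℝ := (degSum₂ D : ℝ) / degSum D

/-- `B_D = M₂² / (M² T)`. -/
def BD : ℝ := (degSum₂ D : ℝ) ^ 2 / ((degSum D : ℝ) ^ 2 * D.T)

variable {D}

/-- Temporal multiplicity `w_{i,j,t}` (for `i = j`: the number of loops at `i` with stamp `t`). -/
def w (G : TGraph D) (i j : Node D) (t : Stamp D) : ℕ := G.count (s(i, j), t)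

/-- Multiplicity `m_{i,j} = ∑ₜ w_{i,j,t}`. -/
def mult (G : TGraph D) (i j : Node D) : ℕ := ∑ t, w G i j t

/-- The number of edges incident at `i` over all timestamps, a loop being counted twice. -/
def degree (G : TGraph D) (i : Node D) : ℕ := ∑ t, ((∑ j, w G i j t) + w G i i t)

/-- No loops, and no two edges with the same nodes and the same timestamp. -/
def IsSimple (G : TGraph D) : Prop := G.Nodup ∧ ∀ e ∈ G, ¬ e.1.IsDiag

def Matches (G : TGraph D) : Prop := ∀ i, degree G i = D.d i

variable (D) in
/-- At least one simple temporal graph matches `(d, T)`. -/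
def Realizable : Prop := ∃ G : TGraph D, IsSimple G ∧ Matches G

/-- `({i, j}, t)` is an edge of `G` which is neither a loop nor in a temporal multi-edge. -/
def IsSimpleEdge (G : TGraph D) (i j : Node D) (t : Stamp D) : Prop := i ≠ j ∧ w G i j t = 1

/-- The tensor `𝐖(G)` of the temporal multiplicities of all loops and temporal multi-edges. -/
def W (G : TGraph D) (i j : Node D) (t : Stamp D) : ℕ :=
  if i = j then w G i i t else if 2 ≤ w G i j t then w G i j t else 0

/-! ## Randomized programs that may restart

A program returns the graphs it has visited, in order, together with a result, or with `none` if it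
has hit a restart instruction. -/

structure Outcome (D : Input) (α : Type) where
  visited : List (TGraph D)
  result : Option α

instance {α : Type} : MeasurableSpace (Outcome D α) := ⊤

variable (D) in
def Prog (α : Type) : Type := PMF (Outcome D α)

/-- Sequential composition: the second program is not entered if the first one restarts. -/
instance : Monad (Prog D) where
  pure a := (PMF.pure ⟨[], some a⟩ : PMF _)
  bind {_ β} p f := PMF.bind p fun o =>
    match o.result with
    | none => PMF.pure (⟨o.visited, none⟩ : Outcome D β)
    | some a => PMF.bind (f a) fun o' =>
        PMF.pure (⟨o.visited ++ o'.visited, o'.result⟩ : Outcome D β)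

def sample {α : Type} (p : PMF α) : Prog D α :=
  PMF.bind p fun a => PMF.pure ⟨[], some a⟩

def visit (G : TGraph D) : Prog D Unit := (PMF.pure ⟨[G], some ()⟩ : PMF _)

def restart {α : Type} : Prog D α := (PMF.pure ⟨[], none⟩ : PMF _)

open scoped Classical in
def restartIf (p : Prop) : Prog D Unit := if p then restart else pure ()

/-- A coin with `P(true) = p` (truncated to `[0, 1]`). -/
def coin (p : ℝ) : PMF Bool :=
  PMF.ofFintype (fun b => if b then min (ENNReal.ofReal p) 1 else 1 - min (ENNReal.ofReal p) 1)
    (by simp [add_tsub_cancel_of_le])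

/-- Restart with probability `p` (truncated to `[0, 1]`). -/
def rejectWithProb (p : ℝ) : Prog D Unit := do
  let b ← sample (coin p)
  restartIf (b = true)

open scoped Classical in
/-- Pick a uniformly random element of `s`; restart if there is none. (All uses are followed by an
f-rejection with probability `1 - |s| / f̄`, which is `1` for `s = ∅`.) -/
def pickUniform {α : Type} (s : Finset α) : Prog D α :=
  if h : s.Nonempty then sample (PMF.uniformOfFinset s h) else restart

/-! ## The temporal configuration model -/

variable (D) in
/-- The urn contains `dᵢ` marbles with label `i`. -/
abbrev Marble := Σ i : Node D, Fin (D.d i)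

instance : Nonempty (Fin (degSum D) ≃ Marble D) := ⟨finSigmaFinEquiv.symm⟩

variable (D) in
/-- Drawing all marbles without replacement amounts to a uniformly random drawing order `σ` of the
marbles. The draws number `2k` and `2k + 1` give the nodes of the `k`-th edge, whose timestamp `τ k`
is uniform and independent. -/
def configModel : PMF (TGraph D) :=
  (PMF.uniformOfFintype
      ((Fin (degSum D) ≃ Marble D) × (Fin (degSum D / 2) → Stamp D))).map fun ⟨σ, τ⟩ =>
    (Finset.univ : Finset (Fin (degSum D / 2))).val.map fun k : Fin (degSum D / 2) =>
      (s((σ ⟨2 * k, by omega⟩).1, (σ ⟨2 * k + 1, by omega⟩).1), τ k)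

/-! ## Initial conditions -/

/-- `L`, the sum of the temporal multiplicities of the loops. -/
def sumLoops (G : TGraph D) : ℕ := ∑ i, ∑ t, W G i i t

/-- `D`, the sum of the temporal multiplicities of the temporal multi-edges (each unordered pair of
nodes is taken once, so that `D / 2` counts the temporal double-edges if there are no others). -/
def sumMulti (G : TGraph D) : ℕ := ∑ i, ∑ j with i < j, ∑ t, W G i j t

/-- The initial conditions with constants `lam` (for loops) and `kap` (for double-edges). -/
structure InitialConditions (lam kap : ℕ) (G : TGraph D) : Prop where
  loops_le : (sumLoops G : ℝ) ≤ BL D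
  multi_le : (sumMulti G : ℝ) / 2 ≤ BD D
  no_double_loop : ∀ i t, W G i i t < 2
  no_triple_edge : ∀ i j t, i ≠ j → W G i j t < 3
  loops_at_le : ∀ i, #{t | W G i i t = 1} ≤ lam
  doubles_at_le : ∀ i, #{x : Node D × Stamp D | i ≠ x.1 ∧ W G i x.1 x.2 = 2} ≤ kap

variable (D) in
/-- The requirements on the input without which only simple initial graphs are accepted. -/
def Requirements : Prop :=
  (degSum D : ℝ) > 16 * (maxDeg D : ℝ) ^ 2 + 4 * maxDeg D + 2 * BL D + 4 * BD D ∧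
    (D.T : ℝ) > maxDeg D - 1

/-! ## Rewiring -/

/-- The edges `old` of `G` can be replaced with the edges `new`: the former are (distinct) edges of
`G`, the latter are distinct and do not exist in `G`. -/
structure CanRewire (G old new : TGraph D) : Prop where
  old_le : old ≤ G
  new_nodup : new.Nodup
  new_notMem : ∀ e ∈ new, e ∉ G

def rewire (G old new : TGraph D) : TGraph D := G - old + new

/-- The number of timestamps `t` such that `({i, j}, t)` does not exist in `G`. -/
def freeStamps (G : TGraph D) (i j : Node D) : ℕ := #{t | w G i j t = 0}

/-- `kᵢ = dᵢ - ∑ₜ (2 Wᵢᵢₜ + ∑_{j ≠ i} Wᵢⱼₜ)`, the number of simple edges at `i`. -/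
def simpleDeg (X : Node D → Node D → Stamp D → ℕ) (i : Node D) : ℝ :=
  (D.d i : ℝ) - ∑ t, (2 * (X i i t : ℝ) + ∑ j with j ≠ i, (X i j t : ℝ))

/-! ## Auxiliary switchings

The switchings `A_{m,n}`, `B_{m,n}`, `C_{m,n,o,p}` follow one pattern. Given are distinct base nodes
`base` (`v₁, …, v₅`, or `v₁, …, v₆`, or `v₁, …, v₁₀`) and `q` pairs `{a p, b p}` of base nodes
(`q = 2, 2, 4`) which are non-edges. For every `p` the switching picks `r p` edges at `a p` and `r p`
edges at `b p` and turns them into `r p` edges between `a p` and `b p` and `r p` edges between the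
other end nodes. -/

/-- The choices for one of the pairs of edges: `({a, x}, tx)` and `({b, y}, ty)` are to be replaced
with `({a, b}, tab)` and `({x, y}, txy)`. -/
structure AuxChoice (D : Input) where
  x : Node D
  y : Node D
  tx : Stamp D
  ty : Stamp D
  tab : Stamp D
  txy : Stamp D
deriving DecidableEq

instance : Fintype (AuxChoice D) :=
  Fintype.ofInjective (fun S => (S.x, S.y, S.tx, S.ty, S.tab, S.txy)) (by
    rintro ⟨⟩ ⟨⟩ h; simpa using h)

abbrev AuxData (D : Input) {q : ℕ} (r : Fin q → ℕ) := (p : Fin q) → Fin (r p) → AuxChoice D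

section Aux

variable {k q : ℕ} {r : Fin q → ℕ}

def auxOld (a b : Fin q → Node D) (S : AuxData D r) : TGraph D :=
  ∑ p, ∑ i, {(s(a p, (S p i).x), (S p i).tx), (s(b p, (S p i).y), (S p i).ty)}

def auxNew (a b : Fin q → Node D) (S : AuxData D r) : TGraph D :=
  ∑ p, ∑ i, {(s(a p, b p), (S p i).tab), (s((S p i).x, (S p i).y), (S p i).txy)}

/-- All nodes involved: the base nodes, the nodes `x`, and the nodes `y`. -/
def auxNodes (base : Fin k → Node D) (S : AuxData D r) :
    Fin k ⊕ (Σ p, Fin (r p)) ⊕ (Σ p, Fin (r p)) → Node D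
  | .inl l => base l
  | .inr (.inl z) => (S z.1 z.2).x
  | .inr (.inr z) => (S z.1 z.2).y

structure IsAuxSwitching (G : TGraph D) (base : Fin k → Node D) (a b : Fin q → Node D)
    (S : AuxData D r) : Prop where
  nonedge : ∀ p, mult G (a p) (b p) = 0
  simple_x : ∀ p i, IsSimpleEdge G (a p) (S p i).x (S p i).tx
  simple_y : ∀ p i, IsSimpleEdge G (b p) (S p i).y (S p i).ty
  distinct : Function.Injective (auxNodes base S)
  rewire : CanRewire G (auxOld a b S) (auxNew a b S)

open scoped Classical in
/-- The auxiliary switchings with multiplicities `r` that can be performed on `G`. -/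
def auxSwitchings (r : Fin q → ℕ) (G : TGraph D) (base : Fin k → Node D) (a b : Fin q → Node D) :
    Finset (AuxData D r) := {S | IsAuxSwitching G base a b S}

open scoped Classical in
/-- The number of auxiliary switchings with multiplicities `r` that produce `G₂`. -/
def auxBackward (r : Fin q → ℕ) (G₂ : TGraph D) (base : Fin k → Node D) (a b : Fin q → Node D) :
    ℕ :=
  #{S : AuxData D r | ∃ G₁ : TGraph D,
    IsAuxSwitching G₁ base a b S ∧ TGen.rewire G₁ (auxOld a b S) (auxNew a b S) = G₂}

end Aux

variable (D) in
/-- The index sets `Θ_A`, `Θ_B` (`q = 2`) and `Θ_C` (`q = 4`): multiplicities `0 ≤ r p < Δ` with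
`mu ≤ maxₚ r p`. -/
abbrev AuxType (q mu : ℕ) := {r : Fin q → Fin (maxDeg D) // ∃ p, mu ≤ (r p : ℕ)}

def AuxType.mults {q mu : ℕ} (θ : AuxType D q mu) (p : Fin q) : ℕ := θ.1 p

def AuxType.total {q mu : ℕ} (θ : AuxType D q mu) : ℕ := ∑ p, θ.mults p

/-- The upper bound `f̄_θ = Δ^{2k} T^{2k}` where `k` is the sum of the multiplicities. -/
def auxFBound {q mu : ℕ} (θ : AuxType D q mu) : ℝ :=
  (maxDeg D : ℝ) ^ (2 * θ.total) * (D.T : ℝ) ^ (2 * θ.total)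

/-- The lower bound `b̲_θ = (M - slack - 4 (k + q + 1) Δ)^k (T - (Δ - 1))^{2k}`. -/
def auxBBound {q mu : ℕ} (slack : ℝ) (θ : AuxType D q mu) : ℝ :=
  ((degSum D : ℝ) - slack - 4 * ((θ.total : ℝ) + q + 1) * maxDeg D) ^ θ.total *
    ((D.T : ℝ) - ((maxDeg D : ℝ) - 1)) ^ (2 * θ.total)

/-- The distribution on `ι ∪ {none}` with `p(i) = p(none) ρ(i)` for all `i` in `ι`. -/
def ratioDist {ι : Type} [Fintype ι] (ρ : ι → ℝ) : PMF (Option ι) :=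
  PMF.normalize (fun o => o.elim 1 fun i => ENNReal.ofReal (ρ i))
    (by
      rw [tsum_fintype]
      exact (lt_of_lt_of_le one_pos (Finset.single_le_sum
        (f := fun o : Option ι => (o.elim 1 fun i => ENNReal.ofReal (ρ i) : ENNReal))
        (fun _ _ => zero_le) (Finset.mem_univ none))).ne')
    (by
      rw [tsum_fintype]
      refine ENNReal.sum_ne_top.2 fun o _ => ?_
      cases o <;> simp)

theorem ratioDist_some {ι : Type} [Fintype ι] (ρ : ι → ℝ) (i : ι) :
    ratioDist ρ (some i) = ratioDist ρ none * ENNReal.ofReal (ρ i) := by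
  simp [ratioDist, PMF.normalize_apply, mul_comm]

open scoped Classical in
variable (D) in
/-- The type distributions `P_A`, `P_B`, `P_C`; `none` is the identity switching `I`. -/
def auxTypeDist (q mu : ℕ) (slack : ℝ) : PMF (Option (AuxType D q mu)) :=
  ratioDist fun θ => auxFBound θ / auxBBound slack θ

variable (D) in
/-- The probability of the identity switching. -/
def probIdentity (q mu : ℕ) (slack : ℝ) : ℝ := (auxTypeDist D q mu slack none).toReal

/-- Choose a type of auxiliary switching (or the identity) and perform it, with rejections. -/
def auxStep {k q : ℕ} (mu : ℕ) (slack : ℝ) (base : Fin k → Node D) (a b : Fin q → Node D)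
    (G' : TGraph D) : Prog D (TGraph D) := do
  let θ? ← sample (auxTypeDist D q mu slack)
  match θ? with
  | none => pure G'
  | some θ => do
    restartIf (∃ p, 1 ≤ mult G' (a p) (b p))
    let S ← pickUniform (auxSwitchings θ.mults G' base a b)
    rejectWithProb (1 - #(auxSwitchings θ.mults G' base a b) / auxFBound θ)
    let G'' := rewire G' (auxOld a b S) (auxNew a b S)
    visit G''
    rejectWithProb (1 - auxBBound slack θ / auxBackward θ.mults G'' base a b)
    pure G''

/-! ## Stage 1 -/

/-- The choices for a `TL` switching at `v₁, t₁`. -/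
structure TLData (D : Input) where
  v2 : Node D
  v3 : Node D
  v4 : Node D
  v5 : Node D
  t2 : Stamp D
  t3 : Stamp D
  t4 : Stamp D
  t5 : Stamp D
  t6 : Stamp D
deriving DecidableEq

instance : Fintype (TLData D) :=
  Fintype.ofInjective
    (fun S => (S.v2, S.v3, S.v4, S.v5, S.t2, S.t3, S.t4, S.t5, S.t6)) (by
    rintro ⟨⟩ ⟨⟩ h; simpa using h)

def tlOld (v1 : Node D) (t1 : Stamp D) (S : TLData D) : TGraph D :=
  {(s(v1, v1), t1), (s(S.v2, S.v4), S.t2), (s(S.v3, S.v5), S.t3)}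

def tlNew (v1 : Node D) (S : TLData D) : TGraph D :=
  {(s(v1, S.v2), S.t4), (s(v1, S.v3), S.t5), (s(S.v4, S.v5), S.t6)}

structure IsTL (G : TGraph D) (v1 : Node D) (t1 : Stamp D) (S : TLData D) : Prop where
  loop : w G v1 v1 t1 = 1
  simple₂₄ : IsSimpleEdge G S.v2 S.v4 S.t2
  simple₃₅ : IsSimpleEdge G S.v3 S.v5 S.t3
  ne_v1 : S.v2 ≠ v1 ∧ S.v3 ≠ v1 ∧ S.v4 ≠ v1 ∧ S.v5 ≠ v1
  v4_ne_v5 : S.v4 ≠ S.v5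
  rewire : CanRewire G (tlOld v1 t1 S) (tlNew v1 S)

open scoped Classical in
def tlSwitchings (G : TGraph D) (v1 : Node D) (t1 : Stamp D) : Finset (TLData D) :=
  {S | IsTL G v1 t1 S}

open scoped Classical in
/-- `b_TL(G', v₁; 0)`: ordered pairs of distinct simple edges at `v₁`. -/
def bTL0 (G : TGraph D) (v1 : Node D) : ℕ :=
  #{x : (Node D × Stamp D) × (Node D × Stamp D) |
    IsSimpleEdge G v1 x.1.1 x.1.2 ∧ IsSimpleEdge G v1 x.2.1 x.2.2 ∧ x.1 ≠ x.2}

open scoped Classical in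
/-- `b_TL(G', v₁ v₂ v₃; 1)`: (oriented) simple edges `({v₄, v₅}, t₆)` avoiding `v₁, v₂, v₃`. -/
def bTL1 (G : TGraph D) (v1 v2 v3 : Node D) : ℕ :=
  #{x : Node D × Node D × Stamp D | IsSimpleEdge G x.1 x.2.1 x.2.2 ∧
    x.1 ∉ ({v1, v2, v3} : Set (Node D)) ∧ x.2.1 ∉ ({v1, v2, v3} : Set (Node D))}

/-- `b_TL(G', v₁ v₂ v₃ v₄ v₅; 2)`: available timestamps for `{v₂, v₄}` and `{v₃, v₅}`. -/
def bTL2 (G : TGraph D) (v2 v4 v3 v5 : Node D) : ℕ := freeStamps G v2 v4 * freeStamps G v3 v5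

/-- One iteration of Stage 1: remove the temporal single-loop `({v₁}, t₁)`. -/
def stage1Step (mu : ℕ) (G : TGraph D) (l : Node D × Stamp D) : Prog D (TGraph D) := do
  let v1 := l.1
  let t1 := l.2
  let M : ℝ := degSum D
  let S ← pickUniform (tlSwitchings G v1 t1)
  rejectWithProb (1 - #(tlSwitchings G v1 t1) / (M ^ 2 * (D.T : ℝ) ^ 3))
  let G' := rewire G (tlOld v1 t1 S) (tlNew v1 S)
  visit G'
  let k1 := simpleDeg (W G') v1
  restartIf (mu ≤ mult G' S.v2 S.v4 ∨ mu ≤ mult G' S.v3 S.v5)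
  rejectWithProb (1 - ((D.T : ℝ) - ((mu : ℝ) - 1)) ^ 2 / bTL2 G' S.v2 S.v4 S.v3 S.v5)
  let G'' ← auxStep mu (2 * BL D + 4 * BD D)
    ![v1, S.v2, S.v3, S.v4, S.v5] ![S.v2, S.v3] ![S.v4, S.v5] G'
  rejectWithProb (1 - (k1 * (k1 - 1)) * (M - 2 * BL D - 4 * BD D - 4 * maxDeg D) /
    (bTL0 G'' v1 * bTL1 G'' v1 S.v2 S.v3))
  pure G''

/-! ## Stage 2 -/

/-- The choices for a `TD₁` switching at `({v₁, v₂}, t₁)`. -/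
structure TD1Data (D : Input) where
  v3 : Node D
  v4 : Node D
  v5 : Node D
  v6 : Node D
  t2 : Stamp D
  t3 : Stamp D
  t4 : Stamp D
  t5 : Stamp D
  t6 : Stamp D
deriving DecidableEq

instance : Fintype (TD1Data D) :=
  Fintype.ofInjective
    (fun S => (S.v3, S.v4, S.v5, S.v6, S.t2, S.t3, S.t4, S.t5, S.t6)) (by
    rintro ⟨⟩ ⟨⟩ h; simpa using h)

def td1Old (v1 v2 : Node D) (t1 : Stamp D) (S : TD1Data D) : TGraph D :=
  {(s(v1, v2), t1), (s(S.v3, S.v5), S.t2), (s(S.v4, S.v6), S.t3)}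

def td1New (v1 v2 : Node D) (S : TD1Data D) : TGraph D :=
  {(s(v1, S.v3), S.t4), (s(v2, S.v4), S.t5), (s(S.v5, S.v6), S.t6)}

structure IsTD1 (G : TGraph D) (v1 v2 : Node D) (t1 : Stamp D) (S : TD1Data D) : Prop where
  double : w G v1 v2 t1 = 2
  simple₃₅ : IsSimpleEdge G S.v3 S.v5 S.t2
  simple₄₆ : IsSimpleEdge G S.v4 S.v6 S.t3
  ne_v1 : S.v3 ≠ v1 ∧ S.v4 ≠ v1 ∧ S.v5 ≠ v1 ∧ S.v6 ≠ v1
  ne_v2 : S.v3 ≠ v2 ∧ S.v4 ≠ v2 ∧ S.v5 ≠ v2 ∧ S.v6 ≠ v2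
  v5_ne_v6 : S.v5 ≠ S.v6
  rewire : CanRewire G (td1Old v1 v2 t1 S) (td1New v1 v2 S)

/-- The choices for a `TD₀` switching at `({v₁, v₂}, t₁)`. -/
structure TD0Data (D : Input) where
  v3 : Node D
  v4 : Node D
  v5 : Node D
  v6 : Node D
  v7 : Node D
  v8 : Node D
  v9 : Node D
  v10 : Node D
  t2 : Stamp D
  t3 : Stamp D
  t4 : Stamp D
  t5 : Stamp D
  t6 : Stamp D
  t7 : Stamp D
  t8 : Stamp D
  t9 : Stamp D
  t10 : Stamp D
  t11 : Stamp D
deriving DecidableEq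

instance : Fintype (TD0Data D) :=
  Fintype.ofInjective
    (fun S => (S.v3, S.v4, S.v5, S.v6, S.v7, S.v8, S.v9, S.v10,
      S.t2, S.t3, S.t4, S.t5, S.t6, S.t7, S.t8, S.t9, S.t10, S.t11)) (by
    rintro ⟨⟩ ⟨⟩ h; simpa using h)

/-- Both copies of the double-edge and four further edges are removed. -/
def td0Old (v1 v2 : Node D) (t1 : Stamp D) (S : TD0Data D) : TGraph D :=
  {(s(v1, v2), t1), (s(v1, v2), t1),
    (s(S.v3, S.v7), S.t2), (s(S.v4, S.v8), S.t3), (s(S.v5, S.v9), S.t4), (s(S.v6, S.v10), S.t5)}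

def td0New (v1 v2 : Node D) (S : TD0Data D) : TGraph D :=
  {(s(v1, S.v3), S.t6), (s(v2, S.v4), S.t7), (s(v1, S.v5), S.t8), (s(v2, S.v6), S.t9),
    (s(S.v7, S.v8), S.t10), (s(S.v9, S.v10), S.t11)}

structure IsTD0 (G : TGraph D) (v1 v2 : Node D) (t1 : Stamp D) (S : TD0Data D) : Prop where
  double : w G v1 v2 t1 = 2
  simple₃₇ : IsSimpleEdge G S.v3 S.v7 S.t2
  simple₄₈ : IsSimpleEdge G S.v4 S.v8 S.t3
  simple₅₉ : IsSimpleEdge G S.v5 S.v9 S.t4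
  simple₆₁₀ : IsSimpleEdge G S.v6 S.v10 S.t5
  ne_v1 : ∀ v ∈ [S.v3, S.v4, S.v5, S.v6, S.v7, S.v8, S.v9, S.v10], v ≠ v1
  ne_v2 : ∀ v ∈ [S.v3, S.v4, S.v5, S.v6, S.v7, S.v8, S.v9, S.v10], v ≠ v2
  v7_ne_v8 : S.v7 ≠ S.v8
  v9_ne_v10 : S.v9 ≠ S.v10
  rewire : CanRewire G (td0Old v1 v2 t1 S) (td0New v1 v2 S)

open scoped Classical in
def td1Switchings (G : TGraph D) (v1 v2 : Node D) (t1 : Stamp D) : Finset (TD1Data D) :=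
  {S | IsTD1 G v1 v2 t1 S}

open scoped Classical in
def td0Switchings (G : TGraph D) (v1 v2 : Node D) (t1 : Stamp D) : Finset (TD0Data D) :=
  {S | IsTD0 G v1 v2 t1 S}

open scoped Classical in
/-- `b_TD₁(G', v₁ v₂; 0)`: simple edges `({v₁, v₃}, t₄)` and `({v₂, v₄}, t₅)`. -/
def bTD1_0 (G : TGraph D) (v1 v2 : Node D) : ℕ :=
  #{x : (Node D × Stamp D) × (Node D × Stamp D) |
    IsSimpleEdge G v1 x.1.1 x.1.2 ∧ IsSimpleEdge G v2 x.2.1 x.2.2}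

open scoped Classical in
/-- `b_TD₁(G', v₁ … v₄; 1)`: (oriented) simple edges `({v₅, v₆}, t₆)` avoiding `v₁, …, v₄`. -/
def bTD1_1 (G : TGraph D) (avoid : Set (Node D)) : ℕ :=
  #{x : Node D × Node D × Stamp D | IsSimpleEdge G x.1 x.2.1 x.2.2 ∧ x.1 ∉ avoid ∧ x.2.1 ∉ avoid}

/-- `b_TD₀(G', v₁ v₂; 0)`: ordered pairs of distinct simple edges at `v₁`, and the same at `v₂`. -/
def bTD0_0 (G : TGraph D) (v1 v2 : Node D) : ℕ := bTL0 G v1 * bTL0 G v2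

open scoped Classical in
/-- `b_TD₀(G', v₁ … v₆; 1)`: distinct (oriented) simple edges `({v₇, v₈}, t₁₀)`,
`({v₉, v₁₀}, t₁₁)` avoiding `v₁, …, v₆`. -/
def bTD0_1 (G : TGraph D) (avoid : Set (Node D)) : ℕ :=
  #{x : (Node D × Node D × Stamp D) × (Node D × Node D × Stamp D) |
    (IsSimpleEdge G x.1.1 x.1.2.1 x.1.2.2 ∧ x.1.1 ∉ avoid ∧ x.1.2.1 ∉ avoid) ∧
    (IsSimpleEdge G x.2.1 x.2.2.1 x.2.2.2 ∧ x.2.1 ∉ avoid ∧ x.2.2.1 ∉ avoid) ∧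
    ((s(x.1.1, x.1.2.1), x.1.2.2) : TEdge D) ≠ (s(x.2.1, x.2.2.1), x.2.2.2)}

/-- `b̲_TD₁(𝐖'; 0) = k₁ k₂`. -/
def bTD1Low0 (X : Node D → Node D → Stamp D → ℕ) (v1 v2 : Node D) : ℝ :=
  simpleDeg X v1 * simpleDeg X v2

variable (D) in
/-- `b̲_TD₁(𝐖'; 1) = M - 4 B_D - 4 Δ`. -/
def bTD1Low1 : ℝ := (degSum D : ℝ) - 4 * BD D - 4 * maxDeg D

variable (D) in
/-- `b̲_TD₁(𝐖'; 2) = (T - (mu - 1))²`. -/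
def bTD1Low2 (mu : ℕ) : ℝ := ((D.T : ℝ) - ((mu : ℝ) - 1)) ^ 2

/-- `b̲_TD₀(𝐖'; 0) = k₁ (k₁ - 1) k₂ (k₂ - 1)`. -/
def bTD0Low0 (X : Node D → Node D → Stamp D → ℕ) (v1 v2 : Node D) : ℝ :=
  simpleDeg X v1 * (simpleDeg X v1 - 1) * (simpleDeg X v2 * (simpleDeg X v2 - 1))

variable (D) in
/-- `b̲_TD₀(𝐖'; 1) = (M - 4 B_D - 4 Δ)²`. -/
def bTD0Low1 : ℝ := ((degSum D : ℝ) - 4 * BD D - 4 * maxDeg D) ^ 2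

variable (D) in
/-- `b̲_TD₀(𝐖'; 2) = (T - (mu - 1))⁴`. -/
def bTD0Low2 (mu : ℕ) : ℝ := ((D.T : ℝ) - ((mu : ℝ) - 1)) ^ 4

variable (D) in
/-- `f̄_TD₁ = M² T³`. -/
def fTD1Bound : ℝ := (degSum D : ℝ) ^ 2 * (D.T : ℝ) ^ 3

variable (D) in
/-- `f̄_TD₀ = M⁴ T⁶`. -/
def fTD0Bound : ℝ := (degSum D : ℝ) ^ 4 * (D.T : ℝ) ^ 6

/-- The tensor `𝐖'` after the removal of the temporal double-edge `({v₁, v₂}, t₁)`. -/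
def clearEntry (X : Node D → Node D → Stamp D → ℕ) (v1 v2 : Node D) (t1 : Stamp D) :
    Node D → Node D → Stamp D → ℕ :=
  fun i j t => if s(i, j) = s(v1, v2) ∧ t = t1 then 0 else X i j t

/-- The ratio `p(TD₁) / p(TD₀)`. -/
def tdRatio (mu : ℕ) (G : TGraph D) (v1 v2 : Node D) (t1 : Stamp D) : ℝ :=
  let X' := clearEntry (W G) v1 v2 t1
  probIdentity D 4 mu (4 * BD D) / probIdentity D 2 mu (4 * BD D) *
    (fTD1Bound D * (bTD0Low0 X' v1 v2 * bTD0Low1 D * bTD0Low2 D mu) /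
      (fTD0Bound D * (bTD1Low0 X' v1 v2 * bTD1Low1 D * bTD1Low2 D mu)))

/-- An iteration of Stage 2 in which `θ = TD₁`. -/
def td1Step (mu : ℕ) (G : TGraph D) (v1 v2 : Node D) (t1 : Stamp D) : Prog D (TGraph D) := do
  let S ← pickUniform (td1Switchings G v1 v2 t1)
  rejectWithProb (1 - #(td1Switchings G v1 v2 t1) / fTD1Bound D)
  let G' := rewire G (td1Old v1 v2 t1 S) (td1New v1 v2 S)
  visit G'
  restartIf (mu ≤ mult G' S.v3 S.v5 ∨ mu ≤ mult G' S.v4 S.v6)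
  rejectWithProb (1 - bTD1Low2 D mu / (freeStamps G' S.v3 S.v5 * freeStamps G' S.v4 S.v6))
  let G'' ← auxStep mu (4 * BD D)
    ![v1, v2, S.v3, S.v4, S.v5, S.v6] ![S.v3, S.v4] ![S.v5, S.v6] G'
  rejectWithProb (1 - bTD1Low0 (W G') v1 v2 * bTD1Low1 D /
    (bTD1_0 G'' v1 v2 * bTD1_1 G'' {v1, v2, S.v3, S.v4}))
  pure G''

/-- An iteration of Stage 2 in which `θ = TD₀`. -/
def td0Step (mu : ℕ) (G : TGraph D) (v1 v2 : Node D) (t1 : Stamp D) : Prog D (TGraph D) := do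
  let S ← pickUniform (td0Switchings G v1 v2 t1)
  rejectWithProb (1 - #(td0Switchings G v1 v2 t1) / fTD0Bound D)
  let G' := rewire G (td0Old v1 v2 t1 S) (td0New v1 v2 S)
  visit G'
  restartIf (mu ≤ mult G' S.v3 S.v7 ∨ mu ≤ mult G' S.v4 S.v8 ∨
    mu ≤ mult G' S.v5 S.v9 ∨ mu ≤ mult G' S.v6 S.v10)
  rejectWithProb (1 - bTD0Low2 D mu /
    (freeStamps G' S.v3 S.v7 * freeStamps G' S.v4 S.v8 *
      freeStamps G' S.v5 S.v9 * freeStamps G' S.v6 S.v10))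
  let G'' ← auxStep mu (4 * BD D)
    ![v1, v2, S.v3, S.v4, S.v5, S.v6, S.v7, S.v8, S.v9, S.v10]
    ![S.v3, S.v4, S.v5, S.v6] ![S.v7, S.v8, S.v9, S.v10] G'
  rejectWithProb (1 - bTD0Low0 (W G') v1 v2 * bTD0Low1 D /
    (bTD0_0 G'' v1 v2 * bTD0_1 G'' {v1, v2, S.v3, S.v4, S.v5, S.v6}))
  pure G''

/-- One iteration of Stage 2: remove the temporal double-edge `({v₁, v₂}, t₁)`. The type is drawn
with `p(TD₁) = p(TD₀) · tdRatio`; here `none` stands for `TD₀`. -/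
def stage2Step (mu : ℕ) (G : TGraph D) (e : Node D × Node D × Stamp D) : Prog D (TGraph D) := do
  let θ ← sample (ratioDist fun _ : Unit => tdRatio mu G e.1 e.2.1 e.2.2)
  match θ with
  | none => td0Step mu G e.1 e.2.1 e.2.2
  | some _ => td1Step mu G e.1 e.2.1 e.2.2

/-! ## The algorithm -/

/-- A rule that fixes, as functions of `𝐖(G)`, an order in which the temporal single-loops are
removed and an order in which the temporal double-edges are removed. Each double-edge is listed once,
with one of its two orientations. -/
structure RemovalOrder (D : Input) where
  loops : (Node D → Node D → Stamp D → ℕ) → List (Node D × Stamp D)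
  loops_nodup : ∀ G : TGraph D, (loops (W G)).Nodup
  mem_loops : ∀ (G : TGraph D) i t, (i, t) ∈ loops (W G) ↔ W G i i t = 1
  doubles : (Node D → Node D → Stamp D → ℕ) → List (Node D × Node D × Stamp D)
  doubles_nodup : ∀ G : TGraph D, (doubles (W G)).Nodup
  of_mem_doubles : ∀ (G : TGraph D) i j t, (i, j, t) ∈ doubles (W G) → i ≠ j ∧ W G i j t = 2
  doubles_once : ∀ (G : TGraph D) i j t, i ≠ j → W G i j t = 2 →
    Xor ((i, j, t) ∈ doubles (W G)) ((j, i, t) ∈ doubles (W G))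

open scoped Classical in
/-- The algorithm from the sampling of an initial graph until it outputs a graph or restarts. -/
def attempt (D : Input) (lam kap mu : ℕ) (π : RemovalOrder D) : Prog D (TGraph D) := do
  let G ← sample (configModel D)
  visit G
  if IsSimple G then pure G
  else if Requirements D ∧ InitialConditions lam kap G then do
    let G₁ ← (π.loops (W G)).foldlM (stage1Step mu) G
    (π.doubles (W G₁)).foldlM (stage2Step mu) G₁
  else restart

/-- The law of a sequence of independent attempts. A run of the algorithm consists of the attempts up
to and including the first one that outputs a graph (and of all attempts if there is none). -/
def runLaw (D : Input) (lam kap mu : ℕ) (π : RemovalOrder D) :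
    Measure (ℕ → Outcome D (TGraph D)) :=
  Measure.infinitePi fun _ => PMF.toMeasure (attempt D lam kap mu π)

/-- The graphs visited during a run, over all attempts that are actually started. -/
def visitedInRun (ω : ℕ → Outcome D (TGraph D)) : Set (TGraph D) :=
  {G | ∃ k, (∀ j < k, (ω j).result = none) ∧ G ∈ (ω k).visited}

end TGen

end

open scoped ENNReal

noncomputable section

namespace TGen

variable {D : Input}

/-! ## Expected values of programs -/

/-! Write μ = m + 2 and c = Δ/M. Let b be the probability that one attempt visits a graph with a
pair of multiplicity above μ, and s the probability that it outputs a graph. The k-th attempt (from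
0) is started only if all earlier ones restarted, so a run visits such a graph with probability at
most ∑ (1 - s)^k b = b/s (`one_sub_le_runLaw`). Hence it suffices that b tends to 0 while s stays
above a positive constant. Both are expected values `wp` of the same program, with different sets of
forbidden graphs and different values of the result.

Upper bound for b. A union bound shows that the initial graph has a pair of multiplicity at least m
+ 2 with probability O(Δ^(2m+2)/M^m), which vanishes because εm > 2 (`configProb_le_pairMult_le`,
`tendsto_maxDeg_pow_div`). Otherwise it is enough that the switchings of an attempt do not raise any
pair by more than one. Every switching consists of one or two units, and a unit picks two arcs of
simple edges; at most 3Δ units are needed. The f-rejection gives each switching probability at most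
1/f̄, so expectations are at most averages over all choices of arcs, and an end of an arc hits a
given node with probability at most c. The potential bounds the probability that some pair will be
hit twice; it is a supermartingale (`sum_stoppedPotential_le`) and starts at (number of units)·κ
with κ = O(c) + P(auxiliary switching). An auxiliary switching counts as a failure: its probability
is O((Δ²/M)^μ') (`le_auxTypeDist`). Altogether 3Δκ tends to 0.

Lower bound for s, if T ≥ 2μ'. The initial conditions hold with probability at least 1/8: Markov's
inequality controls the numbers of loops and double-edges, first moments the rest
(`le_configProb_initialConditions`). In the stages all but a fraction O(c) of the choices of arcs
are generic, and for these each rejection except the one for timestamps is lost with probability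
O(c); these losses are paid by κ within the same induction. The timestamp rejection leaves a factor
((T-μ'+1)/T)² per unit, and over 3Δ ≤ 3T units a constant, at least exp(-12μ'), remains
(`exp_le_stampBound_pow`).

Lower bound for s, if T < 2μ'. Then Δ ≤ T is bounded, and the stages are not used at all: the
initial graph itself is simple with probability bounded below. This comes from a switching argument
in the configuration model, where exchanging ends of two edges removes bad edges
(`le_configProb_isSimple`). -/

theorem tsum_pure_mul {α : Type*} (a : α) (v : α → ℝ≥0∞) :
    ∑' b, (PMF.pure a) b * v b = v a := by
  rw [tsum_eq_single a]
  · simp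
  · intro b hb
    simp [hb]

theorem tsum_bind_mul {α β : Type*} (p : PMF α) (f : α → PMF β) (v : β → ℝ≥0∞) :
    ∑' b, (p.bind f) b * v b = ∑' a, p a * ∑' b, f a b * v b := by
  simp_rw [PMF.bind_apply, ← ENNReal.tsum_mul_right, ← ENNReal.tsum_mul_left]
  rw [ENNReal.tsum_comm]
  simp_rw [mul_assoc]

/-- The law of the outcome of a program. -/
def Prog.law {α : Type} (p : Prog D α) : PMF (Outcome D α) := p

open scoped Classical in
/-- The value of an outcome: `1` if a graph in `B` has been visited, otherwise the value of the
result, and `0` after a restart. -/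
def outcomeValue {α : Type} (B : Set (TGraph D)) (Q : α → ℝ≥0∞) (o : Outcome D α) : ℝ≥0∞ :=
  if ∃ G ∈ o.visited, G ∈ B then 1 else o.result.elim 0 Q

/-- The expected value of a program. -/
def wp {α : Type} (B : Set (TGraph D)) (p : Prog D α) (Q : α → ℝ≥0∞) : ℝ≥0∞ :=
  ∑' o, p.law o * outcomeValue B Q o

section wp

variable {α β : Type} (B : Set (TGraph D))

theorem wp_pure (a : α) (Q : α → ℝ≥0∞) : wp B (pure a) Q = Q a := by
  refine (tsum_pure_mul _ _).trans ?_
  simp [outcomeValue]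

theorem wp_restart (Q : α → ℝ≥0∞) : wp B restart Q = 0 := by
  refine (tsum_pure_mul _ _).trans ?_
  simp [outcomeValue]

open scoped Classical in
theorem wp_visit (G : TGraph D) (Q : Unit → ℝ≥0∞) :
    wp B (visit G) Q = if G ∈ B then 1 else Q () := by
  refine (tsum_pure_mul _ _).trans ?_
  simp [outcomeValue]

theorem wp_sample (p : PMF α) (Q : α → ℝ≥0∞) : wp B (sample p) Q = ∑' a, p a * Q a := by
  refine (tsum_bind_mul _ _ _).trans ?_
  simp_rw [tsum_pure_mul]
  simp [outcomeValue]

/-- The value composes because a visit to `B` in the first program already fixes the value 1,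
whatever follows, and a restart fixes the value 0 if `B` has not been visited. -/
theorem wp_bind (p : Prog D α) (f : α → Prog D β) (Q : β → ℝ≥0∞) :
    wp B (p >>= f) Q = wp B p fun a => wp B (f a) Q := by
  refine (tsum_bind_mul _ _ _).trans ?_
  unfold wp
  congr 1
  funext o
  congr 1
  rcases o with ⟨l, _ | a⟩
  · refine (tsum_pure_mul _ _).trans ?_
    simp [outcomeValue]
  · refine (tsum_bind_mul _ _ _).trans ?_
    simp_rw [tsum_pure_mul]
    by_cases h : ∃ G ∈ l, G ∈ B
    · have : ∀ o' : Outcome D β, outcomeValue B Q ⟨l ++ o'.visited, o'.result⟩ = 1 := by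
        intro o'
        obtain ⟨G, hG, hB⟩ := h
        exact if_pos ⟨G, by simp [hG], hB⟩
      simp only [this, mul_one]
      refine (PMF.tsum_coe (f a).law).trans ?_
      rw [outcomeValue, if_pos h]
    · have : ∀ o' : Outcome D β, outcomeValue B Q ⟨l ++ o'.visited, o'.result⟩ =
          outcomeValue B Q o' := by
        intro o'
        have : (∃ G ∈ l ++ o'.visited, G ∈ B) ↔ ∃ G ∈ o'.visited, G ∈ B := by
          constructor
          · rintro ⟨G, hG, hB⟩
            rcases List.mem_append.1 hG with hG | hG
            · exact (h ⟨G, hG, hB⟩).elim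
            · exact ⟨G, hG, hB⟩
          · rintro ⟨G, hG, hB⟩
            exact ⟨G, List.mem_append.2 (.inr hG), hB⟩
        unfold outcomeValue
        classical exact if_congr this rfl rfl
      simp only [this]
      conv_rhs => rw [outcomeValue, if_neg h]
      rfl

theorem wp_le_one {p : Prog D α} {Q : α → ℝ≥0∞} (h : ∀ a, Q a ≤ 1) : wp B p Q ≤ 1 := by
  rw [← PMF.tsum_coe p.law]
  refine ENNReal.tsum_le_tsum fun o => ?_
  refine mul_le_of_le_one_right' ?_
  unfold outcomeValue
  split_ifs
  · exact le_rfl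
  · rcases o.result with _ | a
    · exact zero_le
    · exact h a

open scoped Classical in
theorem wp_restartIf (p : Prop) (Q : Unit → ℝ≥0∞) :
    wp B (restartIf p) Q = if p then 0 else Q () := by
  unfold restartIf
  split_ifs
  · exact wp_restart B Q
  · exact wp_pure B _ Q

/-- The truncations agree at both ends: for x ≤ 0 the rejection is certain, for x ≥ 1 it never
happens. -/
theorem wp_rejectWithProb (x : ℝ) (Q : Unit → ℝ≥0∞) :
    wp B (rejectWithProb (1 - x)) Q = min (ENNReal.ofReal x) 1 * Q () := by
  unfold rejectWithProb
  rw [wp_bind, wp_sample, tsum_fintype]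
  simp only [wp_restartIf, Fintype.sum_bool, if_true, mul_zero, zero_add, Bool.false_eq_true,
    if_false]
  congr 1
  simp only [coin, PMF.ofFintype_apply, Bool.false_eq_true, if_false]
  rcases le_total x 0 with hx | hx
  · rw [ENNReal.ofReal_of_nonpos hx, min_eq_right (by rw [ENNReal.one_le_ofReal]; linarith)]
    simp
  rcases le_total x 1 with hx1 | hx1
  · rw [min_eq_left (by rw [ENNReal.ofReal_le_one]; linarith),
      min_eq_left (by rw [ENNReal.ofReal_le_one]; linarith), ← ENNReal.ofReal_one,
      ← ENNReal.ofReal_sub _ (by linarith)]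
    congr 1
    ring
  · rw [min_eq_right ((ENNReal.one_le_ofReal (p := x)).2 hx1),
      ENNReal.ofReal_of_nonpos (by linarith : 1 - x ≤ 0)]
    simp

/-- No case distinction is needed: for empty `s` the program restarts and the sum is empty. -/
theorem wp_pickUniform (s : Finset α) (Q : α → ℝ≥0∞) :
    wp B (pickUniform s) Q = ∑ a ∈ s, (#s : ℝ≥0∞)⁻¹ * Q a := by
  classical
  unfold pickUniform
  split_ifs with h
  · rw [wp_sample, tsum_eq_sum (s := s)]
    · refine Finset.sum_congr rfl fun a ha => ?_
      rw [PMF.uniformOfFinset_apply_of_mem h ha]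
    · intro a ha
      rw [PMF.uniformOfFinset_apply_of_notMem h ha, zero_mul]
  · rw [wp_restart, Finset.not_nonempty_iff_eq_empty.1 h, Finset.sum_empty]

end wp

/-! ## A switching with rejections -/

/-- The common form of the iterations of both stages. -/
def switchStep {α : Type} (F : Finset α) (fbar : ℝ) (nxt : α → TGraph D) (R : α → Prop)
    (p₁ : α → ℝ) (aux : α → Prog D (TGraph D)) (p₂ : α → TGraph D → ℝ) :
    Prog D (TGraph D) := do
  let S ← pickUniform F
  rejectWithProb (1 - #F / fbar)
  visit (nxt S)
  restartIf (R S)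
  rejectWithProb (1 - p₁ S)
  let G'' ← aux S
  rejectWithProb (1 - p₂ S G'')
  pure G''

section switchStep

variable {α : Type} (B : Set (TGraph D)) {F : Finset α} {fbar : ℝ} {nxt : α → TGraph D}
  {R : α → Prop} {p₁ : α → ℝ} {aux : α → Prog D (TGraph D)} {p₂ : α → TGraph D → ℝ}

open scoped Classical in
theorem wp_switchStep (Q : TGraph D → ℝ≥0∞) :
    wp B (switchStep F fbar nxt R p₁ aux p₂) Q =
      ∑ S ∈ F, (#F : ℝ≥0∞)⁻¹ * (min (ENNReal.ofReal (#F / fbar)) 1 *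
        if nxt S ∈ B then 1 else if R S then 0 else min (ENNReal.ofReal (p₁ S)) 1 *
          wp B (aux S) fun G'' => min (ENNReal.ofReal (p₂ S G'')) 1 * Q G'') := by
  unfold switchStep
  simp only [wp_bind, wp_pickUniform, wp_rejectWithProb, wp_visit, wp_restartIf, wp_pure]

/-- The purpose of the f-rejection: choosing uniformly among n switchings and accepting with
probability n/f̄ gives each of them probability 1/f̄, independently of the current graph. -/
theorem inv_mul_min_le (n : ℕ) {fbar : ℝ} (hf : 0 < fbar) :
    (n : ℝ≥0∞)⁻¹ * min (ENNReal.ofReal (n / fbar)) 1 ≤ ENNReal.ofReal (1 / fbar) := by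
  rcases Nat.eq_zero_or_pos n with rfl | hn
  · simp
  · refine (mul_le_mul_right (min_le_left _ _) _).trans (le_of_eq ?_)
    have hn' : (0 : ℝ) < n := by exact_mod_cast hn
    rw [← ENNReal.ofReal_natCast, ← ENNReal.ofReal_inv_of_pos hn',
      ← ENNReal.ofReal_mul (by positivity)]
    congr 1
    field_simp

theorem le_inv_mul_min {n : ℕ} (hn : 0 < n) {fbar : ℝ} (hf : 0 < fbar) (h : (n : ℝ) ≤ fbar) :
    ENNReal.ofReal (1 / fbar) ≤ (n : ℝ≥0∞)⁻¹ * min (ENNReal.ofReal (n / fbar)) 1 := by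
  have hn' : (0 : ℝ) < n := by exact_mod_cast hn
  rw [min_eq_left (by rw [ENNReal.ofReal_le_one, div_le_one hf]; exact h),
    ← ENNReal.ofReal_natCast, ← ENNReal.ofReal_inv_of_pos hn', ← ENNReal.ofReal_mul (by positivity)]
  refine le_of_eq ?_
  congr 1
  field_simp

open scoped Classical in
-- Later rejections only lower the value and are dropped. The auxiliary step costs an additive η,
-- and this is paid once, since the probabilities 1/f̄ sum to at most 1.
theorem wp_switchStep_le (hf : 0 < fbar) (hF : (#F : ℝ) ≤ fbar) {Q : TGraph D → ℝ≥0∞} {η : ℝ}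
    (haux : ∀ S ∈ F, ∀ Q' : TGraph D → ℝ≥0∞, (∀ G, Q' G ≤ 1) →
      wp B (aux S) Q' ≤ Q' (nxt S) + ENNReal.ofReal η) (hQ : ∀ G, Q G ≤ 1) :
    wp B (switchStep F fbar nxt R p₁ aux p₂) Q ≤
      (∑ S ∈ F, ENNReal.ofReal (1 / fbar) * if nxt S ∈ B then 1 else Q (nxt S)) +
        ENNReal.ofReal η := by
  rw [wp_switchStep]
  calc _ ≤ ∑ S ∈ F, (ENNReal.ofReal (1 / fbar) * (if nxt S ∈ B then 1 else Q (nxt S)) +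
        ENNReal.ofReal (1 / fbar) * ENNReal.ofReal η) := by
        refine Finset.sum_le_sum fun S hS => ?_
        rw [← mul_assoc, ← mul_add]
        refine mul_le_mul' (inv_mul_min_le _ hf) ?_
        split_ifs
        · exact le_self_add
        · exact zero_le
        · refine (mul_le_of_le_one_left' (min_le_right _ _)).trans ?_
          refine (haux S hS _ fun G => ?_).trans ?_
          · exact mul_le_one' (min_le_right _ _) (hQ G)
          · gcongr
            exact mul_le_of_le_one_left' (min_le_right _ _)
    _ ≤ _ := by
        rw [Finset.sum_add_distrib, Finset.sum_const, nsmul_eq_mul, ← mul_assoc]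
        gcongr
        refine mul_le_of_le_one_left' ?_
        rw [← ENNReal.ofReal_natCast, ← ENNReal.ofReal_mul (by positivity), ENNReal.ofReal_le_one,
          mul_one_div, div_le_one hf]
        exact hF

/-- Only good switchings are kept, and for each of them only the branch without auxiliary switching.
That branch leaves the graph unchanged, so the final rejection needs to be bounded at `nxt S` only.
-/
theorem le_wp_switchStep (hf : 0 < fbar) (hF : (#F : ℝ) ≤ fbar) {Q : TGraph D → ℝ≥0∞}
    {Good : Finset α} (hGood : Good ⊆ F) {ρ π δ : ℝ} (hρ : ρ ≤ 1) (hδ : δ ≤ 1)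
    (haux : ∀ S ∈ Good, ∀ Q' : TGraph D → ℝ≥0∞,
      ENNReal.ofReal π * Q' (nxt S) ≤ wp ∅ (aux S) Q')
    (hR : ∀ S ∈ Good, ¬ R S) (hp₁ : ∀ S ∈ Good, ρ ≤ p₁ S)
    (hp₂ : ∀ S ∈ Good, δ ≤ p₂ S (nxt S)) :
    ∑ S ∈ Good, ENNReal.ofReal (1 / fbar) * (ENNReal.ofReal ρ * (ENNReal.ofReal π *
      (ENNReal.ofReal δ * Q (nxt S)))) ≤ wp ∅ (switchStep F fbar nxt R p₁ aux p₂) Q := by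
  classical
  rw [wp_switchStep]
  refine le_trans ?_ (Finset.sum_le_sum_of_subset hGood)
  refine Finset.sum_le_sum fun S hS => ?_
  rw [← mul_assoc _ (min _ _), if_neg (Set.notMem_empty _), if_neg (hR S hS)]
  refine mul_le_mul' (le_inv_mul_min (Finset.card_pos.2 ⟨S, hGood hS⟩) hf hF) ?_
  refine mul_le_mul' (le_min (ENNReal.ofReal_le_ofReal (hp₁ S hS)) ?_) ?_
  · simpa using hρ
  · refine le_trans ?_ (haux S hS _)
    gcongr
    refine le_min (ENNReal.ofReal_le_ofReal (hp₂ S hS)) ?_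
    simpa using hδ

end switchStep

/-! ## Runs -/

theorem toMeasure_apply_eq_tsum {α : Type} (p : PMF (Outcome D α)) (s : Set (Outcome D α)) :
    p.toMeasure s = ∑' o, s.indicator p o :=
  PMF.toMeasure_apply p MeasurableSpace.measurableSet_top

/-- A run stays outside `B` with probability at least `1 - b / s` if an attempt visits `B` with
probability at most `b` and outputs a graph with probability at least `s`. -/
theorem one_sub_le_runLaw {lam kap mu : ℕ} {π : RemovalOrder D} {B : Set (TGraph D)} {b s : ℝ≥0∞}
    (hb : wp B (attempt D lam kap mu π) (fun _ => 0) ≤ b)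
    (hs : s ≤ wp ∅ (attempt D lam kap mu π) fun _ => 1) :
    1 - b / s ≤ runLaw D lam kap mu π {ω | ∀ G ∈ visitedInRun ω, G ∉ B} := by
  classical
  set p : PMF (Outcome D (TGraph D)) := (attempt D lam kap mu π).law with hp
  set N : Set (Outcome D (TGraph D)) := {o | o.result = none} with hN
  set Bd : Set (Outcome D (TGraph D)) := {o | ∃ G ∈ o.visited, G ∈ B} with hBd
  have hBdm : p.toMeasure Bd ≤ b := by
    refine le_trans (le_of_eq ?_) hb
    rw [toMeasure_apply_eq_tsum]
    refine tsum_congr fun o => ?_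
    rw [outcomeValue]
    by_cases h : ∃ G ∈ o.visited, G ∈ B
    · rw [Set.indicator_of_mem (show o ∈ Bd from h), if_pos h, mul_one]
    · rw [Set.indicator_of_notMem (show o ∉ Bd from h), if_neg h]
      cases o.result <;> simp
  have hNm : p.toMeasure N ≤ 1 - s := by
    have h1 : s ≤ p.toMeasure Nᶜ := by
      refine hs.trans (le_of_eq ?_)
      rw [toMeasure_apply_eq_tsum]
      refine tsum_congr fun o => ?_
      rw [outcomeValue, if_neg (by simp)]
      rcases o with ⟨l, _ | a⟩
      · simp [hN]
      · simp [hN, hp]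
    have h2 : p.toMeasure N = 1 - p.toMeasure Nᶜ := by
      rw [← prob_compl_eq_one_sub MeasurableSpace.measurableSet_top, compl_compl]
    rw [h2]
    exact tsub_le_tsub_left h1 _
  have hs1 : s ≤ 1 := hs.trans (wp_le_one _ fun _ => le_rfl)
  have hlaw : runLaw D lam kap mu π = Measure.infinitePi fun _ : ℕ => p.toMeasure := rfl
  -- The k-th attempt is started only if the k earlier ones have restarted. This event is a
  -- cylinder, so independence yields a product.
  have hcyl : ∀ k : ℕ, runLaw D lam kap mu π {ω | (∀ j < k, ω j ∈ N) ∧ ω k ∈ Bd} ≤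
      (1 - s) ^ k * b := by
    intro k
    have hset : {ω : ℕ → Outcome D (TGraph D) | (∀ j < k, ω j ∈ N) ∧ ω k ∈ Bd} =
        Set.pi (Finset.range (k + 1)) fun j => if j < k then N else Bd := by
      ext ω
      simp only [Set.mem_ofPred_eq, Set.mem_pi, Finset.coe_range, Set.mem_Iio]
      constructor
      · rintro ⟨h1, h2⟩ j hj
        split_ifs with h
        · exact h1 j h
        · obtain rfl : j = k := by omega
          exact h2
      · intro h
        refine ⟨fun j hj => ?_, ?_⟩
        · simpa [hj] using h j (by omega)
        · simpa using h k (by omega)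
    rw [hset, hlaw, Measure.infinitePi_pi _ (fun i _ => MeasurableSpace.measurableSet_top), Finset.prod_range_succ]
    simp only [lt_irrefl, if_false]
    refine mul_le_mul' ?_ hBdm
    calc _ ≤ ∏ _j ∈ Finset.range k, (1 - s) := by
          refine Finset.prod_le_prod' fun j hj => ?_
          rw [if_pos (Finset.mem_range.1 hj)]
          exact hNm
      _ = _ := by simp
  have hcompl : runLaw D lam kap mu π {ω | ∀ G ∈ visitedInRun ω, G ∉ B}ᶜ ≤ b / s := by
    calc _ ≤ runLaw D lam kap mu π (⋃ k : ℕ, {ω | (∀ j < k, ω j ∈ N) ∧ ω k ∈ Bd}) := by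
          refine measure_mono ?_
          intro ω hω
          simp only [Set.mem_compl_iff, Set.mem_ofPred_eq, not_forall, not_not] at hω
          obtain ⟨G, ⟨k, hk, hG⟩, hB⟩ := hω
          exact Set.mem_iUnion.2 ⟨k, hk, G, hG, hB⟩
      _ ≤ ∑' k, runLaw D lam kap mu π {ω | (∀ j < k, ω j ∈ N) ∧ ω k ∈ Bd} :=
          measure_iUnion_le _
      _ ≤ ∑' k, (1 - s) ^ k * b := ENNReal.tsum_le_tsum hcyl
      -- In truncated arithmetic 1 - (1 - s) = s requires s ≤ 1.
      _ = b / s := by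
          rw [ENNReal.tsum_mul_right, ENNReal.tsum_geometric,
            ENNReal.sub_sub_cancel ENNReal.one_ne_top hs1, mul_comm, div_eq_mul_inv]
  have : IsProbabilityMeasure (runLaw D lam kap mu π) := by
    rw [hlaw]
    infer_instance
  rw [tsub_le_iff_right]
  calc 1 = runLaw D lam kap mu π Set.univ := measure_univ.symm
    _ ≤ _ := by
      rw [← Set.union_compl_self {ω | ∀ G ∈ visitedInRun ω, G ∉ B}]
      exact (measure_union_le _ _).trans (by gcongr)

end TGen

end

noncomputable section

namespace TGen

variable {D : Input}

/-! ## Multiplicities, degrees and defects of temporal multigraphs -/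

/-- The number of ends of an edge at a node. -/
def inc {V : Type*} [DecidableEq V] (p : Sym2 V) (v : V) : ℕ :=
  Sym2.lift ⟨fun a b => (if a = v then 1 else 0) + (if b = v then 1 else 0),
    fun _ _ => add_comm _ _⟩ p

@[simp]
theorem inc_mk {V : Type*} [DecidableEq V] (a b v : V) :
    inc s(a, b) v = (if a = v then 1 else 0) + (if b = v then 1 else 0) := rfl

/-- The multiplicity of a pair of nodes. -/
def pairMult (G : TGraph D) (p : Sym2 (Node D)) : ℕ := ∑ t, G.count (p, t)

theorem mult_eq (G : TGraph D) (i j : Node D) : mult G i j = pairMult G s(i, j) := rfl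

theorem pairMult_add (A B : TGraph D) (p : Sym2 (Node D)) :
    pairMult (A + B) p = pairMult A p + pairMult B p := by
  simp [pairMult, Finset.sum_add_distrib]

@[simp]
theorem pairMult_zero (p : Sym2 (Node D)) : pairMult (0 : TGraph D) p = 0 := by
  simp [pairMult]

theorem pairMult_cons (e : TEdge D) (A : TGraph D) (p : Sym2 (Node D)) :
    pairMult (e ::ₘ A) p = pairMult A p + if p = e.1 then 1 else 0 := by
  obtain ⟨q, s⟩ := e
  simp only [pairMult, Multiset.count_cons, Finset.sum_add_distrib, Prod.mk.injEq]
  congr 1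
  by_cases h : p = q <;> simp [h]

theorem pairMult_singleton (e : TEdge D) (p : Sym2 (Node D)) :
    pairMult ({e} : TGraph D) p = if p = e.1 then 1 else 0 := by
  rw [← Multiset.cons_zero, pairMult_cons, pairMult_zero, zero_add]

theorem one_le_pairMult {G : TGraph D} {e : TEdge D} (h : e ∈ G) : 1 ≤ pairMult G e.1 :=
  (Multiset.one_le_count_iff_mem.2 h).trans
    (Finset.single_le_sum (f := fun t => G.count (e.1, t)) (fun _ _ => Nat.zero_le _)
      (Finset.mem_univ e.2))

/-- Written as a sum on both sides, since subtraction of natural numbers is truncated. -/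
theorem pairMult_rewire {G old new : TGraph D} (h : old ≤ G) (p : Sym2 (Node D)) :
    pairMult (rewire G old new) p + pairMult old p = pairMult G p + pairMult new p := by
  conv_rhs => rw [← Multiset.sub_add_cancel h, pairMult_add]
  rw [rewire, pairMult_add]
  ring

theorem degree_add (A B : TGraph D) (i : Node D) : degree (A + B) i = degree A i + degree B i := by
  simp only [degree, w, Multiset.count_add, Finset.sum_add_distrib]
  ring

@[simp]
theorem degree_zero (i : Node D) : degree (0 : TGraph D) i = 0 := by
  simp [degree, w]

theorem degree_cons (e : TEdge D) (A : TGraph D) (i : Node D) :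
    degree (e ::ₘ A) i = degree A i + inc e.1 i := by
  obtain ⟨q, s⟩ := e
  induction q using Sym2.ind with
  | _ a b =>
    simp only [degree, w, Multiset.count_cons, Finset.sum_add_distrib, Prod.mk.injEq, inc_mk]
    -- For a loop at `i` the row sum counts the edge once and the diagonal term a second time.
    have key : (∑ t : Stamp D, ∑ j : Node D, if s(i, j) = s(a, b) ∧ t = s then 1 else 0) +
        (∑ t : Stamp D, if s(i, i) = s(a, b) ∧ t = s then 1 else 0) =
        (if a = i then 1 else 0) + (if b = i then 1 else 0) := by
      by_cases ha : a = i
      · subst ha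
        by_cases hb : b = a
        · subst hb
          simp [Finset.sum_ite_eq', ite_and]
        · have hb' : a ≠ b := fun h => hb h.symm
          simp [hb, hb', Finset.sum_ite_eq', ite_and]
      · have ha' : i ≠ a := fun h => ha h.symm
        by_cases hb : b = i
        · subst hb
          simp [ha, ha', ite_and]
        · have hb' : i ≠ b := fun h => hb h.symm
          simp [ha, hb, ha', hb']
    omega

theorem degree_singleton (e : TEdge D) (i : Node D) :
    degree ({e} : TGraph D) i = inc e.1 i := by
  rw [← Multiset.cons_zero, degree_cons, degree_zero, zero_add]

theorem degree_rewire {G old new : TGraph D} (h : old ≤ G)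
    (hd : ∀ i, degree old i = degree new i) (i : Node D) :
    degree (rewire G old new) i = degree G i := by
  conv_rhs => rw [← Multiset.sub_add_cancel h, degree_add]
  rw [rewire, degree_add, hd]

/-- The entry of `𝐖(G)` at a temporal edge. -/
def defect (G : TGraph D) (e : TEdge D) : ℕ :=
  if e.1.IsDiag ∨ 2 ≤ G.count e then G.count e else 0

theorem W_eq (G : TGraph D) (i j : Node D) (t : Stamp D) : W G i j t = defect G (s(i, j), t) := by
  unfold W defect w
  by_cases h : i = j
  · subst h
    simp
  · simp [h]

theorem defect_le_count (G : TGraph D) (e : TEdge D) : defect G e ≤ G.count e := by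
  unfold defect
  split_ifs
  · exact le_rfl
  · exact Nat.zero_le _

/-- The effect of a switching on `𝐖(G)`: only the entry of the defect `e₀` is changed. -/
theorem defect_rewire {G old new : TGraph D} (h : CanRewire G old new) {e₀ : TEdge D}
    (hnew : ∀ e ∈ new, ¬ e.1.IsDiag) (hold : ∀ e ∈ old, e ≠ e₀ → ¬ e.1.IsDiag ∧ G.count e = 1)
    (he₀ : e₀ ∈ G) (hdiag : e₀.1.IsDiag → G.count e₀ ≤ old.count e₀)
    (hcount : G.count e₀ ≤ old.count e₀ + 1) (e : TEdge D) :
    defect (rewire G old new) e = if e = e₀ then 0 else defect G e := by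
  have hc : (rewire G old new).count e = G.count e - old.count e + new.count e := by
    rw [rewire, Multiset.count_add, Multiset.count_sub]
  have hne : e ∈ new → G.count e = 0 := fun he => Multiset.count_eq_zero.2 (h.new_notMem e he)
  have hn1 := Multiset.nodup_iff_count_le_one.1 h.new_nodup e
  by_cases he : e = e₀
  · subst he
    rw [if_pos rfl]
    have : e ∉ new := fun hx => h.new_notMem e hx he₀
    rw [Multiset.count_eq_zero.2 this] at hc
    unfold defect
    -- A single remaining loop would still be a defect, so all copies must go; off the diagonal one
    -- remaining copy is a simple edge and does no harm. The latter is what happens in a TD₁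
    -- switching.
    by_cases hd : e.1.IsDiag
    · have := hdiag hd
      rw [if_pos (.inl hd)]
      omega
    · rw [if_neg]
      rintro (h1 | h1)
      · exact hd h1
      · omega
  · rw [if_neg he]
    -- An added edge did not exist before and has multiplicity one afterwards; since it is not a
    -- loop, it is no defect in either graph.
    by_cases h1 : e ∈ new
    · have := hne h1
      have := hnew e h1
      simp only [defect, hc]
      simp only [this, false_or]
      split_ifs <;> omega
    · rw [Multiset.count_eq_zero.2 h1] at hc
      by_cases h2 : e ∈ old
      · obtain ⟨h3, h4⟩ := hold e h2 he
        have h5 := Multiset.one_le_count_iff_mem.2 h2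
        simp only [defect, hc, h3, false_or]
        split_ifs <;> omega
      · rw [Multiset.count_eq_zero.2 h2] at hc
        simp only [defect, hc, Nat.sub_zero, add_zero]

/-! ## Simple edges -/

/-- An oriented temporal edge. -/
abbrev Arc (D : Input) := Node D × Node D × Stamp D

/-- The temporal edge of an arc. -/
abbrev arcEdge (x : Arc D) : TEdge D := (s(x.1, x.2.1), x.2.2)

open scoped Classical in
/-- The two orientations of the simple edges. -/
def simpleArcs (G : TGraph D) : Finset (Arc D) := {x | IsSimpleEdge G x.1 x.2.1 x.2.2}

theorem mem_simpleArcs {G : TGraph D} {x : Arc D} :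
    x ∈ simpleArcs G ↔ IsSimpleEdge G x.1 x.2.1 x.2.2 := by
  simp [simpleArcs]

theorem IsSimpleEdge.symm {G : TGraph D} {i j : Node D} {t : Stamp D} (h : IsSimpleEdge G i j t) :
    IsSimpleEdge G j i t := by
  refine ⟨h.1.symm, ?_⟩
  rw [w, Sym2.eq_swap]
  exact h.2

open scoped Classical in
/-- The number of simple edges at a node. -/
def simpleCount (G : TGraph D) (v : Node D) : ℕ := #{x : Node D × Stamp D | IsSimpleEdge G v x.1 x.2}

theorem degree_eq (G : TGraph D) (v : Node D) :
    degree G v = simpleCount G v + ∑ t, (2 * W G v v t + ∑ j with j ≠ v, W G v j t) := by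
  classical
  have h1 : simpleCount G v = ∑ t, ∑ j with j ≠ v, if IsSimpleEdge G v j t then 1 else 0 := by
    rw [simpleCount, Finset.card_filter, Fintype.sum_prod_type, Finset.sum_comm]
    refine Finset.sum_congr rfl fun t _ => ?_
    rw [Finset.sum_filter]
    refine Finset.sum_congr rfl fun j _ => ?_
    by_cases h : j = v
    · subst h
      simp [IsSimpleEdge]
    · simp [h]
  rw [h1, ← Finset.sum_add_distrib, degree]
  refine Finset.sum_congr rfl fun t _ => ?_
  have h2 : ∑ j, w G v j t = w G v v t + ∑ j with j ≠ v, w G v j t := by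
    rw [← Finset.add_sum_erase _ _ (Finset.mem_univ v)]
    congr 1
    refine Finset.sum_congr ?_ fun _ _ => rfl
    ext j
    simp
  have h3 : ∑ j with j ≠ v, w G v j t =
      (∑ j with j ≠ v, if IsSimpleEdge G v j t then 1 else 0) + ∑ j with j ≠ v, W G v j t := by
    rw [← Finset.sum_add_distrib]
    refine Finset.sum_congr rfl fun j hj => ?_
    have hj : v ≠ j := fun h => (Finset.mem_filter.1 hj).2 h.symm
    unfold W IsSimpleEdge
    rw [if_neg hj]
    simp only [hj, ne_eq, not_false_eq_true, true_and]
    split_ifs <;> omega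
  have h4 : W G v v t = w G v v t := if_pos rfl
  rw [h2, h3, h4]
  ring

/-- The number k computed from the tensor 𝐖(G) is the exact number of simple edges. Hence the
factors of the final rejections that depend on k cancel exactly. -/
theorem simpleDeg_eq {G : TGraph D} (hG : Matches G) (v : Node D) :
    simpleDeg (W G) v = simpleCount G v := by
  have := degree_eq G v
  rw [hG v] at this
  rw [simpleDeg, this]
  push_cast
  ring

theorem simpleCount_le (G : TGraph D) (v : Node D) : simpleCount G v ≤ degree G v := by
  rw [degree_eq]
  exact Nat.le_add_right _ _

/-- The number of temporal edges at a node, without multiplicities. -/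
theorem card_incident_le (G : TGraph D) (v : Node D) :
    #{x : Node D × Stamp D | (s(v, x.1), x.2) ∈ G} ≤ degree G v := by
  rw [Finset.card_filter, Fintype.sum_prod_type, Finset.sum_comm, degree]
  refine Finset.sum_le_sum fun t _ => le_trans (Finset.sum_le_sum fun j _ => ?_)
    (Nat.le_add_right _ _)
  split_ifs with h
  · exact Multiset.one_le_count_iff_mem.2 h
  · exact Nat.zero_le _

theorem card_simpleArcs_fst (G : TGraph D) (v : Node D) :
    #{x ∈ simpleArcs G | x.1 = v} = simpleCount G v := by
  classical
  unfold simpleCount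
  refine Finset.card_nbij' (fun x => x.2) (fun y => (v, y)) ?_ ?_ ?_ ?_
  · rintro ⟨a, y⟩ h
    simp only [Finset.coe_filter, mem_simpleArcs, Set.mem_ofPred_eq] at h
    obtain ⟨h, rfl⟩ := h
    simpa using h
  · rintro y h
    simpa [mem_simpleArcs] using h
  · rintro ⟨a, y⟩ h
    simp only [Finset.coe_filter, mem_simpleArcs, Set.mem_ofPred_eq] at h
    rw [← h.2]
  · rintro y h
    rfl

theorem card_simpleArcs_snd (G : TGraph D) (v : Node D) :
    #{x ∈ simpleArcs G | x.2.1 = v} = simpleCount G v := by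
  rw [← card_simpleArcs_fst]
  refine Finset.card_nbij' (fun x => (x.2.1, x.1, x.2.2)) (fun x => (x.2.1, x.1, x.2.2)) ?_ ?_ ?_ ?_
  · rintro ⟨a, b, t⟩ h
    simp only [Finset.coe_filter, mem_simpleArcs, Set.mem_ofPred_eq] at h ⊢
    exact ⟨h.1.symm, h.2⟩
  · rintro ⟨a, b, t⟩ h
    simp only [Finset.coe_filter, mem_simpleArcs, Set.mem_ofPred_eq] at h ⊢
    exact ⟨h.1.symm, h.2⟩
  · rintro ⟨a, b, t⟩ h
    rfl
  · rintro ⟨a, b, t⟩ h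
    rfl

theorem card_simpleArcs (G : TGraph D) : #(simpleArcs G) = ∑ v, simpleCount G v := by
  rw [Finset.card_eq_sum_card_fiberwise (f := fun x => x.1) (t := Finset.univ)
    (fun _ _ => Finset.mem_coe.2 (Finset.mem_univ _))]
  exact Finset.sum_congr rfl fun v _ => card_simpleArcs_fst G v

theorem card_simpleArcs_le {G : TGraph D} (hG : Matches G) : #(simpleArcs G) ≤ degSum D := by
  rw [card_simpleArcs, degSum]
  exact Finset.sum_le_sum fun v _ => (simpleCount_le G v).trans (hG v).le

/-- Each unordered pair is seen from both of its ends on the left, but only once in `sumMulti`. -/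
theorem sum_ne_W (G : TGraph D) :
    ∑ v, ∑ t, ∑ j with j ≠ v, W G v j t = 2 * sumMulti G := by
  classical
  have h1 : ∀ v, ∑ t, ∑ j with j ≠ v, W G v j t =
      ∑ j with v < j, ∑ t, W G v j t + ∑ j with j < v, ∑ t, W G v j t := by
    intro v
    rw [Finset.sum_comm, ← Finset.sum_union]
    · refine Finset.sum_congr ?_ fun _ _ => rfl
      ext j
      simp only [Finset.mem_filter, Finset.mem_univ, true_and, Finset.mem_union]
      rw [ne_iff_lt_or_gt, or_comm]
    · rw [Finset.disjoint_filter]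
      intro j _ h
      exact not_lt.2 h.le
  simp_rw [h1]
  rw [Finset.sum_add_distrib, two_mul]
  congr 1
  unfold sumMulti
  simp_rw [Finset.sum_filter]
  rw [Finset.sum_comm]
  refine Finset.sum_congr rfl fun j _ => Finset.sum_congr rfl fun v _ => ?_
  split_ifs with h
  · refine Finset.sum_congr rfl fun t _ => ?_
    rw [W_eq, W_eq, Sym2.eq_swap]
  · rfl

/-- The handshake identity split into simple edges and defects. With few defects almost all of the M
oriented edge ends belong to simple edges, which are the ones a switching may choose. -/
theorem degSum_eq {G : TGraph D} (hG : Matches G) :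
    degSum D = #(simpleArcs G) + 2 * sumLoops G + 2 * sumMulti G := by
  rw [← sum_ne_W, card_simpleArcs, degSum, sumLoops, Finset.mul_sum, ← Finset.sum_add_distrib,
    ← Finset.sum_add_distrib]
  refine Finset.sum_congr rfl fun v _ => ?_
  rw [← hG v, degree_eq, Finset.sum_add_distrib, Finset.mul_sum, add_assoc]

theorem le_maxDeg (v : Node D) : D.d v ≤ maxDeg D := Finset.le_sup (f := D.d) (Finset.mem_univ v)

theorem card_freeStamps_le (G : TGraph D) (i j : Node D) : freeStamps G i j ≤ D.T := by
  exact (Finset.card_filter_le _ _).trans (by simp)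

theorem le_freeStamps_add_mult (G : TGraph D) (i j : Node D) :
    D.T ≤ freeStamps G i j + mult G i j := by
  have h := Finset.card_filter_add_card_filter_not (s := (Finset.univ : Finset (Stamp D)))
    (fun t => w G i j t = 0)
  rw [Finset.card_univ, Fintype.card_fin] at h
  have h2 : #{t | ¬ w G i j t = 0} ≤ mult G i j := by
    rw [Finset.card_filter, mult]
    refine Finset.sum_le_sum fun t _ => ?_
    split_ifs <;> omega
  unfold freeStamps
  omega

end TGen

end

noncomputable section

set_option linter.unusedSectionVars false

namespace TGen

/-! ## The potential of a family of switchings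

`m₀` and `m` are the multiplicities in the initial and the current graph, and `rest` is the multiset
of pairs of base nodes of the units of switchings still to come. -/

section Potential

variable {V τ : Type*} [Fintype V] [DecidableEq V]

/-- Add an edge between a pair of nodes. -/
def addPair (m : Sym2 V → ℕ) (p : Sym2 V) : Sym2 V → ℕ := fun z => m z + if z = p then 1 else 0

/-- Add the edges of a unit of a switching with base nodes `a`, `b`. -/
def addUnit (m : Sym2 V → ℕ) (a b : V) (e₁ e₂ : V × V × τ) : Sym2 V → ℕ :=
  addPair (addPair (addPair m s(a, e₁.1)) s(b, e₂.1)) s(e₁.2.1, e₂.2.1)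

/-- The number of neighbours to which the multiplicity has increased. -/
def excess (m₀ m : Sym2 V → ℕ) (v : V) : ℕ := #{y | m₀ s(v, y) < m s(v, y)}

/-- The number of occurrences of a node in a multiset of pairs. -/
def occ (rest : Multiset (Sym2 V)) (v : V) : ℕ := (rest.map fun p => inc p v).sum

/-- A bound for the probability that some pair is hit twice. -/
def potential (c κ : ℝ) (m₀ : Sym2 V → ℕ) (rest : Multiset (Sym2 V)) (m : Sym2 V → ℕ) : ℝ :=
  c * ∑ v, (occ rest v + rest.card * c) * (excess m₀ m v : ℝ) + rest.card * κ

open scoped Classical in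
/-- The truncated potential, which is `1` if some pair has been hit twice. -/
def stoppedPotential (c κ : ℝ) (m₀ : Sym2 V → ℕ) (rest : Multiset (Sym2 V)) (m : Sym2 V → ℕ) : ℝ :=
  if ∀ p, m p ≤ m₀ p + 1 then min (potential c κ m₀ rest m) 1 else 1

theorem occ_cons (p : Sym2 V) (rest : Multiset (Sym2 V)) (v : V) :
    occ (p ::ₘ rest) v = inc p v + occ rest v := by
  simp [occ]

theorem occ_add (r s : Multiset (Sym2 V)) (v : V) : occ (r + s) v = occ r v + occ s v := by
  simp [occ]

theorem sum_inc_mul (p q : V) (g : V → ℝ) : ∑ v, (inc s(p, q) v : ℝ) * g v = g p + g q := by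
  simp [inc_mk, add_mul, Finset.sum_add_distrib]

theorem sum_occ (rest : Multiset (Sym2 V)) : ∑ v, (occ rest v : ℝ) = 2 * rest.card := by
  induction rest using Multiset.induction_on with
  | empty => simp [occ]
  | cons p s ih =>
    simp only [occ_cons, Nat.cast_add, Finset.sum_add_distrib, ih, Multiset.card_cons]
    induction p using Sym2.ind with
    | _ a b =>
      have := sum_inc_mul a b fun _ => 1
      simp only [mul_one] at this
      rw [this]
      push_cast
      ring

theorem excess_self (m : Sym2 V → ℕ) (v : V) : excess m m v = 0 := by
  simp [excess]

theorem excess_mono (m₀ : Sym2 V → ℕ) {m m' : Sym2 V → ℕ} (h : ∀ p, m p ≤ m' p) (v : V) :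
    excess m₀ m v ≤ excess m₀ m' v :=
  Finset.card_le_card fun y hy => by
    simp only [Finset.mem_filter, Finset.mem_univ, true_and] at hy ⊢
    exact hy.trans_le (h _)

/-- A pair at `v` determines its other end, so one more edge on `p` creates at most one new
neighbour of `v`, and none if `p` misses `v`. -/
theorem excess_addPair_le (m₀ m : Sym2 V → ℕ) (p : Sym2 V) (v : V) :
    excess m₀ (addPair m p) v ≤ excess m₀ m v + inc p v := by
  classical
  have h1 : #{y | s(v, y) = p} ≤ inc p v := by
    induction p using Sym2.ind with
    | _ a b =>
      by_cases ha : a = v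
      · subst ha
        have : (Finset.univ.filter fun y => s(a, y) = s(a, b)) = {b} := by
          ext y
          simp only [Finset.mem_filter, Finset.mem_univ, true_and, Finset.mem_singleton]
          rw [Sym2.congr_right]
        rw [this, inc_mk, if_pos rfl]
        simp
      · by_cases hb : b = v
        · subst hb
          have : (Finset.univ.filter fun y => s(b, y) = s(a, b)) = {a} := by
            ext y
            simp only [Finset.mem_filter, Finset.mem_univ, true_and, Finset.mem_singleton]
            rw [Sym2.eq_swap, Sym2.congr_left]
          rw [this, inc_mk, if_pos rfl]
          simp
        · rw [Finset.filter_false_of_mem]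
          · simp
          · intro y _ h
            rw [Sym2.eq_iff] at h
            rcases h with h | h
            · exact ha h.1.symm
            · exact hb h.1.symm
  refine le_trans (le_trans (Finset.card_le_card ?_) (Finset.card_union_le _ _))
    (Nat.add_le_add_left h1 _)
  intro y hy
  simp only [Finset.mem_filter, Finset.mem_univ, true_and, Finset.mem_union] at hy ⊢
  by_cases h : s(v, y) = p
  · exact .inr h
  · have : addPair m p s(v, y) = m s(v, y) := by simp [addPair, h]
    exact .inl (this ▸ hy)

variable {c κ : ℝ} {m₀ m : Sym2 V → ℕ}

theorem potential_nonneg (hc : 0 ≤ c) (hκ : 0 ≤ κ) (rest : Multiset (Sym2 V)) :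
    0 ≤ potential c κ m₀ rest m := by
  unfold potential
  positivity

theorem stoppedPotential_nonneg (hc : 0 ≤ c) (hκ : 0 ≤ κ) (rest : Multiset (Sym2 V)) :
    0 ≤ stoppedPotential c κ m₀ rest m := by
  unfold stoppedPotential
  split_ifs
  · exact le_min (potential_nonneg hc hκ rest) zero_le_one
  · exact zero_le_one

theorem stoppedPotential_le_one (rest : Multiset (Sym2 V)) :
    stoppedPotential c κ m₀ rest m ≤ 1 := by
  unfold stoppedPotential
  split_ifs
  · exact min_le_right _ _
  · exact le_rfl

theorem potential_self (rest : Multiset (Sym2 V)) : potential c κ m rest m = rest.card * κ := by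
  simp [potential, excess_self]

/-- This explains the form of the potential. A unit at {a, b} joins `a` and `b` to ends of random
arcs, and each pair already hit at `a` or `b` is hit again with probability at most Δ/M = c: this is
the term in the excesses of `a` and `b`. The third edge joins two random ends and hits a given
ordered pair of nodes with probability at most c², which gives the sum over all nodes. All other
costs of the unit go into κ. -/
theorem potential_cons (a b : V) (rest : Multiset (Sym2 V)) :
    potential c κ m₀ (s(a, b) ::ₘ rest) m = potential c κ m₀ rest m +
      c * (excess m₀ m a + excess m₀ m b + c * ∑ v, (excess m₀ m v : ℝ)) + κ := by
  unfold potential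
  rw [← sum_inc_mul a b fun v => (excess m₀ m v : ℝ), Finset.mul_sum (a := c) (s := Finset.univ)
    (f := fun v => (excess m₀ m v : ℝ)), ← Finset.sum_add_distrib]
  simp only [occ_cons, Multiset.card_cons]
  push_cast
  have : ∀ v, ((inc s(a, b) v : ℝ) + occ rest v + (rest.card + 1) * c) * excess m₀ m v =
    (occ rest v + rest.card * c) * (excess m₀ m v : ℝ) +
      (inc s(a, b) v * excess m₀ m v + c * excess m₀ m v) := fun v => by ring
  simp_rw [this]
  rw [Finset.sum_add_distrib]
  ring

theorem potential_le_cons (hc : 0 ≤ c) (hκ : 0 ≤ κ) (p : Sym2 V) (rest : Multiset (Sym2 V)) :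
    potential c κ m₀ rest m ≤ potential c κ m₀ (p ::ₘ rest) m := by
  induction p using Sym2.ind with
  | _ a b =>
    rw [potential_cons]
    have : 0 ≤ c * (excess m₀ m a + excess m₀ m b + c * ∑ v, (excess m₀ m v : ℝ)) := by positivity
    linarith

theorem potential_mono (hc : 0 ≤ c) {m' : Sym2 V → ℕ} (h : ∀ p, m p ≤ m' p)
    (rest : Multiset (Sym2 V)) : potential c κ m₀ rest m ≤ potential c κ m₀ rest m' := by
  unfold potential
  gcongr with v
  exact excess_mono m₀ h v

/-- A switching also deletes edges. By monotonicity the deletions may be ignored, and only the pairs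
added by `addUnit` are tracked. -/
theorem stoppedPotential_mono (hc : 0 ≤ c) {m' : Sym2 V → ℕ} (h : ∀ p, m p ≤ m' p)
    (rest : Multiset (Sym2 V)) :
    stoppedPotential c κ m₀ rest m ≤ stoppedPotential c κ m₀ rest m' := by
  by_cases h' : ∀ p, m' p ≤ m₀ p + 1
  · rw [stoppedPotential, stoppedPotential, if_pos h', if_pos fun p => (h p).trans (h' p)]
    exact min_le_min_right _ (potential_mono hc h rest)
  · rw [stoppedPotential.eq_def c κ m₀ rest m', if_neg h']
    exact stoppedPotential_le_one rest

theorem potential_addPair_le (hc : 0 ≤ c) (x y : V) (rest : Multiset (Sym2 V)) :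
    potential c κ m₀ rest (addPair m s(x, y)) ≤ potential c κ m₀ rest m +
      c * (occ rest x + occ rest y + 2 * (rest.card * c)) := by
  have h1 : ∑ v, (occ rest v + rest.card * c) * (excess m₀ (addPair m s(x, y)) v : ℝ) ≤
      ∑ v, (occ rest v + rest.card * c) * (excess m₀ m v : ℝ) +
        ∑ v, (inc s(x, y) v : ℝ) * (occ rest v + rest.card * c) := by
    rw [← Finset.sum_add_distrib]
    refine Finset.sum_le_sum fun v _ => ?_
    rw [mul_comm (inc s(x, y) v : ℝ), ← mul_add]
    refine mul_le_mul_of_nonneg_left ?_ (by positivity)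
    exact_mod_cast excess_addPair_le m₀ m s(x, y) v
  rw [sum_inc_mul] at h1
  have h2 := mul_le_mul_of_nonneg_left h1 hc
  unfold potential
  linarith

/-- The three new pairs have six ends, and each of them raises the excess of one node by at most
one. -/
theorem potential_addUnit_le (hc : 0 ≤ c) (a b : V) (e₁ e₂ : V × V × τ)
    (rest : Multiset (Sym2 V)) :
    potential c κ m₀ rest (addUnit m a b e₁ e₂) ≤ potential c κ m₀ rest m +
      c * (occ rest a + occ rest b + occ rest e₁.1 + occ rest e₁.2.1 + occ rest e₂.1 +
        occ rest e₂.2.1 + 6 * (rest.card * c)) := by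
  have h1 := potential_addPair_le (κ := κ) (m₀ := m₀) (m := m) hc a e₁.1 rest
  have h2 := potential_addPair_le (κ := κ) (m₀ := m₀) (m := addPair m s(a, e₁.1)) hc b e₂.1 rest
  have h3 := potential_addPair_le (κ := κ) (m₀ := m₀)
    (m := addPair (addPair m s(a, e₁.1)) s(b, e₂.1)) hc e₁.2.1 e₂.2.1 rest
  unfold addUnit
  linarith

/-- If a unit hits a pair twice then some new pair is one that has already been hit, or two nodes
coincide. -/
theorem collision_of_addUnit (a b : V) (e₁ e₂ : V × V × τ) (hm : ∀ p, m p ≤ m₀ p + 1)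
    (h : ¬ ∀ p, addUnit m a b e₁ e₂ p ≤ m₀ p + 1) :
    m₀ s(a, e₁.1) < m s(a, e₁.1) ∨ m₀ s(b, e₂.1) < m s(b, e₂.1) ∨
      m₀ s(e₁.2.1, e₂.2.1) < m s(e₁.2.1, e₂.2.1) ∨ e₁.1 = e₂.1 ∨ e₁.1 = b ∨
      e₁.2.1 = a ∨ e₁.2.1 = b ∨ e₂.2.1 = a ∨ e₂.2.1 = b := by
  contrapose! h
  obtain ⟨h1, h2, h3, h4, h5, h6, h7, h8, h9⟩ := h
  -- The coincidence of the two outer ends matters for loops, where `a = b`; for `a ≠ b` the two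
  -- pairs can only agree crosswise.
  have hpq : s(a, e₁.1) ≠ s(b, e₂.1) := by
    rw [Ne, Sym2.eq_iff]
    rintro (⟨-, h⟩ | ⟨-, h⟩)
    · exact h4 h
    · exact h5 h
  have hpr : s(a, e₁.1) ≠ s(e₁.2.1, e₂.2.1) := by
    rw [Ne, Sym2.eq_iff]
    rintro (⟨h, -⟩ | ⟨h, -⟩)
    · exact h6 h.symm
    · exact h8 h.symm
  have hqr : s(b, e₂.1) ≠ s(e₁.2.1, e₂.2.1) := by
    rw [Ne, Sym2.eq_iff]
    rintro (⟨h, -⟩ | ⟨h, -⟩)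
    · exact h7 h.symm
    · exact h9 h.symm
  intro z
  have := hm z
  unfold addUnit addPair
  by_cases hz1 : z = s(a, e₁.1)
  · subst hz1
    rw [if_pos rfl, if_neg hpq, if_neg hpr]
    omega
  by_cases hz2 : z = s(b, e₂.1)
  · subst hz2
    rw [if_pos rfl, if_neg hpq.symm, if_neg hqr]
    omega
  by_cases hz3 : z = s(e₁.2.1, e₂.2.1)
  · subst hz3
    rw [if_pos rfl, if_neg hpr.symm, if_neg hqr.symm]
    omega
  rw [if_neg hz1, if_neg hz2, if_neg hz3]
  omega

/-- The bounds for the numbers of arcs of a set at a node that are used for the switchings. -/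
structure ArcBounds (O : Finset (V × V × τ)) (Δ : ℝ) : Prop where
  fst_le : ∀ v, (#{x ∈ O | x.1 = v} : ℝ) ≤ Δ
  snd_le : ∀ v, (#{x ∈ O | x.2.1 = v} : ℝ) ≤ Δ

/-- The only information on random arcs that is used: a fixed end of an arc meets a given node for
at most Δ of the arcs. -/
theorem sum_comp_le_of_card_fiber_le {ι : Type*} {O : Finset ι} {f : ι → V} {Δ : ℝ}
    (h : ∀ v, (#{x ∈ O | f x = v} : ℝ) ≤ Δ) {g : V → ℝ} (hg : ∀ v, 0 ≤ g v) :
    ∑ e ∈ O, g (f e) ≤ Δ * ∑ v, g v := by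
  rw [← Finset.sum_fiberwise_of_maps_to (g := f) (t := Finset.univ) (fun _ _ => Finset.mem_univ _),
    Finset.mul_sum]
  refine Finset.sum_le_sum fun v _ => ?_
  rw [Finset.sum_congr rfl (g := fun _ => g v)
    (fun e he => by rw [(Finset.mem_filter.1 he).2]), Finset.sum_const, nsmul_eq_mul]
  exact mul_le_mul_of_nonneg_right (h v) (hg v)

theorem sum_sum_add {ι : Type*} (O : Finset ι) (C : ℝ) (f₁ f₂ f₃ f₄ : ι → ℝ) (h₁ h₂ : ι → ι → ℝ) :
    ∑ x ∈ O, ∑ y ∈ O, (C + f₁ x + f₂ x + f₃ y + f₄ y + (h₁ x y + h₂ x y)) =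
      #O * (#O * C) + #O * ∑ x ∈ O, f₁ x + #O * ∑ x ∈ O, f₂ x + #O * ∑ x ∈ O, f₃ x +
        #O * ∑ x ∈ O, f₄ x + ((∑ x ∈ O, ∑ y ∈ O, h₁ x y) + ∑ x ∈ O, ∑ y ∈ O, h₂ x y) := by
  simp only [Finset.sum_add_distrib, Finset.sum_const, nsmul_eq_mul, Finset.mul_sum]

/-- One unit of a switching lets the expected potential grow by no more than what is set aside for
it. -/
theorem sum_stoppedPotential_le {O : Finset (V × V × τ)} {Δ M K η : ℝ} (hO : ArcBounds O Δ)
    (hM : 0 < M) (hOM : (#O : ℝ) ≤ M) (hc : c = Δ / M) (hΔ : 0 ≤ Δ) (hη : 0 ≤ η)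
    (hκ : (2 * K + 20) * c + η ≤ κ)
    (a b : V) (rest : Multiset (Sym2 V)) (hocc : ∀ v, (occ rest v : ℝ) ≤ K)
    (hrest : rest.card * c ≤ 1) (hm : ∀ p, m p ≤ m₀ p + 1) :
    ∑ e₁ ∈ O, ∑ e₂ ∈ O, stoppedPotential c κ m₀ rest (addUnit m a b e₁ e₂) ≤
      M ^ 2 * (potential c κ m₀ (s(a, b) ::ₘ rest) m - η) := by
  classical
  have hc0 : 0 ≤ c := by rw [hc]; positivity
  have hK : 0 ≤ K := (Nat.cast_nonneg _).trans (hocc a)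
  have hκ0 : 0 ≤ κ := le_trans (by positivity) hκ
  have hΔc : Δ = c * M := by rw [hc]; field_simp
  set P := potential c κ m₀ rest m with hP
  have hP0 : 0 ≤ P := potential_nonneg hc0 hκ0 rest
  -- `A` marks the pairs that have already been hit, and its row sums are the excesses; `I` marks
  -- coincidences of nodes, with row sums 1.
  set A : V → V → ℝ := fun x y => if m₀ s(x, y) < m s(x, y) then 1 else 0 with hA
  have hA0 : ∀ x y, 0 ≤ A x y := fun x y => by simp only [hA]; split_ifs <;> norm_num
  have hAsum : ∀ x, ∑ y, A x y = excess m₀ m x := by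
    intro x
    simp [hA, excess]
  set I : V → V → ℝ := fun x y => if x = y then 1 else 0 with hI
  have hI0 : ∀ x y, 0 ≤ I x y := fun x y => by simp only [hI]; split_ifs <;> norm_num
  have hIsum : ∀ x, ∑ y, I x y = 1 := by
    intro x
    simp [hI]
  have hIs : ∀ x y, I x y = I y x := fun x y => by simp only [hI, eq_comm]
  set cst : ℝ := P + c * (occ rest a + occ rest b + 6 * (rest.card * c)) with hcst
  have hcst0 : 0 ≤ cst := by positivity
  set g₁ : V → ℝ := fun x => c * occ rest x + A a x + I b x with hg₁
  set g₂ : V → ℝ := fun x => c * occ rest x + A b x with hg₂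
  set g₃ : V → ℝ := fun x => c * occ rest x + I a x + I b x with hg₃
  -- One bound covers both cases. Without a second hit the potential grows by at most six
  -- contributions and the indicators are nonnegative; after a second hit the value is 1, and by
  -- `collision_of_addUnit` at least one indicator equals 1.
  have hpt : ∀ e₁ e₂ : V × V × τ, stoppedPotential c κ m₀ rest (addUnit m a b e₁ e₂) ≤
      cst + g₁ e₁.1 + g₃ e₁.2.1 + g₂ e₂.1 + g₃ e₂.2.1 + (I e₁.1 e₂.1 + A e₁.2.1 e₂.2.1) := by
    intro e₁ e₂
    have hoc : ∀ v, 0 ≤ c * (occ rest v : ℝ) := fun v => by positivity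
    unfold stoppedPotential
    split_ifs with h
    · refine (min_le_left _ _).trans ((potential_addUnit_le hc0 a b e₁ e₂ rest).trans ?_)
      have h1 := hA0 a e₁.1
      have h2 := hA0 b e₂.1
      have h3 := hA0 e₁.2.1 e₂.2.1
      have h4 := hI0 e₁.1 e₂.1
      have h5 := hI0 b e₁.1
      have h6 := hI0 a e₁.2.1
      have h7 := hI0 b e₁.2.1
      have h8 := hI0 a e₂.2.1
      have h9 := hI0 b e₂.2.1
      simp only [hcst, hg₁, hg₂, hg₃]
      linarith
    · have hcol := collision_of_addUnit a b e₁ e₂ hm h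
      have key : 1 ≤ A a e₁.1 + A b e₂.1 + A e₁.2.1 e₂.2.1 + I e₁.1 e₂.1 + I b e₁.1 +
          I a e₁.2.1 + I b e₁.2.1 + I a e₂.2.1 + I b e₂.2.1 := by
        have h1 := hA0 a e₁.1
        have h2 := hA0 b e₂.1
        have h3 := hA0 e₁.2.1 e₂.2.1
        have h4 := hI0 e₁.1 e₂.1
        have h5 := hI0 b e₁.1
        have h6 := hI0 a e₁.2.1
        have h7 := hI0 b e₁.2.1
        have h8 := hI0 a e₂.2.1
        have h9 := hI0 b e₂.2.1
        have hA1 : ∀ x y, m₀ s(x, y) < m s(x, y) → A x y = 1 := fun x y h => if_pos h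
        have hI1 : ∀ x y, x = y → I x y = 1 := fun x y h => if_pos h
        rcases hcol with h | h | h | h | h | h | h | h | h
        · have := hA1 _ _ h; linarith
        · have := hA1 _ _ h; linarith
        · have := hA1 _ _ h; linarith
        · have := hI1 _ _ h; linarith
        · have := hI1 _ _ h.symm; linarith
        · have := hI1 _ _ h.symm; linarith
        · have := hI1 _ _ h.symm; linarith
        · have := hI1 _ _ h.symm; linarith
        · have := hI1 _ _ h.symm; linarith
      have := hoc e₁.1
      have := hoc e₁.2.1
      have := hoc e₂.1
      have := hoc e₂.2.1
      simp only [hg₁, hg₂, hg₃]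
      linarith
  have hfst : ∀ {g : V → ℝ}, (∀ v, 0 ≤ g v) → ∑ e ∈ O, g e.1 ≤ Δ * ∑ v, g v :=
    fun hg => sum_comp_le_of_card_fiber_le hO.fst_le hg
  have hsnd : ∀ {g : V → ℝ}, (∀ v, 0 ≤ g v) → ∑ e ∈ O, g e.2.1 ≤ Δ * ∑ v, g v :=
    fun hg => sum_comp_le_of_card_fiber_le hO.snd_le hg
  have hg₁0 : ∀ v, 0 ≤ g₁ v := fun v => by
    have := hA0 a v
    have := hI0 b v
    simp only [hg₁]
    positivity
  have hg₂0 : ∀ v, 0 ≤ g₂ v := fun v => by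
    have := hA0 b v
    simp only [hg₂]
    positivity
  have hg₃0 : ∀ v, 0 ≤ g₃ v := fun v => by
    have := hI0 a v
    have := hI0 b v
    simp only [hg₃]
    positivity
  have hg₁s : ∑ v, g₁ v = 2 * (rest.card * c) + excess m₀ m a + 1 := by
    simp only [hg₁, Finset.sum_add_distrib, ← Finset.mul_sum, sum_occ, hAsum, hIsum]
    ring
  have hg₂s : ∑ v, g₂ v = 2 * (rest.card * c) + excess m₀ m b := by
    simp only [hg₂, Finset.sum_add_distrib, ← Finset.mul_sum, sum_occ, hAsum]
    ring
  have hg₃s : ∑ v, g₃ v = 2 * (rest.card * c) + 2 := by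
    simp only [hg₃, Finset.sum_add_distrib, ← Finset.mul_sum, sum_occ, hIsum]
    ring
  have s₁ := hfst hg₁0
  have s₂ := hfst hg₂0
  have s₃ := hsnd hg₃0
  rw [hg₁s] at s₁
  rw [hg₂s] at s₂
  rw [hg₃s] at s₃
  have s₄ : ∑ e₁ ∈ O, ∑ e₂ ∈ O, I e₁.1 e₂.1 ≤ M * Δ := by
    calc _ ≤ ∑ e₁ ∈ O, Δ := by
          refine Finset.sum_le_sum fun e₁ _ => ?_
          have := hfst (hI0 e₁.1)
          rwa [hIsum, mul_one] at this
      _ ≤ _ := by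
          rw [Finset.sum_const, nsmul_eq_mul]
          gcongr
  -- Here Δ² = c²M², so this is exactly the term that `potential_cons` releases for the third edge.
  have s₅ : ∑ e₁ ∈ O, ∑ e₂ ∈ O, A e₁.2.1 e₂.2.1 ≤ Δ * Δ * ∑ v, (excess m₀ m v : ℝ) := by
    calc _ ≤ ∑ e₁ ∈ O, Δ * (excess m₀ m e₁.2.1 : ℝ) := by
          refine Finset.sum_le_sum fun e₁ _ => ?_
          have := hsnd (hA0 e₁.2.1)
          rwa [hAsum] at this
      _ ≤ _ := by
          rw [← Finset.mul_sum, mul_assoc]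
          gcongr
          exact hsnd (g := fun v => (excess m₀ m v : ℝ)) fun v => Nat.cast_nonneg _
  have hn0 : (0 : ℝ) ≤ #O := Nat.cast_nonneg _
  calc _ ≤ ∑ e₁ ∈ O, ∑ e₂ ∈ O, (cst + g₁ e₁.1 + g₃ e₁.2.1 + g₂ e₂.1 + g₃ e₂.2.1 +
        (I e₁.1 e₂.1 + A e₁.2.1 e₂.2.1)) :=
        Finset.sum_le_sum fun e₁ _ => Finset.sum_le_sum fun e₂ _ => hpt e₁ e₂
    _ = #O * (#O * cst) + #O * ∑ e ∈ O, g₁ e.1 + #O * ∑ e ∈ O, g₃ e.2.1 +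
        #O * ∑ e ∈ O, g₂ e.1 + #O * ∑ e ∈ O, g₃ e.2.1 + ((∑ e₁ ∈ O, ∑ e₂ ∈ O, I e₁.1 e₂.1) +
          ∑ e₁ ∈ O, ∑ e₂ ∈ O, A e₁.2.1 e₂.2.1) := by
        exact sum_sum_add O cst (fun e => g₁ e.1) (fun e => g₃ e.2.1) (fun e => g₂ e.1)
          (fun e => g₃ e.2.1) (fun e₁ e₂ => I e₁.1 e₂.1) fun e₁ e₂ => A e₁.2.1 e₂.2.1
    _ ≤ M * (M * cst) + M * (Δ * (2 * (rest.card * c) + excess m₀ m a + 1)) +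
        M * (Δ * (2 * (rest.card * c) + 2)) + M * (Δ * (2 * (rest.card * c) + excess m₀ m b)) +
        M * (Δ * (2 * (rest.card * c) + 2)) + (M * Δ + Δ * Δ * ∑ v, (excess m₀ m v : ℝ)) := by
        refine add_le_add (add_le_add (add_le_add (add_le_add (add_le_add ?_ ?_) ?_) ?_) ?_)
          (add_le_add s₄ s₅)
        · exact mul_le_mul hOM (mul_le_mul_of_nonneg_right hOM hcst0) (mul_nonneg hn0 hcst0) hM.le
        · exact mul_le_mul hOM s₁ (Finset.sum_nonneg fun e _ => hg₁0 _) hM.le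
        · exact mul_le_mul hOM s₃ (Finset.sum_nonneg fun e _ => hg₃0 _) hM.le
        · exact mul_le_mul hOM s₂ (Finset.sum_nonneg fun e _ => hg₂0 _) hM.le
        · exact mul_le_mul hOM s₃ (Finset.sum_nonneg fun e _ => hg₃0 _) hM.le
    -- The coefficient 14 is 6 from the growth of the potential and 2 from each of the four sums
    -- over ends. The constant 6 = 1 + 2 + 2 + 1 counts the coincidences of nodes. As `rest.card * c
    -- ≤ 1` and occurrences are at most K, the last summand is at most (2K + 20)c, which κ - η
    -- covers.
    _ = M ^ 2 * (P + c * (excess m₀ m a + excess m₀ m b + c * ∑ v, (excess m₀ m v : ℝ)) +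
        c * (occ rest a + occ rest b + 14 * (rest.card * c) + 6)) := by
        rw [hcst, hΔc]
        ring
    _ ≤ _ := by
        rw [potential_cons, add_sub_assoc]
        refine mul_le_mul_of_nonneg_left (add_le_add_right ?_ _) (sq_nonneg M)
        refine le_trans ?_ (le_sub_iff_add_le.2 hκ)
        rw [mul_comm]
        refine mul_le_mul_of_nonneg_right ?_ hc0
        have := hocc a
        have := hocc b
        linarith

end Potential

end TGen

end

noncomputable section

namespace TGen

variable {D : Input}

/-! ## Units of switchings

A unit with base nodes `a`, `b` replaces two simple edges `{x₁, y₁}`, `{x₂, y₂}` (and one copy of a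
defect `{a, b}`) with `{a, x₁}`, `{b, x₂}`, `{y₁, y₂}`. -/

/-- The two arcs that are removed and the stamps of the three edges that are added. -/
abbrev SwitchUnit (D : Input) := Arc D × Arc D × Stamp D × Stamp D × Stamp D

def unitOld (u : SwitchUnit D) : TGraph D := {arcEdge u.1, arcEdge u.2.1}

def unitNew (a b : Node D) (u : SwitchUnit D) : TGraph D :=
  {(s(a, u.1.1), u.2.2.1), (s(b, u.2.1.1), u.2.2.2.1), (s(u.1.2.1, u.2.1.2.1), u.2.2.2.2)}

/-- Removed and added edges have the same six ends, one at each of the base nodes and one at each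
end of the two arcs. -/
theorem degree_unit (a b : Node D) (t : Stamp D) (u : SwitchUnit D) (i : Node D) :
    degree ((s(a, b), t) ::ₘ unitOld u) i = degree (unitNew a b u) i := by
  simp only [unitOld, unitNew, Multiset.insert_eq_cons, degree_cons, degree_singleton, inc_mk]
  ring

theorem pairMult_add_unitNew (m : Sym2 (Node D) → ℕ) (a b : Node D) (u : SwitchUnit D)
    (p : Sym2 (Node D)) :
    m p + pairMult (unitNew a b u) p = addUnit m a b u.1 u.2.1 p := by
  simp only [unitNew, Multiset.insert_eq_cons, pairMult_cons, pairMult_singleton, addUnit, addPair]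
  ring

theorem arcBounds_simpleArcs {G : TGraph D} (hG : Matches G) :
    ArcBounds (simpleArcs G) (maxDeg D) where
  fst_le v := by
    rw [card_simpleArcs_fst]
    exact_mod_cast (simpleCount_le G v).trans ((hG v).le.trans (le_maxDeg v))
  snd_le v := by
    rw [card_simpleArcs_snd]
    exact_mod_cast (simpleCount_le G v).trans ((hG v).le.trans (le_maxDeg v))

/-- The units whose arcs belong to simple edges. -/
def simpleUnits (G : TGraph D) : Finset (SwitchUnit D) :=
  simpleArcs G ×ˢ simpleArcs G ×ˢ Finset.univ ×ˢ Finset.univ ×ˢ Finset.univ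

theorem mem_simpleUnits {G : TGraph D} {u : SwitchUnit D} :
    u ∈ simpleUnits G ↔ u.1 ∈ simpleArcs G ∧ u.2.1 ∈ simpleArcs G := by
  simp [simpleUnits]

theorem sum_simpleUnits (G : TGraph D) (f : Arc D → Arc D → ℝ) :
    ∑ u ∈ simpleUnits G, f u.1 u.2.1 =
      (D.T : ℝ) ^ 3 * ∑ e₁ ∈ simpleArcs G, ∑ e₂ ∈ simpleArcs G, f e₁ e₂ := by
  simp only [simpleUnits, Finset.sum_product, Finset.sum_const, Finset.card_univ, Fintype.card_fin,
    nsmul_eq_mul, Finset.mul_sum, Finset.card_product, Nat.cast_mul]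
  refine Finset.sum_congr rfl fun _ _ => Finset.sum_congr rfl fun _ _ => ?_
  ring

theorem card_simpleUnits (G : TGraph D) :
    (#(simpleUnits G) : ℝ) = (#(simpleArcs G) : ℝ) ^ 2 * (D.T : ℝ) ^ 3 := by
  simp only [simpleUnits, Finset.card_product, Finset.card_univ, Fintype.card_fin]
  push_cast
  ring

/-- The unit can be performed, and all nodes involved are distinct and outside `U`. -/
structure IsGeneric (G : TGraph D) (U : Finset (Node D)) (a b : Node D) (u : SwitchUnit D) :
    Prop where
  simple₁ : u.1 ∈ simpleArcs G
  simple₂ : u.2.1 ∈ simpleArcs G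
  x₁ : u.1.1 ∉ U
  y₁ : u.1.2.1 ∉ U
  x₂ : u.2.1.1 ∉ U
  y₂ : u.2.1.2.1 ∉ U
  x₁x₂ : u.1.1 ≠ u.2.1.1
  x₁y₂ : u.1.1 ≠ u.2.1.2.1
  y₁x₂ : u.1.2.1 ≠ u.2.1.1
  y₁y₂ : u.1.2.1 ≠ u.2.1.2.1
  new₁ : (s(a, u.1.1), u.2.2.1) ∉ G
  new₂ : (s(b, u.2.1.1), u.2.2.2.1) ∉ G
  new₃ : (s(u.1.2.1, u.2.1.2.1), u.2.2.2.2) ∉ G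

open scoped Classical in
def genericUnits (G : TGraph D) (U : Finset (Node D)) (a b : Node D) : Finset (SwitchUnit D) :=
  {u | IsGeneric G U a b u}

theorem mem_genericUnits {G : TGraph D} {U : Finset (Node D)} {a b : Node D} {u : SwitchUnit D} :
    u ∈ genericUnits G U a b ↔ IsGeneric G U a b u := by
  simp [genericUnits]

/-- A union bound over the ways to fail. An end of an arc in `U` costs Δ#U·M choices of arcs, for
four ends; each of the four coincidences costs ΔM. A new edge that already exists fixes its
timestamp as well, which costs at most Δ²M·T² ≤ ΔM·T³ for each of the three new edges. -/
theorem le_card_genericUnits {G : TGraph D} (hG : Matches G) (U : Finset (Node D)) (a b : Node D)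
    (hΔT : maxDeg D ≤ D.T) :
    ((#(simpleArcs G) : ℝ) ^ 2 - degSum D * ((4 * #U + 7) * maxDeg D)) * (D.T : ℝ) ^ 3 ≤
      #(genericUnits G U a b) := by
  classical
  set O := simpleArcs G with hO
  set Δ : ℝ := (maxDeg D : ℝ) with hΔ
  set T : ℝ := (D.T : ℝ) with hT
  have hT0 : 0 < T := by rw [hT]; exact_mod_cast D.T_pos
  have hΔ0 : 0 ≤ Δ := Nat.cast_nonneg _
  have hΔT' : Δ ≤ T := by rw [hΔ, hT]; exact_mod_cast hΔT
  have hAB := arcBounds_simpleArcs hG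
  have hOM : (#O : ℝ) ≤ degSum D := by exact_mod_cast card_simpleArcs_le hG
  have hn0 : (0 : ℝ) ≤ #O := Nat.cast_nonneg _
  set A : Node D → Node D → Stamp D → ℝ := fun x y t => if (s(x, y), t) ∈ G then 1 else 0 with hA
  have hA0 : ∀ x y t, 0 ≤ A x y t := fun x y t => by simp only [hA]; split_ifs <;> norm_num
  set A' : Node D → Node D → ℝ := fun x y => ∑ t, A x y t with hA'
  have hA'0 : ∀ x y, 0 ≤ A' x y := fun x y => Finset.sum_nonneg fun t _ => hA0 x y t
  have hA's : ∀ x, ∑ y, A' x y ≤ Δ := by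
    intro x
    have h : ∑ y, A' x y = (#{z : Node D × Stamp D | (s(x, z.1), z.2) ∈ G} : ℝ) := by
      rw [Finset.card_filter, Fintype.sum_prod_type]
      push_cast
      rfl
    rw [h, hΔ]
    exact_mod_cast (card_incident_le G x).trans ((hG x).le.trans (le_maxDeg x))
  set I : Node D → Node D → ℝ := fun x y => if x = y then 1 else 0 with hI
  have hI0 : ∀ x y, 0 ≤ I x y := fun x y => by simp only [hI]; split_ifs <;> norm_num
  have hIs : ∀ x, ∑ y, I x y = 1 := by
    intro x
    simp [hI]
  set J : Node D → ℝ := fun x => if x ∈ U then 1 else 0 with hJ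
  have hJ0 : ∀ x, 0 ≤ J x := fun x => by simp only [hJ]; split_ifs <;> norm_num
  have hJs : ∑ y, J y = #U := by simp [hJ]
  have hfst : ∀ {g : Node D → ℝ}, (∀ v, 0 ≤ g v) → ∑ e ∈ O, g e.1 ≤ Δ * ∑ v, g v :=
    fun hg => sum_comp_le_of_card_fiber_le hAB.fst_le hg
  have hsnd : ∀ {g : Node D → ℝ}, (∀ v, 0 ≤ g v) → ∑ e ∈ O, g e.2.1 ≤ Δ * ∑ v, g v :=
    fun hg => sum_comp_le_of_card_fiber_le hAB.snd_le hg
  set g₁ : Arc D → Arc D → ℝ := fun e₁ e₂ => J e₁.1 + J e₁.2.1 + J e₂.1 + J e₂.2.1 +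
    (I e₁.1 e₂.1 + I e₁.1 e₂.2.1 + I e₁.2.1 e₂.1 + I e₁.2.1 e₂.2.1) with hg₁
  have hbad : (#(simpleUnits G \ genericUnits G U a b) : ℝ) ≤ ∑ u ∈ simpleUnits G,
      (g₁ u.1 u.2.1 + (A a u.1.1 u.2.2.1 + A b u.2.1.1 u.2.2.2.1 +
        A u.1.2.1 u.2.1.2.1 u.2.2.2.2)) := by
    rw [Finset.sdiff_eq_filter, Finset.card_filter]
    push_cast
    refine Finset.sum_le_sum fun u hu => ?_
    have h1 := hJ0 u.1.1
    have h2 := hJ0 u.1.2.1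
    have h3 := hJ0 u.2.1.1
    have h4 := hJ0 u.2.1.2.1
    have h5 := hI0 u.1.1 u.2.1.1
    have h6 := hI0 u.1.1 u.2.1.2.1
    have h7 := hI0 u.1.2.1 u.2.1.1
    have h8 := hI0 u.1.2.1 u.2.1.2.1
    have h9 := hA0 a u.1.1 u.2.2.1
    have h10 := hA0 b u.2.1.1 u.2.2.2.1
    have h11 := hA0 u.1.2.1 u.2.1.2.1 u.2.2.2.2
    simp only [hg₁]
    split_ifs with h
    · linarith
    · by_contra hlt
      refine h (mem_genericUnits.2 ?_)
      obtain ⟨hu1, hu2⟩ := mem_simpleUnits.1 hu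
      have hJ1 : ∀ x, x ∈ U → J x = 1 := fun x h => if_pos h
      have hI1 : ∀ x y, x = y → I x y = 1 := fun x y h => if_pos h
      have hA1 : ∀ x y t, (s(x, y), t) ∈ G → A x y t = 1 := fun x y t h => if_pos h
      refine ⟨hu1, hu2, fun h => hlt ?_, fun h => hlt ?_, fun h => hlt ?_, fun h => hlt ?_,
        fun h => hlt ?_, fun h => hlt ?_, fun h => hlt ?_, fun h => hlt ?_, fun h => hlt ?_,
        fun h => hlt ?_, fun h => hlt ?_⟩
      · have := hJ1 _ h; linarith
      · have := hJ1 _ h; linarith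
      · have := hJ1 _ h; linarith
      · have := hJ1 _ h; linarith
      · have := hI1 _ _ h; linarith
      · have := hI1 _ _ h; linarith
      · have := hI1 _ _ h; linarith
      · have := hI1 _ _ h; linarith
      · have := hA1 _ _ _ h; linarith
      · have := hA1 _ _ _ h; linarith
      · have := hA1 _ _ _ h; linarith
  have s1 : ∑ u ∈ simpleUnits G, g₁ u.1 u.2.1 ≤ T ^ 3 * (degSum D * ((4 * #U + 4) * Δ)) := by
    rw [sum_simpleUnits]
    refine mul_le_mul_of_nonneg_left ?_ (by positivity)
    have e := sum_sum_add O 0 (fun e => J e.1) (fun e => J e.2.1) (fun e => J e.1)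
      (fun e => J e.2.1) (fun e₁ e₂ => I e₁.1 e₂.1 + I e₁.1 e₂.2.1 + I e₁.2.1 e₂.1 + I e₁.2.1 e₂.2.1)
      (fun _ _ => 0)
    simp only [zero_add, add_zero, mul_zero, Finset.sum_const_zero] at e
    rw [e]
    have j1 := hfst hJ0
    have j2 := hsnd hJ0
    rw [hJs] at j1 j2
    have i1 : ∑ e₁ ∈ O, ∑ e₂ ∈ O, (I e₁.1 e₂.1 + I e₁.1 e₂.2.1 + I e₁.2.1 e₂.1 + I e₁.2.1 e₂.2.1) ≤
        #O * (4 * Δ) := by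
      calc _ ≤ ∑ e₁ ∈ O, 4 * Δ := by
            refine Finset.sum_le_sum fun e₁ _ => ?_
            simp only [Finset.sum_add_distrib]
            have a1 := hfst (hI0 e₁.1)
            have a2 := hsnd (hI0 e₁.1)
            have a3 := hfst (hI0 e₁.2.1)
            have a4 := hsnd (hI0 e₁.2.1)
            rw [hIs] at a1 a2 a3 a4
            linarith
        _ = _ := by rw [Finset.sum_const, nsmul_eq_mul]
    calc _ ≤ #O * (Δ * #U) + #O * (Δ * #U) + #O * (Δ * #U) + #O * (Δ * #U) + #O * (4 * Δ) := by
          gcongr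
      _ = #O * ((4 * #U + 4) * Δ) := by ring
      _ ≤ _ := by gcongr
  -- The place where Δ ≤ T enters: one factor Δ is traded for T, so that the three conditions on new
  -- edges have the same order as the others.
  have sA : ∀ x : Node D, (∑ e ∈ O, A' x e.1 ≤ T * Δ) ∧ ∑ e ∈ O, A' x e.2.1 ≤ T * Δ := by
    intro x
    constructor
    · refine (hfst (hA'0 x)).trans ?_
      exact mul_le_mul hΔT' (hA's x) (Finset.sum_nonneg fun y _ => hA'0 x y) hT0.le
    · refine (hsnd (hA'0 x)).trans ?_
      exact mul_le_mul hΔT' (hA's x) (Finset.sum_nonneg fun y _ => hA'0 x y) hT0.le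
  have s2 : ∑ u ∈ simpleUnits G, (A a u.1.1 u.2.2.1 + A b u.2.1.1 u.2.2.2.1 +
      A u.1.2.1 u.2.1.2.1 u.2.2.2.2) ≤ T ^ 3 * (degSum D * (3 * Δ)) := by
    have e : ∑ u ∈ simpleUnits G, (A a u.1.1 u.2.2.1 + A b u.2.1.1 u.2.2.2.1 +
        A u.1.2.1 u.2.1.2.1 u.2.2.2.2) = T ^ 2 * (#O * ∑ e ∈ O, A' a e.1 + #O * ∑ e ∈ O, A' b e.1 +
          ∑ e₁ ∈ O, ∑ e₂ ∈ O, A' e₁.2.1 e₂.2.1) := by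
      simp only [simpleUnits, Finset.sum_product, Finset.sum_add_distrib, Finset.sum_const,
        Finset.card_univ, Fintype.card_fin, nsmul_eq_mul, Finset.mul_sum, mul_add,
        Finset.card_product, Nat.cast_mul, hA', pow_two,
        mul_assoc, ← hO, ← hT]
      congr 2
      all_goals
        refine Finset.sum_congr rfl fun e₁ _ => ?_
        try refine Finset.sum_congr rfl fun e₂ _ => ?_
        try refine Finset.sum_congr rfl fun e₂ _ => ?_
        try ring
    rw [e]
    calc _ ≤ T ^ 2 * (#O * (T * Δ) + #O * (T * Δ) + ∑ e₁ ∈ O, T * Δ) := by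
          gcongr
          · exact (sA a).1
          · exact (sA b).1
          · exact (sA _).2
      _ = T ^ 3 * (#O * (3 * Δ)) := by
          rw [Finset.sum_const, nsmul_eq_mul]
          ring
      _ ≤ _ := by gcongr
  rw [Finset.sum_add_distrib] at hbad
  have hcard : (#(simpleUnits G) : ℝ) ≤
      #(simpleUnits G \ genericUnits G U a b) + #(genericUnits G U a b) := by
    exact_mod_cast Finset.card_le_card_sdiff_add_card
  rw [card_simpleUnits] at hcard
  have : T ^ 3 * (degSum D * ((4 * #U + 4) * Δ)) + T ^ 3 * (degSum D * (3 * Δ)) =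
    degSum D * ((4 * #U + 7) * Δ) * T ^ 3 := by ring
  rw [sub_mul]
  linarith

end TGen

end

noncomputable section

namespace TGen

variable {D : Input}

/-! ## The auxiliary step -/

section Aux

variable {k q mu : ℕ} {slack : ℝ} {base : Fin k → Node D} {a b : Fin q → Node D}

/-- A nontrivial auxiliary switching is treated as a complete failure of value 1; nothing about the
graphs it produces is needed. -/
theorem wp_auxStep_le (B : Set (TGraph D)) {G' : TGraph D} {Q : TGraph D → ℝ≥0∞}
    (hQ : ∀ G, Q G ≤ 1) {η : ℝ}
    (h : ENNReal.ofReal (1 - η) ≤ auxTypeDist D q mu slack none) :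
    wp B (auxStep mu slack base a b G') Q ≤ Q G' + ENNReal.ofReal η := by
  unfold auxStep
  rw [wp_bind, wp_sample, tsum_fintype, Fintype.sum_option]
  have hsum := PMF.tsum_coe (auxTypeDist D q mu slack)
  rw [tsum_fintype, Fintype.sum_option] at hsum
  refine add_le_add ?_ ?_
  · rw [wp_pure]
    exact mul_le_of_le_one_left' (PMF.coe_le_one _ _)
  · calc _ ≤ ∑ θ : AuxType D q mu, auxTypeDist D q mu slack (some θ) :=
          Finset.sum_le_sum fun θ _ => mul_le_of_le_one_right' (wp_le_one B hQ)
      _ ≤ _ := by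
        have h2 : ENNReal.ofReal (1 - η) + ENNReal.ofReal η ≥ 1 := by
          rw [← ENNReal.ofReal_one]
          refine (ENNReal.ofReal_le_ofReal (by linarith : (1 : ℝ) ≤ (1 - η) + η)).trans ?_
          exact ENNReal.ofReal_add_le
        have hne : auxTypeDist D q mu slack none ≠ ⊤ := PMF.apply_ne_top _ _
        refine ENNReal.le_of_add_le_add_left hne ?_
        rw [hsum]
        exact h2.le.trans (by gcongr)

theorem le_wp_auxStep {G' : TGraph D} (Q : TGraph D → ℝ≥0∞) {η : ℝ}
    (h : ENNReal.ofReal (1 - η) ≤ auxTypeDist D q mu slack none) :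
    ENNReal.ofReal (1 - η) * Q G' ≤ wp ∅ (auxStep mu slack base a b G') Q := by
  unfold auxStep
  rw [wp_bind, wp_sample, tsum_fintype, Fintype.sum_option, wp_pure]
  exact le_trans (by gcongr) le_self_add

end Aux

/-! ## A single switching and the potential -/

section Step

variable {α : Type} {F : Finset α} {fbar : ℝ} {nxt : α → TGraph D} {R : α → Prop}
  {p₁ : α → ℝ} {aux : α → Prog D (TGraph D)} {p₂ : α → TGraph D → ℝ}

/-- An abstract supermartingale step, with `v` the stopped potential after the switching. Where `v S
= 1` nothing needs to be known about the next graph, which may lie in `B`. The auxiliary step is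
paid by the gap η between P and the average of `v`. -/
theorem wp_switchStep_le_of_sum_le {B : Set (TGraph D)} (hf : 0 < fbar) (hF : (#F : ℝ) ≤ fbar)
    {Q : TGraph D → ℝ≥0∞} {η P : ℝ} (hη : 0 ≤ η)
    (haux : ∀ S ∈ F, ∀ Q' : TGraph D → ℝ≥0∞, (∀ G, Q' G ≤ 1) →
      wp B (aux S) Q' ≤ Q' (nxt S) + ENNReal.ofReal η) (hQ : ∀ G, Q G ≤ 1)
    {v : α → ℝ} (hv : ∀ S ∈ F, 0 ≤ v S)
    (hsum : ∑ S ∈ F, v S ≤ fbar * (P - η))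
    (hnxt : ∀ S ∈ F, v S = 1 ∨ nxt S ∉ B ∧ Q (nxt S) ≤ ENNReal.ofReal (v S)) :
    wp B (switchStep F fbar nxt R p₁ aux p₂) Q ≤ ENNReal.ofReal (min P 1) := by
  classical
  rw [ENNReal.ofReal_min, ENNReal.ofReal_one]
  refine le_min ?_ (wp_le_one B hQ)
  refine (wp_switchStep_le B hf hF haux hQ).trans ?_
  have h1 : (∑ S ∈ F, ENNReal.ofReal (1 / fbar) * if nxt S ∈ B then 1 else Q (nxt S)) ≤
      ENNReal.ofReal (1 / fbar * ∑ S ∈ F, v S) := by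
    rw [ENNReal.ofReal_mul (by positivity), ENNReal.ofReal_sum_of_nonneg hv, Finset.mul_sum]
    refine Finset.sum_le_sum fun S hS => ?_
    refine mul_le_mul_right ?_ _
    rcases hnxt S hS with h | ⟨h, h'⟩
    · rw [h, ENNReal.ofReal_one]
      split_ifs
      · exact le_rfl
      · exact hQ _
    · rwa [if_neg h]
  have h0 : 0 ≤ ∑ S ∈ F, v S := Finset.sum_nonneg hv
  have h2 : 1 / fbar * ∑ S ∈ F, v S ≤ P - η := by
    rw [one_div, inv_mul_le_iff₀ hf]
    exact hsum
  have h3 : 0 ≤ 1 / fbar * ∑ S ∈ F, v S := by positivity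
  calc _ ≤ ENNReal.ofReal (P - η) + ENNReal.ofReal η := by
        gcongr
        exact h1.trans (ENNReal.ofReal_le_ofReal h2)
    _ = ENNReal.ofReal P := by
        rw [← ENNReal.ofReal_add (h3.trans h2) hη, sub_add_cancel]

/-- The counterpart for the success probability. The missing mass γ of switchings that are not good
and the loss `a` in the auxiliary step and the final rejection are both paid by the gap η. Only the
acceptance probability ρ for timestamps survives as a factor, because it is too small to be absorbed
additively. -/
theorem le_wp_switchStep_of_sum_le (hf : 0 < fbar) (hF : (#F : ℝ) ≤ fbar)
    {Q : TGraph D → ℝ≥0∞} {Good : Finset α} (hGood : Good ⊆ F) {ρ π δ η γ a P V : ℝ}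
    (hρ0 : 0 ≤ ρ) (hρ : ρ ≤ 1) (hδ0 : 0 ≤ δ) (hδ : δ ≤ 1) (hπ0 : 0 ≤ π) (hV : 0 ≤ V)
    (haux : ∀ S ∈ Good, ∀ Q' : TGraph D → ℝ≥0∞,
      ENNReal.ofReal π * Q' (nxt S) ≤ wp ∅ (aux S) Q')
    (hR : ∀ S ∈ Good, ¬ R S) (hp₁ : ∀ S ∈ Good, ρ ≤ p₁ S)
    (hp₂ : ∀ S ∈ Good, δ ≤ p₂ S (nxt S)) {v : α → ℝ} (hv : ∀ S ∈ F, 0 ≤ v S)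
    (hv1 : ∀ S ∈ Good, v S ≤ 1)
    (hcard : (1 - γ) * fbar ≤ #Good) (hπδ : 1 - a ≤ π * δ) (hη : γ + a ≤ η)
    (hsum : ∑ S ∈ F, v S ≤ fbar * (P - η)) (ha : 0 ≤ a)
    (hnxt : ∀ S ∈ Good, ENNReal.ofReal (V * (1 - v S)) ≤ Q (nxt S)) :
    ENNReal.ofReal (ρ * V * (1 - P)) ≤ wp ∅ (switchStep F fbar nxt R p₁ aux p₂) Q := by
  refine le_trans ?_ (le_wp_switchStep hf hF hGood hρ hδ haux hR hp₁ hp₂)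
  have hterm : ∀ S ∈ Good, ENNReal.ofReal (1 / fbar * (ρ * (π * (δ * (V * (1 - v S)))))) ≤
      ENNReal.ofReal (1 / fbar) * (ENNReal.ofReal ρ * (ENNReal.ofReal π *
        (ENNReal.ofReal δ * Q (nxt S)))) := by
    intro S hS
    rw [ENNReal.ofReal_mul (by positivity), ENNReal.ofReal_mul hρ0, ENNReal.ofReal_mul hπ0,
      ENNReal.ofReal_mul hδ0]
    gcongr
    exact hnxt S hS
  refine le_trans ?_ (Finset.sum_le_sum hterm)
  have hn : ∀ S ∈ Good, 0 ≤ 1 - v S := fun S hS => by linarith [hv1 S hS]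
  rw [← ENNReal.ofReal_sum_of_nonneg]
  swap
  · intro S hS
    have := hn S hS
    positivity
  refine ENNReal.ofReal_le_ofReal ?_
  have e : ∑ S ∈ Good, 1 / fbar * (ρ * (π * (δ * (V * (1 - v S))))) =
      ρ * V * ((π * δ) * ((∑ S ∈ Good, (1 - v S)) / fbar)) := by
    rw [Finset.sum_div, Finset.mul_sum, Finset.mul_sum]
    refine Finset.sum_congr rfl fun S _ => ?_
    ring
  rw [e]
  refine mul_le_mul_of_nonneg_left ?_ (by positivity)
  set y := (∑ S ∈ Good, (1 - v S)) / fbar with hy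
  have hy0 : 0 ≤ y := div_nonneg (Finset.sum_nonneg hn) hf.le
  have hy1 : y ≤ 1 := by
    rw [hy, div_le_one hf]
    refine le_trans ?_ hF
    refine le_trans (Finset.sum_le_sum (g := fun _ => (1 : ℝ)) fun S hS => ?_) ?_
    · linarith [hv S (hGood hS)]
    · simp only [Finset.sum_const, nsmul_eq_mul, mul_one]
      exact_mod_cast Finset.card_le_card hGood
  have hyl : 1 - γ - (P - η) ≤ y := by
    rw [hy, le_div_iff₀ hf, Finset.sum_sub_distrib, Finset.sum_const, nsmul_eq_mul, mul_one]
    have : ∑ S ∈ Good, v S ≤ ∑ S ∈ F, v S :=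
      Finset.sum_le_sum_of_subset_of_nonneg hGood fun S hS _ => hv S hS
    nlinarith
  have h1 : (1 - a) * y ≤ (π * δ) * y := mul_le_mul_of_nonneg_right hπδ hy0
  have h2 : a * y ≤ a := mul_le_of_le_one_right ha hy1
  linarith

end Step

/-! ### The potential summed over one or two units -/

section Units

variable {α : Type} {G : TGraph D} {F : Finset α} {c κ η K : ℝ} {m₀ : Sym2 (Node D) → ℕ}
  {a b : Node D} {rest : Multiset (Sym2 (Node D))}

theorem card_simpleUnits_le (hG : Matches G) :
    (#(simpleUnits G) : ℝ) ≤ (degSum D : ℝ) ^ 2 * (D.T : ℝ) ^ 3 := by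
  rw [card_simpleUnits]
  have : (#(simpleArcs G) : ℝ) ≤ degSum D := by exact_mod_cast card_simpleArcs_le hG
  gcongr

theorem sum_unit_le (hG : Matches G) (hM : 0 < degSum D)
    (hc : c = (maxDeg D : ℝ) / degSum D) (hη : 0 ≤ η) (hκ : (2 * K + 20) * c + η ≤ κ)
    (hocc : ∀ v, (occ rest v : ℝ) ≤ K) (hrest : rest.card * c ≤ 1) {m : Sym2 (Node D) → ℕ}
    (hm : ∀ p, m p ≤ m₀ p + 1) :
    ∑ u ∈ simpleUnits G, stoppedPotential c κ m₀ rest (addUnit m a b u.1 u.2.1) ≤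
      (degSum D : ℝ) ^ 2 * (D.T : ℝ) ^ 3 * (potential c κ m₀ (s(a, b) ::ₘ rest) m - η) := by
  rw [sum_simpleUnits G fun e₁ e₂ => stoppedPotential c κ m₀ rest (addUnit m a b e₁ e₂),
    mul_comm (_ ^ 2), mul_assoc]
  refine mul_le_mul_of_nonneg_left ?_ (by positivity)
  exact sum_stoppedPotential_le (arcBounds_simpleArcs hG) (by exact_mod_cast hM)
    (by exact_mod_cast card_simpleArcs_le hG) hc (Nat.cast_nonneg _) hη hκ a b rest hocc hrest hm

/-- Both units choose their arcs from the same graph, since TD₀ rewires everything at once, so the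
double sum is handled by two applications of the bound for one unit. The inner sum is at most Z
times the stopped potential after the first unit: if that unit already hits a pair twice, the
trivial bound Z is enough. -/
theorem sum_two_units_le (hG : Matches G) (hM : 0 < degSum D)
    (hc : c = (maxDeg D : ℝ) / degSum D) (hη : 0 ≤ η) (hκ : (2 * K + 20) * c + η ≤ κ)
    (hocc : ∀ v, (occ (s(a, b) ::ₘ rest) v : ℝ) ≤ K)
    (hrest : (s(a, b) ::ₘ rest).card * c ≤ 1) {m : Sym2 (Node D) → ℕ}
    (hm : ∀ p, m p ≤ m₀ p + 1) :
    ∑ u ∈ simpleUnits G, ∑ u' ∈ simpleUnits G,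
      stoppedPotential c κ m₀ rest (addUnit (addUnit m a b u.1 u.2.1) a b u'.1 u'.2.1) ≤
      (degSum D : ℝ) ^ 4 * (D.T : ℝ) ^ 6 *
        (potential c κ m₀ (s(a, b) ::ₘ s(a, b) ::ₘ rest) m - η) := by
  have hc0 : 0 ≤ c := by rw [hc]; positivity
  have hocc' : ∀ v, (occ rest v : ℝ) ≤ K := fun v => by
    refine le_trans ?_ (hocc v)
    rw [occ_cons]
    push_cast
    exact le_add_of_nonneg_left (Nat.cast_nonneg _)
  have hrest' : rest.card * c ≤ 1 := by
    refine le_trans ?_ hrest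
    rw [Multiset.card_cons]
    gcongr
    exact Nat.le_succ _
  set Z : ℝ := (degSum D : ℝ) ^ 2 * (D.T : ℝ) ^ 3 with hZ
  have hZ0 : 0 ≤ Z := by positivity
  have hin : ∀ u ∈ simpleUnits G, ∑ u' ∈ simpleUnits G,
      stoppedPotential c κ m₀ rest (addUnit (addUnit m a b u.1 u.2.1) a b u'.1 u'.2.1) ≤
      Z * stoppedPotential c κ m₀ (s(a, b) ::ₘ rest) (addUnit m a b u.1 u.2.1) := by
    intro u _
    have h1 : ∑ u' ∈ simpleUnits G,
        stoppedPotential c κ m₀ rest (addUnit (addUnit m a b u.1 u.2.1) a b u'.1 u'.2.1) ≤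
        Z * 1 := by
      calc _ ≤ ∑ u' ∈ simpleUnits G, (1 : ℝ) :=
            Finset.sum_le_sum fun u' _ => stoppedPotential_le_one rest
        _ = #(simpleUnits G) := by simp
        _ ≤ _ := by
          rw [mul_one]
          exact card_simpleUnits_le hG
    rw [stoppedPotential.eq_def c κ m₀ (s(a, b) ::ₘ rest)]
    split_ifs with h
    · rw [mul_min_of_nonneg _ _ hZ0]
      refine le_min ((sum_unit_le hG hM hc hη hκ hocc' hrest' h).trans ?_) h1
      gcongr
      linarith
    · exact h1
  refine (Finset.sum_le_sum hin).trans ?_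
  rw [← Finset.mul_sum]
  calc _ ≤ Z * (Z * (potential c κ m₀ (s(a, b) ::ₘ s(a, b) ::ₘ rest) m - η)) :=
        mul_le_mul_of_nonneg_left (sum_unit_le hG hM hc hη hκ hocc hrest hm) hZ0
    _ = _ := by
        rw [hZ]
        ring

end Units

/-! ## The invariant of the stages -/

/-- What is known about the current graph `G` after some switchings from `G₀`, when the defects in
`R` are still to be removed. -/
structure StageInv (G₀ G : TGraph D) (R : Set (TEdge D)) : Prop where
  degrees : Matches G
  defect_le : ∀ e, defect G e ≤ defect G₀ e
  defect_eq : ∀ e ∈ R, defect G e = defect G₀ e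
  pairMult_le : ∀ p, pairMult G p ≤ pairMult G₀ p + 1

theorem StageInv.step {G₀ G G' : TGraph D} {R R' : Set (TEdge D)} (h : StageInv G₀ G R)
    {e₀ : TEdge D} (hR : R' ⊆ R) (he₀ : e₀ ∉ R') (hdeg : ∀ i, degree G' i = degree G i)
    (hdef : ∀ e, defect G' e = if e = e₀ then 0 else defect G e)
    (hm : ∀ p, pairMult G' p ≤ pairMult G₀ p + 1) : StageInv G₀ G' R' where
  degrees i := (hdeg i).trans (h.degrees i)
  defect_le e := by
    rw [hdef]
    split_ifs
    · exact Nat.zero_le _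
    · exact h.defect_le e
  defect_eq e he := by
    rw [hdef, if_neg (show e ≠ e₀ from fun h' => he₀ (h' ▸ he))]
    exact h.defect_eq e (hR he)
  pairMult_le := hm

/-- Defects never grow during the stages, so the number of arcs available at any time is controlled
by the initial graph. -/
theorem StageInv.card_simpleArcs {G₀ G : TGraph D} {R : Set (TEdge D)} (h : StageInv G₀ G R) :
    degSum D ≤ #(simpleArcs G) + 2 * sumLoops G₀ + 2 * sumMulti G₀ := by
  rw [degSum_eq h.degrees]
  have h1 : sumLoops G ≤ sumLoops G₀ := Finset.sum_le_sum fun i _ => Finset.sum_le_sum fun t _ => by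
    rw [W_eq, W_eq]
    exact h.defect_le _
  have h2 : sumMulti G ≤ sumMulti G₀ := Finset.sum_le_sum fun i _ => Finset.sum_le_sum fun j _ =>
    Finset.sum_le_sum fun t _ => by
      rw [W_eq, W_eq]
      exact h.defect_le _
  omega

end TGen

end

noncomputable section

namespace TGen

variable {D : Input}

/-! ## Rewiring with one or two units -/

theorem count_rewire_of_mem_new {G old new : TGraph D} (h : CanRewire G old new) {e : TEdge D}
    (he : e ∈ new) : (rewire G old new).count e = 1 := by
  rw [rewire, Multiset.count_add, Multiset.count_sub,
    Multiset.count_eq_zero.2 (h.new_notMem e he), Multiset.count_eq_one_of_mem h.new_nodup he,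
    Nat.zero_sub]

theorem isSimpleEdge_rewire {G old new : TGraph D} (h : CanRewire G old new) {i j : Node D}
    {t : Stamp D} (hij : i ≠ j) (he : ((s(i, j), t) : TEdge D) ∈ new) :
    IsSimpleEdge (rewire G old new) i j t :=
  ⟨hij, count_rewire_of_mem_new h he⟩

theorem pairMult_eq_zero {A : TGraph D} {p : Sym2 (Node D)} (h : ∀ e ∈ A, e.1 ≠ p) :
    pairMult A p = 0 :=
  Finset.sum_eq_zero fun _ _ => Multiset.count_eq_zero.2 fun ht => h _ ht rfl

/-- A removed edge whose pair receives no new edge loses multiplicity. This brings removed pairs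
below the threshold of the restart rule even if they had reached it. -/
theorem pairMult_rewire_lt {G old new : TGraph D} (h : old ≤ G) {e : TEdge D} (he : e ∈ old)
    (hnew : ∀ e' ∈ new, e'.1 ≠ e.1) : pairMult (rewire G old new) e.1 < pairMult G e.1 := by
  have h1 := pairMult_rewire (new := new) h e.1
  rw [pairMult_eq_zero hnew] at h1
  have h2 := one_le_pairMult he
  omega

theorem pairMult_rewire_le {G old new : TGraph D} (h : old ≤ G) (p : Sym2 (Node D)) :
    pairMult (rewire G old new) p ≤ pairMult G p + pairMult new p := by
  have := pairMult_rewire (new := new) h p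
  omega

theorem replicate_add_le {G A : TGraph D} {e₀ : TEdge D} {k : ℕ} (hA : A.Nodup)
    (he₀ : e₀ ∉ A) (hAG : ∀ e ∈ A, e ∈ G) (hk : k ≤ G.count e₀) :
    Multiset.replicate k e₀ + A ≤ G := by
  rw [Multiset.le_iff_count]
  intro e
  rw [Multiset.count_add, Multiset.count_replicate]
  by_cases h : e₀ = e
  · subst h
    rw [if_pos rfl, Multiset.count_eq_zero.2 he₀]
    exact hk
  · rw [if_neg h, zero_add]
    by_cases h' : e ∈ A
    · rw [Multiset.count_eq_one_of_mem hA h']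
      exact Multiset.one_le_count_iff_mem.2 (hAG e h')
    · rw [Multiset.count_eq_zero.2 h']
      exact Nat.zero_le _

theorem mem_unitOld {u : SwitchUnit D} {e : TEdge D} :
    e ∈ unitOld u ↔ e = arcEdge u.1 ∨ e = arcEdge u.2.1 := by
  simp [unitOld]

theorem mem_unitNew {a b : Node D} {u : SwitchUnit D} {e : TEdge D} :
    e ∈ unitNew a b u ↔ e = (s(a, u.1.1), u.2.2.1) ∨ e = (s(b, u.2.1.1), u.2.2.2.1) ∨
      e = (s(u.1.2.1, u.2.1.2.1), u.2.2.2.2) := by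
  simp [unitNew]

theorem unitOld_simple {G : TGraph D} {u : SwitchUnit D} (hu : u ∈ simpleUnits G) {e : TEdge D}
    (he : e ∈ unitOld u) : ¬ e.1.IsDiag ∧ G.count e = 1 := by
  obtain ⟨h1, h2⟩ := mem_simpleUnits.1 hu
  rcases mem_unitOld.1 he with rfl | rfl
  · exact ⟨(mem_simpleArcs.1 h1).1, (mem_simpleArcs.1 h1).2⟩
  · exact ⟨(mem_simpleArcs.1 h2).1, (mem_simpleArcs.1 h2).2⟩

/-- A unit that creates no loops. -/
structure NoNewLoop (a b : Node D) (u : SwitchUnit D) : Prop where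
  x₁ : u.1.1 ≠ a
  x₂ : u.2.1.1 ≠ b
  y : u.1.2.1 ≠ u.2.1.2.1

theorem NoNewLoop.not_isDiag {a b : Node D} {u : SwitchUnit D} (h : NoNewLoop a b u) {e : TEdge D}
    (he : e ∈ unitNew a b u) : ¬ e.1.IsDiag := by
  rcases mem_unitNew.1 he with rfl | rfl | rfl
  · exact fun h' => h.x₁ (Sym2.mk_isDiag_iff.1 h').symm
  · exact fun h' => h.x₂ (Sym2.mk_isDiag_iff.1 h').symm
  · exact fun h' => h.y (Sym2.mk_isDiag_iff.1 h')

/-! ### Switchings made of one unit -/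

section OneUnit

variable {G : TGraph D} {a b : Node D} {t : Stamp D} {u : SwitchUnit D}

theorem defect_rewire_unit (hu : u ∈ simpleUnits G)
    (h : CanRewire G ((s(a, b), t) ::ₘ unitOld u) (unitNew a b u)) (hl : NoNewLoop a b u)
    (hc : G.count (s(a, b), t) ≤ 2) (hc' : a = b → G.count (s(a, b), t) ≤ 1) (e : TEdge D) :
    defect (rewire G ((s(a, b), t) ::ₘ unitOld u) (unitNew a b u)) e =
      if e = (s(a, b), t) then 0 else defect G e := by
  have h1 : 1 ≤ ((s(a, b), t) ::ₘ unitOld u).count (s(a, b), t) :=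
    Multiset.one_le_count_iff_mem.2 (Multiset.mem_cons_self _ _)
  refine defect_rewire h (fun e he => hl.not_isDiag he) (fun e he hne => ?_)
    (Multiset.mem_of_le h.old_le (Multiset.mem_cons_self _ _)) (fun hd => ?_) ?_ e
  · exact unitOld_simple hu ((Multiset.mem_cons.1 he).resolve_left hne)
  · exact (hc' (Sym2.mk_isDiag_iff.1 hd)).trans h1
  · omega

theorem IsGeneric.noNewLoop {U : Finset (Node D)} (h : IsGeneric G U a b u) (ha : a ∈ U)
    (hb : b ∈ U) : NoNewLoop a b u :=
  ⟨fun h' => h.x₁ (h' ▸ ha), fun h' => h.x₂ (h' ▸ hb), h.y₁y₂⟩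

theorem IsGeneric.mem_simpleUnits {U : Finset (Node D)} (h : IsGeneric G U a b u) :
    u ∈ simpleUnits G :=
  TGen.mem_simpleUnits.2 ⟨h.simple₁, h.simple₂⟩

/-- An end outside `U` distinguishes the edges of a generic unit from the defect {a, b} and, if `U`
contains the nodes of another unit, from the edges of that unit. -/
theorem IsGeneric.exists_notMem_old {U : Finset (Node D)} (h : IsGeneric G U a b u) {e : TEdge D}
    (he : e ∈ unitOld u) : ∃ v ∈ e.1, v ∉ U := by
  rcases mem_unitOld.1 he with rfl | rfl
  · exact ⟨_, Sym2.mem_mk_left _ _, h.x₁⟩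
  · exact ⟨_, Sym2.mem_mk_left _ _, h.x₂⟩

theorem IsGeneric.exists_notMem_new {U : Finset (Node D)} (h : IsGeneric G U a b u) {e : TEdge D}
    (he : e ∈ unitNew a b u) : ∃ v ∈ e.1, v ∉ U := by
  rcases mem_unitNew.1 he with rfl | rfl | rfl
  · exact ⟨_, Sym2.mem_mk_right _ _, h.x₁⟩
  · exact ⟨_, Sym2.mem_mk_right _ _, h.x₂⟩
  · exact ⟨_, Sym2.mem_mk_left _ _, h.y₁⟩

theorem IsGeneric.nodup_old {U : Finset (Node D)} (h : IsGeneric G U a b u) :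
    (unitOld u).Nodup := by
  simp only [unitOld, Multiset.insert_eq_cons, Multiset.nodup_cons, Multiset.mem_singleton,
    Multiset.nodup_singleton, and_true]
  intro h'
  have := congrArg Prod.fst h'
  simp only [Sym2.eq_iff] at this
  rcases this with h' | h'
  · exact h.x₁x₂ h'.1
  · exact h.x₁y₂ h'.1

theorem IsGeneric.nodup_new {U : Finset (Node D)} (h : IsGeneric G U a b u) (ha : a ∈ U)
    (hb : b ∈ U) : (unitNew a b u).Nodup := by
  have hxb : u.1.1 ≠ b := fun h' => h.x₁ (h' ▸ hb)
  have hya : u.1.2.1 ≠ a := fun h' => h.y₁ (h' ▸ ha)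
  have hyb : u.1.2.1 ≠ b := fun h' => h.y₁ (h' ▸ hb)
  have hya' : u.2.1.2.1 ≠ a := fun h' => h.y₂ (h' ▸ ha)
  have hyb' : u.2.1.2.1 ≠ b := fun h' => h.y₂ (h' ▸ hb)
  simp only [unitNew, Multiset.insert_eq_cons, Multiset.nodup_cons, Multiset.mem_singleton,
    Multiset.nodup_singleton, and_true, Multiset.mem_cons, not_or]
  refine ⟨⟨fun h' => ?_, fun h' => ?_⟩, fun h' => ?_⟩
  all_goals
    have := congrArg Prod.fst h'
    simp only [Sym2.eq_iff] at this
  · rcases this with h' | h'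
    · exact h.x₁x₂ h'.2
    · exact hxb h'.2
  · rcases this with h' | h'
    · exact hya h'.1.symm
    · exact hya' h'.1.symm
  · rcases this with h' | h'
    · exact hyb h'.1.symm
    · exact hyb' h'.1.symm

theorem IsGeneric.new_notMem {U : Finset (Node D)} (h : IsGeneric G U a b u) {e : TEdge D}
    (he : e ∈ unitNew a b u) : e ∉ G := by
  rcases mem_unitNew.1 he with rfl | rfl | rfl
  · exact h.new₁
  · exact h.new₂
  · exact h.new₃

theorem IsGeneric.base_notMem_old {U : Finset (Node D)} (h : IsGeneric G U a b u) (ha : a ∈ U)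
    (hb : b ∈ U) : (s(a, b), t) ∉ unitOld u := by
  intro h'
  obtain ⟨v, hv, hvU⟩ := h.exists_notMem_old h'
  rcases Sym2.mem_iff.1 hv with rfl | rfl
  · exact hvU ha
  · exact hvU hb

theorem IsGeneric.canRewire {U : Finset (Node D)} (h : IsGeneric G U a b u) (ha : a ∈ U)
    (hb : b ∈ U) (he : (s(a, b), t) ∈ G) :
    CanRewire G ((s(a, b), t) ::ₘ unitOld u) (unitNew a b u) where
  old_le := by
    have := replicate_add_le (k := 1) h.nodup_old (h.base_notMem_old (t := t) ha hb)
      (fun e he => Multiset.one_le_count_iff_mem.1 (unitOld_simple h.mem_simpleUnits he).2.ge)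
      (Multiset.one_le_count_iff_mem.2 he)
    simpa using this
  new_nodup := h.nodup_new ha hb
  new_notMem e he := h.new_notMem he

/-- The pairs of the removed simple edges are not among the pairs of the added edges. -/
theorem IsGeneric.new_ne_old {U : Finset (Node D)} (h : IsGeneric G U a b u) (ha : a ∈ U)
    (hb : b ∈ U) {e e' : TEdge D} (he : e ∈ unitOld u) (he' : e' ∈ unitNew a b u) :
    e'.1 ≠ e.1 := by
  have hx₁a : u.1.1 ≠ a := fun h' => h.x₁ (h' ▸ ha)
  have hy₁a : u.1.2.1 ≠ a := fun h' => h.y₁ (h' ▸ ha)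
  have hx₂a : u.2.1.1 ≠ a := fun h' => h.x₂ (h' ▸ ha)
  have hy₂a : u.2.1.2.1 ≠ a := fun h' => h.y₂ (h' ▸ ha)
  have hx₁b : u.1.1 ≠ b := fun h' => h.x₁ (h' ▸ hb)
  have hy₁b : u.1.2.1 ≠ b := fun h' => h.y₁ (h' ▸ hb)
  have hx₂b : u.2.1.1 ≠ b := fun h' => h.x₂ (h' ▸ hb)
  have hy₂b : u.2.1.2.1 ≠ b := fun h' => h.y₂ (h' ▸ hb)
  have e1 := h.x₁x₂
  have e2 := h.x₁y₂
  have e3 := h.y₁x₂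
  have e4 := h.y₁y₂
  intro heq
  rcases mem_unitOld.1 he with rfl | rfl <;> rcases mem_unitNew.1 he' with rfl | rfl | rfl <;>
    simp only [Sym2.eq_iff] at heq <;> rcases heq with heq | heq <;> grind

end OneUnit

/-! ### Switchings made of two units -/

section TwoUnits

variable {G : TGraph D} {a b : Node D} {t : Stamp D} {u u' : SwitchUnit D}

/-- The nodes of a unit and the base nodes. -/
def unitNodes (a b : Node D) (u : SwitchUnit D) : Finset (Node D) :=
  {a, b, u.1.1, u.1.2.1, u.2.1.1, u.2.1.2.1}

theorem mem_unitNodes_of_old {e : TEdge D} (he : e ∈ unitOld u) {v : Node D} (hv : v ∈ e.1) :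
    v ∈ unitNodes a b u := by
  rcases mem_unitOld.1 he with rfl | rfl <;> rcases Sym2.mem_iff.1 hv with rfl | rfl <;>
    simp [unitNodes]

theorem mem_unitNodes_of_new {e : TEdge D} (he : e ∈ unitNew a b u) {v : Node D} (hv : v ∈ e.1) :
    v ∈ unitNodes a b u := by
  rcases mem_unitNew.1 he with rfl | rfl | rfl <;> rcases Sym2.mem_iff.1 hv with rfl | rfl <;>
    simp [unitNodes]

theorem left_mem_unitNodes : a ∈ unitNodes a b u := by simp [unitNodes]

theorem right_mem_unitNodes : b ∈ unitNodes a b u := by simp [unitNodes]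

theorem defect_rewire_units (hu : u ∈ simpleUnits G) (hu' : u' ∈ simpleUnits G)
    (h : CanRewire G ((s(a, b), t) ::ₘ (s(a, b), t) ::ₘ (unitOld u + unitOld u'))
      (unitNew a b u + unitNew a b u'))
    (hl : NoNewLoop a b u) (hl' : NoNewLoop a b u') (hc : G.count (s(a, b), t) ≤ 2) (e : TEdge D) :
    defect (rewire G ((s(a, b), t) ::ₘ (s(a, b), t) ::ₘ (unitOld u + unitOld u'))
      (unitNew a b u + unitNew a b u')) e = if e = (s(a, b), t) then 0 else defect G e := by
  have h1 : 2 ≤ ((s(a, b), t) ::ₘ (s(a, b), t) ::ₘ (unitOld u + unitOld u')).count (s(a, b), t) := by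
    rw [Multiset.count_cons_self, Multiset.count_cons_self]
    omega
  refine defect_rewire h (fun e he => ?_) (fun e he hne => ?_)
    (Multiset.mem_of_le h.old_le (Multiset.mem_cons_self _ _)) (fun hd => ?_) ?_ e
  · rcases Multiset.mem_add.1 he with he | he
    · exact hl.not_isDiag he
    · exact hl'.not_isDiag he
  · have he := (Multiset.mem_cons.1 ((Multiset.mem_cons.1 he).resolve_left hne)).resolve_left hne
    rcases Multiset.mem_add.1 he with he | he
    · exact unitOld_simple hu he
    · exact unitOld_simple hu' he
  · omega
  · omega

/-- The second unit avoids all nodes of the first, so no edge of one unit can agree with an edge of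
the other. -/
theorem IsGeneric.canRewire_two (h : IsGeneric G {a, b} a b u)
    (h' : IsGeneric G (unitNodes a b u) a b u') (he : G.count (s(a, b), t) = 2) :
    CanRewire G ((s(a, b), t) ::ₘ (s(a, b), t) ::ₘ (unitOld u + unitOld u'))
      (unitNew a b u + unitNew a b u') where
  old_le := by
    have h1 : (unitOld u + unitOld u').Nodup := by
      rw [Multiset.nodup_add]
      refine ⟨h.nodup_old, h'.nodup_old, Multiset.disjoint_left.2 fun {e} h1 h2 => ?_⟩
      obtain ⟨v, hv, hvU⟩ := h'.exists_notMem_old h2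
      exact hvU (mem_unitNodes_of_old h1 hv)
    have h2 : (s(a, b), t) ∉ unitOld u + unitOld u' := by
      rw [Multiset.mem_add]
      rintro (h2 | h2)
      · exact h.base_notMem_old (by simp) (by simp) h2
      · exact h'.base_notMem_old left_mem_unitNodes right_mem_unitNodes h2
    have := replicate_add_le (k := 2) h1 h2
      (fun e he => Multiset.one_le_count_iff_mem.1 (by
        rcases Multiset.mem_add.1 he with he | he
        · exact (unitOld_simple h.mem_simpleUnits he).2.ge
        · exact (unitOld_simple h'.mem_simpleUnits he).2.ge)) he.ge
    simpa [Multiset.replicate_succ] using this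
  new_nodup := by
    rw [Multiset.nodup_add]
    refine ⟨h.nodup_new (by simp) (by simp), h'.nodup_new left_mem_unitNodes right_mem_unitNodes,
      Multiset.disjoint_left.2 fun {e} h1 h2 => ?_⟩
    obtain ⟨v, hv, hvU⟩ := h'.exists_notMem_new h2
    exact hvU (mem_unitNodes_of_new h1 hv)
  new_notMem e he := by
    rcases Multiset.mem_add.1 he with he | he
    · exact h.new_notMem he
    · exact h'.new_notMem he

theorem IsGeneric.new_ne_old_two (h : IsGeneric G {a, b} a b u)
    (h' : IsGeneric G (unitNodes a b u) a b u') {e e' : TEdge D}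
    (he : e ∈ unitOld u + unitOld u') (he' : e' ∈ unitNew a b u + unitNew a b u') :
    e'.1 ≠ e.1 := by
  rcases Multiset.mem_add.1 he with he | he <;> rcases Multiset.mem_add.1 he' with he' | he'
  · exact h.new_ne_old (by simp) (by simp) he he'
  · intro heq
    obtain ⟨v, hv, hvU⟩ := h'.exists_notMem_new he'
    exact hvU (mem_unitNodes_of_old he (heq ▸ hv))
  · intro heq
    obtain ⟨v, hv, hvU⟩ := h'.exists_notMem_old he
    exact hvU (mem_unitNodes_of_new he' (heq.symm ▸ hv))
  · exact h'.new_ne_old left_mem_unitNodes right_mem_unitNodes he he'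

end TwoUnits

/-! ## The final rejections -/

/-- The number of choices at the base node is exactly k(k - 1), the bound used in the rejection, so
this factor causes no loss. -/
theorem bTL0_eq (G : TGraph D) (v : Node D) :
    bTL0 G v = simpleCount G v * (simpleCount G v - 1) := by
  classical
  unfold bTL0 simpleCount
  rw [Nat.mul_sub_one, ← Finset.offDiag_card]
  congr 1
  ext x
  simp [Finset.mem_offDiag]

theorem bTD1_0_eq (G : TGraph D) (v₁ v₂ : Node D) :
    bTD1_0 G v₁ v₂ = simpleCount G v₁ * simpleCount G v₂ := by
  classical
  unfold bTD1_0 simpleCount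
  rw [← Finset.card_product]
  congr 1
  ext x
  simp

theorem bTD1_1_le {G : TGraph D} (hG : Matches G) (U : Set (Node D)) : bTD1_1 G U ≤ degSum D := by
  classical
  refine le_trans (Finset.card_le_card fun x hx => ?_) (card_simpleArcs_le hG)
  exact mem_simpleArcs.2 (Finset.mem_filter.1 hx).2.1

theorem bTD0_1_le {G : TGraph D} (hG : Matches G) (U : Set (Node D)) :
    bTD0_1 G U ≤ degSum D ^ 2 := by
  classical
  refine le_trans (b := #(simpleArcs G ×ˢ simpleArcs G)) (Finset.card_le_card fun x hx => ?_) ?_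
  · obtain ⟨-, h1, h2, -⟩ := Finset.mem_filter.1 hx
    exact Finset.mem_product.2 ⟨mem_simpleArcs.2 h1.1, mem_simpleArcs.2 h2.1⟩
  · rw [Finset.card_product, pow_two]
    exact Nat.mul_le_mul (card_simpleArcs_le hG) (card_simpleArcs_le hG)

/-- Positivity is needed because a quotient by 0 counts as 0 and would make the rejection certain.
The edge that the switching has just created serves as a witness. -/
theorem bTD1_1_pos {G : TGraph D} {U : Set (Node D)} {i j : Node D} {t : Stamp D}
    (h : IsSimpleEdge G i j t) (hi : i ∉ U) (hj : j ∉ U) : 0 < bTD1_1 G U := by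
  classical exact
  Finset.card_pos.2 ⟨(i, j, t), Finset.mem_filter.2 ⟨Finset.mem_univ _, h, hi, hj⟩⟩

theorem bTD0_1_pos {G : TGraph D} {U : Set (Node D)} {i j i' j' : Node D} {t t' : Stamp D}
    (h : IsSimpleEdge G i j t) (hi : i ∉ U) (hj : j ∉ U)
    (h' : IsSimpleEdge G i' j' t') (hi' : i' ∉ U) (hj' : j' ∉ U)
    (hne : ((s(i, j), t) : TEdge D) ≠ (s(i', j'), t')) : 0 < bTD0_1 G U := by
  classical exact
  Finset.card_pos.2 ⟨((i, j, t), (i', j', t')),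
    Finset.mem_filter.2 ⟨Finset.mem_univ _, ⟨h, hi, hj⟩, ⟨h', hi', hj'⟩, hne⟩⟩

theorem one_le_simpleCount {G : TGraph D} {v x : Node D} {t : Stamp D} (h : IsSimpleEdge G v x t) :
    1 ≤ simpleCount G v := by
  classical exact
  Finset.card_pos.2 ⟨(x, t), Finset.mem_filter.2 ⟨Finset.mem_univ _, h⟩⟩

theorem two_le_simpleCount {G : TGraph D} {v x x' : Node D} {t t' : Stamp D}
    (h : IsSimpleEdge G v x t) (h' : IsSimpleEdge G v x' t') (hx : x ≠ x') :
    2 ≤ simpleCount G v := by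
  classical
  have : ({(x, t), (x', t')} : Finset (Node D × Stamp D)) ⊆
      Finset.univ.filter fun y : Node D × Stamp D => IsSimpleEdge G v y.1 y.2 := by
    intro y hy
    rw [Finset.mem_insert, Finset.mem_singleton] at hy
    rcases hy with rfl | rfl
    · simpa using h
    · simpa using h'
  refine le_trans (le_of_eq ?_) (Finset.card_le_card this)
  rw [Finset.card_pair]
  simp [hx]

/-- After the exact cancellation of the factor that comes from the base nodes, the acceptance
probability is `low / b`, and b is at most M, respectively M² for TD₀. -/
theorem le_ratio {δ k low b M : ℝ} (hk : 0 < k) (hb : 0 < b) (hbM : b ≤ M) (hδ : δ * M ≤ low)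
    (hδ0 : 0 ≤ δ) : δ ≤ k * low / (k * b) := by
  rw [mul_div_mul_left _ _ hk.ne', le_div_iff₀ hb]
  exact (mul_le_mul_of_nonneg_left hbM hδ0).trans hδ

theorem freeStamps_pos {G : TGraph D} {i j : Node D} {mu : ℕ} (h : mult G i j < mu)
    (hT : mu ≤ D.T) : 0 < freeStamps G i j := by
  have := le_freeStamps_add_mult G i j
  omega

end TGen

end

noncomputable section

namespace TGen

variable {D : Input}

/-! ## One iteration of a stage -/

/-- The relations between the parameters of the potential: `c = Δ / M`, the probability `η'` of a
nontrivial auxiliary switching, the probability `η` of a failure for another reason than the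
b-rejection for timestamps, and the amount `κ` set aside for each unit. -/
structure StageParams (D : Input) (mu : ℕ) (c κ η η' K : ℝ) : Prop where
  degSum_pos : 0 < degSum D
  c_eq : c = (maxDeg D : ℝ) / degSum D
  maxDeg_le : maxDeg D ≤ D.T
  aux_nonneg : 0 ≤ η'
  aux_le : η' + 106 * c ≤ η
  κ_ge : (2 * K + 20) * c + η ≤ κ
  K_nonneg : 0 ≤ K
  aux₁ : ENNReal.ofReal (1 - η') ≤ auxTypeDist D 2 mu (2 * BL D + 4 * BD D) none
  aux₂ : ENNReal.ofReal (1 - η') ≤ auxTypeDist D 2 mu (4 * BD D) none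
  aux₃ : ENNReal.ofReal (1 - η') ≤ auxTypeDist D 4 mu (4 * BD D) none
  c_le : 10 * c ≤ 1
  aux_le_one : η' ≤ 1
  slack_le : 2 * BL D + 4 * BD D ≤ 6 * maxDeg D

namespace StageParams

variable {mu : ℕ} {c κ η η' K : ℝ}

theorem M_pos (h : StageParams D mu c κ η η' K) : (0 : ℝ) < degSum D := by
  exact_mod_cast h.degSum_pos

theorem c_nonneg (h : StageParams D mu c κ η η' K) : 0 ≤ c := by
  rw [h.c_eq]
  positivity

theorem maxDeg_eq (h : StageParams D mu c κ η η' K) : (maxDeg D : ℝ) = c * degSum D := by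
  have := h.M_pos
  rw [h.c_eq]
  field_simp

theorem η_nonneg (h : StageParams D mu c κ η η' K) : 0 ≤ η := by
  have := h.aux_le
  have := h.aux_nonneg
  have := h.c_nonneg
  linarith

theorem κ_nonneg (h : StageParams D mu c κ η η' K) : 0 ≤ κ := by
  have := h.κ_ge
  have := h.η_nonneg
  have : 0 ≤ (2 * K + 20) * c := mul_nonneg (by linarith [h.K_nonneg]) h.c_nonneg
  linarith

end StageParams

/-- The lower bound for the acceptance probability in the b-rejection for the timestamps of a unit. -/
def stampBound (D : Input) (mu : ℕ) : ℝ := (((D.T : ℝ) - ((mu : ℝ) - 1)) / D.T) ^ 2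

theorem T_pos' (D : Input) : (0 : ℝ) < D.T := by exact_mod_cast D.T_pos

theorem stampBound_nonneg (mu : ℕ) : 0 ≤ stampBound D mu := sq_nonneg _

theorem stampBound_le_one {mu : ℕ} (hmu : 1 ≤ mu) (hT : mu ≤ D.T) : stampBound D mu ≤ 1 := by
  have h1 : (mu : ℝ) ≤ D.T := by exact_mod_cast hT
  have h2 : (1 : ℝ) ≤ mu := by exact_mod_cast hmu
  have h3 := T_pos' D
  refine pow_le_one₀ (div_nonneg (by linarith) h3.le) ?_
  rw [div_le_one h3]
  linarith

theorem stampBound_le {mu : ℕ} {G : TGraph D} {i j i' j' : Node D} (h : mult G i j < mu)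
    (h' : mult G i' j' < mu) (hT : mu ≤ D.T) :
    stampBound D mu ≤ ((D.T : ℝ) - ((mu : ℝ) - 1)) ^ 2 / (freeStamps G i j * freeStamps G i' j') := by
  have h1 : (0 : ℝ) < freeStamps G i j := by exact_mod_cast freeStamps_pos h hT
  have h2 : (0 : ℝ) < freeStamps G i' j' := by exact_mod_cast freeStamps_pos h' hT
  have h3 : (freeStamps G i j : ℝ) ≤ D.T := by exact_mod_cast card_freeStamps_le G i j
  have h4 : (freeStamps G i' j' : ℝ) ≤ D.T := by exact_mod_cast card_freeStamps_le G i' j'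
  unfold stampBound
  rw [div_pow]
  refine div_le_div_of_nonneg_left (sq_nonneg _) (by positivity) ?_
  rw [pow_two]
  gcongr

theorem ofReal_stopped_le {V P : ℝ} :
    ENNReal.ofReal (V * (1 - min P 1)) ≤ ENNReal.ofReal (V * (1 - P)) := by
  rcases le_total P 1 with h | h
  · rw [min_eq_left h]
  · rw [min_eq_right h, sub_self, mul_zero, ENNReal.ofReal_zero]
    exact zero_le

/-- The initial graph has few defects. -/
def FewDefects (G₀ : TGraph D) : Prop := 2 * sumLoops G₀ + 2 * sumMulti G₀ ≤ 6 * maxDeg D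

section Generic

variable {mu : ℕ} {c κ η η' K : ℝ} {G₀ G : TGraph D} {R R' : Set (TEdge D)}

/-- Defects take at most 6Δ = 6cM of the M arcs, which gives (1 - 6c)² ≥ 1 - 12c. The union bound
with at most six excluded nodes costs (4·6 + 7)c = 31c, and 43 = 12 + 31. -/
theorem le_card_genericUnits' (h : StageParams D mu c κ η η' K) (hG₀ : FewDefects G₀)
    (hinv : StageInv G₀ G R) {U : Finset (Node D)} (hU : #U ≤ 6) (a b : Node D) :
    (1 - 43 * c) * ((degSum D : ℝ) ^ 2 * (D.T : ℝ) ^ 3) ≤ #(genericUnits G U a b) := by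
  refine le_trans ?_ (le_card_genericUnits hinv.degrees U a b h.maxDeg_le)
  rw [← mul_assoc]
  refine mul_le_mul_of_nonneg_right ?_ (by positivity)
  have h1 : (degSum D : ℝ) ≤ #(simpleArcs G) + 6 * maxDeg D := by
    have := hinv.card_simpleArcs
    unfold FewDefects at hG₀
    exact_mod_cast (by omega : degSum D ≤ #(simpleArcs G) + 6 * maxDeg D)
  have h2 : (#U : ℝ) ≤ 6 := by exact_mod_cast hU
  have hM := h.M_pos
  have hc := h.c_nonneg
  have hc1 := h.c_le
  rw [h.maxDeg_eq] at h1 ⊢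
  set M : ℝ := (degSum D : ℝ) with hMdef
  have h3 : (1 - 6 * c) * M ≤ #(simpleArcs G) := by linarith
  have h4 : ((1 - 6 * c) * M) ^ 2 ≤ (#(simpleArcs G) : ℝ) ^ 2 :=
    pow_le_pow_left₀ (mul_nonneg (by linarith) hM.le) h3 2
  have h5 : M * ((4 * #U + 7) * (c * M)) ≤ M * ((4 * 6 + 7) * (c * M)) := by gcongr
  have h6 : 0 ≤ (c * M) ^ 2 := sq_nonneg _
  nlinarith

/-- The unit can be performed as a switching that removes a copy of the defect `{a, b}`. -/
structure UnitValid (G : TGraph D) (a b : Node D) (t : Stamp D) (u : SwitchUnit D) : Prop where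
  simple : u ∈ simpleUnits G
  rewire : CanRewire G ((s(a, b), t) ::ₘ unitOld u) (unitNew a b u)
  noLoop : NoNewLoop a b u
  count_le : G.count (s(a, b), t) ≤ 2
  count_le_one : a = b → G.count (s(a, b), t) ≤ 1

/-- Two units can be performed as a switching that removes both copies of the defect `{a, b}`. -/
structure UnitsValid (G : TGraph D) (a b : Node D) (t : Stamp D) (u u' : SwitchUnit D) : Prop where
  simple : u ∈ simpleUnits G
  simple' : u' ∈ simpleUnits G
  rewire : CanRewire G ((s(a, b), t) ::ₘ (s(a, b), t) ::ₘ (unitOld u + unitOld u'))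
    (unitNew a b u + unitNew a b u')
  noLoop : NoNewLoop a b u
  noLoop' : NoNewLoop a b u'
  count_le : G.count (s(a, b), t) ≤ 2

/-- The result of a switching with one unit. -/
abbrev unitNext (G : TGraph D) (a b : Node D) (t : Stamp D) (u : SwitchUnit D) : TGraph D :=
  rewire G ((s(a, b), t) ::ₘ unitOld u) (unitNew a b u)

/-- The result of a switching with two units. -/
abbrev unitsNext (G : TGraph D) (a b : Node D) (t : Stamp D) (u u' : SwitchUnit D) : TGraph D :=
  rewire G ((s(a, b), t) ::ₘ (s(a, b), t) ::ₘ (unitOld u + unitOld u'))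
    (unitNew a b u + unitNew a b u')

variable {a b : Node D} {t : Stamp D} {u u' : SwitchUnit D}

theorem UnitValid.degree_eq (hu : UnitValid G a b t u) (i : Node D) :
    degree (unitNext G a b t u) i = degree G i :=
  degree_rewire hu.rewire.old_le (fun i => degree_unit a b t u i) i

theorem UnitsValid.degree_eq (hu : UnitsValid G a b t u u') (i : Node D) :
    degree (unitsNext G a b t u u') i = degree G i := by
  refine degree_rewire hu.rewire.old_le (fun i => ?_) i
  have h1 := degree_unit a b t u i
  have h2 := degree_unit a b t u' i
  rw [degree_cons] at h1 h2
  rw [degree_cons, degree_cons, degree_add, degree_add]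
  omega

theorem UnitValid.stageInv (hinv : StageInv G₀ G R) (hu : UnitValid G a b t u) (hR : R' ⊆ R)
    (he : (s(a, b), t) ∉ R') (hm : ∀ p, pairMult (unitNext G a b t u) p ≤ pairMult G₀ p + 1) :
    StageInv G₀ (unitNext G a b t u) R' :=
  hinv.step hR he hu.degree_eq
    (defect_rewire_unit hu.simple hu.rewire hu.noLoop hu.count_le hu.count_le_one) hm

theorem UnitsValid.stageInv (hinv : StageInv G₀ G R) (hu : UnitsValid G a b t u u') (hR : R' ⊆ R)
    (he : (s(a, b), t) ∉ R')
    (hm : ∀ p, pairMult (unitsNext G a b t u u') p ≤ pairMult G₀ p + 1) :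
    StageInv G₀ (unitsNext G a b t u u') R' :=
  hinv.step hR he hu.degree_eq
    (defect_rewire_units hu.simple hu.simple' hu.rewire hu.noLoop hu.noLoop' hu.count_le) hm

theorem UnitValid.pairMult_le (hu : UnitValid G a b t u) (p : Sym2 (Node D)) :
    pairMult (unitNext G a b t u) p ≤ addUnit (pairMult G) a b u.1 u.2.1 p := by
  rw [← pairMult_add_unitNew]
  exact pairMult_rewire_le hu.rewire.old_le p

theorem UnitsValid.pairMult_le (hu : UnitsValid G a b t u u') (p : Sym2 (Node D)) :
    pairMult (unitsNext G a b t u u') p ≤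
      addUnit (addUnit (pairMult G) a b u.1 u.2.1) a b u'.1 u'.2.1 p := by
  rw [← pairMult_add_unitNew, ← pairMult_add_unitNew, add_assoc, ← pairMult_add]
  exact pairMult_rewire_le hu.rewire.old_le p

variable {α : Type} {F : Finset α} {rest : Multiset (Sym2 (Node D))}

/-- The valid switchings embed into the set of all pairs of arcs with stamps, deletions only lower
the stopped potential, and the remaining terms of the full sum are nonnegative. So the average over
all pairs of arcs dominates. -/
theorem sum_oneUnit_le (h : StageParams D mu c κ η η' K) (hinv : StageInv G₀ G R)
    (hocc : ∀ v, (occ rest v : ℝ) ≤ K) (hrest : rest.card * c ≤ 1) (φ : α ≃ SwitchUnit D)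
    (hF : ∀ S ∈ F, UnitValid G a b t (φ S)) :
    ∑ S ∈ F, stoppedPotential c κ (pairMult G₀) rest (pairMult (unitNext G a b t (φ S))) ≤
      (degSum D : ℝ) ^ 2 * (D.T : ℝ) ^ 3 *
        (potential c κ (pairMult G₀) (s(a, b) ::ₘ rest) (pairMult G) - η) := by
  refine le_trans ?_ (sum_unit_le hinv.degrees h.degSum_pos h.c_eq h.η_nonneg h.κ_ge hocc hrest
    hinv.pairMult_le)
  calc _ ≤ ∑ S ∈ F, stoppedPotential c κ (pairMult G₀) rest
        (addUnit (pairMult G) a b (φ S).1 (φ S).2.1) :=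
        Finset.sum_le_sum fun S hS => stoppedPotential_mono h.c_nonneg (hF S hS).pairMult_le rest
    _ = ∑ u ∈ F.map φ.toEmbedding, stoppedPotential c κ (pairMult G₀) rest
        (addUnit (pairMult G) a b u.1 u.2.1) := by
        rw [Finset.sum_map]
        rfl
    _ ≤ _ := by
        refine Finset.sum_le_sum_of_subset_of_nonneg (fun u hu => ?_)
          fun _ _ _ => stoppedPotential_nonneg h.c_nonneg h.κ_nonneg rest
        obtain ⟨S, hS, rfl⟩ := Finset.mem_map.1 hu
        exact (hF S hS).simple

theorem sum_twoUnits_le (h : StageParams D mu c κ η η' K) (hinv : StageInv G₀ G R)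
    (hocc : ∀ v, (occ (s(a, b) ::ₘ rest) v : ℝ) ≤ K) (hrest : (s(a, b) ::ₘ rest).card * c ≤ 1)
    (φ : α ≃ SwitchUnit D × SwitchUnit D)
    (hF : ∀ S ∈ F, UnitsValid G a b t (φ S).1 (φ S).2) :
    ∑ S ∈ F, stoppedPotential c κ (pairMult G₀) rest
        (pairMult (unitsNext G a b t (φ S).1 (φ S).2)) ≤
      (degSum D : ℝ) ^ 4 * (D.T : ℝ) ^ 6 *
        (potential c κ (pairMult G₀) (s(a, b) ::ₘ s(a, b) ::ₘ rest) (pairMult G) - η) := by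
  refine le_trans ?_ (sum_two_units_le hinv.degrees h.degSum_pos h.c_eq h.η_nonneg h.κ_ge hocc hrest
    hinv.pairMult_le)
  rw [← Finset.sum_product']
  calc _ ≤ ∑ S ∈ F, stoppedPotential c κ (pairMult G₀) rest
        (addUnit (addUnit (pairMult G) a b (φ S).1.1 (φ S).1.2.1) a b (φ S).2.1 (φ S).2.2.1) :=
        Finset.sum_le_sum fun S hS => stoppedPotential_mono h.c_nonneg (hF S hS).pairMult_le rest
    _ = ∑ x ∈ F.map φ.toEmbedding, stoppedPotential c κ (pairMult G₀) rest
        (addUnit (addUnit (pairMult G) a b x.1.1 x.1.2.1) a b x.2.1 x.2.2.1) := by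
        rw [Finset.sum_map]
        rfl
    _ ≤ _ := by
        refine Finset.sum_le_sum_of_subset_of_nonneg (fun u hu => ?_)
          fun _ _ _ => stoppedPotential_nonneg h.c_nonneg h.κ_nonneg rest
        obtain ⟨S, hS, rfl⟩ := Finset.mem_map.1 hu
        exact Finset.mem_product.2 ⟨(hF S hS).simple, (hF S hS).simple'⟩

theorem card_oneUnit_le (hG : Matches G) (φ : α ≃ SwitchUnit D)
    (hF : ∀ S ∈ F, UnitValid G a b t (φ S)) :
    (#F : ℝ) ≤ (degSum D : ℝ) ^ 2 * (D.T : ℝ) ^ 3 := by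
  refine le_trans ?_ (card_simpleUnits_le hG)
  rw [← Finset.card_map φ.toEmbedding]
  exact_mod_cast Finset.card_le_card fun u hu => by
    obtain ⟨S, hS, rfl⟩ := Finset.mem_map.1 hu
    exact (hF S hS).simple

theorem card_twoUnits_le (hG : Matches G) (φ : α ≃ SwitchUnit D × SwitchUnit D)
    (hF : ∀ S ∈ F, UnitsValid G a b t (φ S).1 (φ S).2) :
    (#F : ℝ) ≤ (degSum D : ℝ) ^ 4 * (D.T : ℝ) ^ 6 := by
  have h1 : #F ≤ #(simpleUnits G) * #(simpleUnits G) := by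
    rw [← Finset.card_map φ.toEmbedding, ← Finset.card_product]
    exact Finset.card_le_card fun u hu => by
      obtain ⟨S, hS, rfl⟩ := Finset.mem_map.1 hu
      exact Finset.mem_product.2 ⟨(hF S hS).simple, (hF S hS).simple'⟩
  have h2 := card_simpleUnits_le hG
  calc (#F : ℝ) ≤ #(simpleUnits G) * #(simpleUnits G) := by exact_mod_cast h1
    _ ≤ ((degSum D : ℝ) ^ 2 * (D.T : ℝ) ^ 3) * ((degSum D : ℝ) ^ 2 * (D.T : ℝ) ^ 3) := by gcongr
    _ = _ := by ring

end Generic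

end TGen

end

noncomputable section

namespace TGen

variable {D : Input}

/-! ### One switching in terms of the stopped potential -/

section Generic

variable {mu : ℕ} {c κ η η' K : ℝ} {G₀ G : TGraph D} {R R' : Set (TEdge D)}
  {a b : Node D} {t : Stamp D} {α : Type} {F : Finset α} {rest : Multiset (Sym2 (Node D))}
  {Rj : α → Prop} {p₁ : α → ℝ} {aux : α → Prog D (TGraph D)} {p₂ : α → TGraph D → ℝ}
  {Q : TGraph D → ℝ≥0∞}

theorem stoppedPotential_eq (hinv : StageInv G₀ G R) (rest : Multiset (Sym2 (Node D))) :
    stoppedPotential c κ (pairMult G₀) rest (pairMult G) =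
      min (potential c κ (pairMult G₀) rest (pairMult G)) 1 := if_pos hinv.pairMult_le

/-- If no pair has been hit twice, the next graph avoids `B` and satisfies the invariant, so the
bound for `Q` applies; otherwise the stopped potential equals 1 and no information is required. -/
theorem wp_oneUnit_le {B : Set (TGraph D)}
    (hB : ∀ G', (∀ p, pairMult G' p ≤ pairMult G₀ p + 1) → G' ∉ B)
    (h : StageParams D mu c κ η η' K) (hinv : StageInv G₀ G R)
    (hocc : ∀ v, (occ rest v : ℝ) ≤ K) (hrest : rest.card * c ≤ 1) (hR : R' ⊆ R)
    (he : (s(a, b), t) ∉ R') (φ : α ≃ SwitchUnit D) (hF : ∀ S ∈ F, UnitValid G a b t (φ S))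
    (haux : ∀ S, ∀ Q' : TGraph D → ℝ≥0∞, (∀ G, Q' G ≤ 1) →
      wp B (aux S) Q' ≤ Q' (unitNext G a b t (φ S)) + ENNReal.ofReal η')
    (hQ1 : ∀ G, Q G ≤ 1) (hQ : ∀ G', StageInv G₀ G' R' →
      Q G' ≤ ENNReal.ofReal (stoppedPotential c κ (pairMult G₀) rest (pairMult G'))) :
    wp B (switchStep F ((degSum D : ℝ) ^ 2 * (D.T : ℝ) ^ 3)
      (fun S => unitNext G a b t (φ S)) Rj p₁ aux p₂) Q ≤
      ENNReal.ofReal (stoppedPotential c κ (pairMult G₀) (s(a, b) ::ₘ rest) (pairMult G)) := by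
  rw [stoppedPotential_eq hinv]
  have hM := h.M_pos
  have hT := T_pos' D
  refine wp_switchStep_le_of_sum_le (by positivity) (card_oneUnit_le hinv.degrees φ hF)
    h.aux_nonneg (fun S _ => haux S) hQ1
    (v := fun S => stoppedPotential c κ (pairMult G₀) rest (pairMult (unitNext G a b t (φ S))))
    (fun S _ => stoppedPotential_nonneg h.c_nonneg h.κ_nonneg rest)
    ((sum_oneUnit_le h hinv hocc hrest φ hF).trans ?_) fun S hS => ?_
  · have := h.aux_le
    have := h.c_nonneg
    refine mul_le_mul_of_nonneg_left ?_ (by positivity)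
    linarith
  · by_cases hm : ∀ p, pairMult (unitNext G a b t (φ S)) p ≤ pairMult G₀ p + 1
    · exact .inr ⟨hB _ hm, hQ _ ((hF S hS).stageInv hinv hR he hm)⟩
    · exact .inl (if_neg hm)

theorem wp_twoUnits_le {B : Set (TGraph D)}
    (hB : ∀ G', (∀ p, pairMult G' p ≤ pairMult G₀ p + 1) → G' ∉ B)
    (h : StageParams D mu c κ η η' K) (hinv : StageInv G₀ G R)
    (hocc : ∀ v, (occ (s(a, b) ::ₘ rest) v : ℝ) ≤ K) (hrest : (s(a, b) ::ₘ rest).card * c ≤ 1)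
    (hR : R' ⊆ R) (he : (s(a, b), t) ∉ R') (φ : α ≃ SwitchUnit D × SwitchUnit D)
    (hF : ∀ S ∈ F, UnitsValid G a b t (φ S).1 (φ S).2)
    (haux : ∀ S, ∀ Q' : TGraph D → ℝ≥0∞, (∀ G, Q' G ≤ 1) →
      wp B (aux S) Q' ≤ Q' (unitsNext G a b t (φ S).1 (φ S).2) + ENNReal.ofReal η')
    (hQ1 : ∀ G, Q G ≤ 1) (hQ : ∀ G', StageInv G₀ G' R' →
      Q G' ≤ ENNReal.ofReal (stoppedPotential c κ (pairMult G₀) rest (pairMult G'))) :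
    wp B (switchStep F ((degSum D : ℝ) ^ 4 * (D.T : ℝ) ^ 6)
      (fun S => unitsNext G a b t (φ S).1 (φ S).2) Rj p₁ aux p₂) Q ≤
      ENNReal.ofReal (stoppedPotential c κ (pairMult G₀) (s(a, b) ::ₘ s(a, b) ::ₘ rest)
        (pairMult G)) := by
  rw [stoppedPotential_eq hinv]
  have hM := h.M_pos
  have hT := T_pos' D
  refine wp_switchStep_le_of_sum_le (by positivity) (card_twoUnits_le hinv.degrees φ hF)
    h.aux_nonneg (fun S _ => haux S) hQ1
    (v := fun S => stoppedPotential c κ (pairMult G₀) rest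
      (pairMult (unitsNext G a b t (φ S).1 (φ S).2)))
    (fun S _ => stoppedPotential_nonneg h.c_nonneg h.κ_nonneg rest)
    ((sum_twoUnits_le h hinv hocc hrest φ hF).trans ?_) fun S hS => ?_
  · have := h.aux_le
    have := h.c_nonneg
    refine mul_le_mul_of_nonneg_left ?_ (by positivity)
    linarith
  · by_cases hm : ∀ p, pairMult (unitsNext G a b t (φ S).1 (φ S).2) p ≤ pairMult G₀ p + 1
    · exact .inr ⟨hB _ hm, hQ _ ((hF S hS).stageInv hinv hR he hm)⟩
    · exact .inl (if_neg hm)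

theorem sq_one_sub_le (h : StageParams D mu c κ η η' K) :
    1 - (η' + 20 * c) ≤ (1 - η') * (1 - 10 * c) ^ 2 := by
  have h1 := h.c_nonneg
  have h2 := h.c_le
  have h3 := h.aux_nonneg
  have h4 := h.aux_le_one
  have h5 : (1 - 10 * c) ^ 2 ≤ 1 := pow_le_one₀ (by linarith) (by linarith)
  nlinarith [sq_nonneg c]

/-- The good switchings are the generic ones. They miss at most 43c of the mass, and the auxiliary
step together with the final rejection loses at most η' + 20c, which stays within the allowance η' +
106c ≤ η. -/
theorem le_wp_oneUnit (h : StageParams D mu c κ η η' K) (hG₀ : FewDefects G₀)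
    (hmu : 1 ≤ mu) (hmuT : mu ≤ D.T) (hinv : StageInv G₀ G R)
    (hocc : ∀ v, (occ rest v : ℝ) ≤ K) (hrest : rest.card * c ≤ 1) (hR : R' ⊆ R)
    (he : (s(a, b), t) ∉ R') (φ : α ≃ SwitchUnit D) (hF : ∀ S ∈ F, UnitValid G a b t (φ S))
    (hgen : ∀ S, IsGeneric G {a, b} a b (φ S) → S ∈ F)
    (hRj : ∀ S, IsGeneric G {a, b} a b (φ S) → ¬ Rj S)
    (hp₁ : ∀ S, IsGeneric G {a, b} a b (φ S) → stampBound D mu ≤ p₁ S)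
    (hp₂ : ∀ S, IsGeneric G {a, b} a b (φ S) →
      (1 - 10 * c) ^ 2 ≤ p₂ S (unitNext G a b t (φ S)))
    (haux : ∀ S, ∀ Q' : TGraph D → ℝ≥0∞,
      ENNReal.ofReal (1 - η') * Q' (unitNext G a b t (φ S)) ≤ wp ∅ (aux S) Q')
    {V : ℝ} (hV : 0 ≤ V) (hQ : ∀ G', StageInv G₀ G' R' →
      ENNReal.ofReal (V * (1 - stoppedPotential c κ (pairMult G₀) rest (pairMult G'))) ≤ Q G') :
    ENNReal.ofReal (stampBound D mu * V *
      (1 - stoppedPotential c κ (pairMult G₀) (s(a, b) ::ₘ rest) (pairMult G))) ≤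
    wp ∅ (switchStep F ((degSum D : ℝ) ^ 2 * (D.T : ℝ) ^ 3)
      (fun S => unitNext G a b t (φ S)) Rj p₁ aux p₂) Q := by
  rw [stoppedPotential_eq hinv]
  refine ofReal_stopped_le.trans ?_
  have hM := h.M_pos
  have hT := T_pos' D
  have hc := h.c_nonneg
  have hc1 := h.c_le
  have hgood : ∀ S ∈ (genericUnits G {a, b} a b).map φ.symm.toEmbedding,
      IsGeneric G {a, b} a b (φ S) := by
    intro S hS
    obtain ⟨u, hu, rfl⟩ := Finset.mem_map.1 hS
    simpa using mem_genericUnits.1 hu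
  refine le_wp_switchStep_of_sum_le (by positivity) (card_oneUnit_le hinv.degrees φ hF)
    (Good := (genericUnits G {a, b} a b).map φ.symm.toEmbedding)
    (fun S hS => hgen S (hgood S hS)) (stampBound_nonneg mu) (stampBound_le_one hmu hmuT)
    (sq_nonneg _) (pow_le_one₀ (by linarith) (by linarith)) (by linarith [h.aux_le_one]) hV
    (fun S _ => haux S) (fun S hS => hRj S (hgood S hS)) (fun S hS => hp₁ S (hgood S hS))
    (fun S hS => hp₂ S (hgood S hS))
    (v := fun S => stoppedPotential c κ (pairMult G₀) rest (pairMult (unitNext G a b t (φ S))))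
    (fun S _ => stoppedPotential_nonneg h.c_nonneg h.κ_nonneg rest)
    (fun S _ => stoppedPotential_le_one rest) (γ := 43 * c) ?_ (sq_one_sub_le h) ?_
    (sum_oneUnit_le h hinv hocc hrest φ hF) ?_ fun S hS => ?_
  · rw [Finset.card_map]
    exact le_card_genericUnits' h hG₀ hinv (Finset.card_le_two.trans (by norm_num)) a b
  · have := h.aux_le
    linarith
  · have := h.aux_nonneg
    linarith
  · by_cases hm : ∀ p, pairMult (unitNext G a b t (φ S)) p ≤ pairMult G₀ p + 1
    · exact hQ _ ((hF S (hgen S (hgood S hS))).stageInv hinv hR he hm)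
    · simp only [stoppedPotential]
      rw [if_neg hm, sub_self, mul_zero, ENNReal.ofReal_zero]
      exact zero_le

/-- The pairs of units with all nodes distinct. -/
def genericPairs (G : TGraph D) (a b : Node D) : Finset (SwitchUnit D × SwitchUnit D) :=
  (genericUnits G {a, b} a b).biUnion fun u =>
    (genericUnits G (unitNodes a b u) a b).map ⟨fun u' => (u, u'), fun _ _ h => (Prod.mk.inj h).2⟩

theorem mem_genericPairs {x : SwitchUnit D × SwitchUnit D} :
    x ∈ genericPairs G a b ↔ IsGeneric G {a, b} a b x.1 ∧
      IsGeneric G (unitNodes a b x.1) a b x.2 := by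
  rcases x with ⟨u, u'⟩
  simp only [genericPairs, Finset.mem_biUnion, mem_genericUnits, Finset.mem_map]
  constructor
  · rintro ⟨v, hv, v', hv', heq⟩
    cases heq
    exact ⟨hv, hv'⟩
  · rintro ⟨h1, h2⟩
    exact ⟨u, h1, u', h2, rfl⟩

/-- For each generic first unit the second one has to avoid its at most six nodes, and (1 - 43c)² ≥
1 - 86c. Together with the 20c of the other rejections this explains the constant 106 in
`StageParams`. -/
theorem le_card_genericPairs (h : StageParams D mu c κ η η' K) (hG₀ : FewDefects G₀)
    (hinv : StageInv G₀ G R) (a b : Node D) :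
    (1 - 86 * c) * ((degSum D : ℝ) ^ 4 * (D.T : ℝ) ^ 6) ≤ #(genericPairs G a b) := by
  have hM := h.M_pos
  have hT := T_pos' D
  have hc := h.c_nonneg
  set Z : ℝ := (degSum D : ℝ) ^ 2 * (D.T : ℝ) ^ 3 with hZ
  have hZ0 : 0 < Z := by positivity
  have e : (degSum D : ℝ) ^ 4 * (D.T : ℝ) ^ 6 = Z * Z := by rw [hZ]; ring
  rw [e]
  -- For 86c > 1 the bound is negative and trivial; otherwise 1 - 43c is nonnegative, as needed to
  -- multiply the two estimates.
  rcases lt_or_ge 1 (86 * c) with hc1 | hc1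
  · refine le_trans ?_ (Nat.cast_nonneg _)
    exact mul_nonpos_of_nonpos_of_nonneg (by linarith) (by positivity)
  have hcard : #(genericPairs G a b) =
      ∑ u ∈ genericUnits G {a, b} a b, #(genericUnits G (unitNodes a b u) a b) := by
    rw [genericPairs, Finset.card_biUnion]
    · simp
    · intro u _ v _ huv
      rw [Function.onFun, Finset.disjoint_left]
      intro x hx hx'
      obtain ⟨y, -, rfl⟩ := Finset.mem_map.1 hx
      obtain ⟨z, -, hz⟩ := Finset.mem_map.1 hx'
      exact huv (Prod.mk.inj hz).1.symm
  rw [hcard]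
  push_cast
  have h1 : ∀ u ∈ genericUnits G {a, b} a b,
      (1 - 43 * c) * Z ≤ (#(genericUnits G (unitNodes a b u) a b) : ℝ) := fun u _ =>
    le_card_genericUnits' h hG₀ hinv Finset.card_le_six a b
  have h2 := le_card_genericUnits' h hG₀ hinv
    (U := {a, b}) (Finset.card_le_two.trans (by norm_num)) a b
  refine le_trans ?_ (Finset.sum_le_sum h1)
  rw [Finset.sum_const, nsmul_eq_mul]
  have h3 : 0 ≤ (1 - 43 * c) * Z := mul_nonneg (by linarith) hZ0.le
  calc (1 - 86 * c) * (Z * Z) ≤ ((1 - 43 * c) * Z) * ((1 - 43 * c) * Z) := by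
        nlinarith [sq_nonneg (c * Z)]
    _ ≤ _ := mul_le_mul_of_nonneg_right h2 h3

theorem le_wp_twoUnits (h : StageParams D mu c κ η η' K) (hG₀ : FewDefects G₀)
    (hmu : 1 ≤ mu) (hmuT : mu ≤ D.T) (hinv : StageInv G₀ G R)
    (hocc : ∀ v, (occ (s(a, b) ::ₘ rest) v : ℝ) ≤ K) (hrest : (s(a, b) ::ₘ rest).card * c ≤ 1)
    (hR : R' ⊆ R) (he : (s(a, b), t) ∉ R') (φ : α ≃ SwitchUnit D × SwitchUnit D)
    (hF : ∀ S ∈ F, UnitsValid G a b t (φ S).1 (φ S).2)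
    (hgen : ∀ S, φ S ∈ genericPairs G a b → S ∈ F)
    (hRj : ∀ S, φ S ∈ genericPairs G a b → ¬ Rj S)
    (hp₁ : ∀ S, φ S ∈ genericPairs G a b → stampBound D mu ^ 2 ≤ p₁ S)
    (hp₂ : ∀ S, φ S ∈ genericPairs G a b →
      (1 - 10 * c) ^ 2 ≤ p₂ S (unitsNext G a b t (φ S).1 (φ S).2))
    (haux : ∀ S, ∀ Q' : TGraph D → ℝ≥0∞,
      ENNReal.ofReal (1 - η') * Q' (unitsNext G a b t (φ S).1 (φ S).2) ≤ wp ∅ (aux S) Q')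
    {V : ℝ} (hV : 0 ≤ V) (hQ : ∀ G', StageInv G₀ G' R' →
      ENNReal.ofReal (V * (1 - stoppedPotential c κ (pairMult G₀) rest (pairMult G'))) ≤ Q G') :
    ENNReal.ofReal (stampBound D mu ^ 2 * V *
      (1 - stoppedPotential c κ (pairMult G₀) (s(a, b) ::ₘ s(a, b) ::ₘ rest) (pairMult G))) ≤
    wp ∅ (switchStep F ((degSum D : ℝ) ^ 4 * (D.T : ℝ) ^ 6)
      (fun S => unitsNext G a b t (φ S).1 (φ S).2) Rj p₁ aux p₂) Q := by
  rw [stoppedPotential_eq hinv]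
  refine ofReal_stopped_le.trans ?_
  have hM := h.M_pos
  have hT := T_pos' D
  have hc := h.c_nonneg
  have hc1 := h.c_le
  have hgood : ∀ S ∈ (genericPairs G a b).map φ.symm.toEmbedding, φ S ∈ genericPairs G a b := by
    intro S hS
    obtain ⟨u, hu, rfl⟩ := Finset.mem_map.1 hS
    simpa using hu
  refine le_wp_switchStep_of_sum_le (by positivity) (card_twoUnits_le hinv.degrees φ hF)
    (Good := (genericPairs G a b).map φ.symm.toEmbedding)
    (fun S hS => hgen S (hgood S hS)) (sq_nonneg _)
    (pow_le_one₀ (stampBound_nonneg mu) (stampBound_le_one hmu hmuT))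
    (sq_nonneg _) (pow_le_one₀ (by linarith) (by linarith)) (by linarith [h.aux_le_one]) hV
    (fun S _ => haux S) (fun S hS => hRj S (hgood S hS)) (fun S hS => hp₁ S (hgood S hS))
    (fun S hS => hp₂ S (hgood S hS))
    (v := fun S => stoppedPotential c κ (pairMult G₀) rest
      (pairMult (unitsNext G a b t (φ S).1 (φ S).2)))
    (fun S _ => stoppedPotential_nonneg h.c_nonneg h.κ_nonneg rest)
    (fun S _ => stoppedPotential_le_one rest) (γ := 86 * c) ?_ (sq_one_sub_le h) ?_
    (sum_twoUnits_le h hinv hocc hrest φ hF) ?_ fun S hS => ?_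
  · rw [Finset.card_map]
    exact le_card_genericPairs h hG₀ hinv a b
  · have := h.aux_le
    linarith
  · have := h.aux_nonneg
    linarith
  · by_cases hm : ∀ p, pairMult (unitsNext G a b t (φ S).1 (φ S).2) p ≤ pairMult G₀ p + 1
    · exact hQ _ ((hF S (hgen S (hgood S hS))).stageInv hinv hR he hm)
    · simp only [stoppedPotential]
      rw [if_neg hm, sub_self, mul_zero, ENNReal.ofReal_zero]
      exact zero_le

end Generic

end TGen

end

noncomputable section

namespace TGen

variable {D : Input}

/-! ## The three types of switchings -/

theorem ne_of_notMem_pair {α : Type*} [DecidableEq α] {x a b : α} (h : x ∉ ({a, b} : Finset α)) :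
    x ≠ a ∧ x ≠ b := by
  simpa [not_or] using h

/-- A TL switching is one unit whose two base nodes are both the node of the loop; TD₁ is one unit
and TD₀ two units at the ends of the double-edge. These equivalences reduce all three types to
statements about units. -/
def tlEquiv (D : Input) : TLData D ≃ SwitchUnit D where
  toFun S := ((S.v2, S.v4, S.t2), (S.v3, S.v5, S.t3), S.t4, S.t5, S.t6)
  invFun u := ⟨u.1.1, u.2.1.1, u.1.2.1, u.2.1.2.1, u.1.2.2, u.2.1.2.2, u.2.2.1, u.2.2.2.1,
    u.2.2.2.2⟩
  left_inv _ := rfl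
  right_inv _ := rfl

def td1Equiv (D : Input) : TD1Data D ≃ SwitchUnit D where
  toFun S := ((S.v3, S.v5, S.t2), (S.v4, S.v6, S.t3), S.t4, S.t5, S.t6)
  invFun u := ⟨u.1.1, u.2.1.1, u.1.2.1, u.2.1.2.1, u.1.2.2, u.2.1.2.2, u.2.2.1, u.2.2.2.1,
    u.2.2.2.2⟩
  left_inv _ := rfl
  right_inv _ := rfl

def td0Equiv (D : Input) : TD0Data D ≃ SwitchUnit D × SwitchUnit D where
  toFun S := (((S.v3, S.v7, S.t2), (S.v4, S.v8, S.t3), S.t6, S.t7, S.t10),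
    ((S.v5, S.v9, S.t4), (S.v6, S.v10, S.t5), S.t8, S.t9, S.t11))
  invFun x := ⟨x.1.1.1, x.1.2.1.1, x.2.1.1, x.2.2.1.1, x.1.1.2.1, x.1.2.1.2.1, x.2.1.2.1,
    x.2.2.1.2.1, x.1.1.2.2, x.1.2.1.2.2, x.2.1.2.2, x.2.2.1.2.2, x.1.2.2.1, x.1.2.2.2.1,
    x.2.2.2.1, x.2.2.2.2.1, x.1.2.2.2.2, x.2.2.2.2.2⟩
  left_inv _ := rfl
  right_inv _ := rfl

theorem td0New_eq (v₁ v₂ : Node D) (S : TD0Data D) : td0New v₁ v₂ S =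
    unitNew v₁ v₂ (td0Equiv D S).1 + unitNew v₁ v₂ (td0Equiv D S).2 := by
  ext e
  simp only [td0New, unitNew, td0Equiv, Equiv.coe_fn_mk, Multiset.insert_eq_cons,
    Multiset.count_cons, Multiset.count_singleton, Multiset.count_add]
  ring

theorem tlSwitchings_valid {G : TGraph D} {v : Node D} {t : Stamp D} {S : TLData D}
    (hS : S ∈ tlSwitchings G v t) : UnitValid G v v t (tlEquiv D S) := by
  classical
  have h : IsTL G v t S := (Finset.mem_filter.1 hS).2
  refine ⟨mem_simpleUnits.2 ⟨mem_simpleArcs.2 h.simple₂₄, mem_simpleArcs.2 h.simple₃₅⟩, h.rewire,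
    ⟨h.ne_v1.1, h.ne_v1.2.1, h.v4_ne_v5⟩, ?_, fun _ => ?_⟩
  · exact h.loop.le.trans (by norm_num)
  · exact h.loop.le

theorem td1Switchings_valid {G : TGraph D} {v₁ v₂ : Node D} (hv : v₁ ≠ v₂) {t : Stamp D}
    {S : TD1Data D} (hS : S ∈ td1Switchings G v₁ v₂ t) : UnitValid G v₁ v₂ t (td1Equiv D S) := by
  classical
  have h : IsTD1 G v₁ v₂ t S := (Finset.mem_filter.1 hS).2
  exact ⟨mem_simpleUnits.2 ⟨mem_simpleArcs.2 h.simple₃₅, mem_simpleArcs.2 h.simple₄₆⟩, h.rewire,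
    ⟨h.ne_v1.1, h.ne_v2.2.1, h.v5_ne_v6⟩, h.double.le, fun h' => (hv h').elim⟩

theorem td0Switchings_valid {G : TGraph D} {v₁ v₂ : Node D} {t : Stamp D}
    {S : TD0Data D} (hS : S ∈ td0Switchings G v₁ v₂ t) :
    UnitsValid G v₁ v₂ t (td0Equiv D S).1 (td0Equiv D S).2 := by
  classical
  have h : IsTD0 G v₁ v₂ t S := (Finset.mem_filter.1 hS).2
  refine ⟨mem_simpleUnits.2 ⟨mem_simpleArcs.2 h.simple₃₇, mem_simpleArcs.2 h.simple₄₈⟩,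
    mem_simpleUnits.2 ⟨mem_simpleArcs.2 h.simple₅₉, mem_simpleArcs.2 h.simple₆₁₀⟩, ?_,
    ⟨h.ne_v1 S.v3 (by simp), h.ne_v2 S.v4 (by simp), h.v7_ne_v8⟩,
    ⟨h.ne_v1 S.v5 (by simp), h.ne_v2 S.v6 (by simp), h.v9_ne_v10⟩, h.double.le⟩
  have := h.rewire
  rw [td0New_eq] at this
  exact this

theorem tlSwitchings_of_generic {G : TGraph D} {v : Node D} {t : Stamp D} {S : TLData D}
    (hw : w G v v t = 1) (h : IsGeneric G {v, v} v v (tlEquiv D S)) : S ∈ tlSwitchings G v t := by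
  classical
  have h1 : S.v2 ≠ v := (ne_of_notMem_pair h.x₁).1
  have h2 : S.v4 ≠ v := (ne_of_notMem_pair h.y₁).1
  have h3 : S.v3 ≠ v := (ne_of_notMem_pair h.x₂).1
  have h4 : S.v5 ≠ v := (ne_of_notMem_pair h.y₂).1
  refine Finset.mem_filter.2 ⟨Finset.mem_univ _, hw, mem_simpleArcs.1 h.simple₁,
    mem_simpleArcs.1 h.simple₂, ⟨h1, h3, h2, h4⟩, h.y₁y₂, ?_⟩
  exact h.canRewire (by simp) (by simp) (Multiset.one_le_count_iff_mem.1 hw.ge)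

theorem td1Switchings_of_generic {G : TGraph D} {v₁ v₂ : Node D} {t : Stamp D} {S : TD1Data D}
    (hw : w G v₁ v₂ t = 2) (h : IsGeneric G {v₁, v₂} v₁ v₂ (td1Equiv D S)) :
    S ∈ td1Switchings G v₁ v₂ t := by
  classical
  have h1 : S.v3 ≠ v₁ ∧ S.v3 ≠ v₂ := ne_of_notMem_pair h.x₁
  have h2 : S.v5 ≠ v₁ ∧ S.v5 ≠ v₂ := ne_of_notMem_pair h.y₁
  have h3 : S.v4 ≠ v₁ ∧ S.v4 ≠ v₂ := ne_of_notMem_pair h.x₂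
  have h4 : S.v6 ≠ v₁ ∧ S.v6 ≠ v₂ := ne_of_notMem_pair h.y₂
  refine Finset.mem_filter.2 ⟨Finset.mem_univ _, hw, mem_simpleArcs.1 h.simple₁,
    mem_simpleArcs.1 h.simple₂, ⟨h1.1, h3.1, h2.1, h4.1⟩, ⟨h1.2, h3.2, h2.2, h4.2⟩, h.y₁y₂, ?_⟩
  exact h.canRewire (by simp) (by simp) (Multiset.one_le_count_iff_mem.1
    (by rw [w] at hw; omega))

theorem td0Switchings_of_generic {G : TGraph D} {v₁ v₂ : Node D} {t : Stamp D} {S : TD0Data D}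
    (hw : w G v₁ v₂ t = 2) (h : td0Equiv D S ∈ genericPairs G v₁ v₂) :
    S ∈ td0Switchings G v₁ v₂ t := by
  classical
  obtain ⟨h, h'⟩ := mem_genericPairs.1 h
  have hsub : ∀ {x : Node D}, x ∉ unitNodes v₁ v₂ (td0Equiv D S).1 → x ≠ v₁ ∧ x ≠ v₂ :=
    fun hx => ⟨fun e => hx (e ▸ left_mem_unitNodes), fun e => hx (e ▸ right_mem_unitNodes)⟩
  have h1 : S.v3 ≠ v₁ ∧ S.v3 ≠ v₂ := ne_of_notMem_pair h.x₁
  have h2 : S.v7 ≠ v₁ ∧ S.v7 ≠ v₂ := ne_of_notMem_pair h.y₁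
  have h3 : S.v4 ≠ v₁ ∧ S.v4 ≠ v₂ := ne_of_notMem_pair h.x₂
  have h4 : S.v8 ≠ v₁ ∧ S.v8 ≠ v₂ := ne_of_notMem_pair h.y₂
  have h5 : S.v5 ≠ v₁ ∧ S.v5 ≠ v₂ := hsub h'.x₁
  have h6 : S.v9 ≠ v₁ ∧ S.v9 ≠ v₂ := hsub h'.y₁
  have h7 : S.v6 ≠ v₁ ∧ S.v6 ≠ v₂ := hsub h'.x₂
  have h8 : S.v10 ≠ v₁ ∧ S.v10 ≠ v₂ := hsub h'.y₂
  refine Finset.mem_filter.2 ⟨Finset.mem_univ _, hw, mem_simpleArcs.1 h.simple₁,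
    mem_simpleArcs.1 h.simple₂, mem_simpleArcs.1 h'.simple₁, mem_simpleArcs.1 h'.simple₂, ?_, ?_,
    h.y₁y₂, h'.y₁y₂, ?_⟩
  · simp only [List.mem_cons, List.not_mem_nil, or_false]
    rintro x (rfl | rfl | rfl | rfl | rfl | rfl | rfl | rfl)
    exacts [h1.1, h3.1, h5.1, h7.1, h2.1, h4.1, h6.1, h8.1]
  · simp only [List.mem_cons, List.not_mem_nil, or_false]
    rintro x (rfl | rfl | rfl | rfl | rfl | rfl | rfl | rfl)
    exacts [h1.2, h3.2, h5.2, h7.2, h2.2, h4.2, h6.2, h8.2]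
  · rw [td0New_eq]
    exact h.canRewire_two h' hw

theorem bTL1_eq (G : TGraph D) (v₁ v₂ v₃ : Node D) :
    bTL1 G v₁ v₂ v₃ = bTD1_1 G {v₁, v₂, v₃} := by
  unfold bTL1 bTD1_1
  congr!

/-! ### The iterations of the algorithm as instances of switchings by units -/

section Steps

variable {mu : ℕ} {c κ η η' K : ℝ} {G₀ G : TGraph D} {R R' : Set (TEdge D)}
  {v v₁ v₂ : Node D} {t : Stamp D} {rest : Multiset (Sym2 (Node D))}
  {Q : TGraph D → ℝ≥0∞}

theorem wp_stage1Step_le {B : Set (TGraph D)}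
    (hB : ∀ G', (∀ p, pairMult G' p ≤ pairMult G₀ p + 1) → G' ∉ B)
    (h : StageParams D mu c κ η η' K) (hinv : StageInv G₀ G R)
    (hocc : ∀ v, (occ rest v : ℝ) ≤ K) (hrest : rest.card * c ≤ 1) (hR : R' ⊆ R)
    (he : (s(v, v), t) ∉ R')
    (hQ1 : ∀ G, Q G ≤ 1) (hQ : ∀ G', StageInv G₀ G' R' →
      Q G' ≤ ENNReal.ofReal (stoppedPotential c κ (pairMult G₀) rest (pairMult G'))) :
    wp B (stage1Step mu G (v, t)) Q ≤
      ENNReal.ofReal (stoppedPotential c κ (pairMult G₀) (s(v, v) ::ₘ rest) (pairMult G)) := by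
  have := wp_oneUnit_le hB h hinv hocc hrest hR he (tlEquiv D) (F := tlSwitchings G v t)
    (fun S hS => tlSwitchings_valid hS)
    (aux := fun S => auxStep mu (2 * BL D + 4 * BD D) ![v, S.v2, S.v3, S.v4, S.v5] ![S.v2, S.v3]
      ![S.v4, S.v5] (unitNext G v v t (tlEquiv D S)))
    (fun S Q' hQ' => wp_auxStep_le B hQ' h.aux₁) hQ1 hQ
    (Rj := fun S => mu ≤ mult (unitNext G v v t (tlEquiv D S)) S.v2 S.v4 ∨
      mu ≤ mult (unitNext G v v t (tlEquiv D S)) S.v3 S.v5)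
    (p₁ := fun S => ((D.T : ℝ) - ((mu : ℝ) - 1)) ^ 2 /
      bTL2 (unitNext G v v t (tlEquiv D S)) S.v2 S.v4 S.v3 S.v5)
    (p₂ := fun S G'' => (simpleDeg (W (unitNext G v v t (tlEquiv D S))) v *
      (simpleDeg (W (unitNext G v v t (tlEquiv D S))) v - 1)) *
        ((degSum D : ℝ) - 2 * BL D - 4 * BD D - 4 * maxDeg D) /
          (bTL0 G'' v * bTL1 G'' v S.v2 S.v3))
  -- With these parameters the step is a `switchStep` by unfolding of definitions.
  exact this

theorem wp_td1Step_le {B : Set (TGraph D)}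
    (hB : ∀ G', (∀ p, pairMult G' p ≤ pairMult G₀ p + 1) → G' ∉ B)
    (h : StageParams D mu c κ η η' K) (hinv : StageInv G₀ G R)
    (hocc : ∀ v, (occ rest v : ℝ) ≤ K) (hrest : rest.card * c ≤ 1) (hR : R' ⊆ R)
    (hv : v₁ ≠ v₂) (he : (s(v₁, v₂), t) ∉ R')
    (hQ1 : ∀ G, Q G ≤ 1) (hQ : ∀ G', StageInv G₀ G' R' →
      Q G' ≤ ENNReal.ofReal (stoppedPotential c κ (pairMult G₀) rest (pairMult G'))) :
    wp B (td1Step mu G v₁ v₂ t) Q ≤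
      ENNReal.ofReal (stoppedPotential c κ (pairMult G₀) (s(v₁, v₂) ::ₘ rest) (pairMult G)) := by
  have := wp_oneUnit_le hB h hinv hocc hrest hR he (td1Equiv D) (F := td1Switchings G v₁ v₂ t)
    (fun S hS => td1Switchings_valid hv hS)
    (aux := fun S => auxStep mu (4 * BD D) ![v₁, v₂, S.v3, S.v4, S.v5, S.v6] ![S.v3, S.v4]
      ![S.v5, S.v6] (unitNext G v₁ v₂ t (td1Equiv D S)))
    (fun S Q' hQ' => wp_auxStep_le B hQ' h.aux₂) hQ1 hQ
    (Rj := fun S => mu ≤ mult (unitNext G v₁ v₂ t (td1Equiv D S)) S.v3 S.v5 ∨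
      mu ≤ mult (unitNext G v₁ v₂ t (td1Equiv D S)) S.v4 S.v6)
    (p₁ := fun S => bTD1Low2 D mu / (freeStamps (unitNext G v₁ v₂ t (td1Equiv D S)) S.v3 S.v5 *
      freeStamps (unitNext G v₁ v₂ t (td1Equiv D S)) S.v4 S.v6))
    (p₂ := fun S G'' => bTD1Low0 (W (unitNext G v₁ v₂ t (td1Equiv D S))) v₁ v₂ * bTD1Low1 D /
      (bTD1_0 G'' v₁ v₂ * bTD1_1 G'' {v₁, v₂, S.v3, S.v4}))
  exact this

theorem wp_td0Step_le {B : Set (TGraph D)}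
    (hB : ∀ G', (∀ p, pairMult G' p ≤ pairMult G₀ p + 1) → G' ∉ B)
    (h : StageParams D mu c κ η η' K) (hinv : StageInv G₀ G R)
    (hocc : ∀ v, (occ (s(v₁, v₂) ::ₘ rest) v : ℝ) ≤ K) (hrest : (s(v₁, v₂) ::ₘ rest).card * c ≤ 1)
    (hR : R' ⊆ R) (he : (s(v₁, v₂), t) ∉ R')
    (hQ1 : ∀ G, Q G ≤ 1) (hQ : ∀ G', StageInv G₀ G' R' →
      Q G' ≤ ENNReal.ofReal (stoppedPotential c κ (pairMult G₀) rest (pairMult G'))) :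
    wp B (td0Step mu G v₁ v₂ t) Q ≤ ENNReal.ofReal
      (stoppedPotential c κ (pairMult G₀) (s(v₁, v₂) ::ₘ s(v₁, v₂) ::ₘ rest) (pairMult G)) := by
  have hnxt : ∀ S : TD0Data D, rewire G (td0Old v₁ v₂ t S) (td0New v₁ v₂ S) =
      unitsNext G v₁ v₂ t (td0Equiv D S).1 (td0Equiv D S).2 := fun S => by
    rw [td0New_eq]
    rfl
  have := wp_twoUnits_le hB h hinv hocc hrest hR he (td0Equiv D) (F := td0Switchings G v₁ v₂ t)
    (fun S hS => td0Switchings_valid hS)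
    (aux := fun S => auxStep mu (4 * BD D)
      ![v₁, v₂, S.v3, S.v4, S.v5, S.v6, S.v7, S.v8, S.v9, S.v10]
      ![S.v3, S.v4, S.v5, S.v6] ![S.v7, S.v8, S.v9, S.v10]
      (unitsNext G v₁ v₂ t (td0Equiv D S).1 (td0Equiv D S).2))
    (fun S Q' hQ' => wp_auxStep_le B hQ' h.aux₃) hQ1 hQ
    (Rj := fun S => let G' := rewire G (td0Old v₁ v₂ t S) (td0New v₁ v₂ S)
      mu ≤ mult G' S.v3 S.v7 ∨ mu ≤ mult G' S.v4 S.v8 ∨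
        mu ≤ mult G' S.v5 S.v9 ∨ mu ≤ mult G' S.v6 S.v10)
    (p₁ := fun S => let G' := rewire G (td0Old v₁ v₂ t S) (td0New v₁ v₂ S)
      bTD0Low2 D mu / (freeStamps G' S.v3 S.v7 * freeStamps G' S.v4 S.v8 *
        freeStamps G' S.v5 S.v9 * freeStamps G' S.v6 S.v10))
    (p₂ := fun S G'' => bTD0Low0 (W (rewire G (td0Old v₁ v₂ t S) (td0New v₁ v₂ S))) v₁ v₂ *
      bTD0Low1 D / (bTD0_0 G'' v₁ v₂ * bTD0_1 G'' {v₁, v₂, S.v3, S.v4, S.v5, S.v6}))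
  -- The new edges of TD₀ are listed in another order than those of the two units; the multisets are
  -- equal by `td0New_eq`, but not by definition, so they are rewritten before unfolding.
  simp only [← hnxt] at this
  exact this

/-- The invariant allows multiplicity `mu` in the current graph. For a generic switching the removed
pair loses an edge and gains none, so the restart rule does not fire. -/
theorem mult_lt_of_generic {mu : ℕ} (hmult : ∀ p, pairMult G p ≤ mu) {old new : TGraph D}
    (hr : CanRewire G old new) {i j : Node D} {s : Stamp D} (he : ((s(i, j), s) : TEdge D) ∈ old)
    (hne : ∀ e' ∈ new, e'.1 ≠ s(i, j)) : mult (rewire G old new) i j < mu :=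
  (pairMult_rewire_lt hr.old_le he hne).trans_le (hmult _)

theorem le_wp_stage1Step (h : StageParams D mu c κ η η' K) (hG₀ : FewDefects G₀)
    (hmu : 1 ≤ mu) (hmuT : mu ≤ D.T) (hmult : ∀ p, pairMult G₀ p + 1 ≤ mu)
    (hinv : StageInv G₀ G R) (hocc : ∀ v, (occ rest v : ℝ) ≤ K) (hrest : rest.card * c ≤ 1)
    (hw : w G v v t = 1) (hR : R' ⊆ R) (he : (s(v, v), t) ∉ R') {V : ℝ} (hV : 0 ≤ V)
    (hQ : ∀ G', StageInv G₀ G' R' →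
      ENNReal.ofReal (V * (1 - stoppedPotential c κ (pairMult G₀) rest (pairMult G'))) ≤ Q G') :
    ENNReal.ofReal (stampBound D mu * V *
      (1 - stoppedPotential c κ (pairMult G₀) (s(v, v) ::ₘ rest) (pairMult G))) ≤
    wp ∅ (stage1Step mu G (v, t)) Q := by
  have hm : ∀ p, pairMult G p ≤ mu := fun p => (hinv.pairMult_le p).trans (hmult p)
  have hmem : ((s(v, v), t) : TEdge D) ∈ G := Multiset.one_le_count_iff_mem.1 hw.ge
  have hlt : ∀ S, IsGeneric G {v, v} v v (tlEquiv D S) →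
      mult (unitNext G v v t (tlEquiv D S)) S.v2 S.v4 < mu ∧
      mult (unitNext G v v t (tlEquiv D S)) S.v3 S.v5 < mu := fun S hS => by
    have hr := hS.canRewire (t := t) (by simp) (by simp) hmem
    have h1 : arcEdge (tlEquiv D S).1 ∈ unitOld (tlEquiv D S) := mem_unitOld.2 (.inl rfl)
    have h2 : arcEdge (tlEquiv D S).2.1 ∈ unitOld (tlEquiv D S) := mem_unitOld.2 (.inr rfl)
    exact ⟨mult_lt_of_generic hm hr (Multiset.mem_cons_of_mem h1)
        fun e' he' => hS.new_ne_old (by simp) (by simp) h1 he',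
      mult_lt_of_generic hm hr (Multiset.mem_cons_of_mem h2)
        fun e' he' => hS.new_ne_old (by simp) (by simp) h2 he'⟩
  have := le_wp_oneUnit h hG₀ hmu hmuT hinv hocc hrest hR he (tlEquiv D)
    (F := tlSwitchings G v t) (fun S hS => tlSwitchings_valid hS)
    (fun S hS => tlSwitchings_of_generic hw hS)
    (Rj := fun S => mu ≤ mult (unitNext G v v t (tlEquiv D S)) S.v2 S.v4 ∨
      mu ≤ mult (unitNext G v v t (tlEquiv D S)) S.v3 S.v5)
    (fun S hS => by
      have := hlt S hS
      omega)
    (p₁ := fun S => ((D.T : ℝ) - ((mu : ℝ) - 1)) ^ 2 /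
      bTL2 (unitNext G v v t (tlEquiv D S)) S.v2 S.v4 S.v3 S.v5)
    (fun S hS => by
      rw [bTL2]
      push_cast
      exact stampBound_le (hlt S hS).1 (hlt S hS).2 hmuT)
    (p₂ := fun S G'' => (simpleDeg (W (unitNext G v v t (tlEquiv D S))) v *
      (simpleDeg (W (unitNext G v v t (tlEquiv D S))) v - 1)) *
        ((degSum D : ℝ) - 2 * BL D - 4 * BD D - 4 * maxDeg D) /
          (bTL0 G'' v * bTL1 G'' v S.v2 S.v3))
    (fun S hS => by
      -- In the final rejection the two new edges at `v` make k(k - 1) positive and the third new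
      -- edge makes the other count positive. Then k(k - 1) cancels, and what remains is (M - 2B_L -
      -- 4B_D - 4Δ)/M ≥ 1 - 10c.
      have hr := hS.canRewire (t := t) (by simp) (by simp) hmem
      have hval := tlSwitchings_valid (tlSwitchings_of_generic hw hS)
      have hG' : Matches (unitNext G v v t (tlEquiv D S)) := fun i =>
        (hval.degree_eq i).trans (hinv.degrees i)
      have hl := hS.noNewLoop (by simp) (by simp)
      have e1 := isSimpleEdge_rewire hr hl.x₁.symm (mem_unitNew.2 (.inl rfl))
      have e2 := isSimpleEdge_rewire hr hl.x₂.symm (mem_unitNew.2 (.inr (.inl rfl)))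
      have e3 := isSimpleEdge_rewire hr hl.y (mem_unitNew.2 (.inr (.inr rfl)))
      have hk : 2 ≤ simpleCount (unitNext G v v t (tlEquiv D S)) v :=
        two_le_simpleCount e1 e2 hS.x₁x₂
      have hb : 0 < bTL1 (unitNext G v v t (tlEquiv D S)) v S.v2 S.v3 := by
        have hy1 : S.v4 ≠ v := (ne_of_notMem_pair hS.y₁).1
        have hy2 : S.v5 ≠ v := (ne_of_notMem_pair hS.y₂).1
        have hy3 : S.v4 ≠ S.v2 := (mem_simpleArcs.1 hS.simple₁).1.symm
        have hy4 : S.v5 ≠ S.v3 := (mem_simpleArcs.1 hS.simple₂).1.symm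
        have hy5 : S.v4 ≠ S.v3 := hS.y₁x₂
        have hy6 : S.v5 ≠ S.v2 := hS.x₁y₂.symm
        refine bTL1_eq _ _ _ _ ▸ bTD1_1_pos (U := {v, S.v2, S.v3}) e3 ?_ ?_
        · simpa [not_or] using ⟨hy1, hy3, hy5⟩
        · simpa [not_or] using ⟨hy2, hy6, hy4⟩
      have hbM : bTL1 (unitNext G v v t (tlEquiv D S)) v S.v2 S.v3 ≤ degSum D := by
        rw [bTL1_eq]
        exact bTD1_1_le hG' {v, S.v2, S.v3}
      rw [simpleDeg_eq hG', bTL0_eq]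
      have hk' : (2 : ℝ) ≤ simpleCount (unitNext G v v t (tlEquiv D S)) v := by exact_mod_cast hk
      rw [Nat.cast_mul, Nat.cast_sub (by omega), Nat.cast_one]
      have hc := h.c_nonneg
      have hc1 := h.c_le
      refine le_ratio (M := degSum D) (by nlinarith) (by exact_mod_cast hb)
        (by exact_mod_cast hbM) ?_ (sq_nonneg _)
      have h1 := h.slack_le
      have h2 := h.maxDeg_eq
      have h3 := h.M_pos
      -- The square is what TD₀ needs; the weaker bound is used for all types alike.
      have h4 : (1 - 10 * c) ^ 2 ≤ 1 - 10 * c := by nlinarith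
      nlinarith)
    (aux := fun S => auxStep mu (2 * BL D + 4 * BD D) ![v, S.v2, S.v3, S.v4, S.v5] ![S.v2, S.v3]
      ![S.v4, S.v5] (unitNext G v v t (tlEquiv D S)))
    (fun S Q' => le_wp_auxStep Q' h.aux₁) hV hQ
  exact this

theorem le_wp_td1Step (h : StageParams D mu c κ η η' K) (hG₀ : FewDefects G₀)
    (hmu : 1 ≤ mu) (hmuT : mu ≤ D.T) (hmult : ∀ p, pairMult G₀ p + 1 ≤ mu)
    (hinv : StageInv G₀ G R) (hocc : ∀ v, (occ rest v : ℝ) ≤ K) (hrest : rest.card * c ≤ 1)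
    (hv : v₁ ≠ v₂) (hw : w G v₁ v₂ t = 2) (hR : R' ⊆ R) (he : (s(v₁, v₂), t) ∉ R') {V : ℝ}
    (hV : 0 ≤ V)
    (hQ : ∀ G', StageInv G₀ G' R' →
      ENNReal.ofReal (V * (1 - stoppedPotential c κ (pairMult G₀) rest (pairMult G'))) ≤ Q G') :
    ENNReal.ofReal (stampBound D mu * V *
      (1 - stoppedPotential c κ (pairMult G₀) (s(v₁, v₂) ::ₘ rest) (pairMult G))) ≤
    wp ∅ (td1Step mu G v₁ v₂ t) Q := by
  have hm : ∀ p, pairMult G p ≤ mu := fun p => (hinv.pairMult_le p).trans (hmult p)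
  have hmem : ((s(v₁, v₂), t) : TEdge D) ∈ G :=
    Multiset.one_le_count_iff_mem.1 (by rw [w] at hw; omega)
  have hlt : ∀ S, IsGeneric G {v₁, v₂} v₁ v₂ (td1Equiv D S) →
      mult (unitNext G v₁ v₂ t (td1Equiv D S)) S.v3 S.v5 < mu ∧
      mult (unitNext G v₁ v₂ t (td1Equiv D S)) S.v4 S.v6 < mu := fun S hS => by
    have hr := hS.canRewire (t := t) (by simp) (by simp) hmem
    have h1 : arcEdge (td1Equiv D S).1 ∈ unitOld (td1Equiv D S) := mem_unitOld.2 (.inl rfl)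
    have h2 : arcEdge (td1Equiv D S).2.1 ∈ unitOld (td1Equiv D S) := mem_unitOld.2 (.inr rfl)
    exact ⟨mult_lt_of_generic hm hr (Multiset.mem_cons_of_mem h1)
        fun e' he' => hS.new_ne_old (by simp) (by simp) h1 he',
      mult_lt_of_generic hm hr (Multiset.mem_cons_of_mem h2)
        fun e' he' => hS.new_ne_old (by simp) (by simp) h2 he'⟩
  have := le_wp_oneUnit h hG₀ hmu hmuT hinv hocc hrest hR he (td1Equiv D)
    (F := td1Switchings G v₁ v₂ t) (fun S hS => td1Switchings_valid hv hS)
    (fun S hS => td1Switchings_of_generic hw hS)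
    (Rj := fun S => mu ≤ mult (unitNext G v₁ v₂ t (td1Equiv D S)) S.v3 S.v5 ∨
      mu ≤ mult (unitNext G v₁ v₂ t (td1Equiv D S)) S.v4 S.v6)
    (fun S hS => by
      have := hlt S hS
      omega)
    (p₁ := fun S => bTD1Low2 D mu / (freeStamps (unitNext G v₁ v₂ t (td1Equiv D S)) S.v3 S.v5 *
      freeStamps (unitNext G v₁ v₂ t (td1Equiv D S)) S.v4 S.v6))
    (fun S hS => stampBound_le (hlt S hS).1 (hlt S hS).2 hmuT)
    (p₂ := fun S G'' => bTD1Low0 (W (unitNext G v₁ v₂ t (td1Equiv D S))) v₁ v₂ * bTD1Low1 D /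
      (bTD1_0 G'' v₁ v₂ * bTD1_1 G'' {v₁, v₂, S.v3, S.v4}))
    (fun S hS => by
      have hr := hS.canRewire (t := t) (by simp) (by simp) hmem
      have hval := td1Switchings_valid hv (td1Switchings_of_generic hw hS)
      have hG' : Matches (unitNext G v₁ v₂ t (td1Equiv D S)) := fun i =>
        (hval.degree_eq i).trans (hinv.degrees i)
      have hl := hS.noNewLoop (by simp) (by simp)
      have e1 := isSimpleEdge_rewire hr hl.x₁.symm (mem_unitNew.2 (.inl rfl))
      have e2 := isSimpleEdge_rewire hr hl.x₂.symm (mem_unitNew.2 (.inr (.inl rfl)))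
      have e3 := isSimpleEdge_rewire hr hl.y (mem_unitNew.2 (.inr (.inr rfl)))
      have hk1 : (1 : ℝ) ≤ simpleCount (unitNext G v₁ v₂ t (td1Equiv D S)) v₁ := by
        exact_mod_cast one_le_simpleCount e1
      have hk2 : (1 : ℝ) ≤ simpleCount (unitNext G v₁ v₂ t (td1Equiv D S)) v₂ := by
        exact_mod_cast one_le_simpleCount e2
      have hb : 0 < bTD1_1 (unitNext G v₁ v₂ t (td1Equiv D S)) {v₁, v₂, S.v3, S.v4} := by
        have hy1 : S.v5 ≠ v₁ ∧ S.v5 ≠ v₂ := ne_of_notMem_pair hS.y₁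
        have hy2 : S.v6 ≠ v₁ ∧ S.v6 ≠ v₂ := ne_of_notMem_pair hS.y₂
        have hy3 : S.v5 ≠ S.v3 := (mem_simpleArcs.1 hS.simple₁).1.symm
        have hy4 : S.v6 ≠ S.v4 := (mem_simpleArcs.1 hS.simple₂).1.symm
        have hy5 : S.v5 ≠ S.v4 := hS.y₁x₂
        have hy6 : S.v6 ≠ S.v3 := hS.x₁y₂.symm
        refine bTD1_1_pos e3 ?_ ?_
        · simpa [not_or] using ⟨hy1.1, hy1.2, hy3, hy5⟩
        · simpa [not_or] using ⟨hy2.1, hy2.2, hy6, hy4⟩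
      have hbM := bTD1_1_le hG' {v₁, v₂, S.v3, S.v4}
      rw [bTD1Low0, simpleDeg_eq hG', simpleDeg_eq hG', bTD1_0_eq, bTD1Low1]
      rw [Nat.cast_mul]
      have hc := h.c_nonneg
      have hc1 := h.c_le
      refine le_ratio (M := degSum D) (by nlinarith) (by exact_mod_cast hb)
        (by exact_mod_cast hbM) ?_ (sq_nonneg _)
      have h1 := h.slack_le
      have h2 := h.maxDeg_eq
      have h3 := h.M_pos
      have h4 : (1 - 10 * c) ^ 2 ≤ 1 - 10 * c := by nlinarith
      have h5 : 0 ≤ BL D := by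
        unfold BL
        positivity
      nlinarith)
    (aux := fun S => auxStep mu (4 * BD D) ![v₁, v₂, S.v3, S.v4, S.v5, S.v6] ![S.v3, S.v4]
      ![S.v5, S.v6] (unitNext G v₁ v₂ t (td1Equiv D S)))
    (fun S Q' => le_wp_auxStep Q' h.aux₂) hV hQ
  exact this

theorem le_wp_td0Step (h : StageParams D mu c κ η η' K) (hG₀ : FewDefects G₀)
    (hmu : 1 ≤ mu) (hmuT : mu ≤ D.T) (hmult : ∀ p, pairMult G₀ p + 1 ≤ mu)
    (hinv : StageInv G₀ G R)
    (hocc : ∀ v, (occ (s(v₁, v₂) ::ₘ rest) v : ℝ) ≤ K) (hrest : (s(v₁, v₂) ::ₘ rest).card * c ≤ 1)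
    (hw : w G v₁ v₂ t = 2) (hR : R' ⊆ R) (he : (s(v₁, v₂), t) ∉ R') {V : ℝ} (hV : 0 ≤ V)
    (hQ : ∀ G', StageInv G₀ G' R' →
      ENNReal.ofReal (V * (1 - stoppedPotential c κ (pairMult G₀) rest (pairMult G'))) ≤ Q G') :
    ENNReal.ofReal (stampBound D mu ^ 2 * V * (1 - stoppedPotential c κ (pairMult G₀)
      (s(v₁, v₂) ::ₘ s(v₁, v₂) ::ₘ rest) (pairMult G))) ≤
    wp ∅ (td0Step mu G v₁ v₂ t) Q := by
  have hm : ∀ p, pairMult G p ≤ mu := fun p => (hinv.pairMult_le p).trans (hmult p)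
  have hnxt : ∀ S : TD0Data D, rewire G (td0Old v₁ v₂ t S) (td0New v₁ v₂ S) =
      unitsNext G v₁ v₂ t (td0Equiv D S).1 (td0Equiv D S).2 := fun S => by
    rw [td0New_eq]
    rfl
  have hlt : ∀ S, td0Equiv D S ∈ genericPairs G v₁ v₂ →
      (mult (unitsNext G v₁ v₂ t (td0Equiv D S).1 (td0Equiv D S).2) S.v3 S.v7 < mu ∧
      mult (unitsNext G v₁ v₂ t (td0Equiv D S).1 (td0Equiv D S).2) S.v4 S.v8 < mu) ∧
      mult (unitsNext G v₁ v₂ t (td0Equiv D S).1 (td0Equiv D S).2) S.v5 S.v9 < mu ∧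
      mult (unitsNext G v₁ v₂ t (td0Equiv D S).1 (td0Equiv D S).2) S.v6 S.v10 < mu :=
      fun S hS => by
    obtain ⟨hS1, hS2⟩ := mem_genericPairs.1 hS
    have hr := hS1.canRewire_two (t := t) hS2 hw
    have key : ∀ {i j : Node D} {s : Stamp D},
        ((s(i, j), s) : TEdge D) ∈ unitOld (td0Equiv D S).1 + unitOld (td0Equiv D S).2 →
        mult (unitsNext G v₁ v₂ t (td0Equiv D S).1 (td0Equiv D S).2) i j < mu := fun hin =>
      mult_lt_of_generic hm hr (Multiset.mem_cons_of_mem (Multiset.mem_cons_of_mem hin))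
        fun e' he' => hS1.new_ne_old_two hS2 hin he'
    exact ⟨⟨key (s := S.t2) (Multiset.mem_add.2 (.inl (mem_unitOld.2 (.inl rfl)))),
      key (s := S.t3) (Multiset.mem_add.2 (.inl (mem_unitOld.2 (.inr rfl))))⟩,
      key (s := S.t4) (Multiset.mem_add.2 (.inr (mem_unitOld.2 (.inl rfl)))),
      key (s := S.t5) (Multiset.mem_add.2 (.inr (mem_unitOld.2 (.inr rfl))))⟩
  have := le_wp_twoUnits h hG₀ hmu hmuT hinv hocc hrest hR he (td0Equiv D)
    (F := td0Switchings G v₁ v₂ t) (fun S hS => td0Switchings_valid hS)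
    (fun S hS => td0Switchings_of_generic hw hS)
    (Rj := fun S => mu ≤ mult (unitsNext G v₁ v₂ t (td0Equiv D S).1 (td0Equiv D S).2) S.v3 S.v7 ∨
      mu ≤ mult (unitsNext G v₁ v₂ t (td0Equiv D S).1 (td0Equiv D S).2) S.v4 S.v8 ∨
      mu ≤ mult (unitsNext G v₁ v₂ t (td0Equiv D S).1 (td0Equiv D S).2) S.v5 S.v9 ∨
      mu ≤ mult (unitsNext G v₁ v₂ t (td0Equiv D S).1 (td0Equiv D S).2) S.v6 S.v10)
    (fun S hS => by
      have := hlt S hS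
      omega)
    (p₁ := fun S => bTD0Low2 D mu /
      (freeStamps (unitsNext G v₁ v₂ t (td0Equiv D S).1 (td0Equiv D S).2) S.v3 S.v7 *
      freeStamps (unitsNext G v₁ v₂ t (td0Equiv D S).1 (td0Equiv D S).2) S.v4 S.v8 *
      freeStamps (unitsNext G v₁ v₂ t (td0Equiv D S).1 (td0Equiv D S).2) S.v5 S.v9 *
      freeStamps (unitsNext G v₁ v₂ t (td0Equiv D S).1 (td0Equiv D S).2) S.v6 S.v10))
    (fun S hS => by
      have h1 := stampBound_le (hlt S hS).1.1 (hlt S hS).1.2 hmuT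
      have h2 := stampBound_le (hlt S hS).2.1 (hlt S hS).2.2 hmuT
      have h3 := mul_le_mul h1 h2 (stampBound_nonneg mu) (by positivity)
      rw [div_mul_div_comm, ← pow_add, ← pow_two] at h3
      refine h3.trans (le_of_eq ?_)
      rw [bTD0Low2, mul_assoc _ _ (freeStamps _ S.v6 S.v10 : ℝ)])
    (p₂ := fun S G'' =>
      bTD0Low0 (W (unitsNext G v₁ v₂ t (td0Equiv D S).1 (td0Equiv D S).2)) v₁ v₂ * bTD0Low1 D /
        (bTD0_0 G'' v₁ v₂ * bTD0_1 G'' {v₁, v₂, S.v3, S.v4, S.v5, S.v6}))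
    (fun S hS => by
      have hval := td0Switchings_valid (td0Switchings_of_generic hw hS)
      obtain ⟨hS1, hS2⟩ := mem_genericPairs.1 hS
      have hr := hS1.canRewire_two (t := t) hS2 hw
      set G' := unitsNext G v₁ v₂ t (td0Equiv D S).1 (td0Equiv D S).2 with hG'def
      have hG' : Matches G' := fun i => (hval.degree_eq i).trans (hinv.degrees i)
      have hl1 := hS1.noNewLoop (by simp) (by simp)
      have hl2 := hS2.noNewLoop left_mem_unitNodes right_mem_unitNodes
      have n1 : ∀ {e : TEdge D}, e ∈ unitNew v₁ v₂ (td0Equiv D S).1 →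
        e ∈ unitNew v₁ v₂ (td0Equiv D S).1 + unitNew v₁ v₂ (td0Equiv D S).2 :=
        fun h => Multiset.mem_add.2 (.inl h)
      have n2 : ∀ {e : TEdge D}, e ∈ unitNew v₁ v₂ (td0Equiv D S).2 →
        e ∈ unitNew v₁ v₂ (td0Equiv D S).1 + unitNew v₁ v₂ (td0Equiv D S).2 :=
        fun h => Multiset.mem_add.2 (.inr h)
      have e1 := isSimpleEdge_rewire hr hl1.x₁.symm (n1 (mem_unitNew.2 (.inl rfl)))
      have e2 := isSimpleEdge_rewire hr hl1.x₂.symm (n1 (mem_unitNew.2 (.inr (.inl rfl))))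
      have e3 := isSimpleEdge_rewire hr hl1.y (n1 (mem_unitNew.2 (.inr (.inr rfl))))
      have f1 := isSimpleEdge_rewire hr hl2.x₁.symm (n2 (mem_unitNew.2 (.inl rfl)))
      have f2 := isSimpleEdge_rewire hr hl2.x₂.symm (n2 (mem_unitNew.2 (.inr (.inl rfl))))
      have f3 := isSimpleEdge_rewire hr hl2.y (n2 (mem_unitNew.2 (.inr (.inr rfl))))
      have hout : ∀ {x : Node D}, x ∉ unitNodes v₁ v₂ (td0Equiv D S).1 →
          x ≠ v₁ ∧ x ≠ v₂ ∧ x ≠ S.v3 ∧ x ≠ S.v7 ∧ x ≠ S.v4 ∧ x ≠ S.v8 := by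
        intro x hx
        simpa [unitNodes, td0Equiv, not_or] using hx
      have o1 := hout (x := S.v5) hS2.x₁
      have o2 := hout (x := S.v9) hS2.y₁
      have o3 := hout (x := S.v6) hS2.x₂
      have o4 := hout (x := S.v10) hS2.y₂
      have hk1 : 2 ≤ simpleCount G' v₁ := two_le_simpleCount e1 f1 o1.2.2.1.symm
      have hk2 : 2 ≤ simpleCount G' v₂ := two_le_simpleCount e2 f2 o3.2.2.2.2.1.symm
      have hb : 0 < bTD0_1 G' {v₁, v₂, S.v3, S.v4, S.v5, S.v6} := by
        have hy1 : S.v7 ≠ v₁ ∧ S.v7 ≠ v₂ := ne_of_notMem_pair hS1.y₁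
        have hy2 : S.v8 ≠ v₁ ∧ S.v8 ≠ v₂ := ne_of_notMem_pair hS1.y₂
        have hy3 : S.v7 ≠ S.v3 := (mem_simpleArcs.1 hS1.simple₁).1.symm
        have hy4 : S.v8 ≠ S.v4 := (mem_simpleArcs.1 hS1.simple₂).1.symm
        have hy5 : S.v7 ≠ S.v4 := hS1.y₁x₂
        have hy6 : S.v8 ≠ S.v3 := hS1.x₁y₂.symm
        have hz3 : S.v9 ≠ S.v5 := (mem_simpleArcs.1 hS2.simple₁).1.symm
        have hz4 : S.v10 ≠ S.v6 := (mem_simpleArcs.1 hS2.simple₂).1.symm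
        have hz5 : S.v9 ≠ S.v6 := hS2.y₁x₂
        have hz6 : S.v10 ≠ S.v5 := hS2.x₁y₂.symm
        refine bTD0_1_pos e3 ?_ ?_ f3 ?_ ?_ ?_
        · simpa [not_or] using ⟨hy1.1, hy1.2, hy3, hy5, o1.2.2.2.1.symm, o3.2.2.2.1.symm⟩
        · simpa [not_or] using ⟨hy2.1, hy2.2, hy6, hy4, o1.2.2.2.2.2.symm, o3.2.2.2.2.2.symm⟩
        · simpa [not_or] using ⟨o2.1, o2.2.1, o2.2.2.1, o2.2.2.2.2.1, hz3, hz5⟩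
        · simpa [not_or] using ⟨o4.1, o4.2.1, o4.2.2.1, o4.2.2.2.2.1, hz6, hz4⟩
        · intro heq
          have := congrArg Prod.fst heq
          simp only [Sym2.eq_iff] at this
          rcases this with h' | h'
          · exact o2.2.2.2.1 h'.1.symm
          · exact o4.2.2.2.1 h'.1.symm
      have hbM := bTD0_1_le hG' {v₁, v₂, S.v3, S.v4, S.v5, S.v6}
      rw [bTD0Low0, simpleDeg_eq hG', simpleDeg_eq hG', bTD0_0, bTL0_eq, bTL0_eq, bTD0Low1]
      have hk1' : (2 : ℝ) ≤ simpleCount G' v₁ := by exact_mod_cast hk1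
      have hk2' : (2 : ℝ) ≤ simpleCount G' v₂ := by exact_mod_cast hk2
      rw [Nat.cast_mul, Nat.cast_mul, Nat.cast_mul, Nat.cast_sub (by omega),
        Nat.cast_sub (by omega), Nat.cast_one]
      have hc := h.c_nonneg
      have hc1 := h.c_le
      have h1 := h.slack_le
      have h2 := h.maxDeg_eq
      have h3 := h.M_pos
      have h5 : 0 ≤ BL D := by
        unfold BL
        positivity
      have p1 : 0 < (simpleCount G' v₁ : ℝ) * (simpleCount G' v₁ - 1) := by nlinarith
      have p2 : 0 < (simpleCount G' v₂ : ℝ) * (simpleCount G' v₂ - 1) := by nlinarith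
      refine le_ratio (M := (degSum D : ℝ) ^ 2) (mul_pos p1 p2) (by exact_mod_cast hb)
        (by exact_mod_cast hbM) ?_ (sq_nonneg _)
      rw [← mul_pow]
      refine pow_le_pow_left₀ (mul_nonneg (by linarith) h3.le) ?_ 2
      linarith)
    (aux := fun S => auxStep mu (4 * BD D)
      ![v₁, v₂, S.v3, S.v4, S.v5, S.v6, S.v7, S.v8, S.v9, S.v10]
      ![S.v3, S.v4, S.v5, S.v6] ![S.v7, S.v8, S.v9, S.v10]
      (unitsNext G v₁ v₂ t (td0Equiv D S).1 (td0Equiv D S).2))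
    (fun S Q' => le_wp_auxStep Q' h.aux₃) hV hQ
  simp only [← hnxt] at this
  exact this

end Steps

end TGen

end

noncomputable section

namespace TGen

variable {D : Input}

/-! ## The two stages -/

/-- No node occurs more than `K` times in `rest`, and `rest` has at most `1 / c` elements. -/
def IsLight (c K : ℝ) (rest : Multiset (Sym2 (Node D))) : Prop :=
  (∀ v, (occ rest v : ℝ) ≤ K) ∧ rest.card * c ≤ 1

theorem IsLight.add_right {c K : ℝ} (hc : 0 ≤ c) {r s : Multiset (Sym2 (Node D))}
    (h : IsLight c K (r + s)) : IsLight c K s := by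
  refine ⟨fun v => le_trans ?_ (h.1 v), le_trans ?_ h.2⟩
  · rw [occ_add]
    push_cast
    exact le_add_of_nonneg_left (Nat.cast_nonneg _)
  · rw [Multiset.card_add]
    push_cast
    gcongr
    exact le_add_of_nonneg_left (Nat.cast_nonneg _)

theorem stoppedPotential_le_cons {c κ : ℝ} (hc : 0 ≤ c) (hκ : 0 ≤ κ) (m₀ m : Sym2 (Node D) → ℕ)
    (p : Sym2 (Node D)) (rest : Multiset (Sym2 (Node D))) :
    stoppedPotential c κ m₀ rest m ≤ stoppedPotential c κ m₀ (p ::ₘ rest) m := by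
  unfold stoppedPotential
  split_ifs
  · exact min_le_min_right _ (potential_le_cons hc hκ p rest)
  · exact le_rfl

/-! ### Induction along the list of defects -/

section Fold

variable {α : Type} {c κ K : ℝ} {G₀ : TGraph D} {step : TGraph D → α → Prog D (TGraph D)}
  {edge : α → TEdge D} {P : α → Prop} {n : ℕ} {Q : TGraph D → ℝ≥0∞}

theorem nsmul_cons_map_fst (n : ℕ) (e : TEdge D) (s : Multiset (TEdge D))
    (rest : Multiset (Sym2 (Node D))) :
    n • ((e ::ₘ s).map Prod.fst) + rest = n • {e.1} + (n • s.map Prod.fst + rest) := by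
  rw [Multiset.map_cons, ← Multiset.singleton_add, nsmul_add, add_assoc]

/-- Here `n` is the number of units reserved for each defect of the list. The set `R₀` and the
multiset `rest` stand for what is handled after this list, so that in Stage 1 the invariant keeps
the double-edges of Stage 2 untouched. -/
theorem wp_foldlM_le {B : Set (TGraph D)} {R₀ : Set (TEdge D)}
    {rest : Multiset (Sym2 (Node D))} (hc : 0 ≤ c)
    (hstep : ∀ (a : α) (G : TGraph D) (R R' : Set (TEdge D)) (rest : Multiset (Sym2 (Node D)))
      (Q : TGraph D → ℝ≥0∞), P a → StageInv G₀ G R → edge a ∈ R → R' ⊆ R → edge a ∉ R' →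
      IsLight c K (n • {(edge a).1} + rest) → (∀ G, Q G ≤ 1) →
      (∀ G', StageInv G₀ G' R' →
        Q G' ≤ ENNReal.ofReal (stoppedPotential c κ (pairMult G₀) rest (pairMult G'))) →
      wp B (step G a) Q ≤ ENNReal.ofReal
        (stoppedPotential c κ (pairMult G₀) (n • {(edge a).1} + rest) (pairMult G)))
    (hQ1 : ∀ G, Q G ≤ 1) (hQ : ∀ G', StageInv G₀ G' R₀ →
      Q G' ≤ ENNReal.ofReal (stoppedPotential c κ (pairMult G₀) rest (pairMult G'))) :
    ∀ (l : List α) (G : TGraph D), (l.map edge).Nodup → (∀ a ∈ l, P a ∧ edge a ∉ R₀) →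
      StageInv G₀ G ({e | e ∈ l.map edge} ∪ R₀) →
      IsLight c K (n • ((l.map edge : Multiset (TEdge D)).map Prod.fst) + rest) →
      wp B (l.foldlM step G) Q ≤ ENNReal.ofReal (stoppedPotential c κ (pairMult G₀)
        (n • ((l.map edge : Multiset (TEdge D)).map Prod.fst) + rest) (pairMult G))
  | [], G, _, _, hinv, _ => by
    rw [List.foldlM_nil, wp_pure]
    simpa using hQ G (by simpa using hinv)
  | a :: l, G, hnd, hR₀, hinv, hl => by
    rw [List.foldlM_cons, wp_bind]
    rw [List.map_cons, ← Multiset.cons_coe, nsmul_cons_map_fst] at hl ⊢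
    rw [List.map_cons, List.nodup_cons] at hnd
    refine hstep a G _ ({e | e ∈ l.map edge} ∪ R₀) _ _ (hR₀ a List.mem_cons_self).1 hinv (by simp) ?_ ?_ hl
      (fun G => wp_le_one B hQ1) fun G' hG' =>
        wp_foldlM_le hc hstep hQ1 hQ l G' hnd.2 (fun a ha => hR₀ a (List.mem_cons_of_mem _ ha)) hG'
          (hl.add_right hc)
    · refine Set.union_subset_union_left _ fun e he => ?_
      exact List.mem_cons_of_mem _ he
    · rintro (h | h)
      · exact hnd.1 h
      · exact (hR₀ a List.mem_cons_self).2 h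

/-- The value of the result is bounded below by V(1 - potential); each element of the list
multiplies V by the acceptance probability ρ and moves its units into the potential. -/
theorem le_wp_foldlM {R₀ : Set (TEdge D)} {rest : Multiset (Sym2 (Node D))} {ρ V : ℝ}
    (hρ : 0 ≤ ρ) (hV : 0 ≤ V) (hc : 0 ≤ c)
    (hstep : ∀ (a : α) (G : TGraph D) (R R' : Set (TEdge D)) (rest : Multiset (Sym2 (Node D)))
      (Q : TGraph D → ℝ≥0∞) (V : ℝ), P a → 0 ≤ V → StageInv G₀ G R → edge a ∈ R → R' ⊆ R → edge a ∉ R' →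
      IsLight c K (n • {(edge a).1} + rest) →
      (∀ G', StageInv G₀ G' R' → ENNReal.ofReal
        (V * (1 - stoppedPotential c κ (pairMult G₀) rest (pairMult G'))) ≤ Q G') →
      ENNReal.ofReal (ρ * V * (1 - stoppedPotential c κ (pairMult G₀) (n • {(edge a).1} + rest)
        (pairMult G))) ≤ wp ∅ (step G a) Q)
    (hQ : ∀ G', StageInv G₀ G' R₀ → ENNReal.ofReal
        (V * (1 - stoppedPotential c κ (pairMult G₀) rest (pairMult G'))) ≤ Q G') :
    ∀ (l : List α) (G : TGraph D), (l.map edge).Nodup → (∀ a ∈ l, P a ∧ edge a ∉ R₀) →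
      StageInv G₀ G ({e | e ∈ l.map edge} ∪ R₀) →
      IsLight c K (n • ((l.map edge : Multiset (TEdge D)).map Prod.fst) + rest) →
      ENNReal.ofReal (ρ ^ l.length * V * (1 - stoppedPotential c κ (pairMult G₀)
        (n • ((l.map edge : Multiset (TEdge D)).map Prod.fst) + rest) (pairMult G))) ≤
      wp ∅ (l.foldlM step G) Q
  | [], G, _, _, hinv, _ => by
    rw [List.foldlM_nil, wp_pure]
    simpa using hQ G (by simpa using hinv)
  | a :: l, G, hnd, hR₀, hinv, hl => by
    rw [List.foldlM_cons, wp_bind]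
    rw [List.map_cons, ← Multiset.cons_coe, nsmul_cons_map_fst] at hl ⊢
    rw [List.map_cons, List.nodup_cons] at hnd
    rw [List.length_cons, pow_succ', mul_assoc ρ]
    refine hstep a G _ ({e | e ∈ l.map edge} ∪ R₀) _ _ _ (hR₀ a List.mem_cons_self).1 (by positivity) hinv (by simp) ?_ ?_ hl
      fun G' hG' => le_wp_foldlM hρ hV hc hstep hQ l G' hnd.2
        (fun a ha => hR₀ a (List.mem_cons_of_mem _ ha)) hG'
          (hl.add_right hc)
    · refine Set.union_subset_union_left _ fun e he => ?_
      exact List.mem_cons_of_mem _ he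
    · rintro (h | h)
      · exact hnd.1 h
      · exact (hR₀ a List.mem_cons_self).2 h

end Fold

/-- The defects of `G` that are loops. -/
def loopDefects (G : TGraph D) : Finset (TEdge D) := {e | e.1.IsDiag ∧ defect G e = 1}

/-- The defects of `G` that are temporal double-edges. -/
def doubleDefects (G : TGraph D) : Finset (TEdge D) := {e | ¬ e.1.IsDiag ∧ defect G e = 2}

theorem mem_loopDefects {G : TGraph D} {e : TEdge D} :
    e ∈ loopDefects G ↔ e.1.IsDiag ∧ defect G e = 1 := by
  simp [loopDefects]

theorem mem_doubleDefects {G : TGraph D} {e : TEdge D} :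
    e ∈ doubleDefects G ↔ ¬ e.1.IsDiag ∧ defect G e = 2 := by
  simp [doubleDefects]

def loopEdge (l : Node D × Stamp D) : TEdge D := (s(l.1, l.1), l.2)

def doubleEdge (e : Node D × Node D × Stamp D) : TEdge D := (s(e.1, e.2.1), e.2.2)

/-- The order of removal is irrelevant for the bounds: only the multiset of listed edges enters, and
it is that of all loop defects. -/
theorem map_loopEdge_loops (π : RemovalOrder D) (G : TGraph D) :
    ((π.loops (W G)).map loopEdge : Multiset (TEdge D)) = (loopDefects G).val := by
  refine (Multiset.Nodup.ext ?_ (loopDefects G).nodup).2 fun e => ?_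
  · refine Multiset.coe_nodup.2 ((π.loops_nodup G).map fun a b hab => ?_)
    simp only [loopEdge, Prod.mk.injEq, Sym2.eq_iff, and_self, or_self] at hab
    exact Prod.ext hab.1 hab.2
  · simp only [Multiset.mem_coe, List.mem_map, Finset.mem_val, mem_loopDefects]
    constructor
    · rintro ⟨⟨i, t⟩, h, rfl⟩
      exact ⟨rfl, (W_eq G i i t).symm.trans ((π.mem_loops G i t).1 h)⟩
    · obtain ⟨p, t⟩ := e
      induction p using Sym2.ind with
      | _ i j =>
        rintro ⟨h, h'⟩
        obtain rfl : i = j := h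
        exact ⟨(i, t), (π.mem_loops G i t).2 ((W_eq G i i t).trans h'), rfl⟩

theorem map_doubleEdge_doubles (π : RemovalOrder D) (G : TGraph D) :
    ((π.doubles (W G)).map doubleEdge : Multiset (TEdge D)) = (doubleDefects G).val := by
  refine (Multiset.Nodup.ext ?_ (doubleDefects G).nodup).2 fun e => ?_
  · refine Multiset.coe_nodup.2 ((π.doubles_nodup G).map_on ?_)
    rintro ⟨i, j, t⟩ h ⟨i', j', t'⟩ h' heq
    simp only [doubleEdge, Prod.mk.injEq, Sym2.eq_iff] at heq
    obtain ⟨⟨rfl, rfl⟩ | ⟨rfl, rfl⟩, rfl⟩ := heq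
    · rfl
    -- Two list entries with the same edge but opposite orientations are excluded by `doubles_once`.
    · have h2 := π.of_mem_doubles G i j t h
      rcases π.doubles_once G i j t h2.1 h2.2 with ⟨-, h3⟩ | ⟨-, h3⟩
      · exact (h3 h').elim
      · exact (h3 h).elim
  · simp only [Multiset.mem_coe, List.mem_map, Finset.mem_val, mem_doubleDefects]
    constructor
    · rintro ⟨⟨i, j, t⟩, h, rfl⟩
      have h2 := π.of_mem_doubles G i j t h
      exact ⟨h2.1, (W_eq G i j t).symm.trans h2.2⟩
    · obtain ⟨p, t⟩ := e
      induction p using Sym2.ind with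
      | _ i j =>
        rintro ⟨h, h'⟩
        rcases π.doubles_once G i j t h ((W_eq G i j t).trans h') with ⟨h3, -⟩ | ⟨h3, -⟩
        · exact ⟨_, h3, rfl⟩
        · exact ⟨_, h3, Prod.ext Sym2.eq_swap rfl⟩

/-- The switchings that the stages have to perform on `G`, a `TD₀` switching counting twice. -/
def stageUnits (G : TGraph D) : Multiset (Sym2 (Node D)) :=
  1 • (loopDefects G).val.map Prod.fst + (2 • (doubleDefects G).val.map Prod.fst + 0)

/-- Stage 2 reads its list from a random graph, but the set of edges on that list is not random.
Defects do not grow, so no new double-edges appear, and those waiting for Stage 2 are unchanged. -/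
theorem doubleDefects_eq_of_stageInv {G₀ G : TGraph D}
    (h3 : ∀ e : TEdge D, ¬ e.1.IsDiag → defect G₀ e ≤ 2)
    (h : StageInv G₀ G (doubleDefects G₀)) : doubleDefects G = doubleDefects G₀ := by
  ext e
  refine ⟨fun he => ?_, fun he => ?_⟩
  · have he' := mem_doubleDefects.1 he
    have := h.defect_le e
    exact mem_doubleDefects.2 ⟨he'.1, le_antisymm (h3 e he'.1) (he'.2.ge.trans this)⟩
  · have he' := mem_doubleDefects.1 he
    exact mem_doubleDefects.2 ⟨he'.1, (h.defect_eq e he).trans he'.2⟩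

section Stages

variable {mu : ℕ} {c κ η η' K : ℝ} {G₀ : TGraph D}

/-- Both stages, performed on the graph `G`. -/
def stages (mu : ℕ) (π : RemovalOrder D) (G : TGraph D) : Prog D (TGraph D) := do
  let G₁ ← (π.loops (W G)).foldlM (stage1Step mu) G
  (π.doubles (W G₁)).foldlM (stage2Step mu) G₁

/-- The ratio between the probabilities of TD₁ and TD₀ plays no role. Both types satisfy the same
bound, because two units are reserved for every double-edge and the potential is monotone in the
reserve; TD₁ simply leaves one unit unused. -/
theorem wp_stage2Step_le {B : Set (TGraph D)}
    (hB : ∀ G', (∀ p, pairMult G' p ≤ pairMult G₀ p + 1) → G' ∉ B)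
    (h : StageParams D mu c κ η η' K) (e : Node D × Node D × Stamp D) (hv : e.1 ≠ e.2.1)
    (G : TGraph D) (R R' : Set (TEdge D)) (rest : Multiset (Sym2 (Node D)))
    (Q : TGraph D → ℝ≥0∞) (hinv : StageInv G₀ G R) (hR : R' ⊆ R) (he : doubleEdge e ∉ R')
    (hl : IsLight c K (2 • {(doubleEdge e).1} + rest)) (hQ1 : ∀ G, Q G ≤ 1)
    (hQ : ∀ G', StageInv G₀ G' R' →
      Q G' ≤ ENNReal.ofReal (stoppedPotential c κ (pairMult G₀) rest (pairMult G'))) :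
    wp B (stage2Step mu G e) Q ≤ ENNReal.ofReal
      (stoppedPotential c κ (pairMult G₀) (2 • {(doubleEdge e).1} + rest) (pairMult G)) := by
  have hl1 : IsLight c K ((doubleEdge e).1 ::ₘ rest) := by
    rw [two_nsmul, add_assoc] at hl
    simpa using hl.add_right h.c_nonneg
  have hl0 : IsLight c K rest := hl.add_right h.c_nonneg
  have e2 : 2 • {(doubleEdge e).1} + rest = s(e.1, e.2.1) ::ₘ s(e.1, e.2.1) ::ₘ rest := by
    rw [two_nsmul, add_assoc, Multiset.singleton_add, Multiset.singleton_add]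
    rfl
  rw [e2, stage2Step, wp_bind, wp_sample]
  set X := ENNReal.ofReal (stoppedPotential c κ (pairMult G₀)
    (s(e.1, e.2.1) ::ₘ s(e.1, e.2.1) ::ₘ rest) (pairMult G)) with hX
  calc _ ≤ ∑' θ, (ratioDist fun _ : Unit => tdRatio mu G e.1 e.2.1 e.2.2) θ * X := by
        refine ENNReal.tsum_le_tsum fun θ => mul_le_mul_right ?_ _
        cases θ with
        | none => exact wp_td0Step_le hB h hinv hl1.1 hl1.2 hR he hQ1 hQ
        | some _ =>
          exact (wp_td1Step_le hB h hinv hl0.1 hl0.2 hR hv he hQ1 hQ).trans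
            (ENNReal.ofReal_le_ofReal (stoppedPotential_le_cons h.c_nonneg h.κ_nonneg _ _ _ _))
    _ = X := by rw [ENNReal.tsum_mul_right, PMF.tsum_coe, one_mul]

theorem le_wp_stage2Step (h : StageParams D mu c κ η η' K) (hG₀ : FewDefects G₀)
    (hmu : 1 ≤ mu) (hmuT : mu ≤ D.T) (hmult : ∀ p, pairMult G₀ p + 1 ≤ mu)
    (e : Node D × Node D × Stamp D) (hv : e.1 ≠ e.2.1)
    (G : TGraph D) (R R' : Set (TEdge D)) (rest : Multiset (Sym2 (Node D)))
    (Q : TGraph D → ℝ≥0∞) (V : ℝ) (hV : 0 ≤ V) (hinv : StageInv G₀ G R)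
    (hw : w G e.1 e.2.1 e.2.2 = 2) (hR : R' ⊆ R) (he : doubleEdge e ∉ R')
    (hl : IsLight c K (2 • {(doubleEdge e).1} + rest))
    (hQ : ∀ G', StageInv G₀ G' R' → ENNReal.ofReal
      (V * (1 - stoppedPotential c κ (pairMult G₀) rest (pairMult G'))) ≤ Q G') :
    ENNReal.ofReal (stampBound D mu ^ 2 * V * (1 - stoppedPotential c κ (pairMult G₀)
      (2 • {(doubleEdge e).1} + rest) (pairMult G))) ≤ wp ∅ (stage2Step mu G e) Q := by
  have hl1 : IsLight c K ((doubleEdge e).1 ::ₘ rest) := by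
    rw [two_nsmul, add_assoc] at hl
    simpa using hl.add_right h.c_nonneg
  have hl0 : IsLight c K rest := hl.add_right h.c_nonneg
  have e2 : 2 • {(doubleEdge e).1} + rest = s(e.1, e.2.1) ::ₘ s(e.1, e.2.1) ::ₘ rest := by
    rw [two_nsmul, add_assoc, Multiset.singleton_add, Multiset.singleton_add]
    rfl
  rw [e2, stage2Step, wp_bind, wp_sample]
  set X := ENNReal.ofReal (stampBound D mu ^ 2 * V * (1 - stoppedPotential c κ (pairMult G₀)
    (s(e.1, e.2.1) ::ₘ s(e.1, e.2.1) ::ₘ rest) (pairMult G))) with hX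
  calc X = ∑' θ, (ratioDist fun _ : Unit => tdRatio mu G e.1 e.2.1 e.2.2) θ * X := by
        rw [ENNReal.tsum_mul_right, PMF.tsum_coe, one_mul]
    _ ≤ _ := by
        refine ENNReal.tsum_le_tsum fun θ => mul_le_mul_right ?_ _
        cases θ with
        | none => exact le_wp_td0Step h hG₀ hmu hmuT hmult hinv hl1.1 hl1.2 hw hR he hV hQ
        | some _ =>
          -- TD₁ pays the timestamp factor only once and uses one of the two reserved units, so its
          -- own bound is stronger.
          refine le_trans (ENNReal.ofReal_le_ofReal ?_)
            (le_wp_td1Step h hG₀ hmu hmuT hmult hinv hl0.1 hl0.2 hv hw hR he hV hQ)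
          have h1 := stoppedPotential_le_cons h.c_nonneg h.κ_nonneg (pairMult G₀) (pairMult G)
            s(e.1, e.2.1) (s(e.1, e.2.1) ::ₘ rest)
          have h2 := stoppedPotential_le_one (c := c) (κ := κ) (m₀ := pairMult G₀) (m := pairMult G)
            (s(e.1, e.2.1) ::ₘ s(e.1, e.2.1) ::ₘ rest)
          have h3 : stampBound D mu ^ 2 ≤ stampBound D mu :=
            pow_le_of_le_one (stampBound_nonneg mu) (stampBound_le_one hmu hmuT) two_ne_zero
          have h4 := stampBound_nonneg (D := D) mu
          exact mul_le_mul (mul_le_mul_of_nonneg_right h3 hV) (by linarith) (by linarith)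
            (mul_nonneg h4 hV)

/-- The only defects of `G₀` are loops of multiplicity one and double-edges. -/
def MildDefects (G₀ : TGraph D) : Prop :=
  ∀ e : TEdge D, (e.1.IsDiag → defect G₀ e ≤ 1) ∧ (¬ e.1.IsDiag → defect G₀ e ≤ 2)

theorem w_eq_one_of_defect {G : TGraph D} {i : Node D} {t : Stamp D}
    (h : defect G (s(i, i), t) = 1) : w G i i t = 1 := by
  rw [← W_eq, W, if_pos rfl] at h
  exact h

theorem w_eq_two_of_defect {G : TGraph D} {i j : Node D} {t : Stamp D} (hij : i ≠ j)
    (h : defect G (s(i, j), t) = 2) : w G i j t = 2 := by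
  rw [← W_eq, W, if_neg hij] at h
  split_ifs at h
  exact h

theorem loop_of_mem_loops (π : RemovalOrder D) {G : TGraph D} {a : Node D × Stamp D}
    (ha : a ∈ π.loops (W G)) : defect G (loopEdge a) = 1 :=
  (W_eq G a.1 a.1 a.2).symm.trans ((π.mem_loops G a.1 a.2).1 ha)

theorem setOf_mem_map_eq {α : Type*} {l : List α} {f : α → TEdge D} {s : Finset (TEdge D)}
    (h : (l.map f : Multiset (TEdge D)) = s.val) : {e | e ∈ l.map f} = (s : Set (TEdge D)) := by
  ext e
  rw [Set.mem_ofPred_eq, ← Multiset.mem_coe, h, Finset.mem_val, Finset.mem_coe]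

theorem stageInv_self (hG : Matches G₀) (R : Set (TEdge D)) : StageInv G₀ G₀ R :=
  ⟨hG, fun _ => le_rfl, fun _ _ => rfl, fun _ => Nat.le_succ _⟩

theorem doubles_spec (π : RemovalOrder D) (h3 : MildDefects G₀) {G₁ : TGraph D}
    (hG₁ : StageInv G₀ G₁ (doubleDefects G₀)) :
    ((π.doubles (W G₁)).map doubleEdge : Multiset (TEdge D)) = (doubleDefects G₀).val ∧
      ∀ a ∈ π.doubles (W G₁), a.1 ≠ a.2.1 ∧ defect G₀ (doubleEdge a) = 2 := by
  have h1 : ((π.doubles (W G₁)).map doubleEdge : Multiset (TEdge D)) = (doubleDefects G₀).val := by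
    rw [map_doubleEdge_doubles, doubleDefects_eq_of_stageInv (fun e => (h3 e).2) hG₁]
  refine ⟨h1, fun a ha => ?_⟩
  have : doubleEdge a ∈ (doubleDefects G₀).val := by
    rw [← h1]
    exact Multiset.mem_coe.2 (List.mem_map_of_mem ha)
  exact mem_doubleDefects.1 this

theorem wp_stages_le {B : Set (TGraph D)}
    (hB : ∀ G', (∀ p, pairMult G' p ≤ pairMult G₀ p + 1) → G' ∉ B)
    (h : StageParams D mu c κ η η' K) (hG : Matches G₀) (h3 : MildDefects G₀)
    (hl : IsLight c K (stageUnits G₀)) (π : RemovalOrder D) :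
    wp B (stages mu π G₀) (fun _ => 0) ≤ ENNReal.ofReal ((stageUnits G₀).card * κ) := by
  have key : wp B (stages mu π G₀) (fun _ => 0) ≤ ENNReal.ofReal
      (stoppedPotential c κ (pairMult G₀) (stageUnits G₀) (pairMult G₀)) := by
    rw [stages, wp_bind]
    have e1 := map_loopEdge_loops π G₀
    have := wp_foldlM_le (B := B) (G₀ := G₀) (K := K) (κ := κ) (step := stage1Step mu)
      (edge := loopEdge) (P := fun a => defect G₀ (loopEdge a) = 1) (n := 1)
      (R₀ := (doubleDefects G₀ : Set (TEdge D)))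
      (rest := 2 • (doubleDefects G₀).val.map Prod.fst + 0)
      (Q := fun G₁ => wp B ((π.doubles (W G₁)).foldlM (stage2Step mu) G₁) fun _ => 0) h.c_nonneg
      ?_ (fun G => wp_le_one B fun _ => zero_le_one) ?_ (π.loops (W G₀)) G₀ ?_ ?_
      (stageInv_self hG _) ?_
    · rw [e1] at this
      exact this
    · intro a G R R' rest Q ha hinv _ hR he hl hQ1 hQ
      rw [one_nsmul, Multiset.singleton_add] at hl ⊢
      have hl0 : IsLight c K rest := by
        rw [← Multiset.singleton_add] at hl
        exact hl.add_right h.c_nonneg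
      exact wp_stage1Step_le hB h hinv hl0.1 hl0.2 hR he hQ1 hQ
    · intro G₁ hG₁
      obtain ⟨e2, hd⟩ := doubles_spec π h3 hG₁
      have := wp_foldlM_le (B := B) (G₀ := G₀) (K := K) (κ := κ) (step := stage2Step mu)
        (edge := doubleEdge) (P := fun a => a.1 ≠ a.2.1 ∧ defect G₀ (doubleEdge a) = 2) (n := 2)
        (R₀ := ∅) (rest := 0) (Q := fun _ => 0) h.c_nonneg ?_ (fun G => zero_le_one) ?_
        (π.doubles (W G₁)) G₁ ?_ (fun a ha => ⟨hd a ha, fun h => h.elim⟩) ?_ ?_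
      · rw [e2] at this
        exact this
      · intro a G R R' rest Q ha hinv _ hR he hl hQ1 hQ
        exact wp_stage2Step_le hB h a ha.1 G R R' rest Q hinv hR he hl hQ1 hQ
      · exact fun _ _ => zero_le
      · rw [← Multiset.coe_nodup, e2]
        exact (doubleDefects G₀).nodup
      · rw [setOf_mem_map_eq e2, Set.union_empty]
        exact hG₁
      · rw [e2]
        exact hl.add_right h.c_nonneg
    · rw [← Multiset.coe_nodup, e1]
      exact (loopDefects G₀).nodup
    · intro a ha
      refine ⟨loop_of_mem_loops π ha, fun h' => ?_⟩
      exact (mem_doubleDefects.1 h').1 rfl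
    · rw [e1]
      exact hl
  refine key.trans (ENNReal.ofReal_le_ofReal ?_)
  -- At the start nothing has been hit, and the potential is the number of units times κ.
  rw [stoppedPotential, if_pos fun p => Nat.le_succ _, potential_self]
  exact min_le_left _ _

theorem le_wp_stages (h : StageParams D mu c κ η η' K) (hG₀ : FewDefects G₀)
    (hmu : 1 ≤ mu) (hmuT : mu ≤ D.T) (hmult : ∀ p, pairMult G₀ p + 1 ≤ mu)
    (hG : Matches G₀) (h3 : MildDefects G₀) (hl : IsLight c K (stageUnits G₀))
    (π : RemovalOrder D) :
    ENNReal.ofReal (stampBound D mu ^ (stageUnits G₀).card * (1 - (stageUnits G₀).card * κ)) ≤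
      wp ∅ (stages mu π G₀) (fun _ => 1) := by
  have hs := stampBound_nonneg (D := D) mu
  have key : ENNReal.ofReal (stampBound D mu ^ (#(loopDefects G₀)) *
      (stampBound D mu ^ 2) ^ (#(doubleDefects G₀)) * (1 -
      stoppedPotential c κ (pairMult G₀) (stageUnits G₀) (pairMult G₀))) ≤
      wp ∅ (stages mu π G₀) (fun _ => 1) := by
    rw [stages, wp_bind]
    have e1 := map_loopEdge_loops π G₀
    have := le_wp_foldlM (G₀ := G₀) (K := K) (κ := κ) (step := stage1Step mu) (c := c)
      (edge := loopEdge) (P := fun a => defect G₀ (loopEdge a) = 1) (n := 1)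
      (R₀ := (doubleDefects G₀ : Set (TEdge D)))
      (rest := 2 • (doubleDefects G₀).val.map Prod.fst + 0)
      (ρ := stampBound D mu) (V := (stampBound D mu ^ 2) ^ (#(doubleDefects G₀)))
      (Q := fun G₁ => wp ∅ ((π.doubles (W G₁)).foldlM (stage2Step mu) G₁) fun _ => 1)
      hs (by positivity) h.c_nonneg ?_ ?_ (π.loops (W G₀)) G₀ ?_ ?_ (stageInv_self hG _) ?_
    · have hlen : (π.loops (W G₀)).length = #(loopDefects G₀) := by
        rw [← List.length_map (f := loopEdge), ← Multiset.coe_card, e1]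
        rfl
      rw [e1, hlen] at this
      exact this
    · intro a G R R' rest Q V ha hV hinv hR' hR he hl hQ
      rw [one_nsmul, Multiset.singleton_add] at hl ⊢
      have hl0 : IsLight c K rest := by
        rw [← Multiset.singleton_add] at hl
        exact hl.add_right h.c_nonneg
      exact le_wp_stage1Step h hG₀ hmu hmuT hmult hinv hl0.1 hl0.2
        (w_eq_one_of_defect ((hinv.defect_eq _ hR').trans ha)) hR he hV hQ
    · intro G₁ hG₁
      obtain ⟨e2, hd⟩ := doubles_spec π h3 hG₁
      have := le_wp_foldlM (G₀ := G₀) (K := K) (κ := κ) (step := stage2Step mu) (c := c)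
        (edge := doubleEdge) (P := fun a => a.1 ≠ a.2.1 ∧ defect G₀ (doubleEdge a) = 2) (n := 2)
        (R₀ := ∅) (rest := 0) (Q := fun _ => 1) (ρ := stampBound D mu ^ 2) (V := 1) (by positivity)
        zero_le_one h.c_nonneg ?_ ?_
        (π.doubles (W G₁)) G₁ ?_ (fun a ha => ⟨hd a ha, fun h => h.elim⟩) ?_ ?_
      · have hlen : (π.doubles (W G₁)).length = #(doubleDefects G₀) := by
          rw [← List.length_map (f := doubleEdge), ← Multiset.coe_card, e2]
          rfl
        rw [e2, hlen, mul_one] at this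
        exact this
      · intro a G R R' rest Q V ha hV hinv hR' hR he hl hQ
        exact le_wp_stage2Step h hG₀ hmu hmuT hmult a ha.1 G R R' rest Q V hV hinv
          (w_eq_two_of_defect ha.1 ((hinv.defect_eq _ hR').trans ha.2)) hR he hl hQ
      · intro G' _
        rw [one_mul]
        refine ENNReal.ofReal_le_one.2 ?_
        have := stoppedPotential_nonneg (m₀ := pairMult G₀) (m := pairMult G') h.c_nonneg
          h.κ_nonneg 0
        linarith
      · rw [← Multiset.coe_nodup, e2]
        exact (doubleDefects G₀).nodup
      · rw [setOf_mem_map_eq e2, Set.union_empty]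
        exact hG₁
      · rw [e2]
        exact hl.add_right h.c_nonneg
    · rw [← Multiset.coe_nodup, e1]
      exact (loopDefects G₀).nodup
    · intro a ha
      refine ⟨loop_of_mem_loops π ha, fun h' => ?_⟩
      exact (mem_doubleDefects.1 h').1 rfl
    · rw [e1]
      exact hl
  refine le_trans (ENNReal.ofReal_le_ofReal ?_) key
  have hcard : (stageUnits G₀).card = #(loopDefects G₀) + 2 * #(doubleDefects G₀) := by
    simp [stageUnits]
  rw [hcard, pow_add, pow_mul]
  refine mul_le_mul_of_nonneg_left ?_ (by positivity)
  rw [stoppedPotential, if_pos fun p => Nat.le_succ _, potential_self, hcard]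
  linarith [min_le_left ((((#(loopDefects G₀) + 2 * #(doubleDefects G₀) : ℕ) : ℝ)) * κ) 1]

end Stages

end TGen

end

noncomputable section

namespace TGen

variable {D : Input}

/-! ## Consequences of the initial conditions -/

theorem degSum₂_le : degSum₂ D ≤ maxDeg D * degSum D := by
  rw [degSum₂, degSum, Finset.mul_sum]
  refine Finset.sum_le_sum fun i _ => ?_
  rw [mul_comm]
  exact Nat.mul_le_mul_right _ ((Nat.sub_le _ _).trans (le_maxDeg i))

theorem BL_nonneg : 0 ≤ BL D := by
  unfold BL
  positivity

theorem BD_nonneg : 0 ≤ BD D := by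
  unfold BD
  positivity

theorem BL_le : BL D ≤ maxDeg D := by
  unfold BL
  refine div_le_of_le_mul₀ (Nat.cast_nonneg _) (Nat.cast_nonneg _) ?_
  exact_mod_cast degSum₂_le

/-- B_D = B_L²/T ≤ Δ²/T ≤ Δ. -/
theorem BD_le (hT : maxDeg D ≤ D.T) : BD D ≤ maxDeg D := by
  have h1 : BD D = BL D ^ 2 / D.T := by
    unfold BD BL
    rw [div_pow, div_div]
  rw [h1, div_le_iff₀ (T_pos' D)]
  have h2 : BL D ^ 2 ≤ (maxDeg D : ℝ) ^ 2 := pow_le_pow_left₀ BL_nonneg BL_le 2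
  have h3 : (maxDeg D : ℝ) ≤ D.T := by exact_mod_cast hT
  have h4 : (0 : ℝ) ≤ maxDeg D := Nat.cast_nonneg _
  nlinarith

theorem card_loopDefects_le (G : TGraph D) : #(loopDefects G) ≤ sumLoops G := by
  have h1 : loopDefects G ⊆
      ({x : Node D × Stamp D | W G x.1 x.1 x.2 = 1} : Finset _).image loopEdge := by
    rintro ⟨p, t⟩ he
    induction p using Sym2.ind with
    | _ i j =>
      have h := mem_loopDefects.1 he
      obtain rfl : i = j := h.1
      exact Finset.mem_image.2 ⟨(i, t), by simpa [W_eq] using h.2, rfl⟩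
  refine (Finset.card_le_card h1).trans (Finset.card_image_le.trans ?_)
  rw [sumLoops, ← Finset.sum_product', Finset.univ_product_univ, Finset.card_eq_sum_ones]
  refine (Finset.sum_le_sum fun x hx => (Finset.mem_filter.1 hx).2.ge).trans ?_
  exact Finset.sum_le_sum_of_subset (Finset.filter_subset _ _)

variable (D) in
/-- The index set of the sum of the multi-edges. -/
def orderedTriples : Finset (Σ _ : Node D, Σ _ : Node D, Stamp D) :=
  Finset.univ.sigma fun i => ({j | i < j} : Finset (Node D)).sigma fun _ => Finset.univ

theorem mem_orderedTriples {x : Σ _ : Node D, Σ _ : Node D, Stamp D} :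
    x ∈ orderedTriples D ↔ x.1 < x.2.1 := by
  simp [orderedTriples]

theorem sumMulti_eq (G : TGraph D) :
    sumMulti G = ∑ x ∈ orderedTriples D, W G x.1 x.2.1 x.2.2 := by
  rw [orderedTriples, Finset.sum_sigma, sumMulti]
  refine Finset.sum_congr rfl fun i _ => ?_
  rw [Finset.sum_sigma]

theorem two_mul_card_doubleDefects_le (G : TGraph D) : 2 * #(doubleDefects G) ≤ sumMulti G := by
  have h1 : doubleDefects G ⊆ ((orderedTriples D).filter fun x => W G x.1 x.2.1 x.2.2 = 2).image
      fun x => (s(x.1, x.2.1), x.2.2) := by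
    rintro ⟨p, t⟩ he
    induction p using Sym2.ind with
    | _ i j =>
      have h := mem_doubleDefects.1 he
      have hne : i ≠ j := h.1
      rcases lt_or_gt_of_ne hne with hlt | hlt
      · exact Finset.mem_image.2 ⟨⟨i, j, t⟩, by simpa [mem_orderedTriples, hlt, W_eq] using h.2, rfl⟩
      · refine Finset.mem_image.2 ⟨⟨j, i, t⟩, ?_, Prod.ext Sym2.eq_swap rfl⟩
        have h2 := h.2
        rw [Sym2.eq_swap] at h2
        simpa [mem_orderedTriples, hlt, W_eq] using h2
  rw [sumMulti_eq, mul_comm]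
  calc #(doubleDefects G) * 2 ≤ #((orderedTriples D).filter fun x => W G x.1 x.2.1 x.2.2 = 2) * 2 :=
        Nat.mul_le_mul_right _ ((Finset.card_le_card h1).trans Finset.card_image_le)
    _ ≤ ∑ x ∈ (orderedTriples D).filter fun x => W G x.1 x.2.1 x.2.2 = 2, W G x.1 x.2.1 x.2.2 := by
        rw [← smul_eq_mul]
        exact Finset.card_nsmul_le_sum _ _ _ fun x hx => (Finset.mem_filter.1 hx).2.ge
    _ ≤ _ := Finset.sum_le_sum_of_subset (Finset.filter_subset _ _)

theorem card_stageUnits (G : TGraph D) :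
    (stageUnits G).card = #(loopDefects G) + 2 * #(doubleDefects G) := by
  simp [stageUnits]

theorem card_stageUnits_le (G : TGraph D) : (stageUnits G).card ≤ sumLoops G + sumMulti G := by
  rw [card_stageUnits]
  exact add_le_add (card_loopDefects_le G) (two_mul_card_doubleDefects_le G)

theorem occ_map_fst (s : Finset (TEdge D)) (v : Node D) :
    occ (s.val.map Prod.fst) v = ∑ e ∈ s, inc e.1 v := by
  rw [occ, Multiset.map_map]
  rfl

theorem occ_nsmul (n : ℕ) (r : Multiset (Sym2 (Node D))) (v : Node D) :
    occ (n • r) v = n * occ r v := by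
  simp [occ, Multiset.map_nsmul, Multiset.sum_nsmul]

theorem inc_loop_le (p : Sym2 (Node D)) (v : Node D) : inc p v ≤ 2 := by
  induction p using Sym2.ind with
  | _ a b =>
    rw [inc_mk]
    split_ifs <;> omega

theorem inc_le_one {p : Sym2 (Node D)} (hp : ¬ p.IsDiag) (v : Node D) : inc p v ≤ 1 := by
  induction p using Sym2.ind with
  | _ a b =>
    have : a ≠ b := hp
    rw [inc_mk]
    split_ifs with h1 h2
    · exact (this (h1.trans h2.symm)).elim
    all_goals omega

theorem mem_of_inc_ne_zero {p : Sym2 (Node D)} {v : Node D} (h : inc p v ≠ 0) : v ∈ p := by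
  induction p using Sym2.ind with
  | _ a b =>
    rw [inc_mk] at h
    by_contra hv
    rw [Sym2.mem_iff, not_or] at hv
    rw [if_neg (Ne.symm hv.1), if_neg (Ne.symm hv.2)] at h
    exact h rfl

theorem occ_loopDefects_le {G : TGraph D} {lam : ℕ} {v : Node D}
    (h : #{t | W G v v t = 1} ≤ lam) : occ ((loopDefects G).val.map Prod.fst) v ≤ 2 * lam := by
  rw [occ_map_fst, ← Finset.sum_filter_ne_zero]
  have h1 : ((loopDefects G).filter fun e => inc e.1 v ≠ 0) ⊆
      ({t | W G v v t = 1} : Finset (Stamp D)).image fun t => (s(v, v), t) := by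
    rintro ⟨p, t⟩ he
    rw [Finset.mem_filter, mem_loopDefects] at he
    obtain ⟨⟨hd, hw⟩, hi⟩ := he
    induction p using Sym2.ind with
    | _ i j =>
      obtain rfl : i = j := hd
      have := mem_of_inc_ne_zero hi
      rw [Sym2.mem_iff, or_self] at this
      subst this
      exact Finset.mem_image.2 ⟨t, by simpa [W_eq] using hw, rfl⟩
  calc _ ≤ ∑ e ∈ (loopDefects G).filter fun e => inc e.1 v ≠ 0, 2 :=
        Finset.sum_le_sum fun e _ => inc_loop_le _ _
    _ = 2 * #((loopDefects G).filter fun e => inc e.1 v ≠ 0) := by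
        rw [Finset.sum_const, smul_eq_mul, mul_comm]
    _ ≤ _ := Nat.mul_le_mul_left _ (((Finset.card_le_card h1).trans Finset.card_image_le).trans h)

theorem occ_doubleDefects_le {G : TGraph D} {kap : ℕ} {v : Node D}
    (h : #{x : Node D × Stamp D | v ≠ x.1 ∧ W G v x.1 x.2 = 2} ≤ kap) :
    occ ((doubleDefects G).val.map Prod.fst) v ≤ kap := by
  rw [occ_map_fst, ← Finset.sum_filter_ne_zero]
  have h1 : ((doubleDefects G).filter fun e => inc e.1 v ≠ 0) ⊆
      ({x : Node D × Stamp D | v ≠ x.1 ∧ W G v x.1 x.2 = 2} : Finset _).image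
        fun x => (s(v, x.1), x.2) := by
    rintro ⟨p, t⟩ he
    rw [Finset.mem_filter, mem_doubleDefects] at he
    obtain ⟨⟨hd, hw⟩, hi⟩ := he
    obtain ⟨j, rfl⟩ := mem_of_inc_ne_zero hi
    have hj : v ≠ j := hd
    exact Finset.mem_image.2 ⟨(j, t), by simpa [W_eq, hj] using hw, rfl⟩
  calc _ ≤ ∑ e ∈ (doubleDefects G).filter fun e => inc e.1 v ≠ 0, 1 :=
        Finset.sum_le_sum fun e he => inc_le_one (mem_doubleDefects.1 (Finset.mem_filter.1 he).1).1 _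
    _ = #((doubleDefects G).filter fun e => inc e.1 v ≠ 0) := by simp
    _ ≤ _ := ((Finset.card_le_card h1).trans Finset.card_image_le).trans h

namespace InitialConditions

variable {lam kap : ℕ} {G : TGraph D}

/-- The bound is B_L + 2B_D with both quantities at most Δ. It limits the number of units, and twice
this bound limits the arcs lost to defects. -/
theorem sums_le (h : InitialConditions lam kap G) (hT : maxDeg D ≤ D.T) :
    sumLoops G + sumMulti G ≤ 3 * maxDeg D := by
  have h1 := h.loops_le
  have h2 := h.multi_le
  have h3 := BL_le (D := D)
  have h4 := BD_le hT
  have : ((sumLoops G + sumMulti G : ℕ) : ℝ) ≤ ((3 * maxDeg D : ℕ) : ℝ) := by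
    push_cast
    linarith
  exact_mod_cast this

theorem fewDefects (h : InitialConditions lam kap G) (hT : maxDeg D ≤ D.T) : FewDefects G := by
  have := h.sums_le hT
  have : 2 * sumLoops G + 2 * sumMulti G ≤ 6 * maxDeg D := by omega
  exact_mod_cast this

theorem mildDefects (h : InitialConditions lam kap G) : MildDefects G := by
  rintro ⟨p, t⟩
  induction p using Sym2.ind with
  | _ i j =>
    refine ⟨fun hd => ?_, fun hd => ?_⟩
    · obtain rfl : i = j := hd
      rw [← W_eq]
      exact Nat.lt_succ_iff.1 (h.no_double_loop i t)
    · rw [← W_eq]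
      exact Nat.lt_succ_iff.1 (h.no_triple_edge i j t hd)

theorem card_stageUnits_le (h : InitialConditions lam kap G) (hT : maxDeg D ≤ D.T) :
    (stageUnits G).card ≤ 3 * maxDeg D :=
  (TGen.card_stageUnits_le G).trans (h.sums_le hT)

/-- The occurrences of a node are bounded by 2λ, since a loop has both ends at its node, plus 2κ
(the constant for double-edges), since two units are reserved for every double-edge. -/
theorem isLight (h : InitialConditions lam kap G) (hT : maxDeg D ≤ D.T) {c : ℝ} (hc : 0 ≤ c)
    (hc' : 3 * maxDeg D * c ≤ 1) : IsLight c (2 * lam + 2 * kap) (stageUnits G) := by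
  refine ⟨fun v => ?_, le_trans ?_ hc'⟩
  · rw [stageUnits, add_zero, occ_add, occ_nsmul, occ_nsmul, one_mul]
    have h1 := occ_loopDefects_le (h.loops_at_le v)
    have h2 := occ_doubleDefects_le (h.doubles_at_le v)
    exact_mod_cast add_le_add h1 (Nat.mul_le_mul_left 2 h2)
  · refine mul_le_mul_of_nonneg_right ?_ hc
    exact_mod_cast h.card_stageUnits_le hT

end InitialConditions

/-! ## The configuration model -/

variable (D) in
/-- The outcomes of the configuration model. -/
abbrev Config : Type := (Fin (degSum D) ≃ Marble D) × (Fin (degSum D / 2) → Stamp D)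

instance : Nonempty (Config D) := inferInstance

/-- The positions of the two marbles of an edge in the drawing order. -/
def slot (k : Fin (degSum D / 2)) (i : Fin 2) : Fin (degSum D) := ⟨2 * k + i, by omega⟩

theorem slot_inj {k l : Fin (degSum D / 2)} {i j : Fin 2} (h : slot k i = slot l j) :
    k = l ∧ i = j := by
  have h' : 2 * (k : ℕ) + i = 2 * l + j := congrArg Fin.val h
  constructor <;> ext <;> omega

/-- An edge of the configuration model. -/
def configEdge (ω : Config D) (k : Fin (degSum D / 2)) : TEdge D :=
  (s((ω.1 (slot k 0)).1, (ω.1 (slot k 1)).1), ω.2 k)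

def configGraph (ω : Config D) : TGraph D := Finset.univ.val.map (configEdge ω)

theorem configModel_eq :
    configModel D = (PMF.uniformOfFintype (Config D)).map configGraph := rfl

theorem tsum_configModel (v : TGraph D → ℝ≥0∞) :
    ∑' G, configModel D G * v G =
      ∑ ω : Config D, (Fintype.card (Config D) : ℝ≥0∞)⁻¹ * v (configGraph ω) := by
  rw [configModel_eq, PMF.map, tsum_bind_mul, tsum_fintype]
  refine Finset.sum_congr rfl fun ω _ => ?_
  rw [PMF.uniformOfFintype_apply]
  congr 1
  exact tsum_pure_mul _ _

open scoped Classical in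
/-- The probability of an event in the configuration model. -/
def configProb (P : Config D → Prop) : ℝ := (#{ω | P ω} : ℝ) / Fintype.card (Config D)

theorem sum_degree (G : TGraph D) : ∑ i, degree G i = 2 * G.card := by
  induction G using Multiset.induction_on with
  | empty => simp
  | cons e G ih =>
    have : ∑ i, inc e.1 i = 2 := by
      obtain ⟨p, t⟩ := e
      induction p using Sym2.ind with
      | _ a b => simp [Finset.sum_add_distrib]
    simp only [degree_cons, Finset.sum_add_distrib, ih, this, Multiset.card_cons]
    ring

/-- Parity guarantees that the successive pairs of draws exhaust the urn, so that the initial graph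
has the prescribed degrees. -/
theorem Realizable.even (h : Realizable D) : Even (degSum D) := by
  obtain ⟨G, -, hG⟩ := h
  refine ⟨G.card, ?_⟩
  rw [← two_mul, ← sum_degree, degSum]
  exact Finset.sum_congr rfl fun i _ => (hG i).symm

theorem slot_surjective (h : Even (degSum D)) :
    Function.Surjective fun x : Fin (degSum D / 2) × Fin 2 => slot x.1 x.2 := by
  intro p
  obtain ⟨n, hn⟩ := h
  refine ⟨(⟨p / 2, by omega⟩, ⟨p % 2, by omega⟩), ?_⟩
  ext
  simp only [slot]
  omega

theorem degree_map (s : Multiset (Fin (degSum D / 2))) (f : Fin (degSum D / 2) → TEdge D)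
    (i : Node D) : degree (s.map f) i = (s.map fun k => inc (f k).1 i).sum := by
  induction s using Multiset.induction_on with
  | empty => simp
  | cons k s ih =>
    rw [Multiset.map_cons, degree_cons, ih, Multiset.map_cons, Multiset.sum_cons, add_comm]

theorem matches_configGraph (h : Even (degSum D)) (ω : Config D) : Matches (configGraph ω) := by
  intro i
  have e : Function.Bijective fun x : Fin (degSum D / 2) × Fin 2 => slot x.1 x.2 :=
    ⟨fun x y hxy => Prod.ext (slot_inj hxy).1 (slot_inj hxy).2, slot_surjective h⟩
  rw [configGraph, degree_map]
  calc _ = ∑ k, ∑ j : Fin 2, if (ω.1 (slot k j)).1 = i then 1 else 0 := by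
        refine Finset.sum_congr rfl fun k _ => ?_
        rw [Fin.sum_univ_two]
        rfl
    _ = ∑ x : Fin (degSum D / 2) × Fin 2, if (ω.1 (slot x.1 x.2)).1 = i then 1 else 0 := by
        rw [Fintype.sum_prod_type]
    _ = ∑ p : Fin (degSum D), if (ω.1 p).1 = i then 1 else 0 :=
        e.sum_comp fun p => if (ω.1 p).1 = i then 1 else 0
    _ = ∑ x : Marble D, if x.1 = i then 1 else 0 :=
        Equiv.sum_comp ω.1 fun x : Marble D => if x.1 = i then 1 else 0
    _ = _ := by
        rw [Fintype.sum_sigma, Finset.sum_eq_single i]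
        · simp
        · intro x _ hx
          simp [hx]
        · exact fun h => (h (Finset.mem_univ i)).elim

end TGen

end

noncomputable section

namespace TGen

variable {D : Input}

/-! ## One attempt -/

theorem sum_configProb (P : Config D → Prop) [DecidablePred P] :
    ∑ ω : Config D, (Fintype.card (Config D) : ℝ≥0∞)⁻¹ * (if P ω then 1 else 0) =
      ENNReal.ofReal (configProb P) := by
  classical
  have hpos : (0 : ℝ) < Fintype.card (Config D) := by exact_mod_cast Fintype.card_pos
  rw [← Finset.mul_sum, Finset.sum_boole, configProb, div_eq_mul_inv,
    ENNReal.ofReal_mul (Nat.cast_nonneg _), ENNReal.ofReal_natCast, ENNReal.ofReal_inv_of_pos hpos,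
    ENNReal.ofReal_natCast, mul_comm]
  congr!

theorem sum_config_const (x : ℝ≥0∞) :
    ∑ _ω : Config D, (Fintype.card (Config D) : ℝ≥0∞)⁻¹ * x = x := by
  rw [Finset.sum_const, Finset.card_univ, nsmul_eq_mul, ← mul_assoc, ENNReal.mul_inv_cancel,
    one_mul]
  · exact_mod_cast Fintype.card_ne_zero
  · exact ENNReal.natCast_ne_top _

theorem configProb_nonneg (P : Config D → Prop) : 0 ≤ configProb P := by
  unfold configProb
  positivity

section Attempt

variable {lam kap mu m : ℕ} {c κ η η' : ℝ} {π : RemovalOrder D}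

open scoped Classical in
/-- The algorithm after the sampling of the initial graph. -/
def attemptFrom (lam kap mu : ℕ) (π : RemovalOrder D) (G : TGraph D) : Prog D (TGraph D) := do
  visit G
  if IsSimple G then pure G
  else if Requirements D ∧ InitialConditions lam kap G then stages mu π G
  else restart

theorem wp_attempt (B : Set (TGraph D)) (Q : TGraph D → ℝ≥0∞) :
    wp B (attempt D lam kap mu π) Q = ∑ ω : Config D, (Fintype.card (Config D) : ℝ≥0∞)⁻¹ *
      wp B (attemptFrom lam kap mu π (configGraph ω)) Q := by
  rw [← tsum_configModel fun G => wp B (attemptFrom lam kap mu π G) Q, ← wp_sample, ← wp_bind]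
  rfl

open scoped Classical in
theorem wp_attemptFrom (B : Set (TGraph D)) (Q : TGraph D → ℝ≥0∞) (G : TGraph D) :
    wp B (attemptFrom lam kap mu π G) Q = if G ∈ B then 1 else if IsSimple G then Q G else
      if Requirements D ∧ InitialConditions lam kap G then wp B (stages mu π G) Q else 0 := by
  rw [attemptFrom, wp_bind, wp_visit]
  split_ifs
  · rfl
  · exact wp_pure B _ Q
  · rfl
  · exact wp_restart B Q

/-- If the initial graph has a pair of multiplicity at least `m`, the attempt is given up as bad.
Otherwise simple and rejected initial graphs cost nothing, and the stages are bounded by the initial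
potential of at most 3Δ units. -/
theorem wp_attempt_le {B : Set (TGraph D)}
    (hB : ∀ G₀ G : TGraph D, (∀ p, pairMult G₀ p + 1 ≤ m) →
      (∀ p, pairMult G p ≤ pairMult G₀ p + 1) → G ∉ B)
    (h : StageParams D mu c κ η η' (2 * lam + 2 * kap)) (heven : Even (degSum D))
    (hc : 3 * maxDeg D * c ≤ 1) :
    wp B (attempt D lam kap mu π) (fun _ => 0) ≤ ENNReal.ofReal
      (configProb (fun ω : Config D => ¬ ∀ p, pairMult (configGraph ω) p + 1 ≤ m) +
        3 * maxDeg D * κ) := by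
  classical
  have hκ := h.κ_nonneg
  rw [wp_attempt, ENNReal.ofReal_add (configProb_nonneg _) (by positivity), ← sum_configProb,
    ← sum_config_const (D := D) (ENNReal.ofReal (3 * maxDeg D * κ)), ← Finset.sum_add_distrib]
  refine Finset.sum_le_sum fun ω _ => ?_
  rw [← mul_add]
  refine mul_le_mul_right ?_ _
  by_cases hω : ∀ p, pairMult (configGraph ω) p + 1 ≤ m
  · rw [if_neg (not_not.2 hω), zero_add, wp_attemptFrom,
      if_neg (hB _ _ hω fun p => Nat.le_succ _)]
    split_ifs with h1 h2
    · exact zero_le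
    · refine (wp_stages_le (fun G' hG' => hB _ _ hω hG') h (matches_configGraph heven ω)
        h2.2.mildDefects (h2.2.isLight h.maxDeg_le h.c_nonneg hc) π).trans
        (ENNReal.ofReal_le_ofReal ?_)
      refine mul_le_mul_of_nonneg_right ?_ hκ
      exact_mod_cast h2.2.card_stageUnits_le h.maxDeg_le
    · exact zero_le
  · rw [if_pos hω]
    exact (wp_le_one B fun _ => zero_le_one).trans le_self_add

theorem le_wp_attempt_of_simple :
    ENNReal.ofReal (configProb fun ω : Config D => IsSimple (configGraph ω)) ≤
      wp ∅ (attempt D lam kap mu π) (fun _ => 1) := by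
  classical
  rw [wp_attempt, ← sum_configProb]
  refine Finset.sum_le_sum fun ω _ => mul_le_mul_right ?_ _
  rw [wp_attemptFrom]
  split_ifs <;> simp_all

theorem le_wp_attempt (h : StageParams D mu c κ η η' (2 * lam + 2 * kap))
    (heven : Even (degSum D)) (hc : 3 * maxDeg D * c ≤ 1) (hreq : Requirements D)
    (hmu : 1 ≤ mu) (hmuT : mu ≤ D.T) (hm : m ≤ mu) :
    ENNReal.ofReal (configProb (fun ω : Config D => InitialConditions lam kap (configGraph ω) ∧
        ∀ p, pairMult (configGraph ω) p + 1 ≤ m) *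
      (stampBound D mu ^ (3 * maxDeg D) * (1 - 3 * maxDeg D * κ))) ≤
      wp ∅ (attempt D lam kap mu π) (fun _ => 1) := by
  classical
  have hκ := h.κ_nonneg
  have hs := stampBound_nonneg (D := D) mu
  have hs1 := stampBound_le_one (D := D) hmu hmuT
  set X := stampBound D mu ^ (3 * maxDeg D) * (1 - 3 * maxDeg D * κ) with hX
  rw [wp_attempt, ENNReal.ofReal_mul (configProb_nonneg _), ← sum_configProb, Finset.sum_mul]
  refine Finset.sum_le_sum fun ω _ => ?_
  rw [mul_assoc]
  refine mul_le_mul_right ?_ _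
  split_ifs with hω
  · rw [one_mul]
    -- For a negative factor the bound is trivial. If the initial graph happens to be simple it is
    -- output at once, and only X ≤ 1 is needed.
    by_cases h3 : 0 ≤ 1 - 3 * maxDeg D * κ
    · have h1 : X ≤ 1 := by
        have : (0 : ℝ) ≤ 3 * maxDeg D * κ := by positivity
        exact (mul_le_mul_of_nonneg_left (by linarith) (by positivity)).trans
          ((mul_one _).le.trans (pow_le_one₀ hs hs1))
      rw [wp_attemptFrom, if_neg (Set.notMem_empty _)]
      split_ifs with h2 h4
      · exact ENNReal.ofReal_le_one.2 h1
      · refine le_trans (ENNReal.ofReal_le_ofReal ?_) (le_wp_stages h (hω.1.fewDefects h.maxDeg_le)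
          hmu hmuT (fun p => (hω.2 p).trans hm) (matches_configGraph heven ω) hω.1.mildDefects
          (hω.1.isLight h.maxDeg_le h.c_nonneg hc) π)
        have hcard := hω.1.card_stageUnits_le h.maxDeg_le
        have hcard' : ((stageUnits (configGraph ω)).card : ℝ) ≤ 3 * maxDeg D := by
          exact_mod_cast hcard
        refine mul_le_mul (pow_le_pow_of_le_one hs hs1 hcard) ?_ h3 (by positivity)
        have := mul_le_mul_of_nonneg_right hcard' hκ
        linarith
      · exact (h4 ⟨hreq, hω.1⟩).elim
    · have : X ≤ 0 := mul_nonpos_of_nonneg_of_nonpos (by positivity) (not_le.1 h3).le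
      rw [ENNReal.ofReal_of_nonpos this]
      exact zero_le
  · rw [zero_mul]
    exact zero_le

end Attempt

/-! ## The probability of an auxiliary switching -/

/-- The probability of `none` is 1/(1 + ∑ρ), which is at least 1 - ∑r. -/
theorem le_ratioDist_none {ι : Type} [Fintype ι] {ρ r : ι → ℝ} (h0 : ∀ i, 0 ≤ r i)
    (h : ∀ i, ρ i ≤ r i) : ENNReal.ofReal (1 - ∑ i, r i) ≤ ratioDist ρ none := by
  have hs : 0 ≤ ∑ i, r i := Finset.sum_nonneg fun i _ => h0 i
  have h1 : ratioDist ρ none = (1 + ∑ i, ENNReal.ofReal (ρ i))⁻¹ := by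
    simp [ratioDist, PMF.normalize_apply, tsum_fintype]
  have h2 : (1 + ∑ i, ENNReal.ofReal (ρ i)) ≤ ENNReal.ofReal (1 + ∑ i, r i) := by
    rw [ENNReal.ofReal_add zero_le_one hs, ENNReal.ofReal_one,
      ENNReal.ofReal_sum_of_nonneg fun i _ => h0 i]
    exact add_le_add_right (Finset.sum_le_sum fun i _ => ENNReal.ofReal_le_ofReal (h i)) _
  rw [h1]
  refine le_trans ?_ (ENNReal.inv_le_inv.2 h2)
  rw [← ENNReal.ofReal_inv_of_pos (by linarith)]
  refine ENNReal.ofReal_le_ofReal ?_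
  rw [← one_div, le_div_iff₀ (by linarith)]
  nlinarith

theorem sum_half_pow_le (n : ℕ) : ∑ i : Fin n, (1 / 2 : ℝ) ^ (i : ℕ) ≤ 2 := by
  rw [Fin.sum_univ_eq_sum_range fun i => (1 / 2 : ℝ) ^ i, geom_sum_eq (by norm_num)]
  have : (0 : ℝ) ≤ (1 / 2) ^ n := by positivity
  rw [div_le_iff_of_neg (by norm_num)]
  linarith

/-- Without the condition on the largest multiplicity the sum factors into geometric sums. -/
theorem sum_auxType_le (q mu : ℕ) :
    ∑ θ : AuxType D q mu, (1 / 2 : ℝ) ^ θ.total ≤ 2 ^ q := by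
  calc ∑ θ : AuxType D q mu, (1 / 2 : ℝ) ^ θ.total
      = ∑ r ∈ (Finset.univ : Finset (AuxType D q mu)).map (Function.Embedding.subtype _),
          ∏ p, (1 / 2 : ℝ) ^ (r p : ℕ) := by
        rw [Finset.sum_map]
        refine Finset.sum_congr rfl fun θ _ => ?_
        rw [Finset.prod_pow_eq_pow_sum]
        rfl
    _ ≤ ∑ r : Fin q → Fin (maxDeg D), ∏ p, (1 / 2 : ℝ) ^ (r p : ℕ) :=
        Finset.sum_le_sum_of_subset_of_nonneg (Finset.subset_univ _) fun r _ _ => by positivity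
    _ = ∏ _p : Fin q, ∑ i : Fin (maxDeg D), (1 / 2 : ℝ) ^ (i : ℕ) := by
        rw [Finset.prod_univ_sum, Fintype.piFinset_univ]
    _ ≤ ∏ _p : Fin q, 2 :=
        Finset.prod_le_prod (fun _ _ => by positivity) fun _ _ => sum_half_pow_le _
    _ = 2 ^ q := by simp

theorem AuxType.le_total {q mu : ℕ} (θ : AuxType D q mu) : mu ≤ θ.total := by
  obtain ⟨p, hp⟩ := θ.2
  exact hp.trans (Finset.single_le_sum (f := fun p => θ.mults p) (fun _ _ => Nat.zero_le _)
    (Finset.mem_univ p))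

theorem AuxType.total_le {q mu : ℕ} (θ : AuxType D q mu) : θ.total ≤ q * maxDeg D := by
  refine (Finset.sum_le_card_nsmul _ _ (maxDeg D) fun p _ => (θ.1 p).2.le).trans ?_
  simp

/-- A type with K edges per side has ratio at most (2Δ²/(c₀²M))^K = y^K·2^(-K). As K is at least
`mu`, the first factor is at most y^mu, while the powers of 1/2 make the sum over all types at most
2^q ≤ 16. -/
theorem le_auxTypeDist {q mu : ℕ} {slack c₀ : ℝ} (hq : q ≤ 4) (hslack : slack ≤ 6 * maxDeg D)
    (hM : 0 < degSum D) (hΔ : 1 ≤ maxDeg D) (hMΔ : 84 * (maxDeg D : ℝ) ^ 2 ≤ degSum D)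
    (hc₀ : 0 < c₀) (hT : c₀ * D.T ≤ (D.T : ℝ) - maxDeg D)
    (hx : 4 * (maxDeg D : ℝ) ^ 2 / (c₀ ^ 2 * degSum D) ≤ 1) :
    ENNReal.ofReal (1 - 16 * (4 * (maxDeg D : ℝ) ^ 2 / (c₀ ^ 2 * degSum D)) ^ mu) ≤
      auxTypeDist D q mu slack none := by
  set y := 4 * (maxDeg D : ℝ) ^ 2 / (c₀ ^ 2 * degSum D) with hy
  have hM' : (0 : ℝ) < degSum D := by exact_mod_cast hM
  have hΔ' : (1 : ℝ) ≤ maxDeg D := by exact_mod_cast hΔ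
  have hTp := T_pos' D
  have hy0 : 0 ≤ y := by positivity
  have hkey : ∀ θ : AuxType D q mu, auxFBound θ / auxBBound slack θ ≤
      y ^ mu * (1 / 2) ^ θ.total := by
    intro θ
    have hK : ((θ.total : ℕ) : ℝ) ≤ 4 * maxDeg D := by
      exact_mod_cast θ.total_le.trans (Nat.mul_le_mul_right _ hq)
    have hq' : (q : ℝ) ≤ 4 := by exact_mod_cast hq
    -- With K ≤ 4Δ, q ≤ 4 and Δ ≥ 1, at most 6Δ + 16Δ² + 20Δ ≤ 42Δ² ≤ M/2 is subtracted.
    have h1 : (degSum D : ℝ) / 2 ≤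
        (degSum D : ℝ) - slack - 4 * ((θ.total : ℝ) + q + 1) * maxDeg D := by
      nlinarith
    have h2 : c₀ * D.T ≤ (D.T : ℝ) - ((maxDeg D : ℝ) - 1) := by linarith
    have h3 : ((degSum D : ℝ) / 2) ^ θ.total * (c₀ * D.T) ^ (2 * θ.total) ≤ auxBBound slack θ :=
      mul_le_mul (pow_le_pow_left₀ (by positivity) h1 _) (pow_le_pow_left₀ (by positivity) h2 _)
        (by positivity) (pow_nonneg (by linarith [show (0 : ℝ) ≤ degSum D / 2 by positivity]) _)
    calc auxFBound θ / auxBBound slack θ ≤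
        auxFBound θ / (((degSum D : ℝ) / 2) ^ θ.total * (c₀ * D.T) ^ (2 * θ.total)) := by
          refine div_le_div_of_nonneg_left ?_ (by positivity) h3
          unfold auxFBound
          positivity
      _ = y ^ θ.total * (1 / 2) ^ θ.total := by
          unfold auxFBound
          have e : y * (1 / 2) =
              (maxDeg D : ℝ) ^ 2 * (D.T : ℝ) ^ 2 / (degSum D / 2 * (c₀ * D.T) ^ 2) := by
            rw [hy]
            field_simp
            norm_num
          rw [← mul_pow y, e]
          simp only [div_pow, mul_pow, pow_mul]
      _ ≤ y ^ mu * (1 / 2) ^ θ.total :=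
          mul_le_mul_of_nonneg_right (pow_le_pow_of_le_one hy0 hx θ.le_total) (by positivity)
  refine le_trans (ENNReal.ofReal_le_ofReal ?_)
    (le_ratioDist_none (fun θ => by positivity) hkey)
  rw [← Finset.mul_sum]
  have h1 := sum_auxType_le (D := D) q mu
  have h2 : (2 : ℝ) ^ q ≤ 2 ^ 4 := pow_le_pow_right₀ (by norm_num) hq
  have h3 : 0 ≤ y ^ mu := by positivity
  nlinarith

end TGen

end

noncomputable section

namespace TGen

variable {D : Input}

/-! ## Probabilities in the configuration model -/

theorem exists_perm_extending {ι α : Type*} [Fintype α] [DecidableEq α] (x y : ι ↪ α) :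
    ∃ g : Equiv.Perm α, ∀ i, g (x i) = y i := by
  classical
  let e : {a // a ∈ Set.range x} ≃ {a // a ∈ Set.range y} :=
    (Equiv.ofInjective x x.injective).symm.trans (Equiv.ofInjective y y.injective)
  refine ⟨e.extendSubtype, fun i => ?_⟩
  rw [Equiv.extendSubtype_apply_of_mem e (x i) ⟨i, rfl⟩]
  have : (Equiv.ofInjective x x.injective).symm ⟨x i, ⟨i, rfl⟩⟩ = i :=
    Equiv.ofInjective_symm_apply x.injective i
  simp only [e, Equiv.trans_apply, this, Equiv.ofInjective_apply]

variable (D) in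
/-- The marbles and the timestamps of `m` edges of the configuration model. -/
abbrev Pattern (m : ℕ) : Type := (Fin m × Fin 2 ↪ Marble D) × (Fin m → Stamp D)

def patternAt {m : ℕ} (K : Fin m ↪ Fin (degSum D / 2)) (ω : Config D) : Pattern D m :=
  (⟨fun x => ω.1 (slot (K x.1) x.2), fun x y h => by
    have := slot_inj (ω.1.injective h)
    exact Prod.ext (K.injective this.1) this.2⟩, fun r => ω.2 (K r))

/-- Relabelling the marbles by a permutation that carries one pattern to the other, and exchanging
stamps, maps one fiber injectively into the other. By symmetry all fibers have the same size, so the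
marbles and stamps of fixed edges are uniformly distributed. -/
theorem card_patternAt_eq_le {m : ℕ} (K : Fin m ↪ Fin (degSum D / 2)) (e e' : Pattern D m) :
    #{ω | patternAt K ω = e} ≤ #{ω | patternAt K ω = e'} := by
  classical
  obtain ⟨g, hg⟩ := exists_perm_extending e.1 e'.1
  -- A separate transposition of stamps for every edge of `K`, and the identity for all other edges.
  set s : Fin (degSum D / 2) → Equiv.Perm (Stamp D) := fun k =>
    if h : ∃ r, K r = k then Equiv.swap (e.2 h.choose) (e'.2 h.choose) else Equiv.refl _ with hs
  have hsK : ∀ r, s (K r) = Equiv.swap (e.2 r) (e'.2 r) := by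
    intro r
    have h : ∃ r', K r' = K r := ⟨r, rfl⟩
    simp only [hs, dif_pos h, K.injective h.choose_spec]
  refine Finset.card_le_card_of_injOn (fun ω => (ω.1.trans g, fun k => s k (ω.2 k))) ?_ ?_
  · intro ω hω
    simp only [Finset.coe_filter, Finset.mem_univ, true_and, Set.mem_ofPred_eq] at hω ⊢
    subst hω
    refine Prod.ext (Function.Embedding.ext fun x => ?_) (funext fun r => ?_)
    · exact hg x
    · change s (K r) (ω.2 (K r)) = e'.2 r
      rw [hsK]
      exact Equiv.swap_apply_left _ _
  · intro ω _ ω' _ h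
    simp only [Prod.mk.injEq] at h
    refine Prod.ext ?_ (funext fun k => (s k).injective (congrFun h.2 k))
    ext1 p
    exact g.injective (DFunLike.congr_fun h.1 p)

theorem card_pattern (m : ℕ) :
    Fintype.card (Pattern D m) = (degSum D).descFactorial (2 * m) * D.T ^ m := by
  rw [Fintype.card_prod, Fintype.card_embedding_eq, Fintype.card_prod, Fintype.card_fin,
    Fintype.card_fin, Fintype.card_fun, Fintype.card_fin, Fintype.card_fin, Fintype.card_sigma,
    mul_comm m 2]
  simp only [Fintype.card_fin]
  rfl

theorem configProb_patternAt {m : ℕ} (K : Fin m ↪ Fin (degSum D / 2)) (A : Finset (Pattern D m)) :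
    configProb (fun ω => patternAt K ω ∈ A) =
      #A / ((degSum D).descFactorial (2 * m) * (D.T : ℝ) ^ m) := by
  classical
  obtain ⟨ω₀⟩ : Nonempty (Config D) := inferInstance
  set n := #{ω | patternAt K ω = patternAt K ω₀} with hn
  have hfib : ∀ e, #{ω | patternAt K ω = e} = n := fun e =>
    le_antisymm (card_patternAt_eq_le K _ _) (card_patternAt_eq_le K _ _)
  have hcount : ∀ A' : Finset (Pattern D m), #{ω | patternAt K ω ∈ A'} = #A' * n := by
    intro A'
    rw [Finset.card_eq_sum_card_fiberwise (f := patternAt K) (t := A'), Finset.sum_const_nat]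
    · intro e he
      rw [← hfib e, Finset.filter_filter]
      congr 1
      ext ω
      simp only [Finset.mem_filter, Finset.mem_univ, true_and]
      exact ⟨fun h => h.2, fun h => ⟨h ▸ he, h⟩⟩
    · intro ω hω
      exact (Finset.mem_filter.1 hω).2
  have hpos : 0 < n := Finset.card_pos.2 ⟨ω₀, by simp⟩
  have huniv := hcount Finset.univ
  simp only [Finset.mem_univ, Finset.filter_true, Finset.card_univ, card_pattern] at huniv
  unfold configProb
  have h1 : #{ω : Config D | patternAt K ω ∈ A} = #A * n := hcount A
  rw [huniv]
  have hn' : (n : ℝ) ≠ 0 := by exact_mod_cast hpos.ne'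
  convert mul_div_mul_right (#A : ℝ) ((degSum D).descFactorial (2 * m) * (D.T : ℝ) ^ m) hn' using 2
  · rw [← Nat.cast_mul, ← h1]
    congr!
  · push_cast
    ring

theorem configProb_mono {P Q : Config D → Prop} (h : ∀ ω, P ω → Q ω) :
    configProb P ≤ configProb Q := by
  classical
  unfold configProb
  gcongr with ω hω
  exact h ω

theorem configProb_not (P : Config D → Prop) :
    configProb (fun ω => ¬ P ω) = 1 - configProb P := by
  classical
  have h : (Fintype.card (Config D) : ℝ) ≠ 0 := by exact_mod_cast Fintype.card_ne_zero
  have := Finset.card_filter_add_card_filter_not (s := (Finset.univ : Finset (Config D))) P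
  rw [Finset.card_univ] at this
  unfold configProb
  rw [eq_sub_iff_add_eq, ← add_div, div_eq_one_iff_eq h]
  have h' : ((#{ω | P ω} + #{ω | ¬ P ω} : ℕ) : ℝ) = Fintype.card (Config D) := by
    exact_mod_cast this
  rw [← h', add_comm]
  push_cast
  congr!

theorem configProb_or_le (P Q : Config D → Prop) :
    configProb (fun ω => P ω ∨ Q ω) ≤ configProb P + configProb Q := by
  classical
  unfold configProb
  rw [← add_div]
  gcongr
  have : ({ω | P ω ∨ Q ω} : Finset (Config D)) ⊆
      ({ω | P ω} : Finset (Config D)) ∪ ({ω | Q ω} : Finset (Config D)) := by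
    intro ω hω
    simpa using hω
  norm_cast
  convert (Finset.card_le_card this).trans (Finset.card_union_le _ _)
  rfl

theorem configProb_exists_le {ι : Type*} [Fintype ι] (P : ι → Config D → Prop) :
    configProb (fun ω => ∃ i, P i ω) ≤ ∑ i, configProb (P i) := by
  classical
  unfold configProb
  rw [← Finset.sum_div]
  gcongr
  have : ({ω | ∃ i, P i ω} : Finset (Config D)) ⊆ Finset.univ.biUnion fun i => {ω | P i ω} := by
    intro ω hω
    simpa using hω
  norm_cast
  convert (Finset.card_le_card this).trans Finset.card_biUnion_le
  rfl

/-- Markov's inequality for a number of events. -/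
theorem mul_configProb_le {ι : Type*} [Fintype ι] (P : ι → Config D → Prop)
    [∀ ω, DecidablePred fun i => P i ω] (x : ℝ) :
    x * configProb (fun ω => x ≤ #{i | P i ω}) ≤ ∑ i, configProb (P i) := by
  classical
  unfold configProb
  rw [← Finset.sum_div, ← mul_div_assoc]
  gcongr
  calc x * #{ω : Config D | x ≤ #{i | P i ω}}
      = ∑ ω : Config D with x ≤ #{i | P i ω}, x := by
        rw [Finset.sum_const, nsmul_eq_mul, mul_comm]
    _ ≤ ∑ ω : Config D with x ≤ #{i | P i ω}, (#{i | P i ω} : ℝ) :=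
        Finset.sum_le_sum fun ω hω => (Finset.mem_filter.1 hω).2
    _ ≤ ∑ ω : Config D, (#{i | P i ω} : ℝ) :=
        Finset.sum_le_sum_of_subset_of_nonneg (Finset.filter_subset _ _) fun _ _ _ =>
          Nat.cast_nonneg _
    _ = _ := by
        have := Finset.sum_card_bipartiteAbove_eq_sum_card_bipartiteBelow
          (s := (Finset.univ : Finset (Config D))) (t := (Finset.univ : Finset ι))
          fun ω i => P i ω
        simp only [Finset.bipartiteAbove, Finset.bipartiteBelow] at this
        rw [← Nat.cast_sum, ← Nat.cast_sum]
        congr 1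
        convert this using 2
        congr!

/-- The probability that some edges have one of the given patterns. -/
theorem configProb_exists_patternAt_le {m : ℕ} (hM : 4 * m ≤ degSum D)
    (A : Finset (Pattern D m)) :
    configProb (fun ω => ∃ K, patternAt K ω ∈ A) ≤
      (2 / (degSum D * D.T : ℝ)) ^ m * #A := by
  rcases Nat.eq_zero_or_pos m with rfl | hm
  · rw [pow_zero, one_mul]
    refine (configProb_exists_le _).trans ?_
    simp only [configProb_patternAt]
    simp
  have hM0 : (0 : ℝ) < degSum D := by exact_mod_cast (by omega : 0 < degSum D)
  have hT := T_pos' D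
  refine (configProb_exists_le _).trans ?_
  simp only [configProb_patternAt]
  rw [Finset.sum_const, Finset.card_univ, Fintype.card_embedding_eq, Fintype.card_fin,
    Fintype.card_fin, nsmul_eq_mul]
  have h1 : ((degSum D / 2).descFactorial m : ℝ) ≤ ((degSum D : ℝ) / 2) ^ m := by
    refine le_trans (by exact_mod_cast Nat.descFactorial_le_pow _ _) (pow_le_pow_left₀
      (Nat.cast_nonneg _) Nat.cast_div_le m)
  -- Because 4m ≤ M, each of the 2m factors of the falling factorial is at least M/2.
  have h2 : ((degSum D : ℝ) / 2) ^ (2 * m) ≤ (degSum D).descFactorial (2 * m) := by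
    refine le_trans ?_ (Nat.cast_le.2 (Nat.pow_sub_le_descFactorial (degSum D) (2 * m)))
    rw [Nat.cast_pow]
    refine pow_le_pow_left₀ (by positivity) ?_ _
    rw [Nat.cast_sub (by omega), Nat.cast_add]
    have : (4 * m : ℝ) ≤ degSum D := by exact_mod_cast hM
    push_cast
    linarith
  calc ((degSum D / 2).descFactorial m : ℝ) *
        (#A / ((degSum D).descFactorial (2 * m) * (D.T : ℝ) ^ m)) ≤
        ((degSum D : ℝ) / 2) ^ m * (#A / (((degSum D : ℝ) / 2) ^ (2 * m) * (D.T : ℝ) ^ m)) := by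
        gcongr
    _ = _ := by
        have e : 2 / ((degSum D : ℝ) * D.T) = ((degSum D : ℝ) / 2 * D.T)⁻¹ := by field_simp
        rw [e, inv_pow, mul_pow, pow_mul']
        have : ((degSum D : ℝ) / 2) ^ m ≠ 0 := by positivity
        field_simp

end TGen

end

noncomputable section

namespace TGen

variable {D : Input}

/-! ## The initial graph -/

theorem count_configGraph (ω : Config D) (e : TEdge D) :
    (configGraph ω).count e = #{k | configEdge ω k = e} := by
  rw [configGraph, Multiset.count_map]
  simp only [eq_comm (a := e)]
  rfl

theorem pairMult_configGraph (ω : Config D) (p : Sym2 (Node D)) :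
    pairMult (configGraph ω) p = #{k | (configEdge ω k).1 = p} := by
  rw [pairMult, Finset.card_eq_sum_card_fiberwise (f := fun k => (configEdge ω k).2)
    (t := Finset.univ) fun _ _ => Finset.mem_coe.2 (Finset.mem_univ _)]
  refine Finset.sum_congr rfl fun t _ => ?_
  rw [count_configGraph, Finset.filter_filter]
  congr 1
  ext k
  simp [Prod.ext_iff]

theorem sum_card_fiber_le {α β X : Type*} [DecidableEq β] (s : Finset α) (g : α → β) (φ : X → β)
    (I : Finset X) (hφ : Set.InjOn φ I) : ∑ x ∈ I, #{a ∈ s | g a = φ x} ≤ #s := by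
  classical
  rw [← Finset.card_biUnion]
  · exact Finset.card_le_card (Finset.biUnion_subset.2 fun x _ => Finset.filter_subset _ _)
  · intro x hx y hy hxy
    refine Finset.disjoint_left.2 fun a ha ha' => hxy (hφ hx hy ?_)
    rw [← (Finset.mem_filter.1 ha).2, (Finset.mem_filter.1 ha').2]

theorem exists_embedding_of_le_card {α : Type*} [Fintype α] {P : α → Prop} [DecidablePred P]
    {m : ℕ} (h : m ≤ #{a | P a}) : ∃ K : Fin m ↪ α, ∀ r, P (K r) := by
  obtain ⟨s, hs, hm⟩ := Finset.exists_subset_card_eq h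
  refine ⟨(finCongr hm.symm).toEmbedding.trans
    (s.equivFin.symm.toEmbedding.trans (Function.Embedding.subtype _)), fun r => ?_⟩
  exact (Finset.mem_filter.1 (hs (s.equivFin.symm _).2)).2

/-- The edges of a pattern. -/
def patternEdge {m : ℕ} (e : Pattern D m) (r : Fin m) : TEdge D :=
  (s((e.1 (r, 0)).1, (e.1 (r, 1)).1), e.2 r)

theorem patternEdge_patternAt {m : ℕ} (K : Fin m ↪ Fin (degSum D / 2)) (ω : Config D) (r : Fin m) :
    patternEdge (patternAt K ω) r = configEdge ω (K r) := rfl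

theorem card_marbles (i : Node D) : #{x : Marble D | x.1 = i} = D.d i := by
  rw [Finset.card_filter, Fintype.sum_sigma, Finset.sum_eq_single i]
  · simp
  · intro x _ hx
    simp [hx]
  · exact fun h => (h (Finset.mem_univ i)).elim

/-- The stamps are prescribed, and the factor 2 accounts for the two orders in which the marbles of
an edge can be drawn. -/
theorem card_patterns_le {m : ℕ} (f : Fin m → (Node D × Node D) × Stamp D) :
    #{e : Pattern D m | ∀ r, patternEdge e r = (s((f r).1.1, (f r).1.2), (f r).2)} ≤
      ∏ r, 2 * (D.d (f r).1.1 * D.d (f r).1.2) := by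
  set S : Fin m → Finset (Marble D × Marble D) := fun r =>
    ({x : Marble D | x.1 = (f r).1.1} : Finset _) ×ˢ ({x : Marble D | x.1 = (f r).1.2} : Finset _) ∪
    ({x : Marble D | x.1 = (f r).1.2} : Finset _) ×ˢ ({x : Marble D | x.1 = (f r).1.1} : Finset _)
    with hS
  have h1 : ∀ r, #(S r) ≤ 2 * (D.d (f r).1.1 * D.d (f r).1.2) := by
    intro r
    refine (Finset.card_union_le _ _).trans ?_
    rw [Finset.card_product, Finset.card_product, card_marbles, card_marbles]
    exact (by ring : _ = _).le
  refine le_trans ?_ (Finset.prod_le_prod' fun r _ => h1 r)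
  rw [← Fintype.card_piFinset]
  refine Finset.card_le_card_of_injOn (fun e r => (e.1 (r, 0), e.1 (r, 1))) ?_ ?_
  · intro e he
    have he' := (Finset.mem_filter.1 he).2
    refine Finset.mem_coe.2 (Fintype.mem_piFinset.2 fun r => ?_)
    have := congrArg Prod.fst (he' r)
    simp only [patternEdge, Sym2.eq_iff] at this
    rcases this with h | h
    · exact Finset.mem_union_left _ (by simpa using h)
    · exact Finset.mem_union_right _ (by simpa using h)
  · intro e he e' he' h
    have h2 := (Finset.mem_filter.1 he).2
    have h3 := (Finset.mem_filter.1 he').2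
    refine Prod.ext (Function.Embedding.ext fun x => ?_) (funext fun r => ?_)
    · obtain ⟨r, j⟩ := x
      have := congrFun h r
      simp only [Prod.mk.injEq] at this
      fin_cases j
      · exact this.1
      · exact this.2
    · exact (congrArg Prod.snd (h2 r)).trans (congrArg Prod.snd (h3 r)).symm

/-- A union bound for the occurrence of some edges. -/
theorem configProb_exists_edges_le {m : ℕ} (hM : 4 * m ≤ degSum D) {J : Type*} [Fintype J]
    (f : J → Fin m → (Node D × Node D) × Stamp D) :
    configProb (fun ω => ∃ j, ∃ K : Fin m ↪ Fin (degSum D / 2), ∀ r,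
      configEdge ω (K r) = (s((f j r).1.1, (f j r).1.2), (f j r).2)) ≤
      ∑ j, ∏ r, (4 * (D.d (f j r).1.1 * D.d (f j r).1.2) / (degSum D * D.T) : ℝ) := by
  refine (configProb_exists_le _).trans (Finset.sum_le_sum fun j _ => ?_)
  have h1 := configProb_exists_patternAt_le hM
    {e : Pattern D m | ∀ r, patternEdge e r = (s((f j r).1.1, (f j r).1.2), (f j r).2)}
  simp only [Finset.mem_filter, Finset.mem_univ, true_and, patternEdge_patternAt] at h1
  refine h1.trans ((mul_le_mul_of_nonneg_left (Nat.cast_le.2 (card_patterns_le (f j)))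
    (by positivity)).trans (le_of_eq ?_))
  have hpow : (2 / (degSum D * D.T) : ℝ) ^ m = ∏ _r : Fin m, (2 / (degSum D * D.T) : ℝ) := by
    rw [Finset.prod_const, Finset.card_univ, Fintype.card_fin]
  push_cast
  rw [hpow, ← Finset.prod_mul_distrib]
  refine Finset.prod_congr rfl fun r _ => ?_
  ring

theorem sum_pow_le (n : ℕ) : ∑ i, (D.d i : ℝ) ^ (n + 1) ≤ (maxDeg D : ℝ) ^ n * degSum D := by
  rw [degSum, Nat.cast_sum, Finset.mul_sum]
  refine Finset.sum_le_sum fun i _ => ?_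
  rw [pow_succ]
  have : (D.d i : ℝ) ≤ maxDeg D := by exact_mod_cast le_maxDeg i
  gcongr

/-! ### First-moment bounds for rare features of the initial graph -/

section Events

/-- The sum over the stamps cancels the powers of T, and ∑ d^(m+2) ≤ Δ^(m+1)M is used for both
nodes. The bound vanishes as soon as 2m + 2 < (2 + ε)m, that is, 2 < εm; this is the source of the
threshold 3 + 2/ε. -/
theorem configProb_le_pairMult_le {m : ℕ} (hM : 4 * (m + 2) ≤ degSum D) :
    configProb (fun ω : Config D => ∃ p, m + 2 ≤ pairMult (configGraph ω) p) ≤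
      4 ^ (m + 2) * ((maxDeg D : ℝ) ^ (2 * m + 2) / (degSum D : ℝ) ^ m) := by
  have hM0 : (0 : ℝ) < degSum D := by exact_mod_cast (by omega : 0 < degSum D)
  have hT := T_pos' D
  have h1 := configProb_exists_edges_le hM (J := (Node D × Node D) × (Fin (m + 2) → Stamp D))
    fun j r => (j.1, j.2 r)
  refine (configProb_mono ?_).trans (h1.trans ?_)
  · rintro ω ⟨p, hp⟩
    rw [pairMult_configGraph] at hp
    obtain ⟨K, hK⟩ := exists_embedding_of_le_card hp
    induction p using Sym2.ind with
    | _ u v => exact ⟨((u, v), fun r => (configEdge ω (K r)).2), K, fun r => Prod.ext (hK r) rfl⟩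
  · simp only [Finset.prod_const, Finset.card_univ, Fintype.card_fin]
    rw [Fintype.sum_prod_type]
    simp only [Finset.sum_const, Finset.card_univ, Fintype.card_fun, Fintype.card_fin,
      nsmul_eq_mul]
    rw [Fintype.sum_prod_type]
    have h2 : ∀ u v : Node D, ((D.T ^ (m + 2) : ℕ) : ℝ) *
        (4 * (D.d u * D.d v) / (degSum D * D.T)) ^ (m + 2) =
        (4 / degSum D) ^ (m + 2) * ((D.d u : ℝ) ^ (m + 2) * (D.d v : ℝ) ^ (m + 2)) := by
      intro u v
      rw [Nat.cast_pow, ← mul_pow, ← mul_pow, ← mul_pow]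
      congr 1
      field_simp
    simp only [h2]
    simp only [← Finset.mul_sum]
    rw [← Finset.sum_mul]
    have h3 := sum_pow_le (D := D) (m + 1)
    calc (4 / (degSum D : ℝ)) ^ (m + 2) * ((∑ i, (D.d i : ℝ) ^ (m + 2)) *
          ∑ i, (D.d i : ℝ) ^ (m + 2)) ≤ (4 / (degSum D : ℝ)) ^ (m + 2) *
          (((maxDeg D : ℝ) ^ (m + 1) * degSum D) * ((maxDeg D : ℝ) ^ (m + 1) * degSum D)) := by
          gcongr
      _ = _ := by
          rw [div_pow]
          field_simp
          ring

/-- For loops there is only one node to sum over, so the bound vanishes already if εm > 1; this is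
the source of 1 + 1/ε. -/
theorem configProb_le_loops_le {m : ℕ} (hM : 4 * (m + 1) ≤ degSum D) :
    configProb (fun ω : Config D => ∃ i, m + 1 ≤ pairMult (configGraph ω) s(i, i)) ≤
      4 ^ (m + 1) * ((maxDeg D : ℝ) ^ (2 * m + 1) / (degSum D : ℝ) ^ m) := by
  have hM0 : (0 : ℝ) < degSum D := by exact_mod_cast (by omega : 0 < degSum D)
  have hT := T_pos' D
  have h1 := configProb_exists_edges_le hM (J := Node D × (Fin (m + 1) → Stamp D))
    fun j r => ((j.1, j.1), j.2 r)
  refine (configProb_mono ?_).trans (h1.trans ?_)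
  · rintro ω ⟨u, hp⟩
    rw [pairMult_configGraph] at hp
    obtain ⟨K, hK⟩ := exists_embedding_of_le_card hp
    exact ⟨(u, fun r => (configEdge ω (K r)).2), K, fun r => Prod.ext (hK r) rfl⟩
  · simp only [Finset.prod_const, Finset.card_univ, Fintype.card_fin]
    rw [Fintype.sum_prod_type]
    simp only [Finset.sum_const, Finset.card_univ, Fintype.card_fun, Fintype.card_fin,
      nsmul_eq_mul]
    have h2 : ∀ u : Node D, ((D.T ^ (m + 1) : ℕ) : ℝ) *
        (4 * (D.d u * D.d u) / (degSum D * D.T)) ^ (m + 1) =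
        (4 / degSum D) ^ (m + 1) * (D.d u : ℝ) ^ (2 * m + 1 + 1) := by
      intro u
      rw [show 2 * m + 1 + 1 = 2 * (m + 1) by ring, pow_mul, Nat.cast_pow, ← mul_pow, ← mul_pow]
      congr 1
      field_simp
    simp only [h2]
    rw [← Finset.mul_sum]
    have h3 := sum_pow_le (D := D) (2 * m + 1)
    calc _ ≤ (4 / (degSum D : ℝ)) ^ (m + 1) * ((maxDeg D : ℝ) ^ (2 * m + 1) * degSum D) := by
          gcongr
      _ = _ := by
          rw [div_pow]
          field_simp
          ring

/-- Copies share their stamp, so each further copy leaves a factor 1/T. Together with a factor Δ it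
is at most 1; for triple edges this happens twice. -/
theorem configProb_double_loop_le (hM : 8 ≤ degSum D) (hT : maxDeg D ≤ D.T) :
    configProb (fun ω : Config D => ∃ i t, 2 ≤ (configGraph ω).count (s(i, i), t)) ≤
      16 * ((maxDeg D : ℝ) ^ 2 / degSum D) := by
  have hM0 : (0 : ℝ) < degSum D := by exact_mod_cast (by omega : 0 < degSum D)
  have hT0 := T_pos' D
  have hT' : (maxDeg D : ℝ) ≤ D.T := by exact_mod_cast hT
  have h1 := configProb_exists_edges_le (m := 2) hM (J := Node D × Stamp D)
    fun j _ => ((j.1, j.1), j.2)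
  refine (configProb_mono ?_).trans (h1.trans ?_)
  · rintro ω ⟨u, t, hp⟩
    rw [count_configGraph] at hp
    obtain ⟨K, hK⟩ := exists_embedding_of_le_card hp
    exact ⟨(u, t), K, hK⟩
  · simp only [Finset.prod_const, Finset.card_univ, Fintype.card_fin]
    rw [Fintype.sum_prod_type]
    simp only [Finset.sum_const, Finset.card_univ, Fintype.card_fin, nsmul_eq_mul]
    have h2 : ∀ u : Node D, (D.T : ℝ) * (4 * (D.d u * D.d u) / (degSum D * D.T)) ^ 2 =
        16 / (degSum D ^ 2 * D.T) * (D.d u : ℝ) ^ (3 + 1) := by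
      intro u
      field_simp
      ring
    simp only [h2]
    rw [← Finset.mul_sum]
    have h3 := sum_pow_le (D := D) 3
    calc _ ≤ 16 / ((degSum D : ℝ) ^ 2 * D.T) * ((maxDeg D : ℝ) ^ 3 * degSum D) := by
          gcongr
      _ = 16 * ((maxDeg D : ℝ) ^ 2 / degSum D) * (maxDeg D / D.T) := by
          field_simp
      _ ≤ _ := mul_le_of_le_one_right (by positivity) ((div_le_one hT0).2 hT')

theorem configProb_triple_le (hM : 12 ≤ degSum D) (hT : maxDeg D ≤ D.T) :
    configProb (fun ω : Config D => ∃ i j t, 3 ≤ (configGraph ω).count (s(i, j), t)) ≤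
      64 * ((maxDeg D : ℝ) ^ 2 / degSum D) := by
  have hM0 : (0 : ℝ) < degSum D := by exact_mod_cast (by omega : 0 < degSum D)
  have hT0 := T_pos' D
  have hT' : (maxDeg D : ℝ) ≤ D.T := by exact_mod_cast hT
  have h1 := configProb_exists_edges_le (m := 3) hM (J := (Node D × Node D) × Stamp D)
    fun j _ => j
  refine (configProb_mono ?_).trans (h1.trans ?_)
  · rintro ω ⟨u, v, t, hp⟩
    rw [count_configGraph] at hp
    obtain ⟨K, hK⟩ := exists_embedding_of_le_card hp
    exact ⟨((u, v), t), K, hK⟩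
  · simp only [Finset.prod_const, Finset.card_univ, Fintype.card_fin]
    rw [Fintype.sum_prod_type]
    simp only [Finset.sum_const, Finset.card_univ, Fintype.card_fin, nsmul_eq_mul]
    rw [Fintype.sum_prod_type]
    have h2 : ∀ u v : Node D, (D.T : ℝ) * (4 * (D.d u * D.d v) / (degSum D * D.T)) ^ 3 =
        64 / (degSum D ^ 3 * D.T ^ 2) * ((D.d u : ℝ) ^ (2 + 1) * (D.d v : ℝ) ^ (2 + 1)) := by
      intro u v
      field_simp
      ring
    simp only [h2]
    simp only [← Finset.mul_sum]
    rw [← Finset.sum_mul]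
    have h3 := sum_pow_le (D := D) 2
    calc _ ≤ 64 / ((degSum D : ℝ) ^ 3 * D.T ^ 2) *
          (((maxDeg D : ℝ) ^ 2 * degSum D) * ((maxDeg D : ℝ) ^ 2 * degSum D)) := by
          gcongr
      _ = 64 * ((maxDeg D : ℝ) ^ 2 / degSum D) * (maxDeg D / D.T) ^ 2 := by
          field_simp
      _ ≤ _ := mul_le_of_le_one_right (by positivity)
          (pow_le_one₀ (by positivity) ((div_le_one hT0).2 hT'))

/-- The event asks for 2(m + 1) edges in m + 1 equal pairs at a common node. Summing over the other
end and the stamp of a pair yields a factor of order Δ/(MT) besides the square of the degree at the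
common node, and Δ ≤ T removes the rest. -/
theorem configProb_doubles_le {m : ℕ} (hM : 8 * (m + 1) ≤ degSum D) (hT : maxDeg D ≤ D.T) :
    configProb (fun ω : Config D => ∃ i,
      m + 1 ≤ #{x : Node D × Stamp D | 2 ≤ (configGraph ω).count (s(i, x.1), x.2)}) ≤
      16 ^ (m + 1) * ((maxDeg D : ℝ) ^ (2 * m + 1) / (degSum D : ℝ) ^ m) := by
  have hM0 : (0 : ℝ) < degSum D := by exact_mod_cast (by omega : 0 < degSum D)
  have hT0 := T_pos' D
  have hT' : (maxDeg D : ℝ) ≤ D.T := by exact_mod_cast hT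
  have h1 := configProb_exists_edges_le (m := (m + 1) * 2) (by omega)
    (J := Node D × (Fin (m + 1) → Node D × Stamp D))
    fun j r => ((j.1, (j.2 (finProdFinEquiv.symm r).1).1), (j.2 (finProdFinEquiv.symm r).1).2)
  refine (configProb_mono ?_).trans (h1.trans ?_)
  · rintro ω ⟨u, hp⟩
    obtain ⟨x, hx⟩ := exists_embedding_of_le_card hp
    have hK : ∀ r, ∃ K : Fin 2 ↪ Fin (degSum D / 2), ∀ b,
        configEdge ω (K b) = (s(u, (x r).1), (x r).2) := by
      intro r
      have := hx r
      rw [count_configGraph] at this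
      exact exists_embedding_of_le_card this
    choose K hK using hK
    refine ⟨(u, x), ⟨fun r => K (finProdFinEquiv.symm r).1 (finProdFinEquiv.symm r).2, ?_⟩,
      fun r => hK _ _⟩
    -- An edge of the configuration model has only one temporal edge, so a common index forces the
    -- same double-edge, and then injectivity within this double-edge applies.
    intro r r' hr
    have h2 : (x (finProdFinEquiv.symm r).1) = x (finProdFinEquiv.symm r').1 := by
      have := (hK (finProdFinEquiv.symm r).1 (finProdFinEquiv.symm r).2).symm.trans
        ((congrArg (configEdge ω) hr).trans
          (hK (finProdFinEquiv.symm r').1 (finProdFinEquiv.symm r').2))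
      simp only [Prod.mk.injEq, Sym2.congr_right] at this
      exact Prod.ext this.1 this.2
    have h3 := x.injective h2
    simp only at hr
    rw [h3] at hr
    exact finProdFinEquiv.symm.injective (Prod.ext h3 ((K _).injective hr))
  · have h2 : ∀ j : Node D × (Fin (m + 1) → Node D × Stamp D),
        ∏ r : Fin ((m + 1) * 2), (4 * (D.d j.1 * D.d (j.2 (finProdFinEquiv.symm r).1).1) /
          (degSum D * D.T) : ℝ) =
        (16 / (degSum D * D.T : ℝ) ^ 2) ^ (m + 1) * (D.d j.1 : ℝ) ^ (2 * m + 1 + 1) *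
          ∏ r, (D.d (j.2 r).1 : ℝ) ^ 2 := by
      intro j
      rw [Equiv.prod_comp finProdFinEquiv.symm fun x : Fin (m + 1) × Fin 2 =>
        (4 * (D.d j.1 * D.d (j.2 x.1).1) / (degSum D * D.T) : ℝ), Fintype.prod_prod_type]
      simp only [Finset.prod_const, Finset.card_univ, Fintype.card_fin]
      have : ∀ r, (4 * (D.d j.1 * D.d (j.2 r).1) / (degSum D * D.T) : ℝ) ^ 2 =
          (16 / (degSum D * D.T : ℝ) ^ 2) * (D.d j.1 : ℝ) ^ 2 * (D.d (j.2 r).1 : ℝ) ^ 2 := by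
        intro r
        ring
      simp only [this]
      rw [Finset.prod_mul_distrib, Finset.prod_const, Finset.card_univ, Fintype.card_fin, mul_pow]
      ring
    simp only [h2]
    rw [Fintype.sum_prod_type]
    simp only [← Finset.mul_sum]
    rw [← Finset.sum_mul, ← Finset.mul_sum]
    have h4 : ∑ x : Fin (m + 1) → Node D × Stamp D, ∏ r, (D.d (x r).1 : ℝ) ^ 2 =
        (D.T * ∑ i, (D.d i : ℝ) ^ 2) ^ (m + 1) := by
      have := (Finset.prod_univ_sum (fun _ : Fin (m + 1) => (Finset.univ : Finset (Node D × Stamp D)))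
        fun _ x => (D.d x.1 : ℝ) ^ 2).symm
      rw [Fintype.piFinset_univ] at this
      rw [this, Finset.prod_const, Finset.card_univ, Fintype.card_fin, Fintype.sum_prod_type]
      simp only [Finset.sum_const, Finset.card_univ, Fintype.card_fin, nsmul_eq_mul]
      rw [Finset.mul_sum]
    rw [h4]
    have h5 := sum_pow_le (D := D) (2 * m + 1)
    have h6 := sum_pow_le (D := D) 1
    calc _ ≤ (16 / (degSum D * D.T : ℝ) ^ 2) ^ (m + 1) *
          ((maxDeg D : ℝ) ^ (2 * m + 1) * degSum D) *
          (D.T * ((maxDeg D : ℝ) ^ 1 * degSum D)) ^ (m + 1) := by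
          gcongr
      _ = 16 ^ (m + 1) * ((maxDeg D : ℝ) ^ (2 * m + 1) / (degSum D : ℝ) ^ m) *
          (maxDeg D / D.T) ^ (m + 1) := by
          have e : (D.T * ((maxDeg D : ℝ) ^ 1 * degSum D)) * (16 / (degSum D * D.T : ℝ) ^ 2) =
            16 * (maxDeg D / D.T) / degSum D := by
            field_simp
          rw [mul_right_comm, ← mul_pow, mul_comm (16 / _), e, div_pow, mul_pow]
          field_simp
          ring
      _ ≤ _ := mul_le_of_le_one_right (by positivity)
          (pow_le_one₀ (by positivity) ((div_le_one hT0).2 hT'))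

end Events

end TGen

end

noncomputable section

namespace TGen

variable {D : Input}

/-! ## The probability of the initial conditions -/

variable (D) in
/-- The ordered pairs of distinct marbles with the same label. -/
def twins : Finset (Marble D × Marble D) := {x | x.1 ≠ x.2 ∧ x.1.1 = x.2.1}

theorem mem_twins {x : Marble D × Marble D} : x ∈ twins D ↔ x.1 ≠ x.2 ∧ x.1.1 = x.2.1 := by
  simp [twins]

theorem card_twins_le : #(twins D) ≤ degSum₂ D := by
  have : twins D ⊆ Finset.univ.biUnion fun i => ({x : Marble D | x.1 = i} : Finset _).offDiag := by
    intro x hx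
    have := mem_twins.1 hx
    exact Finset.mem_biUnion.2 ⟨x.2.1, Finset.mem_univ _, by simp [this.1, this.2]⟩
  refine (Finset.card_le_card this).trans (Finset.card_biUnion_le.trans ?_)
  refine Finset.sum_le_sum fun i _ => ?_
  rw [Finset.offDiag_card, card_marbles, Nat.mul_sub_one]

theorem Pattern.fst_ne {m : ℕ} (e : Pattern D m) {x y : Fin m × Fin 2} (h : x ≠ y) :
    e.1 x ≠ e.1 y := fun h' => h (e.1.injective h')

/-- Here and below the constants matter, since Markov's inequality is applied at thresholds only a
constant factor above the mean. The count therefore uses ordered pairs of distinct marbles, which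
gives M₂ instead of ∑ d². -/
theorem card_loopPatterns_le :
    #{e : Pattern D 1 | (patternEdge e 0).1.IsDiag} ≤ D.T * degSum₂ D := by
  have h : #((Finset.univ : Finset (Stamp D)) ×ˢ twins D) ≤ D.T * degSum₂ D := by
    rw [Finset.card_product, Finset.card_univ, Fintype.card_fin]
    exact Nat.mul_le_mul_left _ card_twins_le
  refine le_trans (Finset.card_le_card_of_injOn
    (fun e => (e.2 0, (e.1 (0, 0), e.1 (0, 1)))) ?_ ?_) h
  · intro e he
    have he' := (Finset.mem_filter.1 he).2
    exact Finset.mem_coe.2 (Finset.mem_product.2 ⟨Finset.mem_univ _,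
      mem_twins.2 ⟨e.fst_ne (by simp), he'⟩⟩)
  · intro e _ e' _ h
    simp only [Prod.mk.injEq] at h
    refine Prod.ext (Function.Embedding.ext fun x => ?_) (funext fun r => ?_)
    · obtain ⟨r, j⟩ := x
      obtain rfl : r = 0 := Subsingleton.elim _ _
      fin_cases j
      · exact h.2.1
      · exact h.2.2
    · obtain rfl : r = 0 := Subsingleton.elim _ _
      exact h.1

theorem card_straightPatterns_le :
    #{e : Pattern D 2 | e.2 0 = e.2 1 ∧ (e.1 (0, 0)).1 = (e.1 (1, 0)).1 ∧
      (e.1 (0, 1)).1 = (e.1 (1, 1)).1} ≤ D.T * degSum₂ D ^ 2 := by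
  have h : #((Finset.univ : Finset (Stamp D)) ×ˢ twins D ×ˢ twins D) ≤ D.T * degSum₂ D ^ 2 := by
    rw [Finset.card_product, Finset.card_product, Finset.card_univ, Fintype.card_fin, pow_two]
    exact Nat.mul_le_mul_left _ (Nat.mul_le_mul card_twins_le card_twins_le)
  refine le_trans (Finset.card_le_card_of_injOn
    (fun e => (e.2 0, (e.1 (0, 0), e.1 (1, 0)), (e.1 (0, 1), e.1 (1, 1)))) ?_ ?_) h
  · intro e he
    have he' := (Finset.mem_filter.1 he).2
    exact Finset.mem_coe.2 (Finset.mem_product.2 ⟨Finset.mem_univ _, Finset.mem_product.2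
      ⟨mem_twins.2 ⟨e.fst_ne (by simp), he'.2.1⟩, mem_twins.2 ⟨e.fst_ne (by simp), he'.2.2⟩⟩⟩)
  · intro e he e' he' h
    have h1 := (Finset.mem_filter.1 he).2
    have h2 := (Finset.mem_filter.1 he').2
    simp only [Prod.mk.injEq] at h
    refine Prod.ext (Function.Embedding.ext fun x => ?_) (funext fun r => ?_)
    · obtain ⟨r, j⟩ := x
      fin_cases r <;> fin_cases j
      · exact h.2.1.1
      · exact h.2.2.1
      · exact h.2.1.2
      · exact h.2.2.2
    · fin_cases r
      · exact h.1
      · exact h1.1.symm.trans (h.1.trans h2.1)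

theorem card_crossPatterns_le :
    #{e : Pattern D 2 | e.2 0 = e.2 1 ∧ (e.1 (0, 0)).1 = (e.1 (1, 1)).1 ∧
      (e.1 (0, 1)).1 = (e.1 (1, 0)).1} ≤ D.T * degSum₂ D ^ 2 := by
  have h : #((Finset.univ : Finset (Stamp D)) ×ˢ twins D ×ˢ twins D) ≤ D.T * degSum₂ D ^ 2 := by
    rw [Finset.card_product, Finset.card_product, Finset.card_univ, Fintype.card_fin, pow_two]
    exact Nat.mul_le_mul_left _ (Nat.mul_le_mul card_twins_le card_twins_le)
  refine le_trans (Finset.card_le_card_of_injOn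
    (fun e => (e.2 0, (e.1 (0, 0), e.1 (1, 1)), (e.1 (0, 1), e.1 (1, 0)))) ?_ ?_) h
  · intro e he
    have he' := (Finset.mem_filter.1 he).2
    exact Finset.mem_coe.2 (Finset.mem_product.2 ⟨Finset.mem_univ _, Finset.mem_product.2
      ⟨mem_twins.2 ⟨e.fst_ne (by simp), he'.2.1⟩, mem_twins.2 ⟨e.fst_ne (by simp), he'.2.2⟩⟩⟩)
  · intro e he e' he' h
    have h1 := (Finset.mem_filter.1 he).2
    have h2 := (Finset.mem_filter.1 he').2
    simp only [Prod.mk.injEq] at h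
    refine Prod.ext (Function.Embedding.ext fun x => ?_) (funext fun r => ?_)
    · obtain ⟨r, j⟩ := x
      fin_cases r <;> fin_cases j
      · exact h.2.1.1
      · exact h.2.2.1
      · exact h.2.2.2
      · exact h.2.1.2
    · fin_cases r
      · exact h.1
      · exact h1.1.symm.trans (h.1.trans h2.1)

/-- Two equal edges agree either end by end or crosswise. -/
theorem card_doublePatterns_le :
    #{e : Pattern D 2 | patternEdge e 0 = patternEdge e 1} ≤ 2 * (D.T * degSum₂ D ^ 2) := by
  rw [two_mul]
  refine le_trans (le_trans (Finset.card_le_card fun e he => ?_) (Finset.card_union_le _ _))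
    (add_le_add (card_straightPatterns_le (D := D)) (card_crossPatterns_le (D := D)))
  have he' := (Finset.mem_filter.1 he).2
  simp only [patternEdge, Prod.mk.injEq, Sym2.eq_iff] at he'
  rcases he' with ⟨h | h, ht⟩
  · exact Finset.mem_union_left _ (Finset.mem_filter.2 ⟨Finset.mem_univ _, ht, h⟩)
  · exact Finset.mem_union_right _ (Finset.mem_filter.2 ⟨Finset.mem_univ _, ht, h⟩)

theorem sumLoops_configGraph_le (ω : Config D) :
    sumLoops (configGraph ω) ≤ #{k | (configEdge ω k).1.IsDiag} := by
  rw [sumLoops, ← Finset.sum_product', Finset.univ_product_univ]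
  refine le_trans (Finset.sum_le_sum fun x _ => ?_) (sum_card_fiber_le _ (configEdge ω) loopEdge
    Finset.univ fun x _ y _ h => ?_)
  · rw [W, if_pos rfl, w, count_configGraph, Finset.filter_filter]
    refine Finset.card_le_card fun k hk => ?_
    have hk' := (Finset.mem_filter.1 hk).2
    refine Finset.mem_filter.2 ⟨Finset.mem_univ _, ?_, hk'⟩
    rw [hk']
    rfl
  · simp only [loopEdge, Prod.mk.injEq, Sym2.eq_iff, and_self, or_self] at h
    exact Prod.ext h.1 h.2

/-- A temporal edge of multiplicity w ≥ 2 has w(w - 1) ≥ w ordered pairs of distinct copies. -/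
theorem sumMulti_configGraph_le (ω : Config D) : sumMulti (configGraph ω) ≤
    #{K : Fin 2 ↪ Fin (degSum D / 2) | configEdge ω (K 0) = configEdge ω (K 1)} := by
  rw [sumMulti_eq]
  refine le_trans (Finset.sum_le_sum fun x hx => ?_) (sum_card_fiber_le _
    (fun K => configEdge ω (K 0)) (fun x : Σ _ : Node D, Σ _ : Node D, Stamp D =>
      (s(x.1, x.2.1), x.2.2)) (orderedTriples D) fun x hx y hy h => ?_)
  · rw [W_eq, Finset.filter_filter]
    set e : TEdge D := (s(x.1, x.2.1), x.2.2)
    by_cases h0 : defect (configGraph ω) e = 0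
    · rw [h0]
      exact Nat.zero_le _
    have hd : ¬ e.1.IsDiag := (mem_orderedTriples.1 hx).ne
    have h1 : 2 ≤ (configGraph ω).count e := by
      unfold defect at h0
      by_contra h
      rw [if_neg (not_or.2 ⟨hd, h⟩)] at h0
      exact h0 rfl
    have h2 : (configGraph ω).count e ≤ Fintype.card (Fin 2 ↪ {k // configEdge ω k = e}) := by
      rw [Fintype.card_embedding_eq, Fintype.card_fin, Fintype.card_subtype, ← count_configGraph]
      rw [Nat.descFactorial_succ, Nat.descFactorial_one]
      exact Nat.le_mul_of_pos_left _ (by omega)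
    refine (defect_le_count _ _).trans (h2.trans ?_)
    rw [← Finset.card_univ]
    refine Finset.card_le_card_of_injOn (fun K => K.trans (Function.Embedding.subtype _)) ?_ ?_
    · intro K _
      have h3 : ∀ b, configEdge ω (K b) = e := fun b => (K b).2
      simp [h3]
    · intro K _ K' _ h
      ext b
      have := DFunLike.congr_fun h b
      exact congrArg Fin.val this
  · have hx' := mem_orderedTriples.1 hx
    have hy' := mem_orderedTriples.1 hy
    obtain ⟨i, j, t⟩ := x
    obtain ⟨i', j', t'⟩ := y
    simp only [Prod.mk.injEq, Sym2.eq_iff] at h hx' hy'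
    obtain ⟨⟨rfl, rfl⟩ | ⟨rfl, rfl⟩, rfl⟩ := h
    · rfl
    · exact (lt_asymm hx' hy').elim

/-- Markov's inequality with a strict threshold, so that the threshold 0 is allowed: then the mean
is 0 and the event has probability 0. This covers B_L = 0 and B_D = 0. -/
theorem configProb_lt_card_le {ι : Type*} [Fintype ι] (P : ι → Config D → Prop)
    [∀ ω, DecidablePred fun i => P i ω] {x a : ℝ} (hx : 0 ≤ x) (ha : 0 ≤ a)
    (h : ∑ i, configProb (P i) ≤ a * x) : configProb (fun ω => x < #{i | P i ω}) ≤ a := by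
  rcases hx.eq_or_lt with rfl | hx
  · rw [mul_zero] at h
    refine le_trans (configProb_mono fun ω hω => ?_) (((configProb_exists_le P).trans h).trans ha)
    obtain ⟨i, hi⟩ := Finset.card_pos.1 (Nat.cast_pos.1 hω)
    exact ⟨i, (Finset.mem_filter.1 hi).2⟩
  · have h1 := (mul_configProb_le P x).trans h
    rw [mul_comm a] at h1
    exact (configProb_mono fun ω hω => hω.le).trans (le_of_mul_le_mul_left h1 hx)

/-- The mean is at most B_L·M/(2(M - 1)), slightly more than half of the threshold. -/
theorem configProb_loops_le (hM : 30 ≤ degSum D) :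
    configProb (fun ω : Config D => BL D < #{k | (configEdge ω k).1.IsDiag}) ≤ 13 / 25 := by
  have hM' : (30 : ℝ) ≤ degSum D := by exact_mod_cast hM
  have hT := T_pos' D
  refine configProb_lt_card_le (fun k ω => (configEdge ω k).1.IsDiag) BL_nonneg (by norm_num) ?_
  have h1 : ∀ k : Fin (degSum D / 2), configProb (fun ω => (configEdge ω k).1.IsDiag) ≤
      degSum₂ D / (degSum D * (degSum D - 1)) := by
    intro k
    have h2 := configProb_patternAt ⟨fun _ : Fin 1 => k, fun _ _ _ => Subsingleton.elim _ _⟩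
      {e : Pattern D 1 | (patternEdge e 0).1.IsDiag}
    simp only [Finset.mem_filter, Finset.mem_univ, true_and, patternEdge_patternAt] at h2
    refine h2.le.trans ?_
    rw [show (degSum D).descFactorial (2 * 1) = degSum D * (degSum D - 1) by
      simp [Nat.descFactorial_succ, mul_comm], Nat.cast_mul, Nat.cast_sub (by omega), Nat.cast_one,
      pow_one, div_le_div_iff₀ (mul_pos (mul_pos (by linarith) (by linarith)) hT)
        (mul_pos (by linarith) (by linarith))]
    have h3 : (#{e : Pattern D 1 | (patternEdge e 0).1.IsDiag} : ℝ) ≤ D.T * degSum₂ D := by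
      exact_mod_cast card_loopPatterns_le
    have h4 : (0 : ℝ) ≤ degSum D * (degSum D - 1) := by nlinarith
    nlinarith
  refine (Finset.sum_le_sum fun k _ => h1 k).trans ?_
  rw [Finset.sum_const, Finset.card_univ, Fintype.card_fin, nsmul_eq_mul, BL]
  have h5 : ((degSum D / 2 : ℕ) : ℝ) ≤ degSum D / 2 := Nat.cast_div_le
  have h6 : (0 : ℝ) < degSum D - 1 := by linarith
  calc _ ≤ (degSum D : ℝ) / 2 * (degSum₂ D / (degSum D * (degSum D - 1))) := by gcongr
    _ = degSum D / (2 * (degSum D - 1)) * (degSum₂ D / degSum D) := by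
      field_simp
    _ ≤ _ := by
      refine mul_le_mul_of_nonneg_right ?_ (by positivity)
      rw [div_le_div_iff₀ (by linarith) (by norm_num)]
      linarith

/-- The mean number of ordered pairs of equal edges is about B_D/2, so the threshold 2B_D leaves
slightly more than 1/4; the exact factor is M²/(4(M - 1)(M - 3)). -/
theorem configProb_pairs_le (hM : 30 ≤ degSum D) :
    configProb (fun ω : Config D => 2 * BD D <
      #{K : Fin 2 ↪ Fin (degSum D / 2) | configEdge ω (K 0) = configEdge ω (K 1)}) ≤ 29 / 100 := by
  have hM' : (30 : ℝ) ≤ degSum D := by exact_mod_cast hM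
  have hT := T_pos' D
  refine configProb_lt_card_le (x := 2 * BD D)
    (fun (K : Fin 2 ↪ Fin (degSum D / 2)) ω => configEdge ω (K 0) = configEdge ω (K 1))
    (by linarith [BD_nonneg (D := D)]) (by norm_num) ?_
  set M : ℝ := (degSum D : ℝ) with hMdef
  have hp : 0 < M * (M - 1) * (M - 2) * (M - 3) := by
    have h1 : 0 < M - 1 := by linarith
    have h2 : 0 < M - 2 := by linarith
    have h3 : 0 < M - 3 := by linarith
    have h4 : 0 < M := by linarith
    positivity
  have h1 : ∀ K : Fin 2 ↪ Fin (degSum D / 2),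
      configProb (fun ω => configEdge ω (K 0) = configEdge ω (K 1)) ≤
      2 * (degSum₂ D : ℝ) ^ 2 / (M * (M - 1) * (M - 2) * (M - 3) * D.T) := by
    intro K
    have h2 := configProb_patternAt K {e : Pattern D 2 | patternEdge e 0 = patternEdge e 1}
    simp only [Finset.mem_filter, Finset.mem_univ, true_and, patternEdge_patternAt] at h2
    refine h2.le.trans ?_
    have hdf : ((degSum D).descFactorial (2 * 2) : ℝ) = M * (M - 1) * (M - 2) * (M - 3) := by
      have : (degSum D).descFactorial (2 * 2) =
          degSum D * (degSum D - 1) * (degSum D - 2) * (degSum D - 3) := by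
        simp only [Nat.reduceMul, Nat.descFactorial_succ, Nat.descFactorial_zero]
        simp only [Nat.sub_zero, mul_one]
        ring
      rw [this]
      push_cast [Nat.cast_sub (show 1 ≤ degSum D by omega),
        Nat.cast_sub (show 2 ≤ degSum D by omega), Nat.cast_sub (show 3 ≤ degSum D by omega)]
      rfl
    rw [hdf, div_le_div_iff₀ (by positivity) (by positivity)]
    have h3 : (#{e : Pattern D 2 | patternEdge e 0 = patternEdge e 1} : ℝ) ≤
        2 * (D.T * (degSum₂ D : ℝ) ^ 2) := by
      exact_mod_cast card_doublePatterns_le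
    refine (mul_le_mul_of_nonneg_right h3 (by positivity)).trans (le_of_eq ?_)
    ring
  refine (Finset.sum_le_sum fun k _ => h1 k).trans ?_
  rw [Finset.sum_const, Finset.card_univ, Fintype.card_embedding_eq, Fintype.card_fin,
    Fintype.card_fin, nsmul_eq_mul, BD, ← hMdef]
  have h5 : ((degSum D / 2 : ℕ) : ℝ) ≤ M / 2 := Nat.cast_div_le
  have h6 : (((degSum D / 2).descFactorial 2 : ℕ) : ℝ) ≤ M / 2 * (M / 2 - 1) := by
    rw [Nat.descFactorial_succ, Nat.descFactorial_one, Nat.cast_mul, mul_comm,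
      Nat.cast_sub (by omega), Nat.cast_one]
    have : (0 : ℝ) ≤ (degSum D / 2 : ℕ) := Nat.cast_nonneg _
    have h7 : (1 : ℝ) ≤ (degSum D / 2 : ℕ) := by exact_mod_cast (by omega : 1 ≤ degSum D / 2)
    exact mul_le_mul h5 (by linarith) (by linarith) (by linarith)
  have h8 : 0 < M - 1 := by linarith
  have h9 : 0 < M - 2 := by linarith
  have h10 : 0 < M - 3 := by linarith
  have h11 : 0 < M := by linarith
  calc _ ≤ M / 2 * (M / 2 - 1) *
        (2 * (degSum₂ D : ℝ) ^ 2 / (M * (M - 1) * (M - 2) * (M - 3) * D.T)) := by gcongr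
    _ = M ^ 2 / (4 * ((M - 1) * (M - 3))) * (2 * ((degSum₂ D : ℝ) ^ 2 / (M ^ 2 * D.T))) := by
      field_simp
      ring
    _ ≤ _ := by
      refine mul_le_mul_of_nonneg_right ?_ (by positivity)
      rw [div_le_div_iff₀ (by positivity) (by norm_num)]
      nlinarith

theorem configProb_sumLoops_le (hM : 30 ≤ degSum D) :
    configProb (fun ω : Config D => BL D < sumLoops (configGraph ω)) ≤ 13 / 25 :=
  (configProb_mono fun ω hω => lt_of_lt_of_le hω (Nat.cast_le.2 (sumLoops_configGraph_le ω))).trans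
    (configProb_loops_le hM)

theorem configProb_sumMulti_le (hM : 30 ≤ degSum D) :
    configProb (fun ω : Config D => BD D < sumMulti (configGraph ω) / 2) ≤ 29 / 100 := by
  refine (configProb_mono fun ω hω => ?_).trans (configProb_pairs_le hM)
  have : (sumMulti (configGraph ω) : ℝ) ≤
      #{K : Fin 2 ↪ Fin (degSum D / 2) | configEdge ω (K 0) = configEdge ω (K 1)} :=
    Nat.cast_le.2 (sumMulti_configGraph_le ω)
  linarith

/-- The failures add up to at most 13/25 + 29/100 + 1/16 < 7/8; only the numbers of loops and
double-edges have failure bounds that do not become small. The coefficient 80 = 16 + 64 collects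
double loops and triple edges. -/
theorem le_configProb_initialConditions {lam kap m : ℕ} (hM : 30 ≤ degSum D)
    (hlam : 4 * (lam + 1) ≤ degSum D) (hkap : 8 * (kap + 1) ≤ degSum D)
    (hm : 4 * (m + 2) ≤ degSum D) (hT : maxDeg D ≤ D.T)
    (hsmall : 80 * ((maxDeg D : ℝ) ^ 2 / degSum D) +
      4 ^ (lam + 1) * ((maxDeg D : ℝ) ^ (2 * lam + 1) / (degSum D : ℝ) ^ lam) +
      16 ^ (kap + 1) * ((maxDeg D : ℝ) ^ (2 * kap + 1) / (degSum D : ℝ) ^ kap) +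
      4 ^ (m + 2) * ((maxDeg D : ℝ) ^ (2 * m + 2) / (degSum D : ℝ) ^ m) ≤ 1 / 16) :
    1 / 8 ≤ configProb (fun ω : Config D => InitialConditions lam kap (configGraph ω) ∧
      ∀ p, pairMult (configGraph ω) p + 1 ≤ m + 2) := by
  have h1 := configProb_sumLoops_le hM
  have h2 := configProb_sumMulti_le hM
  have h3 := configProb_double_loop_le (by omega) hT
  have h4 := configProb_triple_le (by omega) hT
  have h5 := configProb_le_loops_le hlam
  have h6 := configProb_doubles_le hkap hT
  have h7 := configProb_le_pairMult_le hm
  have hnot := configProb_not fun ω : Config D => InitialConditions lam kap (configGraph ω) ∧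
      ∀ p, pairMult (configGraph ω) p + 1 ≤ m + 2
  have hle : configProb (fun ω : Config D => ¬ (InitialConditions lam kap (configGraph ω) ∧
      ∀ p, pairMult (configGraph ω) p + 1 ≤ m + 2)) ≤ 7 / 8 := by
    refine le_trans (configProb_mono (Q := fun ω =>
      (BL D < sumLoops (configGraph ω)) ∨ (BD D < sumMulti (configGraph ω) / 2) ∨
      (∃ i t, 2 ≤ (configGraph ω).count (s(i, i), t)) ∨
      (∃ i j t, 3 ≤ (configGraph ω).count (s(i, j), t)) ∨
      (∃ i, lam + 1 ≤ pairMult (configGraph ω) s(i, i)) ∨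
      (∃ i, kap + 1 ≤ #{x : Node D × Stamp D | 2 ≤ (configGraph ω).count (s(i, x.1), x.2)}) ∨
      (∃ p, m + 2 ≤ pairMult (configGraph ω) p)) fun ω hω => ?_) ?_
    · by_contra hcon
      simp only [not_or, not_lt, not_exists, not_le] at hcon
      obtain ⟨c1, c2, c3, c4, c5, c6, c7⟩ := hcon
      refine hω ⟨⟨c1, c2, fun i t => ?_, fun i j t hij => ?_, fun i => ?_, fun i => ?_⟩,
        fun p => c7 p⟩
      · rw [W_eq]
        exact (defect_le_count _ _).trans_lt (c3 i t)
      · rw [W_eq]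
        exact (defect_le_count _ _).trans_lt (c4 i j t)
      · refine Nat.lt_succ_iff.1 (lt_of_le_of_lt ?_ (c5 i))
        rw [pairMult, Finset.card_eq_sum_ones]
        refine (Finset.sum_le_sum fun t ht => ?_).trans
          (Finset.sum_le_sum_of_subset (Finset.filter_subset _ _))
        rw [← (Finset.mem_filter.1 ht).2, W_eq]
        exact defect_le_count _ _
      · refine Nat.lt_succ_iff.1 (lt_of_le_of_lt (Finset.card_le_card fun x hx => ?_) (c6 i))
        have := (Finset.mem_filter.1 hx).2.2
        refine Finset.mem_filter.2 ⟨Finset.mem_univ _, ?_⟩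
        rw [← this, W_eq]
        exact defect_le_count _ _
    · refine (configProb_or_le _ _).trans ?_
      refine (add_le_add h1 ((configProb_or_le _ _).trans (add_le_add h2
        ((configProb_or_le _ _).trans (add_le_add h3 ((configProb_or_le _ _).trans
        (add_le_add h4 ((configProb_or_le _ _).trans (add_le_add h5
        ((configProb_or_le _ _).trans (add_le_add h6 h7))))))))))).trans ?_
      linarith
  linarith

end TGen

end

noncomputable section

namespace TGen

variable {D : Input}

/-! ## The probability of a simple initial graph -/

/-- The label of one end of an edge of the configuration model. -/
def endLabel (ω : Config D) (i : Fin 2) (k : Fin (degSum D / 2)) : Node D := (ω.1 (slot k i)).1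

theorem configEdge_eq (ω : Config D) (k : Fin (degSum D / 2)) :
    configEdge ω k = (s(endLabel ω 0 k, endLabel ω 1 k), ω.2 k) := rfl

/-- The edge with index `k` is a loop or has a copy. -/
def IsBad (ω : Config D) (k : Fin (degSum D / 2)) : Prop :=
  (configEdge ω k).1.IsDiag ∨ ∃ l, l ≠ k ∧ configEdge ω l = configEdge ω k

open scoped Classical in
def badEdges (ω : Config D) : Finset (Fin (degSum D / 2)) := {k | IsBad ω k}

theorem mem_badEdges {ω : Config D} {k : Fin (degSum D / 2)} : k ∈ badEdges ω ↔ IsBad ω k := by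
  classical
  simp [badEdges]

theorem isSimple_of_badEdges {ω : Config D} (h : badEdges ω = ∅) : IsSimple (configGraph ω) := by
  have h' : ∀ k, ¬ IsBad ω k := fun k hk => by
    have := mem_badEdges.2 hk
    rw [h] at this
    exact Finset.notMem_empty k this
  refine ⟨?_, fun e he => ?_⟩
  · refine Finset.univ.nodup.map_on fun k _ l _ hkl => ?_
    by_contra hne
    exact h' l (.inr ⟨k, hne, hkl⟩)
  · obtain ⟨k, -, rfl⟩ := Multiset.mem_map.1 he
    exact fun hd => h' k (.inl hd)

theorem card_badEdges_le (ω : Config D) : #(badEdges ω) ≤ #{k | (configEdge ω k).1.IsDiag} +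
    #{K : Fin 2 ↪ Fin (degSum D / 2) | configEdge ω (K 0) = configEdge ω (K 1)} := by
  have h : badEdges ω ⊆ ({k | (configEdge ω k).1.IsDiag} : Finset _) ∪
      ({K : Fin 2 ↪ Fin (degSum D / 2) | configEdge ω (K 0) = configEdge ω (K 1)} :
        Finset _).image fun K => K 0 := by
    intro k hk
    rcases mem_badEdges.1 hk with h | ⟨l, hl, h⟩
    · exact Finset.mem_union_left _ (by simpa using h)
    · refine Finset.mem_union_right _ (Finset.mem_image.2 ⟨⟨![k, l], ?_⟩, ?_, rfl⟩)
      · intro i j hij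
        fin_cases i <;> fin_cases j <;> simp_all
      · exact Finset.mem_filter.2 ⟨Finset.mem_univ _, h.symm⟩
  exact (Finset.card_le_card h).trans ((Finset.card_union_le _ _).trans
    (Nat.add_le_add_left Finset.card_image_le _))

/-- The nodes coincide or are joined by an edge. -/
def IsClose (ω : Config D) (x y : Node D) : Prop := x = y ∨ ∃ r, (configEdge ω r).1 = s(x, y)

theorem card_endLabel_le (ω : Config D) (i : Fin 2) (x : Node D) :
    #{l | endLabel ω i l = x} ≤ maxDeg D := by
  refine le_trans ?_ ((card_marbles x).le.trans (le_maxDeg x))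
  refine Finset.card_le_card_of_injOn (fun l => ω.1 (slot l i)) ?_ ?_
  · intro l hl
    exact Finset.mem_coe.2 (Finset.mem_filter.2 ⟨Finset.mem_univ _, (Finset.mem_filter.1 hl).2⟩)
  · intro l _ l' _ h
    exact (slot_inj (ω.1.injective h)).1

open scoped Classical in
-- At most Δ edges have this end at `x`. Otherwise one of at most 2Δ edges at `x` leads to the node,
-- and each of its two labels occurs at most Δ times; Δ + 4Δ² ≤ 5Δ².
theorem card_isClose_le (ω : Config D) (i : Fin 2) (x : Node D) :
    #{l | IsClose ω x (endLabel ω i l)} ≤ 5 * maxDeg D ^ 2 := by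
  set S : Finset (Fin (degSum D / 2)) :=
    ({r | endLabel ω 0 r = x} : Finset _) ∪ ({r | endLabel ω 1 r = x} : Finset _) with hS
  have hScard : #S ≤ 2 * maxDeg D := by
    refine (Finset.card_union_le _ _).trans ?_
    rw [two_mul]
    exact add_le_add (card_endLabel_le ω 0 x) (card_endLabel_le ω 1 x)
  have hsub : ({l | IsClose ω x (endLabel ω i l)} : Finset (Fin (degSum D / 2))) ⊆
      ({l | endLabel ω i l = x} : Finset _) ∪ S.biUnion fun r =>
        ({l | endLabel ω i l = endLabel ω 0 r} : Finset _) ∪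
          ({l | endLabel ω i l = endLabel ω 1 r} : Finset _) := by
    intro l hl
    rcases (Finset.mem_filter.1 hl).2 with h | ⟨r, hr⟩
    · exact Finset.mem_union_left _ (by simp [h])
    · refine Finset.mem_union_right _ (Finset.mem_biUnion.2 ⟨r, ?_⟩)
      rw [configEdge_eq, Sym2.eq_iff] at hr
      rcases hr with ⟨h1, h2⟩ | ⟨h1, h2⟩
      · exact ⟨Finset.mem_union_left _ (by simp [h1]), Finset.mem_union_right _ (by simp [h2])⟩
      · exact ⟨Finset.mem_union_right _ (by simp [h2]), Finset.mem_union_left _ (by simp [h1])⟩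
  have h2 : #(S.biUnion fun r =>
        ({l | endLabel ω i l = endLabel ω 0 r} : Finset _) ∪
          ({l | endLabel ω i l = endLabel ω 1 r} : Finset _)) ≤ 2 * maxDeg D * (2 * maxDeg D) := by
    refine (Finset.card_biUnion_le_card_mul _ _ (2 * maxDeg D) fun r _ => ?_).trans
      (Nat.mul_le_mul_right _ hScard)
    refine (Finset.card_union_le _ _).trans ?_
    rw [two_mul]
    exact add_le_add (card_endLabel_le ω i _) (card_endLabel_le ω i _)
  refine (Finset.card_le_card hsub).trans ((Finset.card_union_le _ _).trans
    ((add_le_add (card_endLabel_le ω i x) h2).trans ?_))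
  nlinarith [Nat.le_self_pow two_ne_zero (maxDeg D)]

/-- Exchange the second ends of two edges. -/
def swapEnds (ω : Config D) (k l : Fin (degSum D / 2)) : Config D :=
  ((Equiv.swap (slot k 1) (slot l 1)).trans ω.1, ω.2)

theorem swapEnds_swapEnds (ω : Config D) (k l : Fin (degSum D / 2)) :
    swapEnds (swapEnds ω k l) k l = ω := by
  refine Prod.ext (Equiv.ext fun p => ?_) rfl
  simp [swapEnds]

theorem endLabel_swapEnds (ω : Config D) (k l r : Fin (degSum D / 2)) :
    endLabel (swapEnds ω k l) 0 r = endLabel ω 0 r ∧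
      endLabel (swapEnds ω k l) 1 r = endLabel ω 1 (Equiv.swap k l r) := by
  have hne : ∀ k' r' : Fin (degSum D / 2), slot r' 0 ≠ slot k' 1 := fun k' r' h => by
    have := (slot_inj h).2
    simp at this
  constructor
  · change (ω.1 (Equiv.swap (slot k 1) (slot l 1) (slot r 0))).1 = _
    rw [Equiv.swap_apply_of_ne_of_ne (hne k r) (hne l r)]
    rfl
  · change (ω.1 (Equiv.swap (slot k 1) (slot l 1) (slot r 1))).1 = _
    have : Equiv.swap (slot k 1) (slot l 1) (slot r 1) = slot (Equiv.swap k l r) 1 := by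
      have hinj : Function.Injective fun r : Fin (degSum D / 2) => slot r 1 :=
        fun r r' h => (slot_inj h).1
      exact (hinj.map_swap k l r).symm
    rw [this]
    rfl

/-- The pairs of edges whose ends may be exchanged in order to reduce the number of bad edges. -/
def CanSwap (ω : Config D) (k l : Fin (degSum D / 2)) : Prop :=
  IsBad ω k ∧ ¬ IsBad ω l ∧ ¬ IsClose ω (endLabel ω 0 k) (endLabel ω 1 l) ∧
    ¬ IsClose ω (endLabel ω 1 k) (endLabel ω 0 l)

/-! ### Exchanging ends removes a bad edge -/

section Swap

variable {ω : Config D} {k l : Fin (degSum D / 2)}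

theorem CanSwap.ne (h : CanSwap ω k l) : k ≠ l := fun h' => h.2.1 (h' ▸ h.1)

theorem configEdge_swapEnds_left (ω : Config D) (k l : Fin (degSum D / 2)) :
    configEdge (swapEnds ω k l) k = (s(endLabel ω 0 k, endLabel ω 1 l), ω.2 k) := by
  have := endLabel_swapEnds ω k l k
  rw [configEdge_eq, this.1, this.2, Equiv.swap_apply_left]
  rfl

theorem configEdge_swapEnds_right (ω : Config D) (k l : Fin (degSum D / 2)) :
    configEdge (swapEnds ω k l) l = (s(endLabel ω 0 l, endLabel ω 1 k), ω.2 l) := by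
  have := endLabel_swapEnds ω k l l
  rw [configEdge_eq, this.1, this.2, Equiv.swap_apply_right]
  rfl

theorem configEdge_swapEnds_of_ne (ω : Config D) {k l r : Fin (degSum D / 2)} (hk : r ≠ k)
    (hl : r ≠ l) : configEdge (swapEnds ω k l) r = configEdge ω r := by
  have := endLabel_swapEnds ω k l r
  rw [configEdge_eq, this.1, this.2, Equiv.swap_apply_of_ne_of_ne hk hl]
  rfl

/-- The new edge joins two nodes that were neither equal nor adjacent, so it is no loop and no copy
of an edge left in place. -/
theorem CanSwap.not_bad_left (h : CanSwap ω k l) : ¬ IsBad (swapEnds ω k l) k := by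
  obtain ⟨h1, h2, h3, h4⟩ := h
  rintro (hd | ⟨r, hr, he⟩)
  · rw [configEdge_swapEnds_left] at hd
    exact h3 (.inl hd)
  · rw [configEdge_swapEnds_left] at he
    -- The two new edges could be copies of each other. If they agree end by end, the old edge `k`
    -- already joined the ends of the new one; if they agree crosswise, `l` was a loop.
    by_cases hrl : r = l
    · subst hrl
      rw [configEdge_swapEnds_right] at he
      have := congrArg Prod.fst he
      simp only [Sym2.eq_iff] at this
      rcases this with ⟨e1, e2⟩ | ⟨e1, e2⟩
      · exact h3 (.inr ⟨k, by rw [configEdge_eq, ← e2]⟩)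
      · exact h2 (.inl e1)
    · rw [configEdge_swapEnds_of_ne ω hr hrl] at he
      exact h3 (.inr ⟨r, congrArg Prod.fst he⟩)

theorem CanSwap.not_bad_right (h : CanSwap ω k l) : ¬ IsBad (swapEnds ω k l) l := by
  have hkb := h.not_bad_left
  obtain ⟨h1, h2, h3, h4⟩ := h
  rintro (hd | ⟨r, hr, he⟩)
  · rw [configEdge_swapEnds_right] at hd
    exact h4 (.inl (Eq.symm hd))
  · by_cases hrk : r = k
    · subst hrk
      exact hkb (.inr ⟨l, hr.symm, he.symm⟩)
    · rw [configEdge_swapEnds_right, configEdge_swapEnds_of_ne ω hrk hr] at he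
      exact h4 (.inr ⟨r, (congrArg Prod.fst he).trans Sym2.eq_swap⟩)

/-- The edge `k` stops being bad and no other edge becomes bad: a new copy of an unchanged edge
would be one of the two exchanged edges, and these are not bad. -/
theorem CanSwap.card_badEdges_lt (h : CanSwap ω k l) :
    #(badEdges (swapEnds ω k l)) < #(badEdges ω) := by
  refine Finset.card_lt_card ((Finset.ssubset_iff_of_subset fun r hr => ?_).2
    ⟨k, mem_badEdges.2 h.1, fun hk => h.not_bad_left (mem_badEdges.1 hk)⟩)
  have hr' := mem_badEdges.1 hr
  have hrk : r ≠ k := fun e => h.not_bad_left (e ▸ hr')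
  have hrl : r ≠ l := fun e => h.not_bad_right (e ▸ hr')
  have her := configEdge_swapEnds_of_ne ω hrk hrl
  refine mem_badEdges.2 ?_
  rcases hr' with hd | ⟨s, hs, he⟩
  · rw [her] at hd
    exact .inl hd
  · by_cases hsk : s = k
    · subst hsk
      exact (h.not_bad_left (.inr ⟨r, hrk, he.symm⟩)).elim
    by_cases hsl : s = l
    · subst hsl
      exact (h.not_bad_right (.inr ⟨r, hrl, he.symm⟩)).elim
    rw [her, configEdge_swapEnds_of_ne ω hsk hsl] at he
    exact .inr ⟨s, hs, he⟩

/-- Needed for counting backwards. After the exchange these two labels are the ends of the old edge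
`k`: they are equal if it was a loop, and otherwise joined by its copy, which the exchange leaves in
place because `l` was not bad. -/
theorem CanSwap.isClose (h : CanSwap ω k l) :
    IsClose (swapEnds ω k l) (endLabel (swapEnds ω k l) 0 k) (endLabel (swapEnds ω k l) 1 l) := by
  rw [(endLabel_swapEnds ω k l k).1, (endLabel_swapEnds ω k l l).2, Equiv.swap_apply_right]
  rcases h.1 with hd | ⟨r, hr, he⟩
  · exact .inl hd
  · have hrl : r ≠ l := fun e => h.2.1 (.inr ⟨k, h.ne, by rw [← he, e]⟩)
    refine .inr ⟨r, ?_⟩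
    rw [configEdge_swapEnds_of_ne ω hr hrl, he]
    rfl

end Swap

open scoped Classical in
-- It suffices to fix one bad edge `k`. An edge `l` is unsuitable only if it is bad or if one of its
-- ends is close to the corresponding end of `k`, which excludes at most 2·5Δ² further edges.
theorem le_card_canSwap {ω : Config D} (hω : badEdges ω ≠ ∅) :
    degSum D / 2 ≤ #{x : Fin (degSum D / 2) × Fin (degSum D / 2) | CanSwap ω x.1 x.2} +
      (#(badEdges ω) + 10 * maxDeg D ^ 2) := by
  obtain ⟨k, hk⟩ := Finset.nonempty_iff_ne_empty.2 hω
  have hcover : (Finset.univ : Finset (Fin (degSum D / 2))) ⊆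
      ({l | CanSwap ω k l} : Finset _) ∪ (badEdges ω ∪
        (({l | IsClose ω (endLabel ω 0 k) (endLabel ω 1 l)} : Finset _) ∪
          ({l | IsClose ω (endLabel ω 1 k) (endLabel ω 0 l)} : Finset _))) := by
    intro l _
    by_cases h : CanSwap ω k l
    · exact Finset.mem_union_left _ (by simpa using h)
    · refine Finset.mem_union_right _ ?_
      simp only [Finset.mem_union, Finset.mem_filter, Finset.mem_univ, true_and, mem_badEdges]
      by_contra hc
      rw [not_or, not_or] at hc
      exact h ⟨mem_badEdges.1 hk, hc.1, hc.2.1, hc.2.2⟩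
  have h1 : #({l | CanSwap ω k l} : Finset (Fin (degSum D / 2))) ≤
      #{x : Fin (degSum D / 2) × Fin (degSum D / 2) | CanSwap ω x.1 x.2} := by
    refine Finset.card_le_card_of_injOn (fun l => (k, l)) (fun l hl => ?_) fun l _ l' _ h =>
      congrArg Prod.snd h
    simpa using hl
  have h2 := Finset.card_le_card hcover
  rw [Finset.card_univ, Fintype.card_fin] at h2
  have h3 := card_isClose_le ω 1 (endLabel ω 0 k)
  have h4 := card_isClose_le ω 0 (endLabel ω 1 k)
  have h5 := Finset.card_union_le ({l | CanSwap ω k l} : Finset _) (badEdges ω ∪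
        (({l | IsClose ω (endLabel ω 0 k) (endLabel ω 1 l)} : Finset _) ∪
          ({l | IsClose ω (endLabel ω 1 k) (endLabel ω 0 l)} : Finset _)))
  have h6 := Finset.card_union_le (badEdges ω)
        (({l | IsClose ω (endLabel ω 0 k) (endLabel ω 1 l)} : Finset _) ∪
          ({l | IsClose ω (endLabel ω 1 k) (endLabel ω 0 l)} : Finset _))
  have h7 := Finset.card_union_le ({l | IsClose ω (endLabel ω 0 k) (endLabel ω 1 l)} : Finset _)
          ({l | IsClose ω (endLabel ω 1 k) (endLabel ω 0 l)} : Finset _)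
  omega

open scoped Classical in
/-- The switching argument. -/
theorem card_badEdges_eq_le {j n : ℕ} (hn : n + (j + 1 + 10 * maxDeg D ^ 2) ≤ degSum D / 2) :
    #{ω : Config D | #(badEdges ω) = j + 1} * n ≤
      #{ω : Config D | #(badEdges ω) ≤ j} * (degSum D / 2 * (5 * maxDeg D ^ 2)) := by
  set A : Finset (Σ _ : Config D, Fin (degSum D / 2) × Fin (degSum D / 2)) :=
    ({ω : Config D | #(badEdges ω) = j + 1} : Finset _).sigma fun ω =>
      ({x | CanSwap ω x.1 x.2} : Finset _) with hA
  set A' : Finset (Σ _ : Config D, Fin (degSum D / 2) × Fin (degSum D / 2)) :=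
    ({ω : Config D | #(badEdges ω) ≤ j} : Finset _).sigma fun ω =>
      ({x | IsClose ω (endLabel ω 0 x.1) (endLabel ω 1 x.2)} : Finset _) with hA'
  have h1 : #{ω : Config D | #(badEdges ω) = j + 1} * n ≤ #A := by
    rw [hA, Finset.card_sigma, ← smul_eq_mul]
    refine Finset.card_nsmul_le_sum _ _ _ fun ω hω => ?_
    have hω' := (Finset.mem_filter.1 hω).2
    have := le_card_canSwap (ω := ω) (fun h => by rw [h] at hω'; simp at hω')
    omega
  -- Keeping the pair (k, l) makes the map injective, since the exchange is an involution for fixed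
  -- k and l. Forwards almost M/2 exchanges are possible; backwards only pairs with close ends
  -- occur.
  have h2 : #A ≤ #A' := by
    refine Finset.card_le_card_of_injOn (fun x => ⟨swapEnds x.1 x.2.1 x.2.2, x.2⟩) ?_ ?_
    · rintro ⟨ω, k, l⟩ hx
      have hx' := Finset.mem_sigma.1 (Finset.mem_coe.1 hx)
      have hc : CanSwap ω k l := (Finset.mem_filter.1 hx'.2).2
      have hj : #(badEdges ω) = j + 1 := (Finset.mem_filter.1 hx'.1).2
      have hlt := hc.card_badEdges_lt
      refine Finset.mem_coe.2 (Finset.mem_sigma.2 ⟨Finset.mem_filter.2 ⟨Finset.mem_univ _, ?_⟩,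
        Finset.mem_filter.2 ⟨Finset.mem_univ _, hc.isClose⟩⟩)
      simp only
      omega
    · rintro ⟨ω, k, l⟩ _ ⟨ω', k', l'⟩ _ h
      simp only [Sigma.mk.injEq, heq_eq_eq, Prod.mk.injEq] at h
      obtain ⟨h, rfl, rfl⟩ := h
      rw [← swapEnds_swapEnds ω k l, h, swapEnds_swapEnds]
  have h3 : #A' ≤ #{ω : Config D | #(badEdges ω) ≤ j} * (degSum D / 2 * (5 * maxDeg D ^ 2)) := by
    rw [hA', Finset.card_sigma, ← smul_eq_mul]
    refine Finset.sum_le_card_nsmul _ _ _ fun ω _ => ?_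
    have : ({x | IsClose ω (endLabel ω 0 x.1) (endLabel ω 1 x.2)} :
        Finset (Fin (degSum D / 2) × Fin (degSum D / 2))) ⊆
        (Finset.univ : Finset (Fin (degSum D / 2))).biUnion fun k =>
          ({l | IsClose ω (endLabel ω 0 k) (endLabel ω 1 l)} : Finset _).image fun l => (k, l) := by
      rintro ⟨k, l⟩ hx
      simpa using hx
    refine (Finset.card_le_card this).trans ((Finset.card_biUnion_le_card_mul _ _
      (5 * maxDeg D ^ 2) fun k _ => Finset.card_image_le.trans (card_isClose_le ω 1 _)).trans ?_)
    rw [Finset.card_univ, Fintype.card_fin]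
  exact h1.trans (h2.trans h3)

theorem configProb_badEdges_step {j : ℕ}
    (hM : 4 * (j + 2 + 10 * maxDeg D ^ 2) ≤ degSum D) :
    configProb (fun ω : Config D => #(badEdges ω) ≤ j + 1) ≤
      (1 + 10 * (maxDeg D : ℝ) ^ 2) * configProb (fun ω : Config D => #(badEdges ω) ≤ j) := by
  classical
  set N := degSum D / 2 with hN
  have h1 := card_badEdges_eq_le (D := D) (j := j) (n := N - (j + 1 + 10 * maxDeg D ^ 2)) (by omega)
  -- By `hM` at least half of all edges are suitable partners, which removes the dependence on M
  -- from the ratio.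
  have h2 : N ≤ 2 * (N - (j + 1 + 10 * maxDeg D ^ 2)) := by omega
  have hN0 : 0 < N := by omega
  have h3 : #{ω : Config D | #(badEdges ω) = j + 1} ≤
      10 * maxDeg D ^ 2 * #{ω : Config D | #(badEdges ω) ≤ j} := by
    refine Nat.le_of_mul_le_mul_right ?_ hN0
    calc _ ≤ #{ω : Config D | #(badEdges ω) = j + 1} * (2 * (N - (j + 1 + 10 * maxDeg D ^ 2))) :=
          Nat.mul_le_mul_left _ h2
      _ = 2 * (#{ω : Config D | #(badEdges ω) = j + 1} * (N - (j + 1 + 10 * maxDeg D ^ 2))) := by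
          ring
      _ ≤ 2 * (#{ω : Config D | #(badEdges ω) ≤ j} * (N * (5 * maxDeg D ^ 2))) :=
          Nat.mul_le_mul_left _ h1
      _ = _ := by ring
  have h4 : #{ω : Config D | #(badEdges ω) ≤ j + 1} ≤
      #{ω : Config D | #(badEdges ω) ≤ j} + #{ω : Config D | #(badEdges ω) = j + 1} := by
    refine (Finset.card_le_card fun ω hω => ?_).trans (Finset.card_union_le _ _)
    rcases Nat.lt_or_ge #(badEdges ω) (j + 1) with h | h
    · exact Finset.mem_union_left _ (by simpa using Nat.lt_succ_iff.1 h)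
    · exact Finset.mem_union_right _ (by simpa using le_antisymm (Finset.mem_filter.1 hω).2 h)
  have h5 : (#{ω : Config D | #(badEdges ω) ≤ j + 1} : ℝ) ≤
      (1 + 10 * (maxDeg D : ℝ) ^ 2) * #{ω : Config D | #(badEdges ω) ≤ j} := by
    have : #{ω : Config D | #(badEdges ω) ≤ j + 1} ≤
        (1 + 10 * maxDeg D ^ 2) * #{ω : Config D | #(badEdges ω) ≤ j} := by
      rw [add_mul, one_mul]
      omega
    exact_mod_cast this
  unfold configProb
  rw [← mul_div_assoc]
  gcongr
  convert h5
  rfl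

/-- By the Markov bounds there are at most B_L + 2B_D ≤ 3Δ bad edges with probability at least 1/8.
Each of the 3Δ steps down to 0 bad edges costs a factor 1 + 10Δ². The result is useful only for
bounded Δ. -/
theorem le_configProb_isSimple (hM : 30 ≤ degSum D)
    (hM' : 4 * (3 * maxDeg D + 1 + 10 * maxDeg D ^ 2) ≤ degSum D) (hT : maxDeg D ≤ D.T) :
    1 / (8 * (1 + 10 * (maxDeg D : ℝ) ^ 2) ^ (3 * maxDeg D)) ≤
      configProb (fun ω : Config D => IsSimple (configGraph ω)) := by
  have hpos : 0 < 1 + 10 * (maxDeg D : ℝ) ^ 2 := by positivity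
  have h1 : ∀ j, j ≤ 3 * maxDeg D → configProb (fun ω : Config D => #(badEdges ω) ≤ j) ≤
      (1 + 10 * (maxDeg D : ℝ) ^ 2) ^ j * configProb (fun ω : Config D => #(badEdges ω) ≤ 0) := by
    intro j
    induction j with
    | zero => simp
    | succ j ih =>
      intro hj
      refine (configProb_badEdges_step (by omega)).trans ?_
      rw [pow_succ' (1 + 10 * (maxDeg D : ℝ) ^ 2), mul_assoc]
      exact mul_le_mul_of_nonneg_left (ih (by omega)) hpos.le
  have h2 : 1 / 8 ≤ configProb (fun ω : Config D => #(badEdges ω) ≤ 3 * maxDeg D) := by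
    have hnot := configProb_not fun ω : Config D => #(badEdges ω) ≤ 3 * maxDeg D
    have h3 : configProb (fun ω : Config D => ¬ #(badEdges ω) ≤ 3 * maxDeg D) ≤
        13 / 25 + 29 / 100 := by
      refine (configProb_mono fun ω hω => ?_).trans ((configProb_or_le _ _).trans
        (add_le_add (configProb_loops_le hM) (configProb_pairs_le hM)))
      by_contra hcon
      rw [not_or, not_lt, not_lt] at hcon
      have h4 : (#(badEdges ω) : ℝ) ≤ #{k | (configEdge ω k).1.IsDiag} +
          #{K : Fin 2 ↪ Fin (degSum D / 2) | configEdge ω (K 0) = configEdge ω (K 1)} := by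
        exact_mod_cast card_badEdges_le ω
      have h5 := BL_le (D := D)
      have h6 := BD_le hT
      refine hω ?_
      have : (#(badEdges ω) : ℝ) ≤ ((3 * maxDeg D : ℕ) : ℝ) := by
        push_cast
        linarith [hcon.1, hcon.2]
      exact_mod_cast this
    linarith
  have h3 : configProb (fun ω : Config D => #(badEdges ω) ≤ 0) ≤
      configProb (fun ω : Config D => IsSimple (configGraph ω)) :=
    configProb_mono fun ω hω => isSimple_of_badEdges (Finset.card_eq_zero.1 (Nat.le_zero.1 hω))
  rw [div_le_iff₀ (by positivity)]
  have h4 := h2.trans (h1 _ le_rfl)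
  have h5 : (0 : ℝ) < (1 + 10 * (maxDeg D : ℝ) ^ 2) ^ (3 * maxDeg D) := by positivity
  nlinarith

end TGen

end

noncomputable section

namespace TGen

variable {D : Input}

/-! ## A bound for a run -/

theorem exp_neg_two_mul_le {y : ℝ} (h0 : 0 ≤ y) (h1 : y ≤ 1 / 2) : Real.exp (-(2 * y)) ≤ 1 - y := by
  rw [Real.exp_neg, inv_le_iff_one_le_mul₀ (Real.exp_pos _)]
  have h2 := Real.add_one_le_exp (2 * y)
  have h3 : 0 ≤ 1 - y := by linarith
  nlinarith [mul_le_mul_of_nonneg_left h2 h3]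

/-- With y = (mu - 1)/T the left factor is (1 - y)^(6Δ) ≥ exp(-12yΔ), and yΔ ≤ mu because Δ ≤ T. The
condition T ≥ 2 mu ensures y ≤ 1/2. -/
theorem exp_le_stampBound_pow {mu : ℕ} (hmu : 1 ≤ mu) (hT : 2 * mu ≤ D.T)
    (hΔT : maxDeg D ≤ D.T) : Real.exp (-(12 * mu)) ≤ stampBound D mu ^ (3 * maxDeg D) := by
  have hT0 := T_pos' D
  have hmu' : (1 : ℝ) ≤ mu := by exact_mod_cast hmu
  have hT' : 2 * (mu : ℝ) ≤ D.T := by exact_mod_cast hT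
  have hΔT' : (maxDeg D : ℝ) ≤ D.T := by exact_mod_cast hΔT
  set y := ((mu : ℝ) - 1) / D.T with hy
  have hy0 : 0 ≤ y := div_nonneg (by linarith) hT0.le
  have hy1 : y ≤ 1 / 2 := by
    rw [hy, div_le_iff₀ hT0]
    linarith
  have hs : stampBound D mu = (1 - y) ^ 2 := by
    rw [stampBound, sub_div, div_self hT0.ne']
  have hyΔ : y * maxDeg D ≤ mu := by
    rw [hy, div_mul_eq_mul_div, div_le_iff₀ hT0]
    exact mul_le_mul (by linarith) hΔT' (Nat.cast_nonneg _) (by linarith)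
  rw [hs, ← pow_mul]
  refine le_trans ?_ (pow_le_pow_left₀ (Real.exp_pos _).le (exp_neg_two_mul_le hy0 hy1) _)
  rw [← Real.exp_nat_mul]
  refine Real.exp_le_exp.2 ?_
  push_cast
  linarith

/-- A lower bound for the probability that an attempt outputs a graph. -/
def successBound (mu : ℕ) : ℝ :=
  min (1 / 8 * (Real.exp (-(12 * mu)) * (1 / 2)))
    (1 / (8 * (1 + 10 * (2 * mu : ℝ) ^ 2) ^ (3 * (2 * mu))))

theorem successBound_pos (mu : ℕ) : 0 < successBound mu :=
  lt_min (by positivity) (by positivity)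

/-- The probability of an auxiliary switching. -/
def auxBound (D : Input) (mu : ℕ) (c₀ : ℝ) : ℝ :=
  16 * (4 * (maxDeg D : ℝ) ^ 2 / (c₀ ^ 2 * degSum D)) ^ mu

/-- The probability set aside for each unit of the switchings. -/
def unitBound (D : Input) (lam kap mu : ℕ) (c₀ : ℝ) : ℝ :=
  (4 * lam + 4 * kap + 126) * ((maxDeg D : ℝ) / degSum D) + auxBound D mu c₀

theorem auxBound_nonneg (mu : ℕ) (c₀ : ℝ) : 0 ≤ auxBound D mu c₀ := by
  unfold auxBound
  positivity

/-- The conditions on the input under which the bounds for a run hold. -/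
structure IsAdmissible (D : Input) (lam kap mu m : ℕ) (c₀ : ℝ) : Prop where
  even : Even (degSum D)
  deg_ge : 30 ≤ degSum D
  lam_le : 4 * (lam + 1) ≤ degSum D
  kap_le : 8 * (kap + 1) ≤ degSum D
  m_le : 4 * (m + 2) ≤ degSum D
  le_mu : m + 2 ≤ mu
  c₀_pos : 0 < c₀
  le_T : c₀ * D.T ≤ (D.T : ℝ) - maxDeg D
  sq_le : 84 * (maxDeg D : ℝ) ^ 2 ≤ degSum D
  aux_base_le : 4 * (maxDeg D : ℝ) ^ 2 / (c₀ ^ 2 * degSum D) ≤ 1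
  aux_le_one : auxBound D mu c₀ ≤ 1
  unit_le : 3 * maxDeg D * unitBound D lam kap mu c₀ ≤ 1 / 2
  small : 80 * ((maxDeg D : ℝ) ^ 2 / degSum D) +
      4 ^ (lam + 1) * ((maxDeg D : ℝ) ^ (2 * lam + 1) / (degSum D : ℝ) ^ lam) +
      16 ^ (kap + 1) * ((maxDeg D : ℝ) ^ (2 * kap + 1) / (degSum D : ℝ) ^ kap) +
      4 ^ (m + 2) * ((maxDeg D : ℝ) ^ (2 * m + 2) / (degSum D : ℝ) ^ m) ≤ 1 / 16

namespace IsAdmissible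

variable {lam kap mu m : ℕ} {c₀ : ℝ}

theorem maxDeg_pos (h : IsAdmissible D lam kap mu m c₀) : 1 ≤ maxDeg D := by
  by_contra h0
  have h1 : maxDeg D = 0 := by omega
  have h2 : degSum D = 0 := Finset.sum_eq_zero fun i _ => by
    have := le_maxDeg (D := D) i
    omega
  have := h.deg_ge
  omega

theorem maxDeg_le (h : IsAdmissible D lam kap mu m c₀) : maxDeg D ≤ D.T := by
  have h1 : 0 ≤ c₀ * D.T := mul_nonneg h.c₀_pos.le (Nat.cast_nonneg _)
  have h2 := h.le_T
  have : (maxDeg D : ℝ) ≤ D.T := by linarith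
  exact_mod_cast this

theorem stageParams (h : IsAdmissible D lam kap mu m c₀) :
    StageParams D mu ((maxDeg D : ℝ) / degSum D) (unitBound D lam kap mu c₀)
      (auxBound D mu c₀ + 106 * ((maxDeg D : ℝ) / degSum D)) (auxBound D mu c₀)
      (2 * lam + 2 * kap) := by
  have hM : 0 < degSum D := by
    have := h.deg_ge
    omega
  have hM' : (0 : ℝ) < degSum D := by exact_mod_cast hM
  have hΔ := h.maxDeg_pos
  have hΔ' : (1 : ℝ) ≤ maxDeg D := by exact_mod_cast hΔ
  have hBL := BL_le (D := D)
  have hBD := BD_le h.maxDeg_le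
  have hBL0 := BL_nonneg (D := D)
  have hs := h.sq_le
  refine ⟨hM, rfl, h.maxDeg_le, auxBound_nonneg mu c₀, le_rfl, ?_, by positivity, ?_, ?_, ?_, ?_,
    h.aux_le_one, by linarith⟩
  -- With K = 2 lam + 2 kap the amount is 2K + 20 + 106 = 4 lam + 4 kap + 126 times c, plus the
  -- probability of an auxiliary switching.
  · unfold unitBound
    refine le_of_eq ?_
    ring
  · exact le_auxTypeDist (by norm_num) (by linarith) hM hΔ hs h.c₀_pos h.le_T h.aux_base_le
  · exact le_auxTypeDist (by norm_num) (by linarith) hM hΔ hs h.c₀_pos h.le_T h.aux_base_le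
  · exact le_auxTypeDist (by norm_num) (by linarith) hM hΔ hs h.c₀_pos h.le_T h.aux_base_le
  · rw [← mul_div_assoc, div_le_one hM']
    nlinarith

theorem three_mul_le (h : IsAdmissible D lam kap mu m c₀) :
    3 * (maxDeg D : ℝ) * ((maxDeg D : ℝ) / degSum D) ≤ 1 := by
  have hM' : (0 : ℝ) < degSum D := by exact_mod_cast h.stageParams.degSum_pos
  have hs := h.sq_le
  rw [← mul_div_assoc, div_le_one hM']
  nlinarith [sq_nonneg (maxDeg D : ℝ)]

theorem requirements (h : IsAdmissible D lam kap mu m c₀) : Requirements D := by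
  have hΔ' : (1 : ℝ) ≤ maxDeg D := by exact_mod_cast h.maxDeg_pos
  have hs := h.sq_le
  have hsl := h.stageParams.slack_le
  have hT : (maxDeg D : ℝ) ≤ D.T := by exact_mod_cast h.maxDeg_le
  exact ⟨by nlinarith, by linarith⟩

/-- For T < 2 mu the timestamp rejection may leave nothing, but then Δ ≤ T is bounded and simple
initial graphs suffice. For larger T success comes from the initial conditions and the stages. -/
theorem successBound_le (h : IsAdmissible D lam kap mu m c₀) (π : RemovalOrder D) :
    ENNReal.ofReal (successBound mu) ≤ wp ∅ (attempt D lam kap mu π) (fun _ => 1) := by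
  have hmu : 1 ≤ mu := by
    have := h.le_mu
    omega
  rcases Nat.lt_or_ge D.T (2 * mu) with hT | hT
  · refine le_trans (ENNReal.ofReal_le_ofReal ?_) le_wp_attempt_of_simple
    have hΔ : maxDeg D ≤ 2 * mu := h.maxDeg_le.trans hT.le
    have hΔ' : (maxDeg D : ℝ) ≤ 2 * mu := by exact_mod_cast hΔ
    have hbase : 1 + 10 * (maxDeg D : ℝ) ^ 2 ≤ 1 + 10 * (2 * mu : ℝ) ^ 2 := by gcongr
    refine (min_le_right _ _).trans (le_trans ?_ (le_configProb_isSimple h.deg_ge ?_ h.maxDeg_le))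
    · refine one_div_le_one_div_of_le (by positivity) (mul_le_mul_of_nonneg_left ?_ (by norm_num))
      refine (pow_le_pow_left₀ (by positivity) hbase _).trans (pow_le_pow_right₀ ?_ (by omega))
      have : (0 : ℝ) ≤ 10 * (2 * mu : ℝ) ^ 2 := by positivity
      linarith
    · have h1 : 84 * maxDeg D ^ 2 ≤ degSum D := by exact_mod_cast h.sq_le
      have h2 := h.maxDeg_pos
      nlinarith
  · refine le_trans (ENNReal.ofReal_le_ofReal ?_) (le_wp_attempt h.stageParams h.even
      h.three_mul_le h.requirements hmu (by omega) h.le_mu)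
    refine (min_le_left _ _).trans ?_
    have h1 := le_configProb_initialConditions h.deg_ge h.lam_le h.kap_le h.m_le h.maxDeg_le h.small
    have h2 := exp_le_stampBound_pow hmu hT h.maxDeg_le
    have h3 := h.unit_le
    exact mul_le_mul h1 (mul_le_mul h2 (by linarith) (by norm_num)
      (pow_nonneg (stampBound_nonneg mu) _)) (by positivity) (configProb_nonneg _)

theorem wp_attempt_le (h : IsAdmissible D lam kap mu m c₀) (π : RemovalOrder D) :
    wp {G | ∃ i j, m + 2 < mult G i j} (attempt D lam kap mu π) (fun _ => 0) ≤
      ENNReal.ofReal (4 ^ (m + 2) * ((maxDeg D : ℝ) ^ (2 * m + 2) / (degSum D : ℝ) ^ m) +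
        3 * maxDeg D * unitBound D lam kap mu c₀) := by
  refine (TGen.wp_attempt_le (m := m + 2) ?_ h.stageParams h.even h.three_mul_le).trans
    (ENNReal.ofReal_le_ofReal (add_le_add ?_ le_rfl))
  · rintro G₀ G h1 h2 ⟨i, j, hij⟩
    rw [mult_eq] at hij
    exact absurd ((h2 _).trans (h1 _)) (not_le.2 hij)
  · refine (configProb_mono fun ω hω => ?_).trans (configProb_le_pairMult_le h.m_le)
    push Not at hω
    obtain ⟨p, hp⟩ := hω
    exact ⟨p, Nat.lt_succ_iff.1 hp⟩

theorem le_runLaw (h : IsAdmissible D lam kap mu m c₀) (π : RemovalOrder D) :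
    1 - ENNReal.ofReal (4 ^ (m + 2) * ((maxDeg D : ℝ) ^ (2 * m + 2) / (degSum D : ℝ) ^ m) +
        3 * maxDeg D * unitBound D lam kap mu c₀) / ENNReal.ofReal (successBound mu) ≤
      runLaw D lam kap mu π {ω | ∀ G ∈ visitedInRun ω, ∀ i j, mult G i j ≤ m + 2} := by
  refine (one_sub_le_runLaw (h.wp_attempt_le π) (h.successBound_le π)).trans
    (measure_mono fun ω hω G hG i j => ?_)
  exact not_lt.1 fun hlt => hω G hG ⟨i, j, hlt⟩

end IsAdmissible

theorem runLaw_le_one {lam kap mu : ℕ} (π : RemovalOrder D) (s : Set (ℕ → Outcome D (TGraph D))) :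
    runLaw D lam kap mu π s ≤ 1 := by
  unfold runLaw
  have : IsProbabilityMeasure (PMF.toMeasure (attempt D lam kap mu π)) :=
    PMF.toMeasure.isProbabilityMeasure _
  exact prob_le_one

/-! ## Asymptotics -/

section Asymptotics

variable {D : ℕ → Input} {ε : ℝ}

/-- Raising the assumption to the power b/(2 + ε) gives Δ^b = O(M^(b/(2+ε))), and the exponent is
smaller than s. -/
theorem tendsto_maxDeg_pow_div (hε : 0 < ε) (hM : Tendsto (fun k => degSum (D k)) atTop atTop)
    (hΔM : (fun k => (maxDeg (D k) : ℝ) ^ (2 + ε)) =O[atTop] fun k => (degSum (D k) : ℝ))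
    {b s : ℕ} (hbs : (b : ℝ) < (2 + ε) * s) :
    Tendsto (fun k => (maxDeg (D k) : ℝ) ^ b / (degSum (D k) : ℝ) ^ s) atTop (𝓝 0) := by
  have hM' : Tendsto (fun k => (degSum (D k) : ℝ)) atTop atTop :=
    tendsto_natCast_atTop_atTop.comp hM
  have he : 0 < 2 + ε := by linarith
  set a := (b : ℝ) / (2 + ε) with ha
  have ha0 : 0 ≤ a := by positivity
  have has : 0 < s - a := by
    rw [sub_pos, ha, div_lt_iff₀ he]
    linarith
  have h1 : (fun k => (maxDeg (D k) : ℝ) ^ b) =O[atTop] fun k => (degSum (D k) : ℝ) ^ a := by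
    have h2 := hΔM.rpow ha0 (Eventually.of_forall fun k => (Nat.cast_nonneg (degSum (D k)) :
      (0 : ℝ) ≤ _))
    refine h2.congr_left fun k => ?_
    rw [← Real.rpow_mul (Nat.cast_nonneg _), ha, mul_div_cancel₀ _ he.ne', Real.rpow_natCast]
  have h2 : (fun k => (maxDeg (D k) : ℝ) ^ b / (degSum (D k) : ℝ) ^ s) =O[atTop]
      fun k => (degSum (D k) : ℝ) ^ (-(s - a)) := by
    refine (h1.mul (isBigO_refl (fun k => ((degSum (D k) : ℝ) ^ s)⁻¹) atTop)).congr' ?_ ?_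
    · exact Eventually.of_forall fun k => (div_eq_mul_inv _ _).symm
    · filter_upwards [hM'.eventually_gt_atTop 0] with k hk
      rw [neg_sub, Real.rpow_sub hk, Real.rpow_natCast, div_eq_mul_inv]
  exact h2.trans_tendsto ((tendsto_rpow_neg_atTop has).comp hM')

theorem tendsto_auxBound (hε : 0 < ε) (hM : Tendsto (fun k => degSum (D k)) atTop atTop)
    (hΔM : (fun k => (maxDeg (D k) : ℝ) ^ (2 + ε)) =O[atTop] fun k => (degSum (D k) : ℝ))
    (mu b : ℕ) (c₀ : ℝ) (hmu : ((2 * mu + b : ℕ) : ℝ) < (2 + ε) * mu) :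
    Tendsto (fun k => (maxDeg (D k) : ℝ) ^ b * auxBound (D k) mu c₀) atTop (𝓝 0) := by
  have h := (tendsto_maxDeg_pow_div hε hM hΔM hmu).const_mul (16 * (4 / c₀ ^ 2) ^ mu)
  rw [mul_zero] at h
  refine h.congr fun k => ?_
  unfold auxBound
  rw [mul_div_mul_comm, mul_pow, div_pow _ (degSum (D k) : ℝ), pow_add, pow_mul]
  ring

theorem tendsto_unitBound (hε : 0 < ε) (hM : Tendsto (fun k => degSum (D k)) atTop atTop)
    (hΔM : (fun k => (maxDeg (D k) : ℝ) ^ (2 + ε)) =O[atTop] fun k => (degSum (D k) : ℝ))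
    (lam kap mu : ℕ) (c₀ : ℝ) (hmu : ((2 * mu + 1 : ℕ) : ℝ) < (2 + ε) * mu) :
    Tendsto (fun k => 3 * maxDeg (D k) * unitBound (D k) lam kap mu c₀) atTop (𝓝 0) := by
  have h1 := ((tendsto_maxDeg_pow_div hε hM hΔM (b := 2) (s := 1)
    (by push_cast; linarith)).const_mul (3 * (4 * lam + 4 * kap + 126 : ℝ))).add
    ((tendsto_auxBound hε hM hΔM mu 1 c₀ hmu).const_mul 3)
  rw [mul_zero, mul_zero, add_zero] at h1
  refine h1.congr fun k => ?_
  unfold unitBound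
  ring

/-- Each smallness condition is an instance of Δ^b/M^s → 0. The inequalities for lam, kap, mu and m
say precisely that 2s + 1 < (2 + ε)s, respectively 2m + 2 < (2 + ε)m. -/
theorem eventually_isAdmissible (hε : 0 < ε) (hreal : ∀ k, Realizable (D k))
    (hM : Tendsto (fun k => degSum (D k)) atTop atTop)
    (hΔM : (fun k => (maxDeg (D k) : ℝ) ^ (2 + ε)) =O[atTop] fun k => (degSum (D k) : ℝ))
    {c₀ : ℝ} (hc₀ : 0 < c₀)
    (hT : ∀ᶠ k in atTop, c₀ * ((D k).T : ℝ) ≤ ((D k).T : ℝ) - maxDeg (D k))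
    {lam kap mu m : ℕ} (hlam : 1 < ε * lam) (hkap : 1 < ε * kap) (hmu : 1 < ε * mu)
    (hm : 2 < ε * m) (hmmu : m + 2 ≤ mu) :
    ∀ᶠ k in atTop, IsAdmissible (D k) lam kap mu m c₀ := by
  have hsq := tendsto_maxDeg_pow_div hε hM hΔM (b := 2) (s := 1) (by push_cast; linarith)
  simp only [pow_one] at hsq
  have hl := tendsto_maxDeg_pow_div hε hM hΔM (b := 2 * lam + 1) (s := lam)
    (by push_cast; linarith)
  have hk := tendsto_maxDeg_pow_div hε hM hΔM (b := 2 * kap + 1) (s := kap)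
    (by push_cast; linarith)
  have hm' := tendsto_maxDeg_pow_div hε hM hΔM (b := 2 * m + 2) (s := m) (by push_cast; linarith)
  have hsmall := (((hsq.const_mul 80).add (hl.const_mul (4 ^ (lam + 1)))).add
    (hk.const_mul (16 ^ (kap + 1)))).add (hm'.const_mul (4 ^ (m + 2)))
  simp only [mul_zero, add_zero] at hsmall
  have haux := tendsto_auxBound hε hM hΔM mu 0 c₀ (by push_cast; linarith)
  simp only [pow_zero, one_mul] at haux
  have hunit := tendsto_unitBound hε hM hΔM lam kap mu c₀ (by push_cast; linarith)
  have hbase := hsq.const_mul (4 / c₀ ^ 2)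
  rw [mul_zero] at hbase
  filter_upwards [hM.eventually_ge_atTop 30, hM.eventually_ge_atTop (4 * (lam + 1)),
    hM.eventually_ge_atTop (8 * (kap + 1)), hM.eventually_ge_atTop (4 * (m + 2)), hT,
    hsq.eventually_le_const (by norm_num : (0 : ℝ) < 1 / 84),
    hbase.eventually_le_const one_pos, haux.eventually_le_const one_pos,
    hunit.eventually_le_const (by norm_num : (0 : ℝ) < 1 / 2),
    hsmall.eventually_le_const (by norm_num : (0 : ℝ) < 1 / 16)]
    with k h1 h2 h3 h4 h5 h6 h7 h8 h9 h10
  have hpos : (0 : ℝ) < degSum (D k) := by exact_mod_cast (by omega : 0 < degSum (D k))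
  refine ⟨(hreal k).even, h1, h2, h3, h4, hmmu, hc₀, h5, ?_, ?_, h8, h9, h10⟩
  · rw [div_le_iff₀ hpos] at h6
    linarith
  · rw [mul_div_mul_comm]
    exact h7

/-- The floor of 1 + 1/ε exceeds 1/ε strictly, even if 1/ε is an integer. -/
theorem one_lt_mul_of_floor_le (hε : 0 < ε) {n : ℕ} (h : ⌊1 + 1 / ε⌋₊ ≤ n) : 1 < ε * n := by
  have h1 := Nat.lt_floor_add_one (1 + 1 / ε)
  have h2 : ((⌊1 + 1 / ε⌋₊ : ℕ) : ℝ) ≤ n := by exact_mod_cast h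
  have h3 : 1 / ε < n := by linarith
  rwa [div_lt_iff₀' hε] at h3

end Asymptotics

end TGen

end

/-- With high probability no graph visited during a run of T-Gen (restarts included) contains an edge
of multiplicity higher than `⌊3 + 2 / ε⌋`. -/
theorem mainTheorem5 (ε : ℝ) (hε : 0 < ε)
    (D : ℕ → TGen.Input)
    (hreal : ∀ k, TGen.Realizable (D k))
    (hM : Tendsto (fun k => TGen.degSum (D k)) atTop atTop)
    (hΔM : (fun k => (TGen.maxDeg (D k) : ℝ) ^ (2 + ε)) =O[atTop]
      fun k => (TGen.degSum (D k) : ℝ))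
    (hT : ∃ c : ℝ, 0 < c ∧ ∀ᶠ k in atTop,
      c * ((D k).T : ℝ) ≤ ((D k).T : ℝ) - TGen.maxDeg (D k))
    (lam kap mu : ℕ)
    (hlam : ⌊1 + 1 / ε⌋₊ ≤ lam) (hkap : ⌊1 + 1 / ε⌋₊ ≤ kap) (hmu : ⌊3 + 2 / ε⌋₊ ≤ mu)
    (hmuT : mu ≤ ⌈3 + 2 / ε⌉₊ ∨ ∀ᶠ k in atTop, mu ≤ (D k).T)
    (π : ∀ k, TGen.RemovalOrder (D k)) :
    Tendsto
      (fun k => TGen.runLaw (D k) lam kap mu (π k)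
        {ω | ∀ G ∈ TGen.visitedInRun ω, ∀ i j, TGen.mult G i j ≤ ⌊3 + 2 / ε⌋₊})
      atTop (𝓝 1) := by
  obtain ⟨c₀, hc₀, hT⟩ := hT
  have hfloor : 3 ≤ ⌊3 + 2 / ε⌋₊ := Nat.le_floor (by
    have : 0 ≤ 2 / ε := by positivity
    push_cast
    linarith)
  -- With μ = m + 2, an initial multiplicity of at most m + 1 leaves room for one further hit, and m
  -- = ⌊1 + 2/ε⌋ > 2/ε is the exponent of M in the bound for the initial graph.
  obtain ⟨m, hm⟩ : ∃ m, ⌊3 + 2 / ε⌋₊ = m + 2 := ⟨_, (Nat.sub_add_cancel (by omega)).symm⟩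
  rw [hm] at hmu ⊢
  have hεm : 2 < ε * m := by
    have h1 := Nat.lt_floor_add_one (3 + 2 / ε)
    rw [hm] at h1
    push_cast at h1
    exact (div_lt_iff₀' hε).1 (by linarith)
  have hεmu : 2 < ε * mu :=
    hεm.trans_le (mul_le_mul_of_nonneg_left (by exact_mod_cast (by omega : m ≤ mu)) hε.le)
  have hadm := TGen.eventually_isAdmissible hε hreal hM hΔM hc₀ hT
    (TGen.one_lt_mul_of_floor_le hε hlam) (TGen.one_lt_mul_of_floor_le hε hkap)
    (by linarith : 1 < ε * mu) hεm hmu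
  have hβ := ((TGen.tendsto_maxDeg_pow_div hε hM hΔM (b := 2 * m + 2) (s := m)
    (by push_cast; linarith)).const_mul ((4 : ℝ) ^ (m + 2))).add
    (TGen.tendsto_unitBound hε hM hΔM lam kap mu c₀ (by push_cast; linarith))
  rw [mul_zero, add_zero] at hβ
  -- The success bound depends only on `mu`, so it is a positive constant along the sequence and b/s
  -- tends to 0 together with b.
  have hδ := ENNReal.Tendsto.div_const (ENNReal.tendsto_ofReal hβ)
    (b := ENNReal.ofReal (TGen.successBound mu))
    (Or.inr (ENNReal.ofReal_pos.2 (TGen.successBound_pos mu)).ne')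
  rw [ENNReal.ofReal_zero, ENNReal.zero_div] at hδ
  have hlow := ENNReal.Tendsto.sub (tendsto_const_nhds (x := (1 : ENNReal))) hδ
    (Or.inl ENNReal.one_ne_top)
  rw [tsub_zero] at hlow
  exact tendsto_of_tendsto_of_tendsto_of_le_of_le' hlow tendsto_const_nhds
    (hadm.mono fun k hk => hk.le_runLaw (π k)) (.of_forall fun k => TGen.runLaw_le_one _ _)
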